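/- **Proposition 2.2 (Convergence to the decoupled FPU).** For $h\in(0,1]$ let $\|f\|_{L^2(h\mathbb Z)}=(h\sum_{x\in h\mathbb Z}|f(x)|^2)^{1/2}$ for $f:h\mathbb Z\to\mathbb R$, let $(\mathcal F_hf)(\xi)=h\sum_{x\in h\mathbb Z}f(x)e^{-ix\xi}$, $\xi\in[-\frac\pi h,\frac\pi h)$, be the discrete Fourier transform on $L^2(h\mathbb Z)$, let $\nabla_h$ and $\partial_h$ be the Fourier multipliers with symbols $\frac{2i}{h}\sin(\frac{h\xi}{2})$ and $i\xi$, and put $S_h^\pm(t)=e^{\mp\frac{t}{h^2}(\nabla_h-\partial_h)}$, $\|f\|_{H^s(h\mathbb Z)}=\|(1-\partial_h^2)^{s/2}f\|_{L^2(h\mathbb Z)}$ and $\|(f,g)\|_{H^s\times H^s}=(\|f\|_{H^s(h\mathbb Z)}^2+\|g\|_{H^s(h\mathbb Z)}^2)^{1/2}$. Let $V\in C^5(\mathbb R)$ satisfy $V(0)=V'(0)=0$ and (after normalization) $V''(0)=V'''(0)=1$. For real data $u_{h,0}^\pm\in L^2(h\mathbb Z)$, the *coupled FPU* is $$u_h^\pm(t)=S_h^\pm(t)u_{h,0}^\pm\mp\frac14\int_0^tS_h^\pm(t-t_1)\nabla_h\Big[\big\{u_h^\pm(t_1)+e^{\pm\frac{2t_1}{h^2}\partial_h}u_h^\mp(t_1)\big\}^2+h^2e^{\pm\frac{t_1}{h^2}\partial_h}\mathcal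 R(t_1)\Big]dt_1,$$ where the higher-order remainder $\mathcal R$ is determined by $V'(h^2\tilde r_h)-h^2\tilde r_h=\frac{h^4}{2}(\tilde r_h^2+h^2\mathcal R)$, i.e. $\mathcal R=\frac13V^{(4)}(h^2\tilde r_h^*)\tilde r_h^3$ with some $\tilde r_h^*$ between $0$ and $\tilde r_h$, and $\tilde r_h(t)=e^{-\frac{t}{h^2}\partial_h}u_h^+(t)+e^{\frac{t}{h^2}\partial_h}u_h^-(t)$. The *decoupled FPU* is $$v_h^\pm(t)=S_h^\pm(t)u_{h,0}^\pm\mp\frac14\int_0^tS_h^\pm(t-t_1)\nabla_h\big\{v_h^\pm(t_1)\big\}^2dt_1 .$$ Then for every $R>0$ there is $T=T(R)>0$ (depending only on $R$ and $V$, not on $h$ or $s$) such that for every $s\in(0,1]$ there is $C=C(R,s,V)>0$ with the following property. For every $h\in(0,1]$ and all real data with $\|(u_{h,0}^+,u_{h,0}^-)\|_{H^s\times H^s}\le R$, the coupled and the decoupled FPU with data $(u_{h,0}^+,u_{h,0}^-)$ have solutions in $C([-T,T];L^2(h\mathbb Z))$, and any such solutions $(u_h^+,u_h^-)$ and $(v_h^+,v_h^-)$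 satisfy $$\sup_{t\in[-T,T]}\|u_h^\pm(t)-v_h^\pm(t)\|_{L^2(h\mathbb Z)}\le C\,h^s\,\|(u_{h,0}^+,u_{h,0}^-)\|_{H^s\times H^s}\quad\text{for both signs.}$$ -/

import Mathlib

open MeasureTheory Set

namespace FPULattice

noncomputable section

/-! Functions on the lattice `hℤ` are represented by functions `f : ℤ → ℝ`, where `f n` is the value
at the lattice point `x = h n`. As a set, `L²(hℤ)` is `ℓ²(ℤ)`; its norm carries the weight `√h`. -/

/-- The space of real-valued square summable functions on the lattice. Its Mathlib norm is the
unweighted `ℓ²` norm, which for fixed `h` is a multiple of the `L²(hℤ)` norm `l2Norm h`, so that the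
topology is the one of `L²(hℤ)`. -/
abbrev LatticeL2 : Type := lp (fun _ : ℤ => ℝ) 2

/-- The norm `‖f‖_{L²(hℤ)} = (h ∑_{x ∈ hℤ} |f(x)|²)^{1/2}`. -/
def l2Norm (h : ℝ) (f : ℤ → ℝ) : ℝ := Real.sqrt (h * ∑' n : ℤ, |f n| ^ 2)

/-- The frequency circle `ℝ / (2π/h)ℤ`, also described by `[-π/h, π/h)`. -/
abbrev Freq (h : ℝ) : Type := AddCircle (2 * Real.pi / h)

instance factPeriodPos (h : ℝ) [hh : Fact (0 < h)] : Fact (0 < 2 * Real.pi / h) :=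
  ⟨div_pos Real.two_pi_pos hh.out⟩

/-- The discrete Fourier transform `(𝓕_h f)(ξ) = h ∑_{x ∈ hℤ} f(x) e^{-ixξ}` of `f ∈ L²(hℤ)`, the
series being (unconditionally) convergent in `L²` of the frequency circle. Here
`fourierLp 2 (-n)` is the class of the character `ξ ↦ exp (-i h n ξ)`. -/
def fourierTransform (h : ℝ) [Fact (0 < h)] (f : ℤ → ℝ) :
    Lp ℂ 2 (AddCircle.haarAddCircle (T := 2 * Real.pi / h)) :=
  ∑' n : ℤ, (((h * f n : ℝ) : ℂ)) • fourierLp (T := 2 * Real.pi / h) 2 (-n)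

/-- The discrete Fourier multiplier with symbol `m : [-π/h, π/h) → ℂ`,
`(m(D) f)(x) = (1/2π) ∫_{-π/h}^{π/h} m(ξ) (𝓕_h f)(ξ) e^{ixξ} dξ` at `x = h n`. All the symbols below
satisfy `m(-ξ) = conj (m ξ)`, so that the multiplier sends real-valued functions to real-valued
functions and taking the real part only changes the type. -/
def multiplier (h : ℝ) [Fact (0 < h)] (m : ℝ → ℂ) (f : ℤ → ℝ) : ℤ → ℝ := fun n =>
  ((1 / (2 * Real.pi) : ℂ) * ∫ ξ in (-(Real.pi / h))..(Real.pi / h),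
    m ξ * fourierTransform h f (ξ : Freq h) * Complex.exp (Complex.I * h * n * ξ)).re

/-- The symbol `(2i/h) sin(hξ/2)` of `∇_h`. -/
def nablaSymbol (h ξ : ℝ) : ℂ := (2 * Complex.I / h) * (Real.sin (h * ξ / 2) : ℂ)

/-- The symbol `iξ` of `∂_h`. -/
def partialSymbol (ξ : ℝ) : ℂ := Complex.I * ξ

/-- The operator `∇_h`. -/
def nabla (h : ℝ) [Fact (0 < h)] (f : ℤ → ℝ) : ℤ → ℝ := multiplier h (nablaSymbol h) f

/-- The operator `e^{a ∂_h}` for `a ∈ ℝ`. -/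
def expPartial (h : ℝ) [Fact (0 < h)] (a : ℝ) (f : ℤ → ℝ) : ℤ → ℝ :=
  multiplier h (fun ξ => Complex.exp (a * partialSymbol ξ)) f

/-- The linear FPU propagator `S_h^±(t) = e^{∓ (t/h²)(∇_h - ∂_h)}`, where the sign `±` is
`σ = 1` or `σ = -1`. -/
def propagator (h : ℝ) [Fact (0 < h)] (σ t : ℝ) (f : ℤ → ℝ) : ℤ → ℝ :=
  multiplier h
    (fun ξ => Complex.exp (-(σ * t / h ^ 2) * (nablaSymbol h ξ - partialSymbol ξ))) f

/-- The norm `‖f‖_{H^s(hℤ)} = ‖⟨∂_h⟩^s f‖_{L²(hℤ)}`, `⟨ξ⟩ = (1 + |ξ|²)^{1/2}`. -/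
def sobolevNorm (h : ℝ) [Fact (0 < h)] (s : ℝ) (f : ℤ → ℝ) : ℝ :=
  l2Norm h (multiplier h (fun ξ => ((Real.sqrt (1 + |ξ| ^ 2) ^ s : ℝ) : ℂ)) f)

/-- The norm of a pair in `H^s(hℤ) × H^s(hℤ)`. -/
def sobolevPairNorm (h : ℝ) [Fact (0 < h)] (s : ℝ) (f g : ℤ → ℝ) : ℝ :=
  Real.sqrt (sobolevNorm h s f ^ 2 + sobolevNorm h s g ^ 2)

/-- The assumption on the potential, in the normalization `V''(0) = V'''(0) = 1`. -/
structure IsNormalizedPotential (V : ℝ → ℝ) : Prop where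
  contDiff : ContDiff ℝ 5 V
  zero : V 0 = 0
  deriv_one : deriv V 0 = 0
  deriv_two : iteratedDeriv 2 V 0 = 1
  deriv_three : iteratedDeriv 3 V 0 = 1

/-- The higher-order remainder `𝓡`, as a function of the value `r` of `r̃_h`: it is determined by
`V'(h² r) - h² r = (h⁴/2) (r² + h² 𝓡)`. -/
def remainder (V : ℝ → ℝ) (h r : ℝ) : ℝ :=
  2 / h ^ 6 * (deriv V (h ^ 2 * r) - h ^ 2 * r - (h ^ 2 * r) ^ 2 / 2)

/-- The remainder has the Lagrange form `𝓡 = (1/3) V⁽⁴⁾(h² r*) r³` with `r*` between `0` and `r`. -/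
theorem remainder_eq {V : ℝ → ℝ} (hV : IsNormalizedPotential V) {h : ℝ} (hh : 0 < h) (r : ℝ) :
    ∃ rs ∈ uIcc 0 r, remainder V h r = iteratedDeriv 4 V (h ^ 2 * rs) / 3 * r ^ 3 := by
  rcases eq_or_ne r 0 with rfl | hr
  · exact ⟨0, by simp, by simp [remainder, hV.deriv_one]⟩
  have h2 : 0 < h ^ 2 := by positivity
  have hx : (0 : ℝ) ≠ h ^ 2 * r := (mul_ne_zero h2.ne' hr).symm
  have hd : ContDiff ℝ 4 (deriv V) := by
    have := hV.contDiff
    rw [show (5 : WithTop ℕ∞) = 4 + 1 by norm_num, contDiff_succ_iff_deriv] at this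
    exact this.2.2
  have hu : UniqueDiffOn ℝ (uIcc 0 (h ^ 2 * r)) := uniqueDiffOn_Icc (by simpa using hx)
  have key : ∀ k : ℕ, k ≤ 4 → ∀ x ∈ uIcc 0 (h ^ 2 * r),
      iteratedDerivWithin k (deriv V) (uIcc 0 (h ^ 2 * r)) x = iteratedDeriv (k + 1) V x := by
    intro k hk x hx
    rw [iteratedDerivWithin_eq_iteratedDeriv hu _ hx, iteratedDeriv_succ']
    exact (hd.of_le (by exact_mod_cast hk)).contDiffAt
  obtain ⟨y, hy, e⟩ := taylor_mean_remainder_lagrange (f := deriv V) (n := 2) hx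
    (hd.of_le (by norm_num)).contDiffOn
    (((hd.contDiffOn).differentiableOn_iteratedDerivWithin (by norm_num) hu).mono
      uIoo_subset_uIcc_self)
  have h0 : (0 : ℝ) ∈ uIcc 0 (h ^ 2 * r) := left_mem_uIcc
  rw [taylor_within_apply, key 3 (by norm_num) y (uIoo_subset_uIcc_self hy)] at e
  simp only [Finset.sum_range_succ, Finset.sum_range_zero, key 0 (by norm_num) 0 h0,
    key 1 (by norm_num) 0 h0, key 2 (by norm_num) 0 h0, zero_add, Nat.reduceAdd, iteratedDeriv_one,
    hV.deriv_one, hV.deriv_two, hV.deriv_three] at e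
  refine ⟨y / h ^ 2, ?_, ?_⟩
  · have := uIoo_subset_uIcc_self hy
    rw [mem_uIcc] at this ⊢
    rw [div_le_iff₀ h2, le_div_iff₀ h2, div_le_iff₀ h2, le_div_iff₀ h2]
    simpa [mul_comm] using this
  · rw [mul_div_cancel₀ _ h2.ne', remainder]
    have e' : deriv V (h ^ 2 * r) - h ^ 2 * r - (h ^ 2 * r) ^ 2 / 2
        = iteratedDeriv 4 V y * (h ^ 2 * r) ^ 3 / 6 := by
      norm_num [Nat.factorial] at e
      linarith
    rw [e']
    field_simp
    ring

/-- `r̃_h(t) = e^{-(t/h²)∂_h} u_h^+(t) + e^{(t/h²)∂_h} u_h^-(t)`, from the values `up`, `um` of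
`u_h^±` at time `t`. -/
def displacement (h : ℝ) [Fact (0 < h)] (t : ℝ) (up um : ℤ → ℝ) : ℤ → ℝ :=
  expPartial h (-(t / h ^ 2)) up + expPartial h (t / h ^ 2) um

/-- The expression `{u_h^± + e^{±(2t/h²)∂_h} u_h^∓}² + h² e^{±(t/h²)∂_h} 𝓡` at time `t`; `σ = ±1` is
the sign, `u` the component of that sign, `w` the component of the opposite sign, and `r` the
function `r̃_h` at time `t`. -/
def coupledNonlinearity (V : ℝ → ℝ) (h : ℝ) [Fact (0 < h)] (σ t : ℝ) (u w r : ℤ → ℝ) : ℤ → ℝ :=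
  fun n => (u n + expPartial h (σ * (2 * t / h ^ 2)) w n) ^ 2
    + h ^ 2 * expPartial h (σ * (t / h ^ 2)) (fun k => remainder V h (r k)) n

/-- The Duhamel formula `u(t) = S_h^±(t) u₀ ∓ (1/4) ∫_0^t S_h^±(t - t₁) ∇_h N(t₁) dt₁` on `[-T, T]`,
at every lattice point, with `σ = ±1` the sign. -/
def Duhamel (h : ℝ) [Fact (0 < h)] (σ T : ℝ) (u₀ : LatticeL2) (N : ℝ → ℤ → ℝ)
    (u : ℝ → LatticeL2) : Prop :=
  ∀ t ∈ Icc (-T) T, ∀ n : ℤ,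
    u t n = propagator h σ t u₀ n
      - σ * (1 / 4) * ∫ t₁ in (0 : ℝ)..t, propagator h σ (t - t₁) (nabla h (N t₁)) n

/-- `(u⁺, u⁻) ∈ C([-T, T]; L²(hℤ))` solves the coupled FPU with initial data `(u₀⁺, u₀⁻)`. -/
structure IsCoupledSolution (V : ℝ → ℝ) (h : ℝ) [Fact (0 < h)] (T : ℝ) (u₀p u₀m : LatticeL2)
    (up um : ℝ → LatticeL2) : Prop where
  continuousOn_plus : ContinuousOn up (Icc (-T) T)
  continuousOn_minus : ContinuousOn um (Icc (-T) T)
  duhamel_plus : Duhamel h 1 T u₀p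
    (fun t => coupledNonlinearity V h 1 t (up t) (um t) (displacement h t (up t) (um t))) up
  duhamel_minus : Duhamel h (-1) T u₀m
    (fun t => coupledNonlinearity V h (-1) t (um t) (up t) (displacement h t (up t) (um t))) um

/-- `(v⁺, v⁻) ∈ C([-T, T]; L²(hℤ))` solves the decoupled FPU with initial data `(u₀⁺, u₀⁻)`. -/
structure IsDecoupledSolution (h : ℝ) [Fact (0 < h)] (T : ℝ) (u₀p u₀m : LatticeL2)
    (vp vm : ℝ → LatticeL2) : Prop where
  continuousOn_plus : ContinuousOn vp (Icc (-T) T)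
  continuousOn_minus : ContinuousOn vm (Icc (-T) T)
  duhamel_plus : Duhamel h 1 T u₀p (fun t n => vp t n ^ 2) vp
  duhamel_minus : Duhamel h (-1) T u₀m (fun t n => vm t n ^ 2) vm

end

end FPULattice

/-!
# Convergence of the coupled FPU system to the decoupled one

Both systems are written for the profiles `w_ε(t) = S_h^ε(-t) u_h^ε(t)`, on the frequency side, as
`w_ε(t) = U_ε + ∫₀ᵗ N_ε(w_ε, w_{-ε})`; the parameter `lam` is `1` for the coupled and `0` for the
decoupled system. The nonlinearity consists of three quadratic interactions, with the phases
`-p + p + p` (`same`), `-p + p + q` (`cross`) and `-p + q + q` (`opp`), where `p` is `dispersion h` and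
`q` is `dispersionOpp h`, and of the higher-order remainder. Negative times reduce to positive ones by
the reflection `t ↦ -t`, which exchanges the signs (`IsLatticeSolution.isProfile`,
`exists_isLatticeSolution`).

The symbol of `∇_h` is of size `1/h`, so a time of existence which is uniform in `h` has to come from
the oscillation of the phases. For this the profile is damped by `e^{-K t}`, with `K` large, and
represented as `e^{-K t} w(t) = ∫ e^{2πiσt} √ρ(σ) f(σ) dσ` with `f ∈ L²(ℝ × Freq h)` and a fixed
integrable density `ρ = modDensity h K`: an elementary substitute for a Bourgain space. By
Cauchy-Schwarz, a bilinear estimate on this `L²` space follows from the resonance estimate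
`HasResonanceBound`, a bound for the integral of a density along the phase function over the input
frequencies. It is proved by calculus for the explicit phases: the phase `same` is quadratic at its
critical point with a coefficient which the factor `|sin|²` of the output symbol absorbs, the phase
`cross` is monotone with the same gain, and the phase `opp` is bounded below. All three bounds carry
the factor `1/√K`, so on the time interval `[0, 1/K]`, with `K` depending only on the size of the data
and on the potential, the equation is solved by the contraction principle (`exists_modMap_eq`).
Solutions in `C([0, T]; L²)` are unique for fixed `h` (`IsProfile.unique`), hence they all obey the
estimates of the constructed one.

For data in `Hˢ` the interactions `cross` and `opp` are nonresonant and gain `h^{2s}` in the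
resonance estimate (`hasResonanceBound_cross`, `hasResonanceBound_opp`), hence `hˢ` in the bilinear
estimate, and the remainder gains `hˢ` by the Sobolev embedding `norm_val_le_freqSob`. As the decoupled
equation preserves the regularity (`norm_modSob_le_of_eq`), the terms which it neglects have size
`O(hˢ)` along its solution, and the contraction transfers this bound to the difference of the two
solutions (`exists_isProfile_sub_le`).
-/

namespace FPULattice

noncomputable section

open scoped ENNReal ComplexConjugate FourierTransform

/-! ### Densities on the modulation line -/

/-- A density on the modulation line at scale `K`: integrable, and bounded by a multiple of
`1 / (K + |z|)`, both with the constant `C`. -/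
structure IsDensity (K : ℝ) (C : ℝ≥0∞) (ρ : ℝ → ℝ≥0∞) : Prop where
  measurable : Measurable ρ
  lintegral_le : ∫⁻ z, ρ z ≤ C
  mul_le : ∀ z, ENNReal.ofReal (K + |z|) * ρ z ≤ C

theorem IsDensity.le {K : ℝ} {C : ℝ≥0∞} {ρ : ℝ → ℝ≥0∞} (hρ : IsDensity K C ρ) {b z : ℝ}
    (hb : 0 < b) (hz : b ≤ K + |z|) : ρ z ≤ ENNReal.ofReal b⁻¹ * C := by
  have h1 : ENNReal.ofReal b * ρ z ≤ C :=
    (mul_le_mul_left (ENNReal.ofReal_le_ofReal hz) _).trans (hρ.mul_le z)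
  rw [ENNReal.ofReal_inv_of_pos hb]
  have hb0 : ENNReal.ofReal b ≠ 0 := by simpa using hb
  calc ρ z = (ENNReal.ofReal b)⁻¹ * (ENNReal.ofReal b * ρ z) := by
        rw [← mul_assoc, ENNReal.inv_mul_cancel hb0 ENNReal.ofReal_ne_top, one_mul]
    _ ≤ _ := by gcongr

/-- Densities are closed under convolution, since `K + |z| ≤ (K + |x|) + (K + |z - x|)`. -/
theorem IsDensity.conv {K : ℝ} (hK : 0 ≤ K) {Ca Cb : ℝ≥0∞} {a b : ℝ → ℝ≥0∞}
    (ha : IsDensity K Ca a) (hb : IsDensity K Cb b) :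
    IsDensity K (4 * (Ca * Cb)) (fun z => ∫⁻ x, a x * b (z - x)) where
  measurable := by
    have := ha.measurable
    have := hb.measurable
    apply Measurable.lintegral_prod_right' (f := fun p : ℝ × ℝ => a p.2 * b (p.1 - p.2))
    fun_prop
  lintegral_le := by
    have h1 := ha.measurable
    have h2 := hb.measurable
    rw [lintegral_lintegral_swap (by fun_prop)]
    have : ∀ x, ∫⁻ z, a x * b (z - x) = a x * ∫⁻ z, b z := by
      intro x
      rw [lintegral_const_mul _ (by fun_prop), lintegral_sub_right_eq_self b x]
    simp_rw [this]
    rw [lintegral_mul_const _ h1]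
    calc _ ≤ Ca * Cb := mul_le_mul' ha.lintegral_le hb.lintegral_le
      _ ≤ 4 * (Ca * Cb) := le_mul_of_one_le_left (by simp) (by norm_num)
  mul_le := by
    intro z
    have h1 := ha.measurable
    have h2 := hb.measurable
    rw [← lintegral_const_mul _ (by fun_prop)]
    calc ∫⁻ x, ENNReal.ofReal (K + |z|) * (a x * b (z - x))
        ≤ ∫⁻ x, (2 * Ca * b (z - x) + 2 * Cb * a x) := by
          apply lintegral_mono
          intro x
          have : ENNReal.ofReal (K + |z|) ≤
              2 * ENNReal.ofReal (K + |x|) + 2 * ENNReal.ofReal (K + |z - x|) := by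
            rw [show (2 : ℝ≥0∞) = ENNReal.ofReal 2 by simp, ← ENNReal.ofReal_mul (by norm_num),
              ← ENNReal.ofReal_mul (by norm_num), ← ENNReal.ofReal_add (by positivity)
              (by positivity)]
            apply ENNReal.ofReal_le_ofReal
            have := abs_add_le x (z - x)
            rw [add_sub_cancel] at this
            linarith [abs_nonneg x, abs_nonneg (z - x)]
          calc ENNReal.ofReal (K + |z|) * (a x * b (z - x))
              ≤ (2 * ENNReal.ofReal (K + |x|) + 2 * ENNReal.ofReal (K + |z - x|)) *
                (a x * b (z - x)) := mul_le_mul_left this _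
            _ = 2 * (ENNReal.ofReal (K + |x|) * a x) * b (z - x) +
                2 * (ENNReal.ofReal (K + |z - x|) * b (z - x)) * a x := by ring
            _ ≤ 2 * Ca * b (z - x) + 2 * Cb * a x := by
              gcongr
              · exact ha.mul_le x
              · exact hb.mul_le _
      _ = 2 * Ca * (∫⁻ x, b (z - x)) + 2 * Cb * ∫⁻ x, a x := by
          rw [lintegral_add_left (by fun_prop), lintegral_const_mul _ (by fun_prop),
            lintegral_const_mul _ h1]
      _ ≤ 2 * Ca * Cb + 2 * Cb * Ca := by
          rw [lintegral_sub_left_eq_self b z]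
          gcongr
          · exact hb.lintegral_le
          · exact ha.lintegral_le
      _ = 4 * (Ca * Cb) := by ring

/-- Change of variables along an injective function whose derivative is bounded below by `c`. -/
theorem setLIntegral_comp_le {E : Set ℝ} (hE : MeasurableSet E) {g g' : ℝ → ℝ} {c : ℝ} (hc : 0 < c)
    (hg : ∀ y ∈ E, HasDerivAt g (g' y) y) (hg' : ∀ y ∈ E, c ≤ |g' y|) (hinj : InjOn g E)
    (ρ : ℝ → ℝ≥0∞) : ∫⁻ y in E, ρ (g y) ≤ ENNReal.ofReal c⁻¹ * ∫⁻ z, ρ z := by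
  have h1 := lintegral_image_eq_lintegral_abs_deriv_mul hE
    (fun y hy => (hg y hy).hasDerivWithinAt) hinj ρ
  have h2 : ENNReal.ofReal c * ∫⁻ y in E, ρ (g y) ≤ ∫⁻ z, ρ z := by
    calc ENNReal.ofReal c * ∫⁻ y in E, ρ (g y) = ∫⁻ y in E, ENNReal.ofReal c * ρ (g y) := by
          rw [lintegral_const_mul' _ _ ENNReal.ofReal_ne_top]
      _ ≤ ∫⁻ y in E, ENNReal.ofReal |g' y| * ρ (g y) := by
          apply setLIntegral_mono' hE
          intro y hy
          gcongr
          exact hg' y hy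
      _ = ∫⁻ z in g '' E, ρ z := h1.symm
      _ ≤ _ := setLIntegral_le_lintegral _ _
  have hc0 : ENNReal.ofReal c ≠ 0 := by simpa using hc
  rw [ENNReal.ofReal_inv_of_pos hc]
  calc _ = (ENNReal.ofReal c)⁻¹ * (ENNReal.ofReal c * ∫⁻ y in E, ρ (g y)) := by
        rw [← mul_assoc, ENNReal.inv_mul_cancel hc0 ENNReal.ofReal_ne_top, one_mul]
    _ ≤ _ := by gcongr

/-- Inverse square root decay of the integral of a density along a parabola. -/
theorem IsDensity.lintegral_sq_le {K : ℝ} (hK : 0 < K) {C : ℝ≥0∞} {ρ : ℝ → ℝ≥0∞}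
    (hρ : IsDensity K C ρ) (β : ℝ) {e : ℝ} (he : |e| = 1) :
    ∫⁻ q in Ici 0, ρ (β + e * q ^ 2) ≤ ENNReal.ofReal (2 / √(K + |β|)) * C := by
  set B := K + |β| with hB
  have hBpos : 0 < B := by positivity
  have hs : 0 < √B := Real.sqrt_pos.2 hBpos
  have hsB : √B * √B = B := Real.mul_self_sqrt hBpos.le
  have hsplit : Ici (0 : ℝ) ⊆ Icc 0 (√B / 2) ∪ Ici (√B / 2) := by
    intro q hq
    rcases le_total q (√B / 2) with h | h
    · exact Or.inl ⟨hq, h⟩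
    · exact Or.inr h
  -- for `q ≥ √B / 2` the derivative of `β ± q²` is at least `√B`
  have h1 : ∫⁻ q in Ici (√B / 2), ρ (β + e * q ^ 2) ≤ ENNReal.ofReal (√B)⁻¹ * C := by
    refine (setLIntegral_comp_le (g := fun q => β + e * q ^ 2) (g' := fun q => e * (2 * q))
      measurableSet_Ici hs ?_ ?_ ?_ ρ).trans (by gcongr; exact hρ.lintegral_le)
    · intro y _
      simpa using ((hasDerivAt_pow 2 y).const_mul e).const_add β
    · intro y hy
      have hy : √B / 2 ≤ y := hy
      rw [abs_mul, he, one_mul, abs_of_nonneg (by linarith)]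
      linarith
    · intro x hx y hy hxy
      have hx : √B / 2 ≤ x := hx
      have hy : √B / 2 ≤ y := hy
      have he0 : e ≠ 0 := by rintro rfl; simp at he
      have h2 : x ^ 2 = y ^ 2 := by
        have : e * x ^ 2 = e * y ^ 2 := by simpa using hxy
        exact mul_left_cancel₀ he0 this
      exact (sq_eq_sq₀ (by linarith) (by linarith)).1 h2
  -- for `q ≤ √B / 2` the term `q² ≤ B / 4` is too small to bring the argument near zero
  have h2 : ∫⁻ q in Icc 0 (√B / 2), ρ (β + e * q ^ 2) ≤ ENNReal.ofReal (√B)⁻¹ * C := by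
    calc _ ≤ ∫⁻ q in Icc 0 (√B / 2), ENNReal.ofReal (B * (3 / 4))⁻¹ * C := by
          apply setLIntegral_mono' measurableSet_Icc
          intro q hq
          apply hρ.le (by positivity)
          have hq2 : q ^ 2 ≤ B / 4 := by
            have := mul_self_le_mul_self hq.1 hq.2
            nlinarith
          have : |β| ≤ |β + e * q ^ 2| + q ^ 2 := by
            have := abs_sub (β + e * q ^ 2) (e * q ^ 2)
            rw [add_sub_cancel_right, abs_mul e, he, one_mul, abs_of_nonneg (sq_nonneg q)] at this
            exact this
          linarith
      _ = ENNReal.ofReal (B * (3 / 4))⁻¹ * C * ENNReal.ofReal (√B / 2) := by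
          simp
      _ = ENNReal.ofReal ((B * (3 / 4))⁻¹ * (√B / 2)) * C := by
          rw [ENNReal.ofReal_mul (by positivity)]; ring
      _ ≤ _ := by
          gcongr
          rw [inv_mul_eq_div, div_le_iff₀ (by positivity)]
          have : (√B)⁻¹ * (B * (3 / 4)) = √B * (3 / 4) := by
            field_simp; linarith
          rw [this]; linarith
  calc _ ≤ ∫⁻ q in Icc 0 (√B / 2) ∪ Ici (√B / 2), ρ (β + e * q ^ 2) :=
        lintegral_mono_set hsplit
    _ ≤ _ := lintegral_union_le _ _ _
    _ ≤ ENNReal.ofReal (√B)⁻¹ * C + ENNReal.ofReal (√B)⁻¹ * C := add_le_add h2 h1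
    _ = _ := by
      rw [← add_mul, ← ENNReal.ofReal_add (by positivity) (by positivity)]
      congr 2; ring

/-- The decay of `IsDensity.lintegral_sq_le` at a nondegenerate critical point of size `M`: near it,
`M (1 - cos y)` is the square of `√(2M) sin (y / 2)`. -/
theorem IsDensity.lintegral_one_sub_cos_le {K : ℝ} (hK : 0 < K) {C : ℝ≥0∞} {ρ : ℝ → ℝ≥0∞}
    (hρ : IsDensity K C ρ) (β : ℝ) {e : ℝ} (he : |e| = 1) {M : ℝ} (hM : 0 < M) :
    ∫⁻ y in Icc (-(Real.pi / 2)) (Real.pi / 2), ρ (β + e * (M * (1 - Real.cos y)))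
      ≤ ENNReal.ofReal (8 / (√M * √(K + |β|))) * C := by
  have hpi := Real.pi_pos
  have hsM : 0 < √M := Real.sqrt_pos.2 hM
  -- the substitution is injective on each half of the interval; `d` is the sign of `y`
  have key : ∀ E : Set ℝ, MeasurableSet E → E ⊆ Icc (-(Real.pi / 2)) (Real.pi / 2) →
      ∀ d : ℝ, |d| = 1 → (∀ y ∈ E, 0 ≤ d * y) →
      ∫⁻ y in E, ρ (β + e * (M * (1 - Real.cos y)))
        ≤ ENNReal.ofReal (4 / (√M * √(K + |β|))) * C := by
    intro E hE hEsub d hd hdE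
    have hd0 : d ≠ 0 := by rintro rfl; simp at hd
    have hd2 : d ^ 2 = 1 := by rw [← sq_abs, hd]; norm_num
    set g : ℝ → ℝ := fun y => √2 * √M * d * Real.sin (y / 2) with hg
    have hgsq : ∀ y, M * (1 - Real.cos y) = g y ^ 2 := by
      intro y
      have : Real.cos y = 1 - 2 * Real.sin (y / 2) ^ 2 := by
        have := Real.cos_two_mul' (y / 2)
        rw [show 2 * (y / 2) = y by ring] at this
        rw [this, Real.cos_sq']; ring
      rw [this, hg]
      simp only [mul_pow, hd2, Real.sq_sqrt hM.le, Real.sq_sqrt (show (0 : ℝ) ≤ 2 by norm_num)]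
      ring
    have hgpos : ∀ y ∈ E, 0 ≤ g y := by
      intro y hy
      have h1 := hEsub hy
      have h2 := hdE y hy
      have : 0 ≤ d * Real.sin (y / 2) := by
        rcases (abs_eq (by norm_num : (0 : ℝ) ≤ 1)).1 hd with rfl | rfl
        · have : 0 ≤ Real.sin (y / 2) :=
            Real.sin_nonneg_of_nonneg_of_le_pi (by linarith) (by linarith [h1.2])
          linarith
        · have : Real.sin (y / 2) ≤ 0 :=
            Real.sin_nonpos_of_nonpos_of_neg_pi_le (by linarith) (by linarith [h1.1])
          linarith
      simp only [hg]
      rw [mul_assoc]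
      positivity
    calc ∫⁻ y in E, ρ (β + e * (M * (1 - Real.cos y)))
        = ∫⁻ y in E, (Ici 0).indicator (fun q => ρ (β + e * q ^ 2)) (g y) := by
          apply setLIntegral_congr_fun hE
          intro y hy
          simp only [hgsq]
          rw [indicator_of_mem (show g y ∈ Ici 0 from hgpos y hy)]
      _ ≤ ENNReal.ofReal (√M / 2)⁻¹ * ∫⁻ q, (Ici 0).indicator (fun q => ρ (β + e * q ^ 2)) q := by
          apply setLIntegral_comp_le hE
            (g' := fun y => √2 * √M * d * (Real.cos (y / 2) * (1 / 2))) (by positivity)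
          · intro y _
            have := ((hasDerivAt_id y).div_const 2).sin
            exact this.const_mul _
          · intro y hy
            have h1 := hEsub hy
            have hc : √2 / 2 ≤ Real.cos (y / 2) := by
              rw [← Real.cos_pi_div_four, ← Real.cos_abs (y / 2)]
              apply Real.cos_le_cos_of_nonneg_of_le_pi (abs_nonneg _) (by linarith)
              rw [abs_le]; constructor <;> linarith [h1.1, h1.2]
            have h2 : √2 * √2 = 2 := Real.mul_self_sqrt (by norm_num)
            have h20 : 0 < √2 := by positivity
            rw [abs_mul, abs_mul _ d, hd, mul_one, abs_of_nonneg (by positivity),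
              abs_of_nonneg (by nlinarith)]
            nlinarith [mul_le_mul_of_nonneg_left hc (mul_pos h20 hsM).le]
          · intro x hx y hy hxy
            have h1 := hEsub hx
            have h2 := hEsub hy
            have h20 : 0 < √2 := by positivity
            have : Real.sin (x / 2) = Real.sin (y / 2) := by
              refine mul_left_cancel₀ (b := Real.sin (x / 2)) ?_ hxy
              positivity
            have := Real.injOn_sin ⟨by linarith [h1.1], by linarith [h1.2]⟩
              ⟨by linarith [h2.1], by linarith [h2.2]⟩ this
            linarith
      _ = ENNReal.ofReal (√M / 2)⁻¹ * ∫⁻ q in Ici 0, ρ (β + e * q ^ 2) := by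
          rw [lintegral_indicator measurableSet_Ici]
      _ ≤ ENNReal.ofReal (√M / 2)⁻¹ * (ENNReal.ofReal (2 / √(K + |β|)) * C) := by
          gcongr
          exact hρ.lintegral_sq_le hK β he
      _ = _ := by
          rw [← mul_assoc, ← ENNReal.ofReal_mul (by positivity)]
          congr 2
          rw [inv_div, div_mul_div_comm]; norm_num
  have hsub : Icc (-(Real.pi / 2)) (Real.pi / 2) ⊆
      Icc (-(Real.pi / 2)) 0 ∪ Icc 0 (Real.pi / 2) := by
    intro y hy
    rcases le_total y 0 with h | h
    · exact Or.inl ⟨hy.1, h⟩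
    · exact Or.inr ⟨h, hy.2⟩
  calc _ ≤ _ := lintegral_mono_set hsub
    _ ≤ _ := lintegral_union_le _ _ _
    _ ≤ ENNReal.ofReal (4 / (√M * √(K + |β|))) * C + ENNReal.ofReal (4 / (√M * √(K + |β|))) * C := by
        apply add_le_add
        · exact key _ measurableSet_Icc (Icc_subset_Icc_right (by positivity)) (-1) (by simp)
            (fun y hy => by linarith [hy.2])
        · exact key _ measurableSet_Icc (Icc_subset_Icc_left (by linarith)) 1 (by simp)
            (fun y hy => by linarith [hy.1])
    _ = _ := by
        rw [← add_mul, ← ENNReal.ofReal_add (by positivity) (by positivity)]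
        congr 2; ring

/-! ### Phase functions and the weighted resonance estimates -/

/-- The dispersion relation `p(ξ) = (ξ - (2/h) sin(hξ/2)) / h²`, so that `S_h^±(t)` has the symbol
`e^{±itp}`. -/
def dispersion (h x : ℝ) : ℝ := (x - 2 / h * Real.sin (h * x / 2)) / h ^ 2

/-- The dispersion relation `2ξ/h² - p(ξ)` of the counter-propagating wave, seen in the frame moving
with the other wave. -/
def dispersionOpp (h x : ℝ) : ℝ := 2 * x / h ^ 2 - dispersion h x

/-- The Japanese bracket `⟨x⟩`. -/
def jap (x : ℝ) : ℝ := √(1 + |x| ^ 2)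

theorem one_le_jap (x : ℝ) : 1 ≤ jap x := by
  rw [jap, Real.one_le_sqrt]; nlinarith [sq_nonneg |x|]

theorem jap_pos (x : ℝ) : 0 < jap x := zero_lt_one.trans_le (one_le_jap x)

theorem abs_le_jap (x : ℝ) : |x| ≤ jap x := by
  rw [jap]; apply Real.le_sqrt_of_sq_le; linarith

@[fun_prop]
theorem continuous_jap : Continuous jap := by unfold jap; fun_prop

@[fun_prop]
theorem continuous_dispersion (h : ℝ) : Continuous (dispersion h) := by
  unfold dispersion; fun_prop

@[fun_prop]
theorem continuous_dispersionOpp (h : ℝ) : Continuous (dispersionOpp h) := by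
  unfold dispersionOpp; fun_prop

theorem dispersion_neg (h x : ℝ) : dispersion h (-x) = -dispersion h x := by
  simp only [dispersion, mul_neg, neg_div, Real.sin_neg]; ring

theorem phase_same {h : ℝ} (hh : 0 < h) {θ S k : ℝ} (hS : S = θ + k * Real.pi) (y : ℝ) :
    -dispersion h (2 * θ / h) + dispersion h ((S + 2 * y) / h) + dispersion h ((S - 2 * y) / h) =
      2 / h ^ 3 * (k * Real.pi + Real.sin θ - 2 * Real.sin (S / 2) * Real.cos y) := by
  have e1 : h * (2 * θ / h) / 2 = θ := by field_simp
  have e2 : h * ((S + 2 * y) / h) / 2 = S / 2 + y := by field_simp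
  have e3 : h * ((S - 2 * y) / h) / 2 = S / 2 - y := by field_simp
  simp only [dispersion, e1, e2, e3, Real.sin_add, Real.sin_sub]
  field_simp
  rw [hS]; ring

theorem phase_cross {h : ℝ} (hh : 0 < h) {θ S k : ℝ} (hS : S = θ + k * Real.pi) (y : ℝ) :
    -dispersion h (2 * θ / h) + dispersion h ((S + 2 * y) / h)
        + dispersionOpp h ((S - 2 * y) / h) =
      2 / h ^ 3 * (k * Real.pi + Real.sin θ - 2 * Real.cos (S / 2) * Real.sin y) := by
  have e1 : h * (2 * θ / h) / 2 = θ := by field_simp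
  have e2 : h * ((S + 2 * y) / h) / 2 = S / 2 + y := by field_simp
  have e3 : h * ((S - 2 * y) / h) / 2 = S / 2 - y := by field_simp
  simp only [dispersion, dispersionOpp, e1, e2, e3, Real.sin_add, Real.sin_sub]
  field_simp
  rw [hS]; ring

theorem phase_opp {h : ℝ} (hh : 0 < h) {θ S k : ℝ} (hS : S = θ + k * Real.pi) (y : ℝ) :
    -dispersion h (2 * θ / h) + dispersionOpp h ((S + 2 * y) / h)
        + dispersionOpp h ((S - 2 * y) / h) =
      2 / h ^ 3 * (k * Real.pi + Real.sin θ + 2 * Real.sin (S / 2) * Real.cos y) := by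
  have e1 : h * (2 * θ / h) / 2 = θ := by field_simp
  have e2 : h * ((S + 2 * y) / h) / 2 = S / 2 + y := by field_simp
  have e3 : h * ((S - 2 * y) / h) / 2 = S / 2 - y := by field_simp
  simp only [dispersion, dispersionOpp, e1, e2, e3, Real.sin_add, Real.sin_sub]
  field_simp
  rw [hS]; ring

/-- The possible number of wraps around the frequency circle in the sum of two frequencies. -/
def IsWrap (k : ℝ) : Prop := k = 0 ∨ k = 1 ∨ k = -1

theorem IsWrap.sin_eq {k θ S : ℝ} (hk : IsWrap k) (hS : S = θ + k * Real.pi) :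
    Real.sin θ = if k = 0 then Real.sin S else -Real.sin S := by
  rcases hk with rfl | rfl | rfl
  · simp [hS]
  · simp [hS, Real.sin_add_pi]
  · have : S = θ - Real.pi := by rw [hS]; ring
    simp [this, Real.sin_sub_pi]

theorem sq_sin_eq_of_wrap {k θ S : ℝ} (hk : IsWrap k) (hS : S = θ + k * Real.pi) :
    Real.sin θ ^ 2 = 4 * Real.sin (S / 2) ^ 2 * Real.cos (S / 2) ^ 2 := by
  have h2 : Real.sin S = 2 * Real.sin (S / 2) * Real.cos (S / 2) := by
    rw [← Real.sin_two_mul]; ring_nf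
  rw [hk.sin_eq hS]
  split_ifs <;> rw [h2] <;> ring

/-- `sin S + 2 sin (S/2) ≤ 13/5 < π`: a frequency interaction that wraps around the circle is never
resonant. -/
theorem sin_add_two_sin_half_le (S : ℝ) : |Real.sin S| + 2 * |Real.sin (S / 2)| ≤ 13 / 5 := by
  have h2 : Real.sin S = 2 * Real.sin (S / 2) * Real.cos (S / 2) := by
    rw [← Real.sin_two_mul]; ring_nf
  rw [h2, abs_mul, abs_mul]
  set a := |Real.sin (S / 2)| with ha
  set c := |Real.cos (S / 2)| with hc
  have h1 : a ^ 2 + c ^ 2 = 1 := by rw [ha, hc, sq_abs, sq_abs]; exact Real.sin_sq_add_cos_sq _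
  have ha0 : 0 ≤ a := abs_nonneg _
  have hc0 : 0 ≤ c := abs_nonneg _
  -- `(1 - c²)(1 + c)²` is largest at `c = 1 / 2`
  have h4 : (a * (1 + c)) ^ 2 ≤ 27 / 16 := by
    have : (a * (1 + c)) ^ 2 = (1 - c ^ 2) * (1 + c) ^ 2 := by rw [← h1]; ring
    rw [this]
    nlinarith [mul_nonneg (sq_nonneg (c - 1 / 2)) (by nlinarith : (0:ℝ) ≤ c ^ 2 + 3 * c + 11 / 4)]
  have h5 : a * (1 + c) ≤ 13 / 10 := by
    apply le_of_sq_le_sq _ (by norm_num) |> fun h => h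
    linarith [h4, (by norm_num : (27 / 16 : ℝ) ≤ (13 / 10) ^ 2)]
  simp only [abs_two]
  linarith

/-- The phase `same` at its critical point `y = 0` is of size `|sin (S / 2)|³`; if the frequencies
wrap around the circle, it is even bounded below. -/
theorem abs_phase_same_center {k θ S : ℝ} (hk : IsWrap k) (hS : S = θ + k * Real.pi) :
    |Real.sin (S / 2)| ^ 3 / 2 ≤ |k * Real.pi + Real.sin θ - 2 * Real.sin (S / 2)| := by
  have hA1 : |Real.sin (S / 2)| ≤ 1 := Real.abs_sin_le_one _
  have hA0 := abs_nonneg (Real.sin (S / 2))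
  have hA3 : |Real.sin (S / 2)| ^ 3 / 2 ≤ 1 / 2 := by
    have := pow_le_one₀ (n := 3) hA0 hA1
    linarith
  have h13 := sin_add_two_sin_half_le S
  have b1 := neg_abs_le (Real.sin S)
  have b2 := le_abs_self (Real.sin S)
  have b3 := neg_abs_le (Real.sin (S / 2))
  have b4 := le_abs_self (Real.sin (S / 2))
  have hpi := Real.pi_gt_d2
  rw [hk.sin_eq hS]
  rcases hk with rfl | rfl | rfl
  · have h2 : Real.sin S = 2 * Real.sin (S / 2) * Real.cos (S / 2) := by
      rw [← Real.sin_two_mul]; ring_nf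
    have hc1 : Real.cos (S / 2) ≤ 1 := Real.cos_le_one _
    have hc2 : -1 ≤ Real.cos (S / 2) := Real.neg_one_le_cos _
    rw [if_pos rfl, h2, show (0:ℝ) * Real.pi + 2 * Real.sin (S / 2) * Real.cos (S / 2)
      - 2 * Real.sin (S / 2) = Real.sin (S / 2) * (2 * (Real.cos (S / 2) - 1)) by ring, abs_mul,
      abs_of_nonpos (show 2 * (Real.cos (S / 2) - 1) ≤ 0 by linarith)]
    have : |Real.sin (S / 2)| ^ 2 / 2 ≤ -(2 * (Real.cos (S / 2) - 1)) := by
      rw [sq_abs, Real.sin_sq]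
      nlinarith
    calc |Real.sin (S / 2)| ^ 3 / 2 = |Real.sin (S / 2)| * (|Real.sin (S / 2)| ^ 2 / 2) := by ring
      _ ≤ _ := by gcongr
  · rw [if_neg (by norm_num)]
    refine le_trans ?_ (le_abs_self _)
    linarith
  · rw [if_neg (by norm_num)]
    refine le_trans ?_ (neg_le_abs _)
    linarith

/-- The range of the variable `y = h(ξ₁ - ξ₂)/4` when `h(ξ₁ + ξ₂)/2 = S`. -/
def yRange (S : ℝ) : Set ℝ := {y | |S / 2 + y| ≤ Real.pi / 2 ∧ |S / 2 - y| ≤ Real.pi / 2}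

theorem measurableSet_yRange (S : ℝ) : MeasurableSet (yRange S) := by
  exact ((isClosed_le (f := fun y => |S / 2 + y|) (g := fun _ => Real.pi / 2) (by fun_prop)
    (by fun_prop)).inter (isClosed_le (f := fun y => |S / 2 - y|) (g := fun _ => Real.pi / 2)
    (by fun_prop) (by fun_prop))).measurableSet

theorem yRange_subset (S : ℝ) : yRange S ⊆ Icc (-(Real.pi / 2)) (Real.pi / 2) := by
  rintro y ⟨h1, h2⟩
  rw [abs_le] at h1 h2
  constructor <;> linarith

theorem sin_half_le_cos {S y : ℝ} (hy : y ∈ yRange S) : |Real.sin (S / 2)| ≤ Real.cos y := by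
  have hpi := Real.pi_pos
  obtain ⟨h1, h2⟩ := hy
  rw [abs_le] at h1 h2
  rcases le_total 0 S with hS0 | hS0
  · rw [abs_of_nonneg (Real.sin_nonneg_of_nonneg_of_le_pi (by linarith) (by linarith)),
      ← Real.cos_pi_div_two_sub, ← Real.cos_abs y]
    apply Real.cos_le_cos_of_nonneg_of_le_pi (abs_nonneg _) (by linarith)
    rw [abs_le]; constructor <;> linarith
  · rw [abs_of_nonpos (Real.sin_nonpos_of_nonpos_of_neg_pi_le (by linarith) (by linarith)),
      ← Real.sin_neg, ← Real.cos_pi_div_two_sub, ← Real.cos_abs y]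
    apply Real.cos_le_cos_of_nonneg_of_le_pi (abs_nonneg _) (by linarith)
    rw [abs_le]; constructor <;> linarith

/-- The interaction of two counter-propagating waves into a wave is never resonant. -/
theorem abs_phase_opp {k θ S y : ℝ} (hk : IsWrap k) (hS : S = θ + k * Real.pi)
    (hθ : |θ| ≤ Real.pi / 2) (hy : y ∈ yRange S) :
    2 * |Real.sin (S / 2)| ≤
      |k * Real.pi + Real.sin θ + 2 * Real.sin (S / 2) * Real.cos y| := by
  have hpi := Real.pi_gt_d2
  obtain ⟨h1, h2⟩ := id hy
  rw [abs_le] at h1 h2 hθ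
  have hA1 : |Real.sin (S / 2)| ≤ 1 := Real.abs_sin_le_one _
  have hcy : 0 ≤ Real.cos y :=
    Real.cos_nonneg_of_neg_pi_div_two_le_of_le (by linarith) (by linarith)
  have s1 := Real.sin_le_one S
  have s2 := Real.neg_one_le_sin S
  rw [hk.sin_eq hS]
  rcases hk with rfl | rfl | rfl
  · have hh2 : Real.sin S = 2 * Real.sin (S / 2) * Real.cos (S / 2) := by
      rw [← Real.sin_two_mul]; ring_nf
    rw [if_pos rfl, hh2, show (0:ℝ) * Real.pi + 2 * Real.sin (S / 2) * Real.cos (S / 2)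
      + 2 * Real.sin (S / 2) * Real.cos y
      = 2 * Real.sin (S / 2) * (Real.cos (S / 2) + Real.cos y) by ring, abs_mul, abs_mul, abs_two]
    have hcS : 0 ≤ Real.cos (S / 2) :=
      Real.cos_nonneg_of_neg_pi_div_two_le_of_le (by linarith) (by linarith)
    have hcyA := sin_half_le_cos hy
    have : 1 ≤ Real.cos (S / 2) + Real.cos y := by
      have hsc := Real.sin_sq_add_cos_sq (S / 2)
      rw [← sq_abs (Real.sin _)] at hsc
      nlinarith [abs_nonneg (Real.sin (S / 2)), Real.cos_le_one (S / 2)]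
    rw [abs_of_nonneg (by linarith : 0 ≤ Real.cos (S / 2) + Real.cos y)]
    nlinarith [abs_nonneg (Real.sin (S / 2))]
  · rw [if_neg (by norm_num)]
    refine le_trans ?_ (le_abs_self _)
    have : 0 ≤ Real.sin (S / 2) := Real.sin_nonneg_of_nonneg_of_le_pi (by linarith) (by linarith)
    nlinarith [mul_nonneg this hcy]
  · rw [if_neg (by norm_num)]
    refine le_trans ?_ (neg_le_abs _)
    have : Real.sin (S / 2) ≤ 0 := Real.sin_nonpos_of_nonpos_of_neg_pi_le (by linarith) (by linarith)
    nlinarith [mul_nonneg (neg_nonneg.2 this) hcy]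

theorem exists_sign (a : ℝ) : ∃ e : ℝ, |e| = 1 ∧ a = e * |a| := by
  rcases le_total 0 a with h | h
  · exact ⟨1, by simp, by simp [abs_of_nonneg h]⟩
  · exact ⟨-1, by simp, by simp [abs_of_nonpos h]⟩

theorem sqrt_mul_add_le {K X σ β : ℝ} (hK : 0 < K) (hX : X ≤ |σ| + |β|) :
    K * X ≤ (K + |σ|) * (K + |β|) := by
  nlinarith [abs_nonneg σ, abs_nonneg β, mul_nonneg (abs_nonneg σ) (abs_nonneg β)]

/-- The resonance estimate for two waves travelling in the same direction as the output. -/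
theorem setLIntegral_same_le {h K : ℝ} (hh : 0 < h) (hK : 0 < K) {C : ℝ≥0∞} {ρ : ℝ → ℝ≥0∞}
    (hρ : IsDensity K C ρ) (σ : ℝ) {ε : ℝ} (hε : |ε| = 1) {θ S k : ℝ} (hk : IsWrap k)
    (hS : S = θ + k * Real.pi) {W : ℝ} (hW0 : 0 ≤ W) (hW : W ≤ 1 / (√K * √(K + |σ|))) :
    ENNReal.ofReal (4 / h ^ 3 * Real.sin θ ^ 2 * W) *
      ∫⁻ y in Icc (-(Real.pi / 2)) (Real.pi / 2),
        ρ (σ - ε * (-dispersion h (2 * θ / h) + dispersion h ((S + 2 * y) / h)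
          + dispersion h ((S - 2 * y) / h)) / (2 * Real.pi))
      ≤ ENNReal.ofReal (128 * Real.pi / K) * C := by
  have hpi := Real.pi_pos
  obtain ⟨e, he, heA⟩ := exists_sign (Real.sin (S / 2))
  have hsq := sq_sin_eq_of_wrap hk hS
  set A := |Real.sin (S / 2)| with hA
  have hA0 : 0 ≤ A := abs_nonneg _
  have hε0 : ε ^ 2 = 1 := by rw [← sq_abs, hε]; norm_num
  rw [heA, mul_pow, show e ^ 2 = 1 by rw [← sq_abs, he]; norm_num, one_mul] at hsq
  rcases hA0.eq_or_lt with hA0' | hApos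
  · rw [hsq, ← hA0']; simp
  set Φ₀ := 2 / h ^ 3 * (k * Real.pi + Real.sin θ - 2 * Real.sin (S / 2)) with hΦ
  set β := σ - ε * Φ₀ / (2 * Real.pi) with hβ
  set M := 2 * A / (Real.pi * h ^ 3) with hM
  have hMpos : 0 < M := by positivity
  have hfun : ∀ y, σ - ε * (-dispersion h (2 * θ / h) + dispersion h ((S + 2 * y) / h)
          + dispersion h ((S - 2 * y) / h)) / (2 * Real.pi)
        = β + (-ε * e) * (M * (1 - Real.cos y)) := by
    intro y
    rw [phase_same hh hS, hβ, hΦ, hM, heA]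
    field_simp
    ring
  simp_rw [hfun]
  have hee : |-ε * e| = 1 := by rw [abs_mul, abs_neg, hε, he, one_mul]
  -- `σ - β` is the critical value of the phase, so it is bounded by the two modulations together
  have hX : A ^ 3 / (2 * Real.pi * h ^ 3) ≤ |σ| + |β| := by
    have h1 : A ^ 3 / h ^ 3 ≤ |Φ₀| := by
      rw [hΦ, abs_mul, abs_of_pos (by positivity : 0 < 2 / h ^ 3)]
      have := abs_phase_same_center hk hS
      calc A ^ 3 / h ^ 3 = 2 / h ^ 3 * (A ^ 3 / 2) := by ring
        _ ≤ _ := by gcongr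
    have h2 : |Φ₀| / (2 * Real.pi) ≤ |σ| + |β| := by
      have : |σ - β| ≤ |σ| + |β| := abs_sub _ _
      rw [hβ, sub_sub_cancel, abs_div, abs_mul, hε, one_mul,
        abs_of_pos (by positivity : 0 < 2 * Real.pi)] at this
      exact this
    refine le_trans ?_ h2
    rw [show A ^ 3 / (2 * Real.pi * h ^ 3) = A ^ 3 / h ^ 3 / (2 * Real.pi) by field_simp]
    gcongr
  have hprod := sqrt_mul_add_le hK hX
  calc _ ≤ ENNReal.ofReal (4 / h ^ 3 * Real.sin θ ^ 2 * W) *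
        (ENNReal.ofReal (8 / (√M * √(K + |β|))) * C) := by
        gcongr
        exact hρ.lintegral_one_sub_cos_le hK β hee hMpos
    _ = ENNReal.ofReal (4 / h ^ 3 * Real.sin θ ^ 2 * W * (8 / (√M * √(K + |β|)))) * C := by
        rw [← mul_assoc, ← ENNReal.ofReal_mul (by positivity)]
    _ ≤ _ := by
        gcongr
        have hs2 : Real.sin θ ^ 2 ≤ 4 * A ^ 2 := by
          rw [hsq]; nlinarith [Real.cos_sq_le_one (S / 2), sq_nonneg A]
        -- the output weight and the decay at the critical point gain the square roots of the two
        -- modulations; their product absorbs the factor `A²` of the output symbol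
        have hbig : K * A ^ 2 / (Real.pi * h ^ 3) ≤
            (√K * √(K + |σ|)) * (√M * √(K + |β|)) := by
          rw [← Real.sqrt_mul hK.le, ← Real.sqrt_mul hMpos.le,
            ← Real.sqrt_mul (by positivity)]
          apply Real.le_sqrt_of_sq_le
          calc (K * A ^ 2 / (Real.pi * h ^ 3)) ^ 2
              = K * M * (K * (A ^ 3 / (2 * Real.pi * h ^ 3))) := by
                rw [hM]; field_simp
            _ ≤ K * M * ((K + |σ|) * (K + |β|)) := by gcongr
            _ = _ := by ring
        have hsK : 0 < √K * √(K + |σ|) := by positivity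
        have hsM : 0 < √M * √(K + |β|) := by positivity
        calc 4 / h ^ 3 * Real.sin θ ^ 2 * W * (8 / (√M * √(K + |β|)))
            ≤ 4 / h ^ 3 * (4 * A ^ 2) * (1 / (√K * √(K + |σ|))) * (8 / (√M * √(K + |β|))) := by
              gcongr
          _ = 128 * A ^ 2 / h ^ 3 / ((√K * √(K + |σ|)) * (√M * √(K + |β|))) := by
              field_simp; ring
          _ ≤ 128 * A ^ 2 / h ^ 3 / (K * A ^ 2 / (Real.pi * h ^ 3)) := by gcongr
          _ = 128 * Real.pi / K := by field_simp

/-- The weight `(⟨x⟩⟨y⟩)^{-2s}` for two frequencies. -/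
def wt (s x y : ℝ) : ℝ := (jap x * jap y) ^ (-(2 * s))

theorem wt_nonneg (s x y : ℝ) : 0 ≤ wt s x y :=
  Real.rpow_nonneg (mul_nonneg (jap_pos x).le (jap_pos y).le) _

theorem one_le_jap_mul (x y : ℝ) : 1 ≤ jap x * jap y := by
  nlinarith [one_le_jap x, one_le_jap y]

theorem wt_le_one {s : ℝ} (hs : 0 ≤ s) (x y : ℝ) : wt s x y ≤ 1 :=
  Real.rpow_le_one_of_one_le_of_nonpos (one_le_jap_mul x y) (by linarith)

@[fun_prop]
theorem continuous_wt (s : ℝ) : Continuous fun p : ℝ × ℝ => wt s p.1 p.2 := by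
  unfold wt
  apply Continuous.rpow_const (by fun_prop)
  intro p
  exact Or.inl (by have := one_le_jap_mul p.1 p.2; positivity)

/-- If `A ≤ 1` and `A ≤ h ⟨x⟩⟨y⟩`, then powers `A^a` with `2s ≤ a` times the weight are at most
`h^{2s}`. -/
theorem mul_wt_le {s h A x y : ℝ} (hs : 0 ≤ s) (hh : 0 < h) (hA0 : 0 ≤ A) (hA1 : A ≤ 1)
    (hA : A ≤ h * (jap x * jap y)) {n : ℕ} (hn : 2 * s ≤ n) (hn0 : n ≠ 0) :
    A ^ n * wt s x y ≤ h ^ (2 * s) := by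
  have hL := one_le_jap_mul x y
  rcases hA0.eq_or_lt with rfl | hApos
  · simp [hn0]; positivity
  have h1 : A ^ n ≤ A ^ (2 * s) := by
    rw [← Real.rpow_natCast]
    exact Real.rpow_le_rpow_of_exponent_ge hApos hA1 hn
  calc A ^ n * wt s x y ≤ (h * (jap x * jap y)) ^ (2 * s) * wt s x y := by
        gcongr
        · exact wt_nonneg _ _ _
        · exact h1.trans (Real.rpow_le_rpow hA0 hA (by linarith))
    _ = h ^ (2 * s) := by
        rw [Real.mul_rpow hh.le (by linarith), wt, mul_assoc, ← Real.rpow_add (by linarith)]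
        simp

theorem sin_half_le_jap {h S y : ℝ} (hh : 0 < h) :
    |Real.sin (S / 2)| ≤ h * (jap ((S + 2 * y) / h) * jap ((S - 2 * y) / h)) ∧
    |Real.sin (S / 2)| ≤ h * max (jap ((S + 2 * y) / h)) (jap ((S - 2 * y) / h)) := by
  set x₁ := (S + 2 * y) / h with hx1
  set x₂ := (S - 2 * y) / h with hx2
  have h1 : |Real.sin (S / 2)| ≤ |S / 2| := Real.abs_sin_le_abs
  have h2 : S / 2 = h * (x₁ + x₂) / 4 := by rw [hx1, hx2]; field_simp; ring
  have h3 : |S / 2| ≤ h * (jap x₁ + jap x₂) / 4 := by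
    rw [h2, abs_div, abs_mul, abs_of_pos hh, abs_of_pos (by norm_num : (0:ℝ) < 4)]
    gcongr
    exact (abs_add_le _ _).trans (add_le_add (abs_le_jap _) (abs_le_jap _))
  have j1 := one_le_jap x₁
  have j2 := one_le_jap x₂
  constructor
  · have : jap x₁ + jap x₂ ≤ 4 * (jap x₁ * jap x₂) := by nlinarith
    have := mul_le_mul_of_nonneg_left this hh.le
    linarith
  · have := le_max_left (jap x₁) (jap x₂)
    have := le_max_right (jap x₁) (jap x₂)
    have : jap x₁ + jap x₂ ≤ 4 * max (jap x₁) (jap x₂) := by linarith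
    have := mul_le_mul_of_nonneg_left this hh.le
    linarith

/-- The phase `cross` has the derivative `2B cos y` in `y`, up to a factor, so it is monotone where
`cos y` is positive. -/
theorem setLIntegral_cross_aux {h K : ℝ} (hh : 0 < h) {C : ℝ≥0∞} {ρ : ℝ → ℝ≥0∞}
    (hρ : IsDensity K C ρ) (σ : ℝ) {ε : ℝ} (hε : |ε| = 1) {c B δ : ℝ} (hB : 0 < B) (hδ : 0 < δ)
    {E : Set ℝ} (hE : MeasurableSet E) (hEsub : E ⊆ Icc (-(Real.pi / 2)) (Real.pi / 2))
    (hcos : ∀ y ∈ E, δ ≤ Real.cos y) :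
    ∫⁻ y in E, ρ (σ - ε * (2 / h ^ 3 * (c - 2 * B * Real.sin y)) / (2 * Real.pi))
      ≤ ENNReal.ofReal (Real.pi * h ^ 3 / (2 * B * δ)) * C := by
  have hpi := Real.pi_pos
  have hε0 : ε ≠ 0 := by rintro rfl; simp at hε
  refine (setLIntegral_comp_le
    (g := fun y => σ - ε * (2 / h ^ 3 * (c - 2 * B * Real.sin y)) / (2 * Real.pi))
    (g' := fun y => ε * (2 * B / (Real.pi * h ^ 3)) * Real.cos y) (c := 2 * B * δ / (Real.pi * h ^ 3))
    hE (by positivity) ?_ ?_ ?_ ρ).trans ?_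
  · intro y _
    have := ((((((Real.hasDerivAt_sin y).const_mul (2 * B)).const_sub c).const_mul
      (2 / h ^ 3)).const_mul ε).div_const (2 * Real.pi)).const_sub σ
    convert! this using 1
    field_simp
  · intro y hy
    have := hcos y hy
    rw [abs_mul, abs_mul, hε, one_mul, abs_of_pos (by positivity),
      abs_of_nonneg (hδ.le.trans this)]
    calc _ = 2 * B / (Real.pi * h ^ 3) * δ := by ring
      _ ≤ _ := by gcongr
  · intro x hx y hy hxy
    apply Real.injOn_sin (hEsub hx) (hEsub hy)
    simp only at hxy
    field_simp at hxy
    have h3 : ε * (2 * B) * (Real.sin x - Real.sin y) = 0 := by linear_combination hxy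
    simp only [mul_eq_zero, hε0, hB.ne', OfNat.ofNat_ne_zero, or_self, false_or] at h3
    linarith
  · rw [inv_div]
    gcongr
    exact hρ.lintegral_le

/-- The weighted estimate for the interaction of waves travelling in opposite directions. -/
theorem setLIntegral_cross_le {h K : ℝ} (hh : 0 < h) (hh1 : h ≤ 1) (hK : 0 < K) {C : ℝ≥0∞}
    {ρ : ℝ → ℝ≥0∞} (hρ : IsDensity K C ρ) (σ : ℝ) {ε : ℝ} (hε : |ε| = 1) {θ S k : ℝ}
    (hk : IsWrap k) (hS : S = θ + k * Real.pi) (hSpi : |S| ≤ Real.pi) {W : ℝ}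
    (hW : W ≤ 1 / K) {s : ℝ} (hs0 : 0 ≤ s) (hs1 : s ≤ 1) :
    ENNReal.ofReal (4 / h ^ 3 * Real.sin θ ^ 2 * W) *
      ∫⁻ y in yRange S,
        ρ (σ - ε * (-dispersion h (2 * θ / h) + dispersion h ((S + 2 * y) / h)
          + dispersionOpp h ((S - 2 * y) / h)) / (2 * Real.pi)) *
        ENNReal.ofReal (wt s ((S + 2 * y) / h) ((S - 2 * y) / h))
      ≤ ENNReal.ofReal (24 * Real.pi * h ^ (2 * s) / K) * C := by
  have hpi := Real.pi_pos
  simp_rw [phase_cross hh hS]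
  have hsq := sq_sin_eq_of_wrap hk hS
  rw [← sq_abs (Real.sin (S / 2))] at hsq
  set A := |Real.sin (S / 2)| with hA
  have hA0 : 0 ≤ A := abs_nonneg _
  have hA1 : A ≤ 1 := Real.abs_sin_le_one _
  set B := Real.cos (S / 2) with hB
  rw [abs_le] at hSpi
  have hB0 : 0 ≤ B := Real.cos_nonneg_of_neg_pi_div_two_le_of_le (by linarith) (by linarith)
  have hB1 : B ≤ 1 := Real.cos_le_one _
  rcases hA0.eq_or_lt with hA0' | hApos
  · rw [hsq, ← hA0']; simp
  rcases hB0.eq_or_lt with hB0' | hBpos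
  · rw [hsq, ← hB0']; simp
  set P : ℝ → ℝ≥0∞ := fun y =>
    ρ (σ - ε * (2 / h ^ 3 * (k * Real.pi + Real.sin θ - 2 * B * Real.sin y)) / (2 * Real.pi))
  set w : ℝ → ℝ := fun y => wt s ((S + 2 * y) / h) ((S - 2 * y) / h) with hw
  have hH : 0 < h ^ (2 * s) := Real.rpow_pos_of_pos hh _
  set E₁ := yRange S ∩ Icc (-(Real.pi / 4)) (Real.pi / 4)
  set E₂ := yRange S \ Icc (-(Real.pi / 4)) (Real.pi / 4)
  have mE₁ : MeasurableSet E₁ := (measurableSet_yRange S).inter measurableSet_Icc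
  have mE₂ : MeasurableSet E₂ := (measurableSet_yRange S).diff measurableSet_Icc
  -- for small `y` the phase has a large derivative, and the gain comes at the cost of `A⁻²`, which
  -- the output symbol pays for
  have b1 : ∫⁻ y in E₁, P y * ENNReal.ofReal (w y) ≤
      ENNReal.ofReal (Real.pi * h ^ 3 / (2 * B * (1 / 2))) * C *
        ENNReal.ofReal (h ^ (2 * s) / A ^ 2) := by
    calc _ ≤ ∫⁻ y in E₁, P y * ENNReal.ofReal (h ^ (2 * s) / A ^ 2) := by
          apply setLIntegral_mono' mE₁
          intro y _
          gcongr
          rw [le_div_iff₀ (by positivity), mul_comm]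
          exact mul_wt_le hs0 hh hA0 hA1 (sin_half_le_jap hh).1 (by push_cast; linarith)
            two_ne_zero
      _ = (∫⁻ y in E₁, P y) * ENNReal.ofReal (h ^ (2 * s) / A ^ 2) := by
          rw [lintegral_mul_const' _ _ ENNReal.ofReal_ne_top]
      _ ≤ _ := by
          gcongr
          refine setLIntegral_cross_aux hh hρ σ hε hBpos (by norm_num) mE₁
            (inter_subset_left.trans (yRange_subset S)) ?_
          intro y hy
          have : √2 / 2 ≤ Real.cos y := by
            rw [← Real.cos_pi_div_four, ← Real.cos_abs y]
            apply Real.cos_le_cos_of_nonneg_of_le_pi (abs_nonneg _) (by linarith)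
            rw [abs_le]; exact hy.2
          have : (1 : ℝ) ≤ √2 := Real.one_le_sqrt.2 (by norm_num)
          linarith
  -- for large `y` only `cos y ≥ A` is available, but the weight gains by itself
  have b2 : ∫⁻ y in E₂, P y * ENNReal.ofReal (w y) ≤
      ENNReal.ofReal (Real.pi * h ^ 3 / (2 * B * A)) * C * ENNReal.ofReal (h ^ (2 * s)) := by
    calc _ ≤ ∫⁻ y in E₂, P y * ENNReal.ofReal (h ^ (2 * s)) := by
          apply setLIntegral_mono' mE₂
          intro y hy
          gcongr
          -- the two frequencies are at distance at least `π/h`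
          have hy4 : Real.pi / 4 < |y| := by
            by_contra hcon
            exact hy.2 (abs_le.1 (not_lt.1 hcon))
          set x₁ := (S + 2 * y) / h with hx1
          set x₂ := (S - 2 * y) / h with hx2
          have h3 : x₁ - x₂ = 4 * y / h := by rw [hx1, hx2]; ring
          have h4 : Real.pi / h ≤ jap x₁ + jap x₂ := by
            calc Real.pi / h ≤ 4 * |y| / h := by gcongr; linarith
              _ = |x₁ - x₂| := by
                rw [h3, abs_div, abs_mul, abs_of_pos hh]; norm_num
              _ ≤ _ := (abs_sub _ _).trans (add_le_add (abs_le_jap _) (abs_le_jap _))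
          have j1 := one_le_jap x₁
          have j2 := one_le_jap x₂
          have hpi3 := Real.pi_gt_three
          have h5 : h⁻¹ ≤ jap x₁ * jap x₂ := by
            have h6 : 3 * h⁻¹ ≤ Real.pi / h := by
              rw [div_eq_mul_inv]; gcongr
            have : jap x₁ + jap x₂ ≤ 1 + jap x₁ * jap x₂ := by nlinarith
            have : 1 ≤ h⁻¹ := (one_le_inv₀ hh).2 hh1
            linarith
          calc wt s x₁ x₂ ≤ (h⁻¹) ^ (-(2 * s)) :=
                Real.rpow_le_rpow_of_nonpos (by positivity) h5 (by linarith)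
            _ = h ^ (2 * s) := by rw [Real.inv_rpow hh.le, Real.rpow_neg hh.le, inv_inv]
      _ = (∫⁻ y in E₂, P y) * ENNReal.ofReal (h ^ (2 * s)) := by
          rw [lintegral_mul_const' _ _ ENNReal.ofReal_ne_top]
      _ ≤ _ := by
          gcongr
          exact setLIntegral_cross_aux hh hρ σ hε hBpos hApos mE₂
            (sdiff_subset.trans (yRange_subset S)) (fun y hy => sin_half_le_cos hy.1)
  have hcoef : 4 / h ^ 3 * Real.sin θ ^ 2 * W ≤ 16 * A ^ 2 * B ^ 2 / h ^ 3 * (1 / K) := by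
    rw [hsq]
    calc 4 / h ^ 3 * (4 * A ^ 2 * B ^ 2) * W = 16 * A ^ 2 * B ^ 2 / h ^ 3 * W := by ring
      _ ≤ _ := by gcongr
  calc _ = ENNReal.ofReal (4 / h ^ 3 * Real.sin θ ^ 2 * W) *
        ((∫⁻ y in E₁, P y * ENNReal.ofReal (w y)) + ∫⁻ y in E₂, P y * ENNReal.ofReal (w y)) := by
        rw [lintegral_inter_add_sdiff _ _ measurableSet_Icc]
    _ ≤ ENNReal.ofReal (16 * A ^ 2 * B ^ 2 / h ^ 3 * (1 / K)) *
        (ENNReal.ofReal (Real.pi * h ^ 3 / (2 * B * (1 / 2))) * C *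
          ENNReal.ofReal (h ^ (2 * s) / A ^ 2)
        + ENNReal.ofReal (Real.pi * h ^ 3 / (2 * B * A)) * C * ENNReal.ofReal (h ^ (2 * s))) := by
        gcongr
    _ = ENNReal.ofReal (16 * A ^ 2 * B ^ 2 / h ^ 3 * (1 / K) *
          (Real.pi * h ^ 3 / (2 * B * (1 / 2)) * (h ^ (2 * s) / A ^ 2) +
            Real.pi * h ^ 3 / (2 * B * A) * h ^ (2 * s))) * C := by
        rw [ENNReal.ofReal_mul (p := 16 * A ^ 2 * B ^ 2 / h ^ 3 * (1 / K)) (by positivity),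
          ENNReal.ofReal_add (by positivity) (by positivity),
          ENNReal.ofReal_mul (p := Real.pi * h ^ 3 / (2 * B * (1 / 2))) (by positivity),
          ENNReal.ofReal_mul (p := Real.pi * h ^ 3 / (2 * B * A)) (by positivity)]
        ring
    _ ≤ _ := by
        gcongr
        have : 16 * A ^ 2 * B ^ 2 / h ^ 3 * (1 / K) *
          (Real.pi * h ^ 3 / (2 * B * (1 / 2)) * (h ^ (2 * s) / A ^ 2) +
            Real.pi * h ^ 3 / (2 * B * A) * h ^ (2 * s))
            = (16 * B + 8 * A * B) * (Real.pi * h ^ (2 * s) / K) := by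
          field_simp
          ring
        rw [this]
        calc (16 * B + 8 * A * B) * (Real.pi * h ^ (2 * s) / K)
            ≤ 24 * (Real.pi * h ^ (2 * s) / K) := by gcongr; nlinarith
          _ = _ := by ring

/-- The weighted measure estimate in the interaction of two counter-propagating waves, off the
resonant modulations. -/
theorem sin_half_mul_setLIntegral_wt_le {s : ℝ} (hs0 : 0 ≤ s) (hs1 : s ≤ 1) :
    ∃ c : ℝ, 0 < c ∧ ∀ h S : ℝ, 0 < h → h ≤ 1 →
      ENNReal.ofReal |Real.sin (S / 2)| *
        ∫⁻ y in yRange S, ENNReal.ofReal (wt s ((S + 2 * y) / h) ((S - 2 * y) / h))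
      ≤ ENNReal.ofReal (c * h ^ (2 * s)) := by
  have hpi := Real.pi_pos
  -- for `2s ≤ 1` the bound holds pointwise; for `2s > 1` the factor `|sin (S / 2)|` is at most `h`
  -- times the larger bracket, which its weight absorbs, and the other weight is integrable in
  -- `x = 2y / h`, which gains a second factor `h`
  rcases le_or_gt (2 * s) 1 with h2s | h2s
  · refine ⟨Real.pi, hpi, fun h S hh hh1 => ?_⟩
    rw [← lintegral_const_mul' _ _ ENNReal.ofReal_ne_top]
    calc _ ≤ ∫⁻ y in yRange S, ENNReal.ofReal (h ^ (2 * s)) := by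
          apply setLIntegral_mono' (measurableSet_yRange S)
          intro y _
          rw [← ENNReal.ofReal_mul (abs_nonneg _)]
          apply ENNReal.ofReal_le_ofReal
          have := mul_wt_le (n := 1) hs0 hh (abs_nonneg (Real.sin (S / 2)))
            (Real.abs_sin_le_one _) (sin_half_le_jap (y := y) hh).1 (by simpa using h2s) one_ne_zero
          simpa using this
      _ ≤ ∫⁻ y in Icc (-(Real.pi / 2)) (Real.pi / 2), ENNReal.ofReal (h ^ (2 * s)) :=
          lintegral_mono_set (yRange_subset S)
      _ = _ := by
          rw [lintegral_const, Measure.restrict_apply_univ, Real.volume_Icc,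
            ← ENNReal.ofReal_mul (by positivity)]
          congr 1; ring
  · have hint : Integrable (fun x : ℝ => jap x ^ (-(2 * s))) := by
      have := integrable_rpow_neg_one_add_norm_sq (E := ℝ) (μ := volume) (r := 2 * s)
        (by simpa using h2s)
      refine this.congr (Filter.Eventually.of_forall fun x => ?_)
      simp only [jap, Real.norm_eq_abs, Real.sqrt_eq_rpow]
      rw [← Real.rpow_mul (by positivity)]
      congr 1; ring
    set I := ∫ x : ℝ, jap x ^ (-(2 * s)) with hI
    have hI0 : 0 ≤ I := integral_nonneg fun x => Real.rpow_nonneg (jap_pos x).le _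
    have hIl : ∫⁻ x : ℝ, ENNReal.ofReal (jap x ^ (-(2 * s))) = ENNReal.ofReal I :=
      (ofReal_integral_eq_lintegral_ofReal hint
        (Filter.Eventually.of_forall fun x => Real.rpow_nonneg (jap_pos x).le _)).symm
    refine ⟨I + 1, by positivity, fun h S hh hh1 => ?_⟩
    have hcv : ∀ d : ℝ, |d| = 1 →
        ∫⁻ y : ℝ, ENNReal.ofReal (jap ((S + d * (2 * y)) / h) ^ (-(2 * s)))
          ≤ ENNReal.ofReal (h / 2) * ENNReal.ofReal I := by
      intro d hd
      rw [← hIl, ← setLIntegral_univ]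
      have hd0 : d ≠ 0 := by rintro rfl; simp at hd
      have := setLIntegral_comp_le (E := univ) MeasurableSet.univ
        (g := fun y => (S + d * (2 * y)) / h) (g' := fun _ => d * (2 * 1) / h) (c := 2 / h)
        (by positivity)
        (fun y _ => ((((hasDerivAt_id y).const_mul 2).const_mul d).const_add S).div_const h)
        (fun y _ => by rw [abs_div, abs_mul, hd, abs_of_pos hh]; norm_num)
        (fun x _ y _ hxy => by
          simp only at hxy
          field_simp at hxy
          have h3 : d * 2 * (x - y) = 0 := by linarith
          simp only [mul_eq_zero, hd0, OfNat.ofNat_ne_zero, or_self, false_or] at h3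
          linarith)
        (fun x => ENNReal.ofReal (jap x ^ (-(2 * s))))
      rwa [inv_div] at this
    calc _ = ∫⁻ y in yRange S, ENNReal.ofReal |Real.sin (S / 2)| *
          ENNReal.ofReal (wt s ((S + 2 * y) / h) ((S - 2 * y) / h)) := by
          rw [lintegral_const_mul' _ _ ENNReal.ofReal_ne_top]
      _ ≤ ∫⁻ y in yRange S, ENNReal.ofReal h *
          (ENNReal.ofReal (jap ((S + 1 * (2 * y)) / h) ^ (-(2 * s))) +
            ENNReal.ofReal (jap ((S + (-1) * (2 * y)) / h) ^ (-(2 * s)))) := by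
          apply setLIntegral_mono' (measurableSet_yRange S)
          intro y _
          rw [one_mul, neg_one_mul, ← sub_eq_add_neg]
          have hmax := (sin_half_le_jap (S := S) (y := y) hh).2
          set a := jap ((S + 2 * y) / h) with ha
          set b := jap ((S - 2 * y) / h) with hb
          have ha1 : 1 ≤ a := one_le_jap _
          have hb1 : 1 ≤ b := one_le_jap _
          rw [← ENNReal.ofReal_mul (abs_nonneg _), ← ENNReal.ofReal_add (by positivity)
            (by positivity), ← ENNReal.ofReal_mul hh.le]
          apply ENNReal.ofReal_le_ofReal
          have hwt : wt s ((S + 2 * y) / h) ((S - 2 * y) / h) = a ^ (-(2 * s)) * b ^ (-(2 * s)) := by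
            rw [wt, Real.mul_rpow (by positivity) (by positivity)]
          rw [hwt]
          have hpow : ∀ {c : ℝ}, 1 ≤ c → c * c ^ (-(2 * s)) ≤ 1 := by
            intro c hc
            have : c * c ^ (-(2 * s)) = c ^ (1 + -(2 * s)) := by
              rw [Real.rpow_add (by linarith), Real.rpow_one]
            rw [this]
            exact Real.rpow_le_one_of_one_le_of_nonpos hc (by linarith)
          have pa := Real.rpow_nonneg (show 0 ≤ a by linarith) (-(2 * s))
          have pb := Real.rpow_nonneg (show 0 ≤ b by linarith) (-(2 * s))
          rcases le_total a b with hab | hab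
          · rw [max_eq_right hab] at hmax
            calc _ ≤ h * b * (a ^ (-(2 * s)) * b ^ (-(2 * s))) := by gcongr
              _ = h * a ^ (-(2 * s)) * (b * b ^ (-(2 * s))) := by ring
              _ ≤ h * a ^ (-(2 * s)) * 1 := by gcongr; exact hpow hb1
              _ ≤ _ := by nlinarith [mul_nonneg hh.le pb]
          · rw [max_eq_left hab] at hmax
            calc _ ≤ h * a * (a ^ (-(2 * s)) * b ^ (-(2 * s))) := by gcongr
              _ = h * b ^ (-(2 * s)) * (a * a ^ (-(2 * s))) := by ring
              _ ≤ h * b ^ (-(2 * s)) * 1 := by gcongr; exact hpow ha1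
              _ ≤ _ := by nlinarith [mul_nonneg hh.le pa]
      _ ≤ ∫⁻ y, ENNReal.ofReal h *
          (ENNReal.ofReal (jap ((S + 1 * (2 * y)) / h) ^ (-(2 * s))) +
            ENNReal.ofReal (jap ((S + (-1) * (2 * y)) / h) ^ (-(2 * s)))) :=
          setLIntegral_le_lintegral _ _
      _ = ENNReal.ofReal h * ((∫⁻ y, ENNReal.ofReal (jap ((S + 1 * (2 * y)) / h) ^ (-(2 * s)))) +
            ∫⁻ y, ENNReal.ofReal (jap ((S + (-1) * (2 * y)) / h) ^ (-(2 * s)))) := by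
          rw [lintegral_const_mul' _ _ ENNReal.ofReal_ne_top, lintegral_add_left]
          apply Measurable.ennreal_ofReal
          apply Measurable.pow_const
          exact (continuous_jap.measurable).comp (by fun_prop)
      _ ≤ ENNReal.ofReal h * (ENNReal.ofReal (h / 2) * ENNReal.ofReal I
            + ENNReal.ofReal (h / 2) * ENNReal.ofReal I) := by
          gcongr
          · exact hcv 1 (by simp)
          · exact hcv (-1) (by simp)
      _ = ENNReal.ofReal (h * (h / 2 * I + h / 2 * I)) := by
          rw [← ENNReal.ofReal_mul (by positivity), ← ENNReal.ofReal_add (by positivity)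
            (by positivity), ← ENNReal.ofReal_mul hh.le]
      _ ≤ _ := by
          apply ENNReal.ofReal_le_ofReal
          have : h ^ (2 : ℝ) ≤ h ^ (2 * s) :=
            Real.rpow_le_rpow_of_exponent_ge hh hh1 (by linarith)
          rw [Real.rpow_two] at this
          have hp : 0 ≤ h ^ (2 * s) := Real.rpow_nonneg hh.le _
          nlinarith

theorem add_mul_wt_le {s h A x y : ℝ} (hs0 : 0 ≤ s) (hs1 : s ≤ 1) (hh : 0 < h) (hh1 : h ≤ 1)
    (hA0 : 0 ≤ A) (hA1 : A ≤ 1) (hA : A ≤ h * (jap x * jap y)) :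
    (h ^ 2 + h * A) * wt s x y ≤ 2 * h ^ (2 * s) := by
  have h2 : h ^ 2 ≤ h ^ (2 * s) := by
    rw [← Real.rpow_two]
    exact Real.rpow_le_rpow_of_exponent_ge hh hh1 (by linarith)
  have hH : 0 < h ^ (2 * s) := Real.rpow_pos_of_pos hh _
  have w0 := wt_nonneg s x y
  have w1 := wt_le_one hs0 x y
  have hb : h * A * wt s x y ≤ h ^ (2 * s) := by
    rcases le_or_gt (2 * s) 1 with h2s | h2s
    · have := mul_wt_le (n := 1) hs0 hh hA0 hA1 hA (by simpa using h2s) one_ne_zero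
      rw [pow_one] at this
      calc h * A * wt s x y = h * (A * wt s x y) := by ring
        _ ≤ 1 * h ^ (2 * s) := by gcongr
        _ = _ := one_mul _
    · have hL := one_le_jap_mul x y
      have : (jap x * jap y) * wt s x y ≤ 1 := by
        have : (jap x * jap y) * wt s x y = (jap x * jap y) ^ (1 + -(2 * s)) := by
          rw [Real.rpow_add (by linarith), Real.rpow_one, wt]
        rw [this]
        exact Real.rpow_le_one_of_one_le_of_nonpos hL (by linarith)
      calc h * A * wt s x y ≤ h * (h * (jap x * jap y)) * wt s x y := by gcongr
        _ = h ^ 2 * ((jap x * jap y) * wt s x y) := by ring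
        _ ≤ h ^ 2 * 1 := by gcongr
        _ ≤ _ := by linarith
  nlinarith

/-- The total coefficient of the interaction `opp` for large output modulations `l² ≥ M / 2`. -/
theorem opp_coefficient_le {h A l M : ℝ} (hh : 0 < h) (hA : 0 < A)
    (hM : M = 2 * A / (Real.pi * h ^ 3)) (hl : √(M / 2) ≤ l) :
    16 * A ^ 2 / h ^ 3 * (1 / (h * l ^ 3) + h / l) * (8 / √M) ≤ 1280 * (h ^ 2 + h * A) := by
  have hpi := Real.pi_pos
  have hMpos : 0 < M := by rw [hM]; positivity
  set m := √(M / 2) with hm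
  have hmpos : 0 < m := Real.sqrt_pos.2 (by positivity)
  have hm2 : m ^ 2 = A / (Real.pi * h ^ 3) := by
    rw [hm, Real.sq_sqrt (by positivity), hM]; field_simp
  have hmM : m ≤ √M := Real.sqrt_le_sqrt (by linarith)
  have hpi2 : Real.pi ^ 2 ≤ 10 := by
    have := Real.pi_lt_d2
    nlinarith
  have hpi1 : Real.pi ≤ 10 := by linarith [Real.pi_lt_four]
  calc _ ≤ 16 * A ^ 2 / h ^ 3 * (1 / (h * m ^ 3) + h / m) * (8 / m) := by gcongr
    _ = 128 * A ^ 2 / h ^ 3 * (1 / (h * (m ^ 2) ^ 2) + h / m ^ 2) := by field_simp; ring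
    _ = 128 * (Real.pi ^ 2 * h ^ 2 + Real.pi * (h * A)) := by
        rw [hm2]; field_simp
    _ ≤ 128 * (10 * h ^ 2 + 10 * (h * A)) := by gcongr
    _ = _ := by ring

/-- The weighted estimate for the interaction of two counter-propagating waves. -/
theorem setLIntegral_opp_le {s : ℝ} (hs0 : 0 ≤ s) (hs1 : s ≤ 1) :
    ∃ c : ℝ, 0 < c ∧ ∀ {h K : ℝ}, 0 < h → h ≤ 1 → 1 ≤ K → ∀ {C : ℝ≥0∞}
    {ρ : ℝ → ℝ≥0∞}, IsDensity K C ρ → ∀ (σ : ℝ) {ε : ℝ}, |ε| = 1 → ∀ {θ S k : ℝ},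
    IsWrap k → S = θ + k * Real.pi → |θ| ≤ Real.pi / 2 → ∀ {W : ℝ}, 0 ≤ W → W ≤ 1 / K →
    W ≤ 1 / (h * √(K + |σ|) ^ 3) + h / √(K + |σ|) →
    ENNReal.ofReal (4 / h ^ 3 * Real.sin θ ^ 2 * W) *
      ∫⁻ y in yRange S,
        ρ (σ - ε * (-dispersion h (2 * θ / h) + dispersionOpp h ((S + 2 * y) / h)
          + dispersionOpp h ((S - 2 * y) / h)) / (2 * Real.pi)) *
        ENNReal.ofReal (wt s ((S + 2 * y) / h) ((S - 2 * y) / h))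
      ≤ ENNReal.ofReal (c * h ^ (2 * s) / √K) * C := by
  have hpi := Real.pi_pos
  obtain ⟨c', hc', hwt⟩ := sin_half_mul_setLIntegral_wt_le hs0 hs1
  refine ⟨2560 + 16 * Real.pi * c', by positivity, ?_⟩
  intro h K hh hh1 hK1 C ρ hρ σ ε hε θ S k hk hS hθ W hW0 hWK hWσ
  have hK : 0 < K := by linarith
  have hwt := hwt h S hh hh1
  simp_rw [phase_opp hh hS]
  have hsq := sq_sin_eq_of_wrap hk hS
  rw [← sq_abs (Real.sin (S / 2))] at hsq
  have hphase := fun y hy => abs_phase_opp (y := y) hk hS hθ hy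
  have hjap := fun y => (sin_half_le_jap (S := S) (y := y) hh).1
  obtain ⟨e, he, heA⟩ := exists_sign (Real.sin (S / 2))
  set A := |Real.sin (S / 2)| with hA
  have hA0 : 0 ≤ A := abs_nonneg _
  have hA1 : A ≤ 1 := Real.abs_sin_le_one _
  have hH : 0 < h ^ (2 * s) := Real.rpow_pos_of_pos hh _
  have hs2 : Real.sin θ ^ 2 ≤ 4 * A ^ 2 := by
    rw [hsq]; nlinarith [Real.cos_sq_le_one (S / 2), sq_nonneg A]
  rcases hA0.eq_or_lt with hA0' | hApos
  · rw [hsq, ← hA0']; simp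
  have hsK : 0 < √K := Real.sqrt_pos.2 hK
  set M := 2 * A / (Real.pi * h ^ 3) with hM
  have hMpos : 0 < M := by positivity
  set w : ℝ → ℝ := fun y => wt s ((S + 2 * y) / h) ((S - 2 * y) / h) with hw
  rcases le_or_gt (M / 2) |σ| with hσ | hσ
  · -- the output modulation is large
    set Φ₀ := 2 / h ^ 3 * (k * Real.pi + Real.sin θ + 2 * Real.sin (S / 2)) with hΦ
    set β := σ - ε * Φ₀ / (2 * Real.pi) with hβ
    have hfun : ∀ y, σ - ε * (2 / h ^ 3 * (k * Real.pi + Real.sin θ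
          + 2 * Real.sin (S / 2) * Real.cos y)) / (2 * Real.pi)
        = β + (ε * e) * (M * (1 - Real.cos y)) := by
      intro y
      rw [hβ, hΦ, hM, heA]
      field_simp
      ring
    simp_rw [hfun]
    have hee : |ε * e| = 1 := by rw [abs_mul, hε, he, one_mul]
    set l := √(K + |σ|) with hl
    have hlM : √(M / 2) ≤ l := Real.sqrt_le_sqrt (by linarith)
    have hlpos : 0 < l := Real.sqrt_pos.2 (by positivity)
    have hMs : 0 < √M := Real.sqrt_pos.2 hMpos
    have hβK : √K ≤ √(K + |β|) := Real.sqrt_le_sqrt (by linarith [abs_nonneg β])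
    calc _ ≤ ENNReal.ofReal (4 / h ^ 3 * Real.sin θ ^ 2 * W) *
          ∫⁻ y in Icc (-(Real.pi / 2)) (Real.pi / 2), ρ (β + (ε * e) * (M * (1 - Real.cos y))) *
            ENNReal.ofReal (2 * h ^ (2 * s) / (h ^ 2 + h * A)) := by
          gcongr ENNReal.ofReal _ * ?_
          refine (setLIntegral_mono' (measurableSet_yRange S) ?_).trans
            (lintegral_mono_set (yRange_subset S))
          intro y hy
          gcongr
          rw [le_div_iff₀ (by positivity), mul_comm]
          exact add_mul_wt_le hs0 hs1 hh hh1 hA0 hA1 (hjap y)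
      _ = ENNReal.ofReal (4 / h ^ 3 * Real.sin θ ^ 2 * W) *
          ((∫⁻ y in Icc (-(Real.pi / 2)) (Real.pi / 2), ρ (β + (ε * e) * (M * (1 - Real.cos y)))) *
            ENNReal.ofReal (2 * h ^ (2 * s) / (h ^ 2 + h * A))) := by
          rw [lintegral_mul_const' _ _ ENNReal.ofReal_ne_top]
      _ ≤ ENNReal.ofReal (4 / h ^ 3 * Real.sin θ ^ 2 * W) *
          (ENNReal.ofReal (8 / (√M * √(K + |β|))) * C *
            ENNReal.ofReal (2 * h ^ (2 * s) / (h ^ 2 + h * A))) := by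
          gcongr
          exact hρ.lintegral_one_sub_cos_le hK β hee hMpos
      _ = ENNReal.ofReal (4 / h ^ 3 * Real.sin θ ^ 2 * W * (8 / (√M * √(K + |β|))) *
            (2 * h ^ (2 * s) / (h ^ 2 + h * A))) * C := by
          rw [ENNReal.ofReal_mul (q := 2 * h ^ (2 * s) / (h ^ 2 + h * A)) (by positivity),
            ENNReal.ofReal_mul (q := 8 / (√M * √(K + |β|))) (by positivity)]
          ring
      _ ≤ _ := by
          gcongr
          calc _ ≤ 4 / h ^ 3 * (4 * A ^ 2) * (1 / (h * l ^ 3) + h / l) * (8 / (√M * √K)) *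
                (2 * h ^ (2 * s) / (h ^ 2 + h * A)) := by gcongr
            _ = (16 * A ^ 2 / h ^ 3 * (1 / (h * l ^ 3) + h / l) * (8 / √M)) *
                (2 * h ^ (2 * s) / (h ^ 2 + h * A) / √K) := by
                field_simp; ring
            _ ≤ (1280 * (h ^ 2 + h * A)) * (2 * h ^ (2 * s) / (h ^ 2 + h * A) / √K) := by
                exact mul_le_mul_of_nonneg_right (opp_coefficient_le hh hApos hM hlM)
                  (by positivity)
            _ = 2560 * h ^ (2 * s) / √K := by field_simp; ring
            _ ≤ _ := by
                gcongr
                have : 0 ≤ 16 * Real.pi * c' := by positivity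
                linarith
  · -- the output modulation is small, so that an input modulation is large
    calc _ ≤ ENNReal.ofReal (4 / h ^ 3 * Real.sin θ ^ 2 * W) *
          ∫⁻ y in yRange S, ENNReal.ofReal (M / 2)⁻¹ * C * ENNReal.ofReal (w y) := by
          gcongr ENNReal.ofReal _ * ?_
          apply setLIntegral_mono' (measurableSet_yRange S)
          intro y hy
          gcongr
          apply hρ.le (by positivity)
          set Φ := 2 / h ^ 3 * (k * Real.pi + Real.sin θ
            + 2 * Real.sin (S / 2) * Real.cos y) with hΦ
          have h1 : M ≤ |Φ| / (2 * Real.pi) := by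
            rw [hΦ, abs_mul, abs_of_pos (by positivity : 0 < 2 / h ^ 3), hM]
            calc 2 * A / (Real.pi * h ^ 3) = 2 / h ^ 3 * (2 * A) / (2 * Real.pi) := by
                  field_simp
              _ ≤ _ := by
                gcongr
                exact hphase y hy
          have h2 : |Φ| / (2 * Real.pi) ≤ |σ| + |σ - ε * Φ / (2 * Real.pi)| := by
            have : |σ - (σ - ε * Φ / (2 * Real.pi))| ≤ _ := abs_sub σ _
            rw [sub_sub_cancel, abs_div, abs_mul, hε, one_mul,
              abs_of_pos (by positivity : 0 < 2 * Real.pi)] at this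
            exact this
          linarith
      _ = ENNReal.ofReal (4 / h ^ 3 * Real.sin θ ^ 2 * W) *
          (ENNReal.ofReal (M / 2)⁻¹ * C * ∫⁻ y in yRange S, ENNReal.ofReal (w y)) := by
          congr 1
          apply lintegral_const_mul
          apply Measurable.ennreal_ofReal
          exact (continuous_wt s).measurable.comp
            (g := fun p : ℝ × ℝ => wt s p.1 p.2) (f := fun y => ((S + 2 * y) / h, (S - 2 * y) / h))
            (by fun_prop)
      _ ≤ ENNReal.ofReal (4 / h ^ 3 * (4 * A ^ 2) * (1 / K)) *
          (ENNReal.ofReal (M / 2)⁻¹ * C * ∫⁻ y in yRange S, ENNReal.ofReal (w y)) := by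
          gcongr
      _ = ENNReal.ofReal (16 * Real.pi / K) * C *
          (ENNReal.ofReal A * ∫⁻ y in yRange S, ENNReal.ofReal (w y)) := by
          have : 4 / h ^ 3 * (4 * A ^ 2) * (1 / K) = 16 * Real.pi / K * A * (M / 2) := by
            rw [hM]; field_simp; norm_num
          rw [this, ENNReal.ofReal_mul (by positivity), ENNReal.ofReal_mul (by positivity),
            ENNReal.ofReal_inv_of_pos (by positivity)]
          have hM0 : ENNReal.ofReal (M / 2) ≠ 0 := by
            rw [Ne, ENNReal.ofReal_eq_zero, not_le]; positivity
          calc _ = ENNReal.ofReal (16 * Real.pi / K) * C *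
              (ENNReal.ofReal A * ∫⁻ y in yRange S, ENNReal.ofReal (w y)) *
              (ENNReal.ofReal (M / 2) * (ENNReal.ofReal (M / 2))⁻¹) := by ring
            _ = _ := by rw [ENNReal.mul_inv_cancel hM0 ENNReal.ofReal_ne_top, mul_one]
      _ ≤ ENNReal.ofReal (16 * Real.pi / K) * C * ENNReal.ofReal (c' * h ^ (2 * s)) := by
          gcongr
      _ = ENNReal.ofReal (16 * Real.pi / K * (c' * h ^ (2 * s))) * C := by
          rw [ENNReal.ofReal_mul (q := c' * h ^ (2 * s)) (by positivity)]; ring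
      _ ≤ _ := by
          gcongr
          have hKK : √K ≤ K := Real.sqrt_le_iff.2 ⟨hK.le, by nlinarith⟩
          calc 16 * Real.pi / K * (c' * h ^ (2 * s)) = 16 * Real.pi * c' * h ^ (2 * s) / K := by ring
            _ ≤ 16 * Real.pi * c' * h ^ (2 * s) / √K := by gcongr
            _ ≤ _ := by gcongr; linarith

/-! ### The frequency circle -/

/-- The normalized Haar measure of the frequency circle. -/
abbrev haarFreq (h : ℝ) [Fact (0 < h)] : Measure (Freq h) :=
  AddCircle.haarAddCircle (T := 2 * Real.pi / h)

/-- The representative of a frequency in `(-π/h, π/h]`. -/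
def rep {h : ℝ} [Fact (0 < h)] (ξ : Freq h) : ℝ :=
  (AddCircle.equivIoc (2 * Real.pi / h) (-(Real.pi / h)) ξ : ℝ)

section
variable {h : ℝ} [hh : Fact (0 < h)]

theorem neg_add_period (h : ℝ) : -(Real.pi / h) + 2 * Real.pi / h = Real.pi / h := by ring

theorem rep_mem (ξ : Freq h) : rep ξ ∈ Ioc (-(Real.pi / h)) (Real.pi / h) := by
  have := (AddCircle.equivIoc (2 * Real.pi / h) (-(Real.pi / h)) ξ).2
  exact ⟨this.1, this.2.trans_eq (neg_add_period h)⟩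

theorem coe_rep (ξ : Freq h) : ((rep ξ : ℝ) : Freq h) = ξ :=
  (AddCircle.equivIoc (2 * Real.pi / h) (-(Real.pi / h))).symm_apply_apply ξ

theorem rep_coe {x : ℝ} (hx : x ∈ Ioc (-(Real.pi / h)) (Real.pi / h)) :
    rep ((x : ℝ) : Freq h) = x := by
  have := AddCircle.equivIoc_coe_eq (p := 2 * Real.pi / h) (a := -(Real.pi / h)) (x := x)
    ⟨hx.1, hx.2.trans_eq (neg_add_period h).symm⟩
  simp [rep, this]

@[fun_prop]
theorem measurable_rep : Measurable (rep : Freq h → ℝ) :=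
  measurable_subtype_coe.comp
    (AddCircle.measurableEquivIoc (2 * Real.pi / h) (-(Real.pi / h))).measurable

theorem abs_rep_le (ξ : Freq h) : |rep ξ| ≤ Real.pi / h := by
  have := rep_mem ξ
  rw [abs_le]; exact ⟨this.1.le, this.2⟩

theorem abs_half_rep_le (ξ : Freq h) : |h * rep ξ / 2| ≤ Real.pi / 2 := by
  have h0 := hh.out
  rw [abs_div, abs_mul, abs_of_pos h0, abs_two]
  have := mul_le_mul_of_nonneg_left (abs_rep_le ξ) h0.le
  rw [mul_div_cancel₀ _ h0.ne'] at this
  linarith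

theorem lintegral_haarFreq (f : Freq h → ℝ≥0∞) :
    ∫⁻ ξ, f ξ ∂haarFreq h =
      ENNReal.ofReal (h / (2 * Real.pi)) * ∫⁻ x in Ioc (-(Real.pi / h)) (Real.pi / h), f (x : Freq h) := by
  have h0 := hh.out
  have hT : 0 < 2 * Real.pi / h := by have := Real.pi_pos; positivity
  have h1 := AddCircle.lintegral_preimage (2 * Real.pi / h) (-(Real.pi / h)) f
  rw [neg_add_period] at h1
  rw [h1, AddCircle.volume_eq_smul_haarAddCircle, lintegral_smul_measure, smul_eq_mul, ← mul_assoc,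
    ← ENNReal.ofReal_mul (by positivity), div_mul_div_comm]
  rw [show h * (2 * Real.pi) / (2 * Real.pi * h) = 1 by
    have := Real.pi_pos
    field_simp]
  simp

/-- A frequency integral over all ways to split `ξ = ξ₁ + ξ₂`, in the coordinate `y` with
`hξ₁ = S + 2y`, `hξ₂ = S - 2y`, where `2S = h(ξ₁ + ξ₂)` may differ from `hξ` by a wrap around the
circle. -/
theorem lintegral_split_le (F : ℝ → ℝ → ℝ≥0∞) (hF : Measurable (Function.uncurry F)) (ξ : Freq h)
    {B : ℝ≥0∞} {c : ℝ≥0∞}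
    (hB : ∀ k : ℝ, IsWrap k → |h * rep ξ / 2 + k * Real.pi| ≤ Real.pi →
      c * ∫⁻ y in yRange (h * rep ξ / 2 + k * Real.pi),
        F ((h * rep ξ / 2 + k * Real.pi + 2 * y) / h) ((h * rep ξ / 2 + k * Real.pi - 2 * y) / h)
        ≤ B) :
    c * ∫⁻ ξ₁, F (rep ξ₁) (rep (ξ - ξ₁)) ∂haarFreq h ≤ B := by
  have h0 := hh.out
  have hpi := Real.pi_pos
  set x := rep ξ with hx
  have hxm : x ∈ Ioc (-(Real.pi / h)) (Real.pi / h) := rep_mem ξ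
  set S : ℝ → ℝ := fun k => h * x / 2 + k * Real.pi with hS
  set Y : ℝ → Set ℝ := fun k => {z | (h * z - S k) / 2 ∈ yRange (S k)} with hY
  have mY : ∀ k, MeasurableSet (Y k) := fun k =>
    (measurableSet_yRange (S k)).preimage (f := fun z => (h * z - S k) / 2) (by fun_prop)
  set G : ℝ → ℝ → ℝ≥0∞ := fun k => (Y k).indicator (fun z => F z (2 * S k / h - z)) with hG
  have mG : ∀ k, Measurable (G k) := fun k =>
    Measurable.indicator (hF.comp (f := fun z => (z, 2 * S k / h - z)) (by fun_prop)) (mY k)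
  -- the representative of `ξ - ξ₁` differs from `x - z` by at most one period
  have hpt : ∀ z ∈ Ioc (-(Real.pi / h)) (Real.pi / h),
      F (rep (z : Freq h)) (rep (ξ - (z : Freq h))) ≤ G 0 z + G 1 z + G (-1) z := by
    intro z hz
    rw [rep_coe hz]
    set v := rep (ξ - (z : Freq h)) with hv
    have hvm : v ∈ Ioc (-(Real.pi / h)) (Real.pi / h) := rep_mem _
    have hcoe : ((v - (x - z) : ℝ) : Freq h) = 0 := by
      rw [AddCircle.coe_sub, AddCircle.coe_sub, hv, coe_rep, hx, coe_rep, sub_self]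
    rw [AddCircle.coe_eq_zero_iff] at hcoe
    obtain ⟨n, hn⟩ := hcoe
    rw [zsmul_eq_mul] at hn
    have hT : 0 < Real.pi / h := by positivity
    have hTT : 2 * Real.pi / h = 2 * (Real.pi / h) := by ring
    rw [hTT] at hn
    have hn1 : (n : ℝ) < 2 := by
      by_contra hcon
      have : 2 * (2 * (Real.pi / h)) ≤ n * (2 * (Real.pi / h)) := by
        apply mul_le_mul_of_nonneg_right (not_lt.1 hcon) (by positivity)
      linarith [hvm.2, hxm.1, hz.2]
    have hn2 : (-2 : ℝ) < n := by
      by_contra hcon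
      have : (n : ℝ) * (2 * (Real.pi / h)) ≤ (-2) * (2 * (Real.pi / h)) := by
        apply mul_le_mul_of_nonneg_right (not_lt.1 hcon) (by positivity)
      linarith [hvm.1, hxm.2, hz.1]
    have hval : F z v = G n z := by
      have hSz : 2 * S n / h - z = v := by
        simp only [hS]
        have : v = x - z + n * (2 * (Real.pi / h)) := by linarith
        rw [this]; field_simp; ring
      have hmem : z ∈ Y n := by
        simp only [hY, mem_ofPred_eq, yRange]
        have e1 : S n / 2 + (h * z - S n) / 2 = h * z / 2 := by ring
        have e2 : S n / 2 - (h * z - S n) / 2 = h * v / 2 := by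
          rw [← hSz]; field_simp; ring
        rw [e1, e2]
        constructor
        · rw [← rep_coe hz]; exact abs_half_rep_le _
        · exact abs_half_rep_le _
      simp only [hG]
      rw [indicator_of_mem hmem, hSz]
    have hn1' : n < 2 := by exact_mod_cast hn1
    have hn2' : -2 < n := by exact_mod_cast hn2
    rw [hval]
    have : n = 0 ∨ n = 1 ∨ n = -1 := by omega
    rcases this with rfl | rfl | rfl
    · simp only [Int.cast_zero]; rw [add_assoc]; exact le_self_add
    · simp only [Int.cast_one]; rw [add_comm (G 0 z), add_assoc]; exact le_self_add
    · simp only [Int.cast_neg, Int.cast_one]; exact le_add_self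
  -- the substitution `y = (h z - S) / 2` turns the normalized measure on the circle into `dy / π`
  have hk : ∀ k, IsWrap k → c * (ENNReal.ofReal (h / (2 * Real.pi)) * ∫⁻ z, G k z) ≤
      ENNReal.ofReal (1 / Real.pi) * B := by
    intro k hk
    have e1 : ∫⁻ z, G k z ≤ ENNReal.ofReal (2 / h) *
        ∫⁻ y in yRange (S k), F ((S k + 2 * y) / h) ((S k - 2 * y) / h) := by
      have := setLIntegral_comp_le (E := univ) MeasurableSet.univ
        (g := fun z => (h * z - S k) / 2) (g' := fun _ => h * 1 / 2) (c := h / 2) (by positivity)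
        (fun y _ => (((hasDerivAt_id y).const_mul h).sub_const (S k)).div_const 2)
        (fun y _ => by rw [mul_one, abs_of_pos (by positivity)])
        (fun a _ b _ hab => by
          simp only at hab
          have : h * (a - b) = 0 := by linarith
          rcases mul_eq_zero.1 this with h | h
          · exact absurd h h0.ne'
          · linarith)
        ((yRange (S k)).indicator fun y => F ((S k + 2 * y) / h) ((S k - 2 * y) / h))
      rw [lintegral_indicator (measurableSet_yRange _), inv_div, setLIntegral_univ] at this
      refine le_trans (lintegral_mono fun z => ?_) this
      simp only [hG]
      by_cases hz : z ∈ Y k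
      · rw [indicator_of_mem hz, indicator_of_mem (show (h * z - S k) / 2 ∈ yRange (S k) from hz)]
        apply le_of_eq
        congr 1 <;> field_simp <;> ring
      · rw [indicator_of_notMem hz]; exact zero_le
    have e2 : c * ∫⁻ y in yRange (S k), F ((S k + 2 * y) / h) ((S k - 2 * y) / h) ≤ B := by
      rcases le_or_gt |S k| Real.pi with hSk | hSk
      · exact hB k hk hSk
      · have : yRange (S k) = ∅ := by
          ext y
          simp only [yRange, mem_ofPred_eq, mem_empty_iff_false, iff_false, not_and, not_le]
          intro h1
          by_contra h2
          rw [not_lt] at h2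
          have : |S k| ≤ |S k / 2 + y| + |S k / 2 - y| := by
            have := abs_add_le (S k / 2 + y) (S k / 2 - y)
            rwa [show S k / 2 + y + (S k / 2 - y) = S k by ring] at this
          linarith
        simp [this]
    calc c * (ENNReal.ofReal (h / (2 * Real.pi)) * ∫⁻ z, G k z)
        ≤ c * (ENNReal.ofReal (h / (2 * Real.pi)) * (ENNReal.ofReal (2 / h) *
          ∫⁻ y in yRange (S k), F ((S k + 2 * y) / h) ((S k - 2 * y) / h))) := by gcongr
      _ = ENNReal.ofReal (h / (2 * Real.pi) * (2 / h)) *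
          (c * ∫⁻ y in yRange (S k), F ((S k + 2 * y) / h) ((S k - 2 * y) / h)) := by
          rw [ENNReal.ofReal_mul (by positivity)]; ring
      _ ≤ ENNReal.ofReal (h / (2 * Real.pi) * (2 / h)) * B := by gcongr
      _ = _ := by congr 2; field_simp
  rw [lintegral_haarFreq]
  calc _ ≤ c * (ENNReal.ofReal (h / (2 * Real.pi)) * ∫⁻ z, (G 0 z + G 1 z + G (-1) z)) := by
        gcongr c * (_ * ?_)
        exact (setLIntegral_mono' measurableSet_Ioc hpt).trans (setLIntegral_le_lintegral _ _)
    _ = c * (ENNReal.ofReal (h / (2 * Real.pi)) * ∫⁻ z, G 0 z) +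
        c * (ENNReal.ofReal (h / (2 * Real.pi)) * ∫⁻ z, G 1 z) +
        c * (ENNReal.ofReal (h / (2 * Real.pi)) * ∫⁻ z, G (-1) z) := by
        rw [lintegral_add_right _ (mG (-1)), lintegral_add_left (mG 0)]; ring
    _ ≤ ENNReal.ofReal (1 / Real.pi) * B + ENNReal.ofReal (1 / Real.pi) * B +
        ENNReal.ofReal (1 / Real.pi) * B := by
        exact add_le_add (add_le_add (hk 0 (Or.inl rfl)) (hk 1 (Or.inr (Or.inl rfl))))
          (hk (-1) (Or.inr (Or.inr rfl)))
    _ = ENNReal.ofReal (3 / Real.pi) * B := by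
        rw [← add_mul, ← add_mul, ← ENNReal.ofReal_add (by positivity) (by positivity),
          ← ENNReal.ofReal_add (by positivity) (by positivity)]
        congr 2; ring
    -- the three possible numbers of wraps contribute `B / π` each, and `3 < π`
    _ ≤ 1 * B := by
        gcongr
        rw [ENNReal.ofReal_le_one, div_le_one hpi]
        exact Real.pi_gt_three.le
    _ = B := one_mul B

/-! ### The modulation weight -/

/-- The density whose inverse is the square of the modulation weight. The first term makes the
weight as strong as `|σ|^{3/4}` at high modulations; the second one weakens it to `|σ|^{1/2}` near
`|σ| = h⁻²`, the modulation of the interaction of two counter-propagating waves, where no more is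
affordable. -/
def modDensity (h K σ : ℝ) : ℝ :=
  √K / √(K + |σ|) ^ 3 + h / (√(K + |σ|) * (1 + h ^ 2 * √(K + |σ|) ^ 2))

theorem modDensity_pos {h K : ℝ} (h0 : 0 < h) (hK : 0 < K) (σ : ℝ) : 0 < modDensity h K σ := by
  have : 0 < K + |σ| := by positivity
  unfold modDensity; positivity

/-- The weight of the output modulation in the bilinear estimates. -/
def outWeight (h K σ : ℝ) : ℝ := 1 / ((K + |σ|) ^ 2 * modDensity h K σ)

theorem outWeight_nonneg {h K : ℝ} (h0 : 0 < h) (hK : 0 < K) (σ : ℝ) : 0 ≤ outWeight h K σ := by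
  have := modDensity_pos h0 hK σ
  unfold outWeight; positivity

theorem outWeight_le {h K : ℝ} (h0 : 0 < h) (hK : 0 < K) (σ : ℝ) :
    outWeight h K σ ≤ 1 / (√K * √(K + |σ|)) := by
  have hL : 0 < K + |σ| := by positivity
  have hl : 0 < √(K + |σ|) := Real.sqrt_pos.2 hL
  have hsq : K + |σ| = √(K + |σ|) ^ 2 := (Real.sq_sqrt hL.le).symm
  unfold outWeight modDensity
  set l := √(K + |σ|)
  rw [hsq]
  apply one_div_le_one_div_of_le (by positivity)
  have : 0 ≤ (l ^ 2) ^ 2 * (h / (l * (1 + h ^ 2 * l ^ 2))) := by positivity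
  calc √K * l = (l ^ 2) ^ 2 * (√K / l ^ 3) := by field_simp
    _ ≤ _ := by rw [mul_add]; linarith

theorem outWeight_le' {h K : ℝ} (h0 : 0 < h) (hK : 0 < K) (σ : ℝ) :
    outWeight h K σ ≤ 1 / (h * √(K + |σ|) ^ 3) + h / √(K + |σ|) := by
  have hL : 0 < K + |σ| := by positivity
  have hl : 0 < √(K + |σ|) := Real.sqrt_pos.2 hL
  have hsq : K + |σ| = √(K + |σ|) ^ 2 := (Real.sq_sqrt hL.le).symm
  unfold outWeight modDensity
  set l := √(K + |σ|)
  rw [hsq]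
  have : 1 / (h * l ^ 3) + h / l = 1 / ((l ^ 2) ^ 2 * (h / (l * (1 + h ^ 2 * l ^ 2)))) := by
    field_simp
  rw [this]
  apply one_div_le_one_div_of_le (by positivity)
  have : 0 ≤ (l ^ 2) ^ 2 * (√K / l ^ 3) := by positivity
  rw [mul_add]; linarith

theorem outWeight_le_inv {h K : ℝ} (h0 : 0 < h) (hK : 0 < K) (σ : ℝ) :
    outWeight h K σ ≤ 1 / K := by
  refine (outWeight_le h0 hK σ).trans ?_
  apply one_div_le_one_div_of_le hK
  calc K = √K * √K := (Real.mul_self_sqrt hK.le).symm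
    _ ≤ _ := by gcongr; linarith [abs_nonneg σ]

/-- The resonance estimate for the interaction of waves with dispersion relations `q₁`, `q₂`, with
the weights `(⟨ξ₁⟩⟨ξ₂⟩)^{-2s}` and the constant `B`. -/
def HasResonanceBound (h : ℝ) [Fact (0 < h)] (K ε : ℝ) (q₁ q₂ : ℝ → ℝ) (s B : ℝ) : Prop :=
  ∀ (C : ℝ≥0∞) (ρ : ℝ → ℝ≥0∞), IsDensity K C ρ → ∀ (σ : ℝ) (ξ : Freq h),
    ENNReal.ofReal (4 / h ^ 3 * Real.sin (h * rep ξ / 2) ^ 2 * outWeight h K σ) *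
      ∫⁻ ξ₁, ρ (σ - ε * (-dispersion h (rep ξ) + q₁ (rep ξ₁) + q₂ (rep (ξ - ξ₁))) / (2 * Real.pi)) *
        ENNReal.ofReal (wt s (rep ξ₁) (rep (ξ - ξ₁))) ∂haarFreq h ≤ ENNReal.ofReal B * C

theorem two_mul_half_div (ξ : Freq h) : 2 * (h * rep ξ / 2) / h = rep ξ := by
  have := hh.out
  field_simp

theorem hasResonanceBound_same {K : ℝ} (hK : 1 ≤ K) {ε : ℝ} (hε : |ε| = 1) :
    HasResonanceBound h K ε (dispersion h) (dispersion h) 0 (128 * Real.pi / √K) := by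
  intro C ρ hρ σ ξ
  have h0 := hh.out
  have hK0 : 0 < K := by linarith
  have hm := hρ.measurable
  apply lintegral_split_le (F := fun x₁ x₂ => ρ (σ - ε * (-dispersion h (rep ξ) + dispersion h x₁
    + dispersion h x₂) / (2 * Real.pi)) * ENNReal.ofReal (wt 0 x₁ x₂))
  · apply Measurable.mul
    · exact hm.comp (by fun_prop)
    · exact ((continuous_wt 0).measurable).ennreal_ofReal
  · intro k hk hS
    have := setLIntegral_same_le h0 hK0 hρ σ hε hk rfl (outWeight_nonneg h0 hK0 σ)
      (outWeight_le h0 hK0 σ) (θ := h * rep ξ / 2)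
    rw [two_mul_half_div] at this
    refine le_trans ?_ (this.trans ?_)
    · gcongr ENNReal.ofReal _ * ?_
      refine le_trans (lintegral_mono_set (yRange_subset _)) ?_
      simp [wt]
    · gcongr ENNReal.ofReal (128 * Real.pi / ?_) * _
      exact Real.sqrt_le_iff.2 ⟨hK0.le, by nlinarith⟩

theorem hasResonanceBound_cross (hh1 : h ≤ 1) {K : ℝ} (hK : 1 ≤ K) {ε : ℝ} (hε : |ε| = 1) {s : ℝ}
    (hs0 : 0 ≤ s) (hs1 : s ≤ 1) :
    HasResonanceBound h K ε (dispersion h) (dispersionOpp h) s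
      (24 * Real.pi * h ^ (2 * s) / √K) := by
  intro C ρ hρ σ ξ
  have h0 := hh.out
  have hK0 : 0 < K := by linarith
  have hm := hρ.measurable
  apply lintegral_split_le (F := fun x₁ x₂ => ρ (σ - ε * (-dispersion h (rep ξ) + dispersion h x₁
    + dispersionOpp h x₂) / (2 * Real.pi)) * ENNReal.ofReal (wt s x₁ x₂))
  · apply Measurable.mul
    · exact hm.comp (by fun_prop)
    · exact ((continuous_wt s).measurable).ennreal_ofReal
  · intro k hk hS
    have := setLIntegral_cross_le h0 hh1 hK0 hρ σ hε hk rfl hS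
      (outWeight_le_inv h0 hK0 σ) hs0 hs1 (θ := h * rep ξ / 2)
    rw [two_mul_half_div] at this
    refine this.trans ?_
    gcongr ENNReal.ofReal (24 * Real.pi * h ^ (2 * s) / ?_) * _
    exact Real.sqrt_le_iff.2 ⟨hK0.le, by nlinarith⟩

end

theorem hasResonanceBound_opp {s : ℝ} (hs0 : 0 ≤ s) (hs1 : s ≤ 1) :
    ∃ c : ℝ, 0 < c ∧ ∀ (h : ℝ) [Fact (0 < h)], h ≤ 1 → ∀ K : ℝ, 1 ≤ K → ∀ ε : ℝ, |ε| = 1 →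
    HasResonanceBound h K ε (dispersionOpp h) (dispersionOpp h) s (c * h ^ (2 * s) / √K) := by
  obtain ⟨c, hc, H⟩ := setLIntegral_opp_le hs0 hs1
  refine ⟨c, hc, fun h hh hh1 K hK ε hε C ρ hρ σ ξ => ?_⟩
  have h0 := hh.out
  have hK0 : 0 < K := by linarith
  have hm := hρ.measurable
  apply lintegral_split_le (F := fun x₁ x₂ => ρ (σ - ε * (-dispersion h (rep ξ) + dispersionOpp h x₁
    + dispersionOpp h x₂) / (2 * Real.pi)) * ENNReal.ofReal (wt s x₁ x₂))
  · apply Measurable.mul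
    · exact hm.comp (by fun_prop)
    · exact ((continuous_wt s).measurable).ennreal_ofReal
  · intro k hk hS
    have := H h0 hh1 hK hρ σ hε hk rfl (abs_half_rep_le ξ) (outWeight_nonneg h0 hK0 σ)
      (outWeight_le_inv h0 hK0 σ) (outWeight_le' h0 hK0 σ)
    rwa [two_mul_half_div] at this

/-! ### Multiplication operators -/

section
variable {α : Type*} [MeasurableSpace α] {μ : Measure α}

open Classical in
/-- Multiplication by a bounded function on `L²`; zero if the function is not in `L^∞`. -/
def mulLp (μ : Measure α) (φ : α → ℂ) : Lp ℂ 2 μ →L[ℂ] Lp ℂ 2 μ :=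
  if hφ : MemLp φ ∞ μ then (ContinuousLinearMap.mul ℂ ℂ).holderL μ ∞ 2 2 (hφ.toLp φ) else 0

theorem coeFn_mulLp {φ : α → ℂ} (hφ : MemLp φ ∞ μ) (f : Lp ℂ 2 μ) :
    mulLp μ φ f =ᵐ[μ] fun x => φ x * f x := by
  rw [mulLp, dif_pos hφ]
  have := (ContinuousLinearMap.mul ℂ ℂ).coeFn_holder (r := 2) (hφ.toLp φ) f
  filter_upwards [this, hφ.coeFn_toLp] with x h1 h2
  rw [ContinuousLinearMap.holderL_apply_apply, h1, h2]; rfl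

theorem mulLp_mulLp {φ ψ χ : α → ℂ} (hφ : MemLp φ ∞ μ) (hψ : MemLp ψ ∞ μ) (hχ : MemLp χ ∞ μ)
    (he : ∀ x, χ x = φ x * ψ x) (f : Lp ℂ 2 μ) : mulLp μ φ (mulLp μ ψ f) = mulLp μ χ f := by
  apply Lp.ext
  filter_upwards [coeFn_mulLp hφ (mulLp μ ψ f), coeFn_mulLp hψ f, coeFn_mulLp hχ f] with x h1 h2 h3
  rw [h1, h2, h3, he]; ring

theorem norm_mulLp_le_norm {φ ψ : α → ℂ} (hφ : MemLp φ ∞ μ) (hψ : MemLp ψ ∞ μ)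
    (he : ∀ x, ‖φ x‖ ≤ ‖ψ x‖) (f : Lp ℂ 2 μ) : ‖mulLp μ φ f‖ ≤ ‖mulLp μ ψ f‖ := by
  apply Lp.norm_le_norm_of_ae_le
  filter_upwards [coeFn_mulLp hφ f, coeFn_mulLp hψ f] with x h1 h2
  rw [h1, h2, norm_mul, norm_mul]
  exact mul_le_mul_of_nonneg_right (he x) (norm_nonneg _)

theorem norm_mulLp_le {φ : α → ℂ} (hφ : MemLp φ ∞ μ) {c : ℝ}
    (he : ∀ x, ‖φ x‖ ≤ c) (f : Lp ℂ 2 μ) : ‖mulLp μ φ f‖ ≤ c * ‖f‖ := by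
  apply Lp.norm_le_mul_norm_of_ae_le_mul
  filter_upwards [coeFn_mulLp hφ f] with x h1
  rw [h1, norm_mul]
  exact mul_le_mul_of_nonneg_right (he x) (norm_nonneg _)

theorem mulLp_one (f : Lp ℂ 2 μ) : mulLp μ (fun _ => 1) f = f := by
  apply Lp.ext
  filter_upwards [coeFn_mulLp (memLp_top_const (1 : ℂ)) f] with x h1
  rw [h1, one_mul]

theorem mulLp_sub {φ ψ χ : α → ℂ} (hφ : MemLp φ ∞ μ) (hψ : MemLp ψ ∞ μ) (hχ : MemLp χ ∞ μ)
    (he : ∀ x, χ x = φ x - ψ x) (f : Lp ℂ 2 μ) : mulLp μ χ f = mulLp μ φ f - mulLp μ ψ f := by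
  apply Lp.ext
  filter_upwards [coeFn_mulLp hφ f, coeFn_mulLp hψ f, coeFn_mulLp hχ f,
    Lp.coeFn_sub (mulLp μ φ f) (mulLp μ ψ f)] with x h1 h2 h3 h4
  rw [h3, h4, Pi.sub_apply, h1, h2, he]; ring

end

/-! ### Fourier multipliers on the frequency side -/

/-- The space `L²` of the frequency circle. -/
abbrev FreqL2 (h : ℝ) [Fact (0 < h)] : Type := Lp ℂ 2 (haarFreq h)

section
variable {h : ℝ} [hh : Fact (0 < h)]

/-- Multiplication by the symbol `m` on the frequency side. -/
def symb (h : ℝ) [Fact (0 < h)] (m : ℝ → ℂ) : FreqL2 h →L[ℂ] FreqL2 h :=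
  mulLp (haarFreq h) fun ξ => m (rep ξ)

theorem exists_bound_symbol (h : ℝ) {m : ℝ → ℂ} (hm : Continuous m) :
    ∃ c : ℝ, ∀ x ∈ Icc (-(Real.pi / h)) (Real.pi / h), ‖m x‖ ≤ c :=
  isCompact_Icc.exists_bound_of_continuousOn hm.continuousOn

theorem memLp_symbol {m : ℝ → ℂ} (hm : Continuous m) :
    MemLp (fun ξ : Freq h => m (rep ξ)) ∞ (haarFreq h) := by
  obtain ⟨c, hc⟩ := exists_bound_symbol h hm
  exact memLp_top_of_bound (hm.measurable.comp measurable_rep).aestronglyMeasurable c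
    (.of_forall fun ξ => hc _ ⟨(rep_mem ξ).1.le, (rep_mem ξ).2⟩)

theorem coeFn_symb {m : ℝ → ℂ} (hm : Continuous m) (F : FreqL2 h) :
    symb h m F =ᵐ[haarFreq h] fun ξ => m (rep ξ) * F ξ := coeFn_mulLp (memLp_symbol hm) F

theorem symb_symb {m m' m'' : ℝ → ℂ} (hm : Continuous m) (hm' : Continuous m')
    (he : ∀ x, m'' x = m x * m' x) (F : FreqL2 h) : symb h m (symb h m' F) = symb h m'' F := by
  have : Continuous m'' := by rw [funext he]; exact hm.mul hm'
  exact mulLp_mulLp (memLp_symbol hm) (memLp_symbol hm') (memLp_symbol this) (fun _ => he _) F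

theorem symb_one {m : ℝ → ℂ} (he : ∀ x, m x = 1) (F : FreqL2 h) : symb h m F = F := by
  rw [funext he]; exact mulLp_one F

theorem symb_sub {m m' m'' : ℝ → ℂ} (hm : Continuous m) (hm' : Continuous m')
    (he : ∀ x, m'' x = m x - m' x) (F : FreqL2 h) :
    symb h m'' F = symb h m F - symb h m' F := by
  have : Continuous m'' := by rw [funext he]; exact hm.sub hm'
  exact mulLp_sub (memLp_symbol hm) (memLp_symbol hm') (memLp_symbol this) (fun _ => he _) F

theorem norm_symb_le {m : ℝ → ℂ} (hm : Continuous m) {c : ℝ}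
    (he : ∀ x, |x| ≤ Real.pi / h → ‖m x‖ ≤ c) (F : FreqL2 h) : ‖symb h m F‖ ≤ c * ‖F‖ :=
  norm_mulLp_le (memLp_symbol hm) (fun _ => he _ (abs_rep_le _)) F

theorem norm_symb_le_norm {m m' : ℝ → ℂ} (hm : Continuous m) (hm' : Continuous m')
    (he : ∀ x, ‖m x‖ ≤ ‖m' x‖) (F : FreqL2 h) : ‖symb h m F‖ ≤ ‖symb h m' F‖ :=
  norm_mulLp_le_norm (memLp_symbol hm) (memLp_symbol hm') (fun _ => he _) F

theorem norm_symb_eq {m : ℝ → ℂ} (hm : Continuous m) (he : ∀ x, ‖m x‖ = 1) (F : FreqL2 h) :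
    ‖symb h m F‖ = ‖F‖ := by
  apply le_antisymm
  · simpa using norm_symb_le hm (c := 1) (fun x _ => (he x).le) F
  · have := norm_symb_le_norm (h := h) (m := fun _ => 1) (m' := m) continuous_const hm
      (fun x => by rw [he x, norm_one]) F
    rwa [symb_one (fun _ => rfl)] at this

/-! ### Lattice values -/

/-- The value at the lattice point `h n` of the (complex-valued) function with the normalized Fourier
transform `F`; the normalization is chosen so that `h ∑ₙ |val F n|² = ‖F‖²`. -/
def val (F : FreqL2 h) (n : ℤ) : ℂ := ((√h)⁻¹ : ℝ) * fourierBasis.repr F (-n)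

theorem sqrt_ne_zero_of_fact (h : ℝ) [hh : Fact (0 < h)] : √h ≠ 0 := (Real.sqrt_pos.2 hh.out).ne'

theorem val_eq_integral (F : FreqL2 h) (n : ℤ) :
    val F n = ((√h)⁻¹ : ℝ) * ∫ ξ, fourier n ξ * F ξ ∂haarFreq h := by
  rw [val, fourierBasis_repr, fourierCoeff]; simp

theorem val_congr_ae {F : FreqL2 h} {g : Freq h → ℂ} (hg : F =ᵐ[haarFreq h] g) (n : ℤ) :
    val F n = ((√h)⁻¹ : ℝ) * ∫ ξ, fourier n ξ * g ξ ∂haarFreq h := by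
  rw [val_eq_integral, integral_congr_ae]
  filter_upwards [hg] with x hx; rw [hx]

theorem val_ext {F G : FreqL2 h} (he : ∀ n, val F n = val G n) : F = G := by
  apply fourierBasis.repr.injective
  ext n
  have := he (-n)
  rw [val, val, neg_neg] at this
  have h1 : (((√h)⁻¹ : ℝ) : ℂ) ≠ 0 := by
    exact_mod_cast inv_ne_zero (sqrt_ne_zero_of_fact h)
  exact mul_left_cancel₀ h1 this

/-- The lattice value as a continuous linear functional. -/
def valL (h : ℝ) [Fact (0 < h)] (n : ℤ) : FreqL2 h →L[ℂ] ℂ :=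
  (((√h)⁻¹ : ℝ) : ℂ) • innerSL ℂ (fourierBasis (T := 2 * Real.pi / h) (-n))

theorem valL_apply (F : FreqL2 h) (n : ℤ) : valL h n F = val F n := by
  rw [valL, val, HilbertBasis.repr_apply_apply]; simp

theorem val_add (F G : FreqL2 h) (n : ℤ) : val (F + G) n = val F n + val G n := by
  simp_rw [← valL_apply, map_add]
theorem val_sub (F G : FreqL2 h) (n : ℤ) : val (F - G) n = val F n - val G n := by
  simp_rw [← valL_apply, map_sub]
theorem val_smul (c : ℂ) (F : FreqL2 h) (n : ℤ) : val (c • F) n = c * val F n := by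
  simp_rw [← valL_apply, map_smul, smul_eq_mul]

theorem hasSum_sq_val (F : FreqL2 h) : HasSum (fun n => ‖val F n‖ ^ 2) (h⁻¹ * ‖F‖ ^ 2) := by
  have h0 := hh.out
  have h1 := lp.hasSum_norm (p := 2) (by norm_num) (fourierBasis.repr F)
  rw [LinearIsometryEquiv.norm_map] at h1
  have h2 := ((Equiv.neg ℤ).hasSum_iff.2 h1).mul_left h⁻¹
  simp only [ENNReal.toReal_ofNat, Real.rpow_ofNat] at h2
  convert! h2 using 2 with n
  rw [val, norm_mul, mul_pow, Complex.norm_real, Real.norm_eq_abs, sq_abs, inv_pow,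
    Real.sq_sqrt h0.le]
  rfl

theorem norm_val_le (F : FreqL2 h) (n : ℤ) : ‖val F n‖ ≤ (√h)⁻¹ * ‖F‖ := by
  have h0 := hh.out
  apply le_of_sq_le_sq _ (by positivity)
  have := le_hasSum (hasSum_sq_val F) n (fun _ _ => by positivity)
  rw [mul_pow, inv_pow, Real.sq_sqrt h0.le]; exact this

/-- `F` is the normalized Fourier transform of the real-valued lattice function `f`. -/
def Represents (F : FreqL2 h) (f : ℤ → ℝ) : Prop := ∀ n, val F n = f n

theorem Represents.l2Norm_eq {F : FreqL2 h} {f : ℤ → ℝ} (hF : Represents F f) :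
    l2Norm h f = ‖F‖ := by
  have h0 := hh.out
  have := (hasSum_sq_val F).tsum_eq
  rw [l2Norm, tsum_congr (g := fun n => ‖val F n‖ ^ 2) (fun n => by
      rw [hF n, Complex.norm_real, Real.norm_eq_abs]), this,
    mul_inv_cancel_left₀ h0.ne', Real.sqrt_sq (norm_nonneg _)]

theorem exists_represents_of_summable {f : ℤ → ℝ} (hf : Summable fun n => |f n| ^ 2) :
    ∃ F : FreqL2 h, Represents F f := by
  have hm : Memℓp (fun n : ℤ => ((√h * f (-n) : ℝ) : ℂ)) 2 := by
    apply memℓp_gen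
    simp only [ENNReal.toReal_ofNat, Real.rpow_ofNat, Complex.norm_real, norm_mul, mul_pow]
    exact ((Equiv.neg ℤ).summable_iff.2 hf).mul_left _
  refine ⟨fourierBasis.repr.symm ⟨_, hm⟩, fun n => ?_⟩
  rw [val, LinearIsometryEquiv.apply_symm_apply]
  change ((√h)⁻¹ : ℝ) * ((√h * f (- -n) : ℝ) : ℂ) = _
  rw [neg_neg, ← Complex.ofReal_mul, inv_mul_cancel_left₀ (sqrt_ne_zero_of_fact h)]

theorem summable_latticeL2 (f : LatticeL2) : Summable fun n => |f n| ^ 2 := by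
  have := (lp.memℓp f).summable (by norm_num)
  simpa using this

/-- The normalized Fourier transform. -/
def toFreq (h : ℝ) [Fact (0 < h)] (f : LatticeL2) : FreqL2 h :=
  (exists_represents_of_summable (h := h) (summable_latticeL2 f)).choose

theorem represents_toFreq (f : LatticeL2) : Represents (toFreq h f) f :=
  (exists_represents_of_summable (h := h) (summable_latticeL2 f)).choose_spec

theorem Represents.unique {F G : FreqL2 h} {f : ℤ → ℝ} (hF : Represents F f)
    (hG : Represents G f) : F = G := val_ext fun n => by rw [hF, hG]

theorem Represents.add {F G : FreqL2 h} {f g : ℤ → ℝ} (hF : Represents F f)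
    (hG : Represents G g) : Represents (F + G) (f + g) := fun n => by
  rw [val_add, hF, hG]; simp

theorem Represents.sub {F G : FreqL2 h} {f g : ℤ → ℝ} (hF : Represents F f)
    (hG : Represents G g) : Represents (F - G) (fun n => f n - g n) := fun n => by
  rw [val_sub, hF, hG]; simp

theorem Represents.smul {F : FreqL2 h} {f : ℤ → ℝ} (hF : Represents F f) (c : ℝ) :
    Represents ((c : ℂ) • F) (fun n => c * f n) := fun n => by
  rw [val_smul, hF]; simp

theorem norm_toFreq_sub (f g : LatticeL2) : ‖toFreq h f - toFreq h g‖ = √h * ‖f - g‖ := by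
  have h1 := ((represents_toFreq (h := h) f).sub (represents_toFreq g)).l2Norm_eq
  have h0 := hh.out
  rw [← h1, l2Norm, Real.sqrt_mul h0.le]
  congr 1
  rw [lp.norm_eq_tsum_rpow (by norm_num)]
  simp [Real.sqrt_eq_rpow]

theorem continuous_toFreq : Continuous (toFreq h) := by
  have : LipschitzWith (Real.toNNReal (√h)) (toFreq h) := by
    apply LipschitzWith.of_dist_le_mul
    intro f g
    rw [dist_eq_norm, norm_toFreq_sub, dist_eq_norm, Real.coe_toNNReal _ (Real.sqrt_nonneg h)]
  exact this.continuous

theorem Represents.fourierTransform_eq {F : FreqL2 h} {f : ℤ → ℝ} (hF : Represents F f) :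
    fourierTransform h f = ((√h : ℝ) : ℂ) • F := by
  have h0 := hh.out
  rw [fourierTransform]
  apply HasSum.tsum_eq
  have h1 := ((Equiv.neg ℤ).hasSum_iff.2 (fourierBasis.hasSum_repr F)).const_smul ((√h : ℝ) : ℂ)
  convert! h1 using 2 with n
  have h2 : fourierBasis.repr F (-n) = ((√h : ℝ) : ℂ) * f n := by
    rw [← hF n, val, ← mul_assoc, ← Complex.ofReal_mul, mul_inv_cancel₀ (sqrt_ne_zero_of_fact h)]
    simp
  simp only [Function.comp, Equiv.neg_apply]
  rw [h2, coe_fourierBasis, smul_smul, ← mul_assoc, ← Complex.ofReal_mul,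
    Real.mul_self_sqrt h0.le, Complex.ofReal_mul]

theorem Represents.multiplier_eq {F : FreqL2 h} {f : ℤ → ℝ} (hF : Represents F f) {m : ℝ → ℂ}
    (hm : Continuous m) (n : ℤ) : multiplier h m f n = (val (symb h m F) n).re := by
  have h0 := hh.out
  have hpi := Real.pi_pos
  rw [multiplier, val_congr_ae (coeFn_symb hm F)]
  congr 1
  have h1 : fourierTransform h f =ᵐ[haarFreq h] fun ξ => ((√h : ℝ) : ℂ) * F ξ := by
    rw [hF.fourierTransform_eq]
    filter_upwards [Lp.coeFn_smul ((√h : ℝ) : ℂ) F] with x hx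
    rw [hx]; rfl
  have h2 : ∫ ξ, fourier n ξ * (m (rep ξ) * F ξ) ∂haarFreq h = ((√h : ℝ) : ℂ)⁻¹ *
      ∫ ξ, fourier n ξ * (m (rep ξ) * fourierTransform h f ξ) ∂haarFreq h := by
    rw [← integral_const_mul]
    apply integral_congr_ae
    filter_upwards [h1] with ξ hξ
    rw [hξ]
    have : ((√h : ℝ) : ℂ) ≠ 0 := by exact_mod_cast sqrt_ne_zero_of_fact h
    field_simp
  rw [h2, AddCircle.integral_haarAddCircle]
  have h3 := AddCircle.intervalIntegral_preimage (2 * Real.pi / h) (-(Real.pi / h))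
    (fun ξ : Freq h => fourier n ξ * (m (rep ξ) * fourierTransform h f ξ))
  rw [neg_add_period] at h3
  rw [← h3]
  have h4 : ∫ a in (-(Real.pi / h))..(Real.pi / h),
      fourier n (a : Freq h) * (m (rep (a : Freq h)) * fourierTransform h f (a : Freq h)) =
      ∫ ξ in (-(Real.pi / h))..(Real.pi / h),
    m ξ * fourierTransform h f (ξ : Freq h) * Complex.exp (Complex.I * h * n * ξ) := by
    have : -(Real.pi / h) ≤ Real.pi / h := by have : 0 < Real.pi / h := by positivity
                                              linarith
    apply intervalIntegral.integral_congr_ae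
    filter_upwards with a ha
    rw [uIoc_of_le this] at ha
    rw [rep_coe ha, fourier_coe_apply, mul_comm]
    congr 2
    have : (h : ℂ) ≠ 0 := by exact_mod_cast h0.ne'
    have hpi' : (Real.pi : ℂ) ≠ 0 := by exact_mod_cast hpi.ne'
    push_cast
    field_simp
  rw [h4, ← mul_assoc, Complex.real_smul, ← mul_assoc]
  congr 1
  have h5 : ((√h : ℝ) : ℂ) * ((√h : ℝ) : ℂ) = h := by
    rw [← Complex.ofReal_mul, Real.mul_self_sqrt h0.le]
  have : (h : ℂ) ≠ 0 := by exact_mod_cast h0.ne'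
  have hpi' : (Real.pi : ℂ) ≠ 0 := by exact_mod_cast hpi.ne'
  push_cast
  rw [← mul_inv, h5]
  field_simp

/-! ### Complex conjugation -/

theorem rep_neg_ae : ∀ᵐ ξ ∂haarFreq h, rep (-ξ) = -rep ξ := by
  have h0 := hh.out
  have hpi := Real.pi_pos
  have : ∀ᵐ ξ ∂haarFreq h, ξ ≠ ((Real.pi / h : ℝ) : Freq h) := by
    rw [ae_iff]
    simp only [ne_eq, not_not, ofPred_eq_eq_singleton]
    rw [← nonpos_iff_eq_zero]
    have := lintegral_haarFreq (h := h) (({((Real.pi / h : ℝ) : Freq h)} : Set (Freq h)).indicator 1)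
    rw [lintegral_indicator_one (measurableSet_singleton _)] at this
    rw [this, ← setLIntegral_congr (Ioo_ae_eq_Ioc (a := -(Real.pi / h)) (b := Real.pi / h)),
      setLIntegral_congr_fun (g := 0) measurableSet_Ioo]
    · simp
    · intro x hx
      simp only [Pi.zero_apply]
      rw [indicator_of_notMem]
      intro hx'
      rw [mem_singleton_iff] at hx'
      have h2 := congrArg rep hx'
      have : 0 < Real.pi / h := by positivity
      rw [rep_coe ⟨hx.1, hx.2.le⟩, rep_coe ⟨by linarith, le_rfl⟩] at h2
      exact hx.2.ne h2
  filter_upwards [this] with ξ hξ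
  have h1 := rep_mem ξ
  have h2 : rep ξ ≠ Real.pi / h := fun hc => hξ (by rw [← hc, coe_rep])
  have h3 : ((-rep ξ : ℝ) : Freq h) = -ξ := by rw [AddCircle.coe_neg, coe_rep]
  rw [← h3, rep_coe]
  exact ⟨by linarith [lt_of_le_of_ne h1.2 h2], by linarith [h1.1]⟩

theorem measurePreserving_neg_freq :
    MeasurePreserving (fun ξ : Freq h => -ξ) (haarFreq h) (haarFreq h) :=
  Measure.measurePreserving_neg _

theorem memLp_conjFreq (F : FreqL2 h) :
    MemLp (fun ξ => conj (F (-ξ))) 2 (haarFreq h) :=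
  ((Lp.memLp F).comp_measurePreserving measurePreserving_neg_freq).star

/-- The Fourier transform of the complex conjugate function. -/
def conjFreq (F : FreqL2 h) : FreqL2 h := (memLp_conjFreq F).toLp

theorem coeFn_conjFreq (F : FreqL2 h) :
    conjFreq F =ᵐ[haarFreq h] fun ξ => conj (F (-ξ)) := (memLp_conjFreq F).coeFn_toLp

theorem val_conjFreq (F : FreqL2 h) (n : ℤ) : val (conjFreq F) n = conj (val F n) := by
  rw [val_congr_ae (coeFn_conjFreq F), val_eq_integral, map_mul, Complex.conj_ofReal,
    ← integral_conj, ← integral_neg_eq_self]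
  congr 2
  ext ξ
  rw [neg_neg, map_mul, ← fourier_neg, fourier_apply, fourier_apply, smul_neg, neg_smul]

theorem conjFreq_symb {m : ℝ → ℂ} (hm : Continuous m) (hc : ∀ x, m (-x) = conj (m x))
    (F : FreqL2 h) : conjFreq (symb h m F) = symb h m (conjFreq F) := by
  apply Lp.ext
  filter_upwards [coeFn_conjFreq (symb h m F), coeFn_symb hm (conjFreq F), coeFn_conjFreq F,
    measurePreserving_neg_freq.quasiMeasurePreserving.ae (coeFn_symb hm F), rep_neg_ae (h := h)]
    with ξ h1 h2 h3 h4 h5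
  rw [h1, h2, h3, h4, h5, hc, map_mul, Complex.conj_conj]

theorem norm_conjFreq_sub (F G : FreqL2 h) : ‖conjFreq F - conjFreq G‖ = ‖F - G‖ := by
  have h0 := hh.out
  have h1 := hasSum_sq_val (conjFreq F - conjFreq G)
  simp only [val_sub, val_conjFreq, ← map_sub, RCLike.norm_conj] at h1
  simp only [← val_sub] at h1
  have h2 := mul_left_cancel₀ (inv_ne_zero h0.ne') (h1.unique (hasSum_sq_val (F - G)))
  exact (sq_eq_sq₀ (norm_nonneg _) (norm_nonneg _)).1 h2

theorem continuous_conjFreq : Continuous (conjFreq : FreqL2 h → FreqL2 h) :=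
  (Isometry.of_dist_eq fun F G => by rw [dist_eq_norm, dist_eq_norm, norm_conjFreq_sub]).continuous

theorem represents_of_conjFreq_eq {F : FreqL2 h} (hF : conjFreq F = F) :
    Represents F (fun n => (val F n).re) := fun n => by
  have := val_conjFreq F n
  rw [hF] at this
  exact (Complex.conj_eq_iff_re.1 this.symm).symm

theorem Represents.conjFreq_eq {F : FreqL2 h} {f : ℤ → ℝ} (hF : Represents F f) :
    conjFreq F = F :=
  val_ext fun n => by rw [val_conjFreq, hF n, Complex.conj_ofReal]

theorem Represents.symb {F : FreqL2 h} {f : ℤ → ℝ} (hF : Represents F f) {m : ℝ → ℂ}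
    (hm : Continuous m) (hc : ∀ x, m (-x) = conj (m x)) :
    Represents (symb h m F) (multiplier h m f) := by
  rw [funext (hF.multiplier_eq hm)]
  apply represents_of_conjFreq_eq
  rw [conjFreq_symb hm hc, hF.conjFreq_eq]

/-- The real lattice function represented by `F`. -/
def ofFreq (F : FreqL2 h) : LatticeL2 :=
  ⟨fun n => (val F n).re, by
    apply memℓp_gen
    simp only [ENNReal.toReal_ofNat, Real.rpow_ofNat, Real.norm_eq_abs]
    refine (hasSum_sq_val F).summable.of_nonneg_of_le (fun _ => by positivity) fun n => ?_
    gcongr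
    exact Complex.abs_re_le_norm _⟩

theorem ofFreq_apply (F : FreqL2 h) (n : ℤ) : ofFreq F n = (val F n).re := rfl

theorem continuous_ofFreq : Continuous (ofFreq : FreqL2 h → LatticeL2) := by
  have h0 := hh.out
  have : LipschitzWith (Real.toNNReal (√h)⁻¹) (ofFreq : FreqL2 h → LatticeL2) := by
    apply LipschitzWith.of_dist_le_mul
    intro F G
    rw [dist_eq_norm, dist_eq_norm, Real.coe_toNNReal _ (by positivity)]
    apply le_of_sq_le_sq _ (by positivity)
    have h1 := lp.hasSum_norm (p := 2) (by norm_num) (ofFreq F - ofFreq G)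
    simp only [ENNReal.toReal_ofNat, Real.rpow_ofNat] at h1
    rw [mul_pow, inv_pow, Real.sq_sqrt h0.le]
    refine hasSum_le (fun n => ?_) h1 (hasSum_sq_val (F - G))
    rw [val_sub]
    gcongr
    rw [lp.coeFn_sub, Pi.sub_apply, ofFreq_apply, ofFreq_apply, ← Complex.sub_re]
    exact Complex.abs_re_le_norm _
  exact this.continuous

end

/-! ### The product of lattice functions on the frequency side -/

/-- The Cauchy-Schwarz inequality for lower integrals. -/
theorem sq_lintegral_mul_le {α : Type*} [MeasurableSpace α] (μ : Measure α) {f g : α → ℝ≥0∞}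
    (hf : AEMeasurable f μ) (hg : AEMeasurable g μ) :
    (∫⁻ x, f x * g x ∂μ) ^ 2 ≤ (∫⁻ x, f x ^ 2 ∂μ) * ∫⁻ x, g x ^ 2 ∂μ := by
  have h1 := ENNReal.lintegral_mul_le_Lp_mul_Lq μ Real.HolderConjugate.two_two hf hg
  have h2 : ∀ a : ℝ≥0∞, (a ^ (1 / (2 : ℝ))) ^ 2 = a := fun a => by
    rw [← ENNReal.rpow_natCast, ← ENNReal.rpow_mul]; norm_num
  have h3 := pow_le_pow_left₀ zero_le h1 2
  rw [mul_pow, h2, h2] at h3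
  simpa using h3

theorem lintegral_enorm_sq {α : Type*} [MeasurableSpace α] {μ : Measure α} (f : Lp ℂ 2 μ) :
    ∫⁻ x, ‖f x‖ₑ ^ 2 ∂μ = ‖f‖ₑ ^ 2 := by
  rw [Lp.enorm_def, eLpNorm_eq_lintegral_rpow_enorm_toReal (by norm_num) (by norm_num)]
  rw [← ENNReal.rpow_natCast _ 2, ← ENNReal.rpow_mul]
  norm_num

section
variable {h : ℝ} [hh : Fact (0 < h)]

theorem integrable_freq (F : FreqL2 h) : Integrable F (haarFreq h) :=
  (Lp.memLp F).integrable (by norm_num)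

theorem stronglyMeasurable_conv (F G : FreqL2 h) :
    StronglyMeasurable fun ξ => ∫ ξ₁, F ξ₁ * G (ξ - ξ₁) ∂haarFreq h := by
  apply StronglyMeasurable.integral_prod_right
  exact ((Lp.stronglyMeasurable F).comp_measurable measurable_snd).mul
    ((Lp.stronglyMeasurable G).comp_measurable (measurable_fst.sub measurable_snd))

theorem enorm_conv_le (F G : FreqL2 h) (ξ : Freq h) :
    ∫⁻ ξ₁, ‖F ξ₁‖ₑ * ‖G (ξ - ξ₁)‖ₑ ∂haarFreq h ≤ ‖F‖ₑ * ‖G‖ₑ := by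
  have h1 := sq_lintegral_mul_le (haarFreq h) (f := fun ξ₁ => ‖F ξ₁‖ₑ)
    (g := fun ξ₁ => ‖G (ξ - ξ₁)‖ₑ) (Lp.stronglyMeasurable F).measurable.enorm.aemeasurable
    ((Lp.stronglyMeasurable G).measurable.enorm.comp
      (measurable_const.sub measurable_id)).aemeasurable
  rw [lintegral_sub_left_eq_self (fun ξ₁ => ‖G ξ₁‖ₑ ^ 2) ξ, lintegral_enorm_sq,
    lintegral_enorm_sq, ← mul_pow] at h1
  exact (ENNReal.pow_le_pow_left_iff two_ne_zero).1 h1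

theorem norm_conv_le (F G : FreqL2 h) (ξ : Freq h) :
    ‖∫ ξ₁, F ξ₁ * G (ξ - ξ₁) ∂haarFreq h‖ ≤ ‖F‖ * ‖G‖ := by
  have h1 := (enorm_integral_le_lintegral_enorm
    (fun ξ₁ => F ξ₁ * G (ξ - ξ₁)) (μ := haarFreq h)).trans
    ((lintegral_mono fun ξ₁ => (enorm_mul _ _).le).trans (enorm_conv_le F G ξ))
  have := ENNReal.toReal_mono (by finiteness) h1
  simpa using this

theorem memLp_conv (F G : FreqL2 h) :
    MemLp (fun ξ => (((√h)⁻¹ : ℝ) : ℂ) * ∫ ξ₁, F ξ₁ * G (ξ - ξ₁) ∂haarFreq h) 2 (haarFreq h) := by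
  apply MemLp.const_mul
  exact MemLp.of_bound (stronglyMeasurable_conv F G).aestronglyMeasurable _
    (.of_forall (norm_conv_le F G))

/-- The Fourier transform of the pointwise product of two lattice functions. -/
def prodFreq (F G : FreqL2 h) : FreqL2 h := (memLp_conv F G).toLp

theorem coeFn_prodFreq (F G : FreqL2 h) :
    prodFreq F G =ᵐ[haarFreq h]
      fun ξ => (((√h)⁻¹ : ℝ) : ℂ) * ∫ ξ₁, F ξ₁ * G (ξ - ξ₁) ∂haarFreq h :=
  (memLp_conv F G).coeFn_toLp

theorem integrable_fourier_mul (F : FreqL2 h) (n : ℤ) :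
    Integrable (fun ξ => fourier n ξ * F ξ) (haarFreq h) := by
  apply (integrable_freq F).bdd_mul (c := 1)
  · exact (map_continuous (fourier n)).aestronglyMeasurable
  · exact .of_forall fun ξ => (Circle.norm_coe _).le

theorem val_prodFreq (F G : FreqL2 h) (n : ℤ) : val (prodFreq F G) n = val F n * val G n := by
  rw [val_congr_ae (coeFn_prodFreq F G), val_eq_integral, val_eq_integral]
  have h1 := integral_convolution (μ := haarFreq h) (ν := haarFreq h) (ContinuousLinearMap.mul ℂ ℂ)
    (integrable_fourier_mul F n) (integrable_fourier_mul G n)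
  simp only [ContinuousLinearMap.mul_apply', convolution] at h1
  have h2 : ∀ ξ : Freq h, ∫ t, fourier n t * F t * (fourier n (ξ - t) * G (ξ - t)) ∂haarFreq h =
      fourier n ξ * ∫ ξ₁, F ξ₁ * G (ξ - ξ₁) ∂haarFreq h := fun ξ => by
    rw [← integral_const_mul]
    congr 1; ext t
    have : fourier n ξ = fourier n t * fourier n (ξ - t) := by
      rw [fourier_apply, fourier_apply, fourier_apply, ← Circle.coe_mul, ← AddCircle.toCircle_add, ← smul_add, add_sub_cancel]
    rw [this]; ring
  simp only [h2] at h1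
  have h3 : ∀ ξ : Freq h, fourier n ξ * ((((√h)⁻¹ : ℝ) : ℂ) * ∫ ξ₁, F ξ₁ * G (ξ - ξ₁) ∂haarFreq h) =
      (((√h)⁻¹ : ℝ) : ℂ) * (fourier n ξ * ∫ ξ₁, F ξ₁ * G (ξ - ξ₁) ∂haarFreq h) := fun ξ => by ring
  simp only [h3]
  rw [integral_const_mul, h1]
  ring

theorem norm_le_of_norm_val_le {F G : FreqL2 h} {c : ℝ} (hc : 0 ≤ c)
    (he : ∀ n, ‖val F n‖ ≤ c * ‖val G n‖) : ‖F‖ ≤ c * ‖G‖ := by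
  have h0 := hh.out
  apply le_of_sq_le_sq _ (by positivity)
  have h1 : h⁻¹ * ‖F‖ ^ 2 ≤ c ^ 2 * (h⁻¹ * ‖G‖ ^ 2) := by
    refine hasSum_le (fun n => ?_) (hasSum_sq_val F) ((hasSum_sq_val G).mul_left _)
    rw [← mul_pow]
    exact pow_le_pow_left₀ (norm_nonneg _) (he n) 2
  have h2 : 0 < h⁻¹ := by positivity
  rw [mul_pow]
  nlinarith

theorem norm_prodFreq_le (F G : FreqL2 h) : ‖prodFreq F G‖ ≤ (√h)⁻¹ * ‖F‖ * ‖G‖ := by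
  apply norm_le_of_norm_val_le (by positivity)
  intro n
  rw [val_prodFreq, norm_mul]
  exact mul_le_mul_of_nonneg_right (norm_val_le F n) (norm_nonneg _)

/-- The product as a continuous bilinear map. -/
def prodFreqL (h : ℝ) [Fact (0 < h)] : FreqL2 h →L[ℂ] FreqL2 h →L[ℂ] FreqL2 h :=
  LinearMap.mkContinuous₂ (LinearMap.mk₂ ℂ prodFreq
    (fun F F' G => val_ext fun n => by simp only [val_prodFreq, val_add]; ring)
    (fun c F G => val_ext fun n => by simp only [val_prodFreq, val_smul]; ring)
    (fun F G G' => val_ext fun n => by simp only [val_prodFreq, val_add]; ring)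
    (fun c F G => val_ext fun n => by simp only [val_prodFreq, val_smul]; ring))
    (√h)⁻¹ (fun F G => norm_prodFreq_le F G)

theorem prodFreqL_apply (F G : FreqL2 h) : prodFreqL h F G = prodFreq F G := rfl

theorem conjFreq_prodFreq (F G : FreqL2 h) :
    conjFreq (prodFreq F G) = prodFreq (conjFreq F) (conjFreq G) :=
  val_ext fun n => by simp only [val_conjFreq, val_prodFreq, map_mul]

theorem conjFreq_add (F G : FreqL2 h) : conjFreq (F + G) = conjFreq F + conjFreq G :=
  val_ext fun n => by simp only [val_conjFreq, val_add, map_add]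

theorem conjFreq_smul (c : ℝ) (F : FreqL2 h) :
    conjFreq ((c : ℂ) • F) = (c : ℂ) • conjFreq F :=
  val_ext fun n => by simp only [val_conjFreq, val_smul, map_mul, Complex.conj_ofReal]

theorem Represents.mul {F G : FreqL2 h} {f g : ℤ → ℝ} (hF : Represents F f)
    (hG : Represents G g) : Represents (prodFreq F G) (fun n => f n * g n) := fun n => by
  rw [val_prodFreq, hF, hG]; simp

/-! ### The higher-order remainder -/

/-- On bounded sets, `remainder V h` has a Lipschitz constant quadratic in the size of the
arguments. -/
theorem exists_remainder_sub_le {V : ℝ → ℝ} (hV : IsNormalizedPotential V) (B : ℝ) :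
    ∃ C : ℝ, 0 ≤ C ∧ ∀ h : ℝ, 0 < h → ∀ r r' m : ℝ, |r| ≤ m → |r'| ≤ m → h ^ 2 * m ≤ B →
      |remainder V h r - remainder V h r'| ≤ C * m ^ 2 * |r - r'| := by
  set g : ℝ → ℝ := fun x => deriv V x - x - x ^ 2 / 2 with hg
  have hV5 := hV.contDiff
  have hd4 : ContDiff ℝ 4 (deriv V) := by
    rw [show (5 : WithTop ℕ∞) = 4 + 1 by norm_num, contDiff_succ_iff_deriv] at hV5
    exact hV5.2.2
  have hd3 : ContDiff ℝ 3 (deriv (deriv V)) := by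
    rw [show (4 : WithTop ℕ∞) = 3 + 1 by norm_num, contDiff_succ_iff_deriv] at hd4
    exact hd4.2.2
  have hd2 : ContDiff ℝ 2 (deriv (deriv (deriv V))) := by
    rw [show (3 : WithTop ℕ∞) = 2 + 1 by norm_num, contDiff_succ_iff_deriv] at hd3
    exact hd3.2.2
  have hd1 : ContDiff ℝ 1 (deriv (deriv (deriv (deriv V)))) := by
    rw [show (2 : WithTop ℕ∞) = 1 + 1 by norm_num, contDiff_succ_iff_deriv] at hd2
    exact hd2.2.2
  have e2 : deriv (deriv V) 0 = 1 := by
    have := hV.deriv_two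
    simpa [iteratedDeriv_succ, iteratedDeriv_zero] using this
  have e3 : deriv (deriv (deriv V)) 0 = 1 := by
    have := hV.deriv_three
    simpa [iteratedDeriv_succ, iteratedDeriv_zero] using this
  have a1 : ∀ x, HasDerivAt g (deriv (deriv V) x - 1 - x) x := fun x => by
    have := (((hd4.differentiable (by norm_num)) x).hasDerivAt.sub (hasDerivAt_id x)).sub
      (((hasDerivAt_id x).pow 2).div_const 2)
    simp only [Nat.cast_ofNat, id_eq, Nat.add_one_sub_one, pow_one, mul_one] at this
    rw [show deriv (deriv V) x - 1 - x = deriv (deriv V) x - 1 - 2 * x / 2 by ring]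
    exact this
  have a2 : ∀ x, HasDerivAt (fun x => deriv (deriv V) x - 1 - x) (deriv (deriv (deriv V)) x - 1) x :=
    fun x => (((hd3.differentiable (by norm_num)) x).hasDerivAt.sub_const 1).sub (hasDerivAt_id x)
  have a3 : ∀ x, HasDerivAt (fun x => deriv (deriv (deriv V)) x - 1)
      (deriv (deriv (deriv (deriv V))) x) x :=
    fun x => ((hd2.differentiable (by norm_num)) x).hasDerivAt.sub_const 1
  obtain ⟨C, hC⟩ := (isCompact_Icc (a := -B) (b := B)).exists_bound_of_continuousOn
    hd1.continuous.continuousOn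
  refine ⟨2 * |C|, by positivity, fun h h0 r r' m hr hr' hm => ?_⟩
  have hm0 : 0 ≤ m := (abs_nonneg r).trans hr
  set I := Icc (-(h ^ 2 * m)) (h ^ 2 * m)
  have hI : Convex ℝ I := convex_Icc _ _
  have h0I : (0 : ℝ) ∈ I := by
    have : 0 ≤ h ^ 2 * m := by positivity
    exact ⟨by linarith, this⟩
  have hxI : ∀ x ∈ I, |x - 0| ≤ h ^ 2 * m := fun x hx => by rw [sub_zero]; exact abs_le.2 hx
  -- the bound for the fourth derivative is integrated from zero, where the lower ones of `g`
  -- vanish; each integration gains the length `h² m` of the interval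
  have b3 : ∀ x ∈ I, ‖deriv (deriv (deriv (deriv V))) x‖ ≤ |C| := fun x hx =>
    (hC x ⟨by linarith [hx.1], by linarith [hx.2]⟩).trans (le_abs_self C)
  have b2 : ∀ x ∈ I, ‖deriv (deriv (deriv V)) x - 1‖ ≤ |C| * (h ^ 2 * m) := fun x hx => by
    have := hI.norm_image_sub_le_of_norm_hasDerivWithin_le
      (fun y _ => (a3 y).hasDerivWithinAt) b3 h0I hx
    rw [e3, sub_self, sub_zero] at this
    exact this.trans (mul_le_mul_of_nonneg_left (hxI x hx) (abs_nonneg C))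
  have b1 : ∀ x ∈ I, ‖deriv (deriv V) x - 1 - x‖ ≤ |C| * (h ^ 2 * m) * (h ^ 2 * m) := fun x hx => by
    have := hI.norm_image_sub_le_of_norm_hasDerivWithin_le
      (fun y _ => (a2 y).hasDerivWithinAt) b2 h0I hx
    rw [e2, sub_self, sub_zero, sub_zero] at this
    exact this.trans (mul_le_mul_of_nonneg_left (hxI x hx) (by positivity))
  have hmem : ∀ x, |x| ≤ m → h ^ 2 * x ∈ I := fun x hx => by
    have : |h ^ 2 * x| ≤ h ^ 2 * m := by
      rw [abs_mul, abs_of_pos (by positivity : 0 < h ^ 2)]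
      exact mul_le_mul_of_nonneg_left hx (by positivity)
    exact abs_le.1 this
  have := hI.norm_image_sub_le_of_norm_hasDerivWithin_le
      (fun y _ => (a1 y).hasDerivWithinAt) b1 (hmem r' hr') (hmem r hr)
  rw [Real.norm_eq_abs, Real.norm_eq_abs] at this
  have e : remainder V h r - remainder V h r' = 2 / h ^ 6 * (g (h ^ 2 * r) - g (h ^ 2 * r')) := by
    simp only [remainder, hg]; ring
  rw [e, abs_mul, abs_of_pos (by positivity : 0 < 2 / h ^ 6)]
  calc _ ≤ 2 / h ^ 6 * (|C| * (h ^ 2 * m) * (h ^ 2 * m) * |h ^ 2 * r - h ^ 2 * r'|) := by gcongr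
    _ = _ := by
      rw [← mul_sub, abs_mul, abs_of_pos (by positivity : 0 < h ^ 2)]
      field_simp

theorem remainder_zero {V : ℝ → ℝ} (hV : IsNormalizedPotential V) (h : ℝ) :
    remainder V h 0 = 0 := by simp [remainder, hV.deriv_one]

theorem summable_remainder {V : ℝ → ℝ} (hV : IsNormalizedPotential V) (F : FreqL2 h) :
    Summable fun n => |remainder V h (val F n).re| ^ 2 := by
  have h0 := hh.out
  set m := (√h)⁻¹ * ‖F‖
  obtain ⟨C, hC, H⟩ := exists_remainder_sub_le hV (h ^ 2 * m)
  refine ((hasSum_sq_val F).summable.mul_left ((C * m ^ 2) ^ 2)).of_nonneg_of_le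
    (fun _ => by positivity) fun n => ?_
  rw [← mul_pow]
  gcongr
  have := H h h0 (val F n).re 0 m ((Complex.abs_re_le_norm _).trans (norm_val_le F n))
    (by rw [abs_zero]; positivity) le_rfl
  rw [remainder_zero hV, sub_zero, sub_zero] at this
  exact this.trans (mul_le_mul_of_nonneg_left (Complex.abs_re_le_norm _) (by positivity))

open Classical in
/-- The remainder on the frequency side; zero if it is not square summable. -/
def remFreq (V : ℝ → ℝ) (F : FreqL2 h) : FreqL2 h :=
  if hs : Summable fun n => |remainder V h (val F n).re| ^ 2 then
    (exists_represents_of_summable (h := h) hs).choose else 0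

theorem represents_remFreq {V : ℝ → ℝ} (hV : IsNormalizedPotential V) (F : FreqL2 h) :
    Represents (remFreq V F) (fun n => remainder V h (val F n).re) := by
  have hs := summable_remainder hV F
  rw [remFreq, dif_pos hs]
  exact (exists_represents_of_summable (h := h) hs).choose_spec

theorem conjFreq_remFreq {V : ℝ → ℝ} (hV : IsNormalizedPotential V) (F : FreqL2 h) :
    conjFreq (remFreq V F) = remFreq V (conjFreq F) := by
  rw [(represents_remFreq hV F).conjFreq_eq]
  apply (represents_remFreq hV F).unique
  intro n
  rw [represents_remFreq hV]
  simp only [val_conjFreq, Complex.conj_re]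

theorem Represents.remFreq {V : ℝ → ℝ} (hV : IsNormalizedPotential V) {F : FreqL2 h} {f : ℤ → ℝ}
    (hF : Represents F f) : Represents (remFreq V F) (fun n => remainder V h (f n)) := by
  intro n
  rw [represents_remFreq hV]
  simp only [hF n, Complex.ofReal_re]

end

theorem exists_remFreq_sub_le {V : ℝ → ℝ} (hV : IsNormalizedPotential V) (B : ℝ) :
    ∃ C : ℝ, 0 ≤ C ∧ ∀ (h : ℝ) [Fact (0 < h)], ∀ (F G : FreqL2 h) (m : ℝ),
      (∀ n, ‖val F n‖ ≤ m) → (∀ n, ‖val G n‖ ≤ m) → h ^ 2 * m ≤ B →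
      ‖remFreq V F - remFreq V G‖ ≤ C * m ^ 2 * ‖F - G‖ := by
  obtain ⟨C, hC, H⟩ := exists_remainder_sub_le hV B
  refine ⟨C, hC, fun h hh F G m hF hG hm => ?_⟩
  have h0 := hh.out
  apply norm_le_of_norm_val_le (by positivity)
  intro n
  rw [val_sub, represents_remFreq hV, represents_remFreq hV, ← Complex.ofReal_sub,
    Complex.norm_real, Real.norm_eq_abs]
  refine (H h h0 _ _ m ((Complex.abs_re_le_norm _).trans (hF n))
    ((Complex.abs_re_le_norm _).trans (hG n)) hm).trans ?_
  gcongr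
  rw [← Complex.sub_re, ← val_sub]
  exact Complex.abs_re_le_norm _

/-! ### The profile nonlinearity -/

section
variable {h : ℝ} [hh : Fact (0 < h)]

theorem continuous_symb_family {m : ℝ → ℝ → ℂ} (hm : Continuous (Function.uncurry m)) :
    Continuous fun t => symb h (m t) := by
  let f : C(ℝ × Icc (-(Real.pi / h)) (Real.pi / h), ℂ) := ⟨fun p => m p.1 p.2, by fun_prop⟩
  have hf : Continuous f.curry := f.curry.continuous
  have hmt : ∀ t, Continuous (m t) := fun t => hm.comp (by fun_prop : Continuous fun x => (t, x))
  rw [Metric.continuous_iff] at hf ⊢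
  intro t ε hε
  obtain ⟨δ, hδ, H⟩ := hf t ε hε
  refine ⟨δ, hδ, fun t' ht' => lt_of_le_of_lt ?_ (H t' ht')⟩
  rw [dist_eq_norm]
  apply ContinuousLinearMap.opNorm_le_bound _ dist_nonneg
  intro F
  rw [_root_.sub_apply,
    ← symb_sub (m'' := fun x => m t' x - m t x) (hmt t') (hmt t) (fun _ => rfl)]
  apply norm_symb_le ((hmt t').sub (hmt t))
  intro x hx
  change ‖m t' x - m t x‖ ≤ _
  rw [← dist_eq_norm]
  exact ContinuousMap.dist_apply_le_dist (f := f.curry t') (g := f.curry t) ⟨x, abs_le.1 hx⟩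

/-- The symbol `e^{i a q(ξ)}`. -/
def flow (a : ℝ) (q : ℝ → ℝ) (x : ℝ) : ℂ := Complex.exp ((a * q x : ℝ) * Complex.I)

theorem norm_flow (a : ℝ) (q : ℝ → ℝ) (x : ℝ) : ‖flow a q x‖ = 1 :=
  Complex.norm_exp_ofReal_mul_I _

theorem continuous_flow_family {q : ℝ → ℝ} (hq : Continuous q) :
    Continuous (Function.uncurry fun a => flow a q) := by
  unfold flow Function.uncurry; fun_prop

@[fun_prop]
theorem continuous_flow (a : ℝ) {q : ℝ → ℝ} (hq : Continuous q) : Continuous (flow a q) := by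
  unfold flow; fun_prop

theorem flow_neg_arg (a : ℝ) {q : ℝ → ℝ} (hq : ∀ x, q (-x) = -q x) (x : ℝ) :
    flow a q (-x) = conj (flow a q x) := by
  rw [flow, flow, ← Complex.exp_conj, hq]
  congr 1
  simp

theorem flow_mul_flow_neg (a : ℝ) (q : ℝ → ℝ) (x : ℝ) : flow (-a) q x * flow a q x = 1 := by
  rw [flow, flow, ← Complex.exp_add]; simp

theorem symb_flow_neg (a : ℝ) {q : ℝ → ℝ} (hq : Continuous q) (F : FreqL2 h) :
    symb h (flow (-a) q) (symb h (flow a q) F) = F := by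
  rw [symb_symb (m'' := fun _ => 1) (continuous_flow _ hq) (continuous_flow _ hq)
    (fun x => (flow_mul_flow_neg a q x).symm)]
  exact symb_one (fun _ => rfl) F

theorem norm_symb_flow (a : ℝ) {q : ℝ → ℝ} (hq : Continuous q) (F : FreqL2 h) :
    ‖symb h (flow a q) F‖ = ‖F‖ := norm_symb_eq (continuous_flow a hq) (norm_flow a q) F

theorem dispersionOpp_neg (h x : ℝ) : dispersionOpp h (-x) = -dispersionOpp h x := by
  rw [dispersionOpp, dispersionOpp, dispersion_neg]; ring

@[fun_prop]
theorem continuous_nablaSymbol (h : ℝ) : Continuous (nablaSymbol h) := by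
  unfold nablaSymbol; fun_prop

theorem nablaSymbol_neg (h x : ℝ) : nablaSymbol h (-x) = conj (nablaSymbol h x) := by
  unfold nablaSymbol
  rw [mul_neg, neg_div, Real.sin_neg]
  rw [map_mul, Complex.conj_ofReal, map_div₀, map_mul, Complex.conj_I, Complex.conj_ofReal,
    Complex.conj_ofNat]
  push_cast
  ring

theorem norm_nablaSymbol (x : ℝ) :
    ‖nablaSymbol h x‖ = 2 / h * |Real.sin (h * x / 2)| := by
  have h0 := hh.out
  unfold nablaSymbol
  rw [norm_mul, Complex.norm_real, Real.norm_eq_abs]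
  simp [abs_of_pos h0]

/-- The outer multiplier `∓ (1/4) e^{∓ i t p(ξ)} ∇_h` of the profile equation. -/
def outSymbol (h ε t : ℝ) (x : ℝ) : ℂ :=
  ((-(ε / 4) : ℝ) : ℂ) * (flow (-(ε * t)) (dispersion h) x * nablaSymbol h x)

theorem continuous_outSymbol_family (h ε : ℝ) : Continuous (Function.uncurry (outSymbol h ε)) := by
  unfold outSymbol flow nablaSymbol Function.uncurry; fun_prop

@[fun_prop]
theorem continuous_outSymbol (h ε t : ℝ) : Continuous (outSymbol h ε t) := by
  unfold outSymbol; fun_prop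

theorem outSymbol_neg (h ε t x : ℝ) : outSymbol h ε t (-x) = conj (outSymbol h ε t x) := by
  rw [outSymbol, outSymbol, flow_neg_arg _ (dispersion_neg h), nablaSymbol_neg, map_mul, map_mul,
    Complex.conj_ofReal]

theorem norm_outSymbol (h0 : 0 < h) {ε : ℝ} (hε : |ε| = 1) (t x : ℝ) :
    ‖outSymbol h ε t x‖ = 1 / (2 * h) * |Real.sin (h * x / 2)| := by
  rw [outSymbol, norm_mul, norm_mul, norm_flow, norm_nablaSymbol, Complex.norm_real, norm_neg,
    Real.norm_eq_abs, abs_div, hε]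
  norm_num
  field_simp
  ring

theorem norm_outSymbol_le (h0 : 0 < h) {ε : ℝ} (hε : |ε| = 1) (t x : ℝ) :
    ‖outSymbol h ε t x‖ ≤ 1 / (2 * h) := by
  rw [norm_outSymbol h0 hε]
  exact mul_le_of_le_one_right (by positivity) (Real.abs_sin_le_one _)

/-- The bilinear interaction, in the profile equation of the sign `ε`, of two waves with the
dispersion relations `q₁` and `q₂`. -/
def bil (h : ℝ) [Fact (0 < h)] (ε : ℝ) (q₁ q₂ : ℝ → ℝ) (t : ℝ) (F G : FreqL2 h) : FreqL2 h :=
  symb h (outSymbol h ε t) (prodFreq (symb h (flow (ε * t) q₁) F) (symb h (flow (ε * t) q₂) G))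

theorem bil_sub_sub (ε : ℝ) (q₁ q₂ : ℝ → ℝ) (t : ℝ) (F G F' G' : FreqL2 h) :
    bil h ε q₁ q₂ t F G - bil h ε q₁ q₂ t F' G' =
      bil h ε q₁ q₂ t (F - F') G + bil h ε q₁ q₂ t F' (G - G') := by
  simp only [bil, ← prodFreqL_apply, map_sub, _root_.sub_apply]
  abel

theorem bil_smul_smul (ε : ℝ) (q₁ q₂ : ℝ → ℝ) (t : ℝ) (c : ℂ) (F G : FreqL2 h) :
    bil h ε q₁ q₂ t (c • F) (c • G) = c ^ 2 • bil h ε q₁ q₂ t F G := by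
  simp only [bil, ← prodFreqL_apply, map_smul, _root_.smul_apply, smul_smul, sq]

theorem norm_bil_le {ε : ℝ} (hε : |ε| = 1) {q₁ q₂ : ℝ → ℝ} (h1 : Continuous q₁)
    (h2 : Continuous q₂) (t : ℝ) (F G : FreqL2 h) :
    ‖bil h ε q₁ q₂ t F G‖ ≤ 1 / (2 * h) * (√h)⁻¹ * ‖F‖ * ‖G‖ := by
  have h0 := hh.out
  refine (norm_symb_le (continuous_outSymbol h ε t) (fun x _ => norm_outSymbol_le h0 hε t x) _).trans ?_
  have := norm_prodFreq_le (symb h (flow (ε * t) q₁) F) (symb h (flow (ε * t) q₂) G)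
  rw [norm_symb_flow _ h1, norm_symb_flow _ h2] at this
  calc _ ≤ 1 / (2 * h) * ((√h)⁻¹ * ‖F‖ * ‖G‖) := by gcongr
    _ = _ := by ring

theorem continuous_bil (ε : ℝ) {q₁ q₂ : ℝ → ℝ} (h1 : Continuous q₁) (h2 : Continuous q₂)
    {F G : ℝ → FreqL2 h} (hF : Continuous F) (hG : Continuous G) :
    Continuous fun t => bil h ε q₁ q₂ t (F t) (G t) := by
  have c1 : Continuous fun t => symb h (flow (ε * t) q₁) :=
    (continuous_symb_family (continuous_flow_family h1)).comp (by fun_prop)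
  have c2 : Continuous fun t => symb h (flow (ε * t) q₂) :=
    (continuous_symb_family (continuous_flow_family h2)).comp (by fun_prop)
  have c3 : Continuous fun t => symb h (outSymbol h ε t) :=
    continuous_symb_family (continuous_outSymbol_family h ε)
  simp only [bil, ← prodFreqL_apply]
  exact c3.clm_apply (((prodFreqL h).continuous.comp (c1.clm_apply hF)).clm_apply (c2.clm_apply hG))

theorem conjFreq_bil (ε : ℝ) {q₁ q₂ : ℝ → ℝ} (h1 : Continuous q₁) (h2 : Continuous q₂)
    (o1 : ∀ x, q₁ (-x) = -q₁ x) (o2 : ∀ x, q₂ (-x) = -q₂ x) (t : ℝ) (F G : FreqL2 h) :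
    conjFreq (bil h ε q₁ q₂ t F G) = bil h ε q₁ q₂ t (conjFreq F) (conjFreq G) := by
  rw [bil, bil, conjFreq_symb (by fun_prop) (outSymbol_neg h ε t), conjFreq_prodFreq,
    conjFreq_symb (by fun_prop) (flow_neg_arg _ o1), conjFreq_symb (by fun_prop) (flow_neg_arg _ o2)]

end

theorem continuous_remSymbol (h ε t : ℝ) : Continuous
    fun x => ((h ^ 2 : ℝ) : ℂ) * (outSymbol h ε t x * flow (ε * t / h ^ 2) id x) := by fun_prop

section
variable {h : ℝ} [hh : Fact (0 < h)]

/-- The transform of `r̃_h` at time `t`, from the profiles `F` of the sign `ε` and `G` of the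
opposite sign. -/
def dispFreq (h : ℝ) [Fact (0 < h)] (ε t : ℝ) (F G : FreqL2 h) : FreqL2 h :=
  symb h (flow (-(ε * t / h ^ 2)) id)
    (symb h (flow (ε * t) (dispersion h)) F + symb h (flow (ε * t) (dispersionOpp h)) G)

/-- The contribution of the higher-order remainder to the profile equation of the sign `ε`. -/
def remTerm (V : ℝ → ℝ) (h : ℝ) [Fact (0 < h)] (ε t : ℝ) (F G : FreqL2 h) : FreqL2 h :=
  symb h (fun x => ((h ^ 2 : ℝ) : ℂ) * (outSymbol h ε t x * flow (ε * t / h ^ 2) id x))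
    (remFreq V (dispFreq h ε t F G))

theorem norm_dispFreq_le (ε t : ℝ) (F G : FreqL2 h) : ‖dispFreq h ε t F G‖ ≤ ‖F‖ + ‖G‖ := by
  rw [dispFreq, norm_symb_flow _ continuous_id]
  refine (norm_add_le _ _).trans ?_
  rw [norm_symb_flow _ (continuous_dispersion h), norm_symb_flow _ (continuous_dispersionOpp h)]

theorem dispFreq_sub (ε t : ℝ) (F G F' G' : FreqL2 h) :
    dispFreq h ε t F G - dispFreq h ε t F' G' = dispFreq h ε t (F - F') (G - G') := by
  simp only [dispFreq, map_sub, map_add]; abel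

theorem continuous_dispFreq (ε : ℝ) {F G : ℝ → FreqL2 h} (hF : Continuous F) (hG : Continuous G) :
    Continuous fun t => dispFreq h ε t (F t) (G t) := by
  have c1 : Continuous fun t => symb h (flow (ε * t) (dispersion h)) :=
    (continuous_symb_family (continuous_flow_family (continuous_dispersion h))).comp (by fun_prop)
  have c2 : Continuous fun t => symb h (flow (ε * t) (dispersionOpp h)) :=
    (continuous_symb_family (continuous_flow_family (continuous_dispersionOpp h))).comp (by fun_prop)
  have c3 : Continuous fun t => symb h (flow (-(ε * t / h ^ 2)) id) :=
    (continuous_symb_family (continuous_flow_family continuous_id)).comp (by fun_prop)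
  exact c3.clm_apply ((c1.clm_apply hF).add (c2.clm_apply hG))

theorem conjFreq_dispFreq (ε t : ℝ) (F G : FreqL2 h) :
    conjFreq (dispFreq h ε t F G) = dispFreq h ε t (conjFreq F) (conjFreq G) := by
  rw [dispFreq, dispFreq, conjFreq_symb (by fun_prop) (flow_neg_arg _ (q := id) (fun _ => rfl)), conjFreq_add,
    conjFreq_symb (by fun_prop) (flow_neg_arg _ (dispersion_neg h)),
    conjFreq_symb (by fun_prop) (flow_neg_arg _ (dispersionOpp_neg h))]

theorem norm_remTerm_sub_le (V : ℝ → ℝ) {ε : ℝ} (hε : |ε| = 1) (t : ℝ) (F G F' G' : FreqL2 h) :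
    ‖remTerm V h ε t F G - remTerm V h ε t F' G'‖ ≤
      h * ‖remFreq V (dispFreq h ε t F G) - remFreq V (dispFreq h ε t F' G')‖ := by
  have h0 := hh.out
  rw [remTerm, remTerm, ← map_sub]
  apply norm_symb_le (continuous_remSymbol h ε t)
  intro x _
  rw [norm_mul, norm_mul, norm_flow, Complex.norm_real, Real.norm_eq_abs, abs_of_pos (by positivity)]
  calc h ^ 2 * (‖outSymbol h ε t x‖ * 1) ≤ h ^ 2 * (1 / (2 * h) * 1) := by
        gcongr; exact norm_outSymbol_le h0 hε t x
    _ = h / 2 := by field_simp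
    _ ≤ h := by linarith

theorem continuous_remFreq {V : ℝ → ℝ} (hV : IsNormalizedPotential V) :
    Continuous (remFreq V : FreqL2 h → FreqL2 h) := by
  have h0 := hh.out
  rw [continuous_iff_continuousAt]
  intro F
  set m := (√h)⁻¹ * (‖F‖ + 1) with hm
  obtain ⟨C, hC, H⟩ := exists_remFreq_sub_le hV (h ^ 2 * m)
  apply continuousAt_of_locally_lipschitz (r := 1) one_pos (C * m ^ 2)
  intro G hG
  rw [dist_eq_norm] at hG
  rw [dist_eq_norm, dist_eq_norm]
  refine H h G F m (fun n => (norm_val_le G n).trans ?_) (fun n => (norm_val_le F n).trans ?_) le_rfl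
  · have : ‖G‖ ≤ ‖F‖ + 1 := by
      have := norm_add_le (G - F) F
      rw [sub_add_cancel] at this
      linarith
    rw [hm]; gcongr
  · rw [hm]; gcongr; linarith

theorem continuous_remTerm {V : ℝ → ℝ} (hV : IsNormalizedPotential V) (ε : ℝ)
    {F G : ℝ → FreqL2 h} (hF : Continuous F) (hG : Continuous G) :
    Continuous fun t => remTerm V h ε t (F t) (G t) := by
  have c : Continuous fun t =>
      symb h (fun x => ((h ^ 2 : ℝ) : ℂ) * (outSymbol h ε t x * flow (ε * t / h ^ 2) id x)) := by
    apply continuous_symb_family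
    unfold outSymbol flow nablaSymbol Function.uncurry; fun_prop
  exact c.clm_apply ((continuous_remFreq hV).comp (continuous_dispFreq ε hF hG))

theorem conjFreq_remTerm {V : ℝ → ℝ} (hV : IsNormalizedPotential V) (ε t : ℝ) (F G : FreqL2 h) :
    conjFreq (remTerm V h ε t F G) = remTerm V h ε t (conjFreq F) (conjFreq G) := by
  rw [remTerm, remTerm, conjFreq_symb (continuous_remSymbol h ε t), conjFreq_remFreq hV,
    conjFreq_dispFreq]
  intro x
  rw [outSymbol_neg, flow_neg_arg _ (q := id) (fun _ => rfl), map_mul, map_mul, Complex.conj_ofReal]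

/-- The right-hand side of the profile equation of the sign `ε`: the profiles `F`, `G` of the signs
`ε`, `-ε` are the transforms of the solution, transported back by the linear flow. The coupled
equation is the case `lam = 1`, the decoupled one the case `lam = 0`. -/
def profileNL (V : ℝ → ℝ) (h : ℝ) [Fact (0 < h)] (lam ε t : ℝ) (F G : FreqL2 h) : FreqL2 h :=
  bil h ε (dispersion h) (dispersion h) t F F
    + ((2 * lam : ℝ) : ℂ) • bil h ε (dispersion h) (dispersionOpp h) t F G
    + ((lam ^ 2 : ℝ) : ℂ) • bil h ε (dispersionOpp h) (dispersionOpp h) t G G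
    + (lam : ℂ) • remTerm V h ε t F G

theorem continuous_profileNL {V : ℝ → ℝ} (hV : IsNormalizedPotential V) (lam ε : ℝ)
    {F G : ℝ → FreqL2 h} (hF : Continuous F) (hG : Continuous G) :
    Continuous fun t => profileNL V h lam ε t (F t) (G t) := by
  have c1 := continuous_dispersion h
  have c2 := continuous_dispersionOpp h
  have b1 := continuous_bil ε c1 c1 hF hF
  have b2 := (continuous_bil ε c1 c2 hF hG).const_smul ((2 * lam : ℝ) : ℂ)
  have b3 := (continuous_bil ε c2 c2 hG hG).const_smul ((lam ^ 2 : ℝ) : ℂ)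
  have b4 := (continuous_remTerm hV ε hF hG).const_smul (lam : ℂ)
  unfold profileNL
  exact ((b1.add b2).add b3).add b4

theorem conjFreq_profileNL {V : ℝ → ℝ} (hV : IsNormalizedPotential V) (lam ε t : ℝ)
    (F G : FreqL2 h) : conjFreq (profileNL V h lam ε t F G) =
      profileNL V h lam ε t (conjFreq F) (conjFreq G) := by
  have c1 := continuous_dispersion h
  have c2 := continuous_dispersionOpp h
  have o1 := dispersion_neg h
  have o2 := dispersionOpp_neg h
  simp only [profileNL, conjFreq_add, conjFreq_smul, conjFreq_remTerm hV]
  rw [conjFreq_bil ε c1 c1 o1 o1, conjFreq_bil ε c1 c2 o1 o2, conjFreq_bil ε c2 c2 o2 o2]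

theorem norm_bil_sub_le {ε : ℝ} (hε : |ε| = 1) {q₁ q₂ : ℝ → ℝ} (h1 : Continuous q₁)
    (h2 : Continuous q₂) (t : ℝ) {F G F' G' : FreqL2 h} {M D : ℝ} (hG : ‖G‖ ≤ M) (hF' : ‖F'‖ ≤ M)
    (hFF : ‖F - F'‖ ≤ D) (hGG : ‖G - G'‖ ≤ D) :
    ‖bil h ε q₁ q₂ t F G - bil h ε q₁ q₂ t F' G'‖ ≤ 1 / h * (√h)⁻¹ * M * D := by
  have h0 := hh.out
  have hD : 0 ≤ D := (norm_nonneg _).trans hFF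
  have hM : 0 ≤ M := (norm_nonneg _).trans hG
  rw [bil_sub_sub]
  refine (norm_add_le _ _).trans ((add_le_add (norm_bil_le hε h1 h2 t _ _)
    (norm_bil_le hε h1 h2 t _ _)).trans ?_)
  calc _ ≤ 1 / (2 * h) * (√h)⁻¹ * D * M + 1 / (2 * h) * (√h)⁻¹ * M * D := by gcongr
    _ = _ := by ring

/-- For fixed `h` the nonlinearity is locally Lipschitz; the constant is not uniform as `h → 0`. -/
theorem exists_profileNL_sub_le {V : ℝ → ℝ} (hV : IsNormalizedPotential V) (lam : ℝ) {ε : ℝ}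
    (hε : |ε| = 1) (M : ℝ) : ∃ L : ℝ, 0 ≤ L ∧ ∀ (t : ℝ) (F G F' G' : FreqL2 h) (D : ℝ),
      ‖F‖ ≤ M → ‖G‖ ≤ M → ‖F'‖ ≤ M → ‖G'‖ ≤ M → ‖F - F'‖ ≤ D → ‖G - G'‖ ≤ D →
      ‖profileNL V h lam ε t F G - profileNL V h lam ε t F' G'‖ ≤ L * D := by
  have h0 := hh.out
  have c1 := continuous_dispersion h
  have c2 := continuous_dispersionOpp h
  set m := (√h)⁻¹ * (M + M) with hm
  obtain ⟨C, hC, H⟩ := exists_remFreq_sub_le hV (h ^ 2 * m)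
  set b := 1 / h * (√h)⁻¹ * |M| with hb
  have hb0 : 0 ≤ b := by positivity
  refine ⟨b + |2 * lam| * b + |lam ^ 2| * b + |lam| * (h * (C * m ^ 2 * 2)), by positivity,
    fun t F G F' G' D hF hG hF' hG' hFF hGG => ?_⟩
  have hD : 0 ≤ D := (norm_nonneg _).trans hFF
  have hMM := le_abs_self M
  have e1 := norm_bil_sub_le hε c1 c1 t (hF.trans hMM) (hF'.trans hMM) hFF hFF
  have e2 := norm_bil_sub_le hε c1 c2 t (hG.trans hMM) (hF'.trans hMM) hFF hGG
  have e3 := norm_bil_sub_le hε c2 c2 t (hG.trans hMM) (hG'.trans hMM) hGG hGG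
  have bd : ∀ F G : FreqL2 h, ‖F‖ ≤ M → ‖G‖ ≤ M → ∀ n, ‖val (dispFreq h ε t F G) n‖ ≤ m := by
    intro F G hF hG n
    refine (norm_val_le _ n).trans ?_
    rw [hm]
    gcongr
    exact (norm_dispFreq_le ε t F G).trans (add_le_add hF hG)
  have e4 := norm_remTerm_sub_le V hε t F G F' G'
  have e5 := H h (dispFreq h ε t F G) (dispFreq h ε t F' G') m (bd F G hF hG) (bd F' G' hF' hG') le_rfl
  rw [dispFreq_sub] at e5
  have e6 := (norm_dispFreq_le ε t (F - F') (G - G')).trans (add_le_add hFF hGG)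
  have e7 : ‖remTerm V h ε t F G - remTerm V h ε t F' G'‖ ≤ h * (C * m ^ 2 * 2) * D := by
    calc _ ≤ h * (C * m ^ 2 * (D + D)) := e4.trans (by gcongr; exact e5.trans (by gcongr))
      _ = _ := by ring
  have : profileNL V h lam ε t F G - profileNL V h lam ε t F' G' =
      (bil h ε (dispersion h) (dispersion h) t F F - bil h ε (dispersion h) (dispersion h) t F' F')
    + ((2 * lam : ℝ) : ℂ) • (bil h ε (dispersion h) (dispersionOpp h) t F G
        - bil h ε (dispersion h) (dispersionOpp h) t F' G')
    + ((lam ^ 2 : ℝ) : ℂ) • (bil h ε (dispersionOpp h) (dispersionOpp h) t G G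
        - bil h ε (dispersionOpp h) (dispersionOpp h) t G' G')
    + (lam : ℂ) • (remTerm V h ε t F G - remTerm V h ε t F' G') := by
    simp only [profileNL, smul_sub]; abel
  rw [this]
  refine (norm_add_le _ _).trans ?_
  have f1 := norm_add₃_le (a := bil h ε (dispersion h) (dispersion h) t F F - bil h ε (dispersion h) (dispersion h) t F' F') (b := ((2 * lam : ℝ) : ℂ) • (bil h ε (dispersion h) (dispersionOpp h) t F G
        - bil h ε (dispersion h) (dispersionOpp h) t F' G')) (c := ((lam ^ 2 : ℝ) : ℂ) • (bil h ε (dispersionOpp h) (dispersionOpp h) t G G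
        - bil h ε (dispersionOpp h) (dispersionOpp h) t G' G'))
  refine (add_le_add_left f1 _).trans ?_
  rw [norm_smul, norm_smul, norm_smul, Complex.norm_real, Complex.norm_real, Complex.norm_real]
  simp only [Real.norm_eq_abs]
  calc _ ≤ b * D + |2 * lam| * (b * D) + |lam ^ 2| * (b * D) + |lam| * (h * (C * m ^ 2 * 2) * D) := by
        gcongr
    _ = _ := by ring

/-- `w₊`, `w₋` solve the profile equation on `[0, T]` with data `U₊`, `U₋`. -/
structure IsProfile (V : ℝ → ℝ) (h : ℝ) [Fact (0 < h)] (lam T : ℝ) (U : ℝ → FreqL2 h)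
    (w : ℝ → ℝ → FreqL2 h) : Prop where
  continuous : ∀ ε, |ε| = 1 → Continuous (w ε)
  eq : ∀ ε, |ε| = 1 → ∀ t ∈ Icc 0 T,
    w ε t = U ε + ∫ t' in (0 : ℝ)..t, profileNL V h lam ε t' (w ε t') (w (-ε) t')

theorem IsProfile.hasDerivWithinAt {V : ℝ → ℝ} (hV : IsNormalizedPotential V) {lam T : ℝ}
    {U : ℝ → FreqL2 h} {w : ℝ → ℝ → FreqL2 h} (hw : IsProfile V h lam T U w) {ε : ℝ} (hε : |ε| = 1)
    {t : ℝ} (ht : t ∈ Ico 0 T) :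
    HasDerivWithinAt (w ε) (profileNL V h lam ε t (w ε t) (w (-ε) t)) (Ici t) t := by
  have hc := continuous_profileNL hV lam ε (hw.continuous ε hε) (hw.continuous (-ε) (by rwa [abs_neg]))
  have h1 := (hc.integral_hasStrictDerivAt 0 t).hasDerivAt.const_add (U ε)
  refine h1.hasDerivWithinAt.congr_of_eventuallyEq ?_ (hw.eq ε hε t ⟨ht.1, ht.2.le⟩)
  filter_upwards [Icc_mem_nhdsGE ht.2] with y hy
  exact hw.eq ε hε y ⟨ht.1.trans hy.1, hy.2⟩

/-- Uniqueness is that of an ordinary differential equation with a locally Lipschitz right-hand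
side. -/
theorem IsProfile.unique {V : ℝ → ℝ} (hV : IsNormalizedPotential V) {lam T : ℝ}
    {U : ℝ → FreqL2 h} {w w' : ℝ → ℝ → FreqL2 h} (hw : IsProfile V h lam T U w)
    (hw' : IsProfile V h lam T U w') {ε : ℝ} (hε : |ε| = 1) {t : ℝ} (ht : t ∈ Icc 0 T) :
    w ε t = w' ε t := by
  have hε' : |-ε| = 1 := by rwa [abs_neg]
  have hT : 0 ≤ T := ht.1.trans ht.2
  obtain ⟨M, hM⟩ : ∃ M, ∀ t ∈ Icc 0 T, ‖(w ε t, w (-ε) t)‖ ≤ M ∧ ‖(w' ε t, w' (-ε) t)‖ ≤ M := by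
    obtain ⟨M₁, h1⟩ := (isCompact_Icc (a := (0 : ℝ)) (b := T)).exists_bound_of_continuousOn
      (((hw.continuous ε hε).prodMk (hw.continuous (-ε) hε')).continuousOn)
    obtain ⟨M₂, h2⟩ := (isCompact_Icc (a := (0 : ℝ)) (b := T)).exists_bound_of_continuousOn
      (((hw'.continuous ε hε).prodMk (hw'.continuous (-ε) hε')).continuousOn)
    exact ⟨max M₁ M₂, fun t ht => ⟨(h1 t ht).trans (le_max_left _ _),
      (h2 t ht).trans (le_max_right _ _)⟩⟩
  obtain ⟨L₁, hL₁, H₁⟩ := exists_profileNL_sub_le (h := h) hV lam hε M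
  obtain ⟨L₂, hL₂, H₂⟩ := exists_profileNL_sub_le (h := h) hV lam hε' M
  have key := ODE_solution_unique_of_mem_Icc_right
    (v := fun t p => (profileNL V h lam ε t p.1 p.2, profileNL V h lam (-ε) t p.2 p.1))
    (s := fun _ => {p : FreqL2 h × FreqL2 h | ‖p‖ ≤ M}) (K := Real.toNNReal (max L₁ L₂))
    (f := fun t => (w ε t, w (-ε) t)) (g := fun t => (w' ε t, w' (-ε) t)) (a := 0) (b := T)
    (fun t _ => LipschitzOnWith.of_dist_le_mul fun p hp p' hp' => ?_)
    ((hw.continuous ε hε).prodMk (hw.continuous (-ε) hε')).continuousOn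
    (fun t ht => ?_) (fun t ht => (hM t ⟨ht.1, ht.2.le⟩).1)
    ((hw'.continuous ε hε).prodMk (hw'.continuous (-ε) hε')).continuousOn
    (fun t ht => ?_) (fun t ht => (hM t ⟨ht.1, ht.2.le⟩).2) ?_
  · exact congrArg Prod.fst (key ht)
  · rw [Real.coe_toNNReal _ (hL₁.trans (le_max_left _ _)), Prod.dist_eq, dist_eq_norm, dist_eq_norm,
      dist_eq_norm]
    have a1 : ‖p.1‖ ≤ M := (norm_fst_le p).trans hp
    have a2 : ‖p.2‖ ≤ M := (norm_snd_le p).trans hp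
    have a3 : ‖p'.1‖ ≤ M := (norm_fst_le p').trans hp'
    have a4 : ‖p'.2‖ ≤ M := (norm_snd_le p').trans hp'
    have a5 : ‖p.1 - p'.1‖ ≤ ‖p - p'‖ := norm_fst_le (p - p')
    have a6 : ‖p.2 - p'.2‖ ≤ ‖p - p'‖ := norm_snd_le (p - p')
    apply max_le
    · exact (H₁ t _ _ _ _ _ a1 a2 a3 a4 a5 a6).trans
        (mul_le_mul_of_nonneg_right (le_max_left _ _) (norm_nonneg _))
    · exact (H₂ t _ _ _ _ _ a2 a1 a4 a3 a6 a5).trans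
        (mul_le_mul_of_nonneg_right (le_max_right _ _) (norm_nonneg _))
  · have := (hw.hasDerivWithinAt hV hε ht).prodMk (hw.hasDerivWithinAt hV hε' ht)
    rwa [neg_neg] at this
  · have := (hw'.hasDerivWithinAt hV hε ht).prodMk (hw'.hasDerivWithinAt hV hε' ht)
    rwa [neg_neg] at this
  · have h0 : (0 : ℝ) ∈ Icc 0 T := ⟨le_rfl, hT⟩
    rw [hw.eq ε hε 0 h0, hw.eq (-ε) hε' 0 h0, hw'.eq ε hε 0 h0, hw'.eq (-ε) hε' 0 h0]
    simp

/-- Conjugation as a continuous real-linear map. -/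
def conjFreqL (h : ℝ) [Fact (0 < h)] : FreqL2 h →L[ℝ] FreqL2 h where
  toFun := conjFreq
  map_add' := conjFreq_add
  map_smul' c F := by
    rw [RCLike.real_smul_eq_coe_smul (K := ℂ) c F, RingHom.id_apply,
      RCLike.real_smul_eq_coe_smul (K := ℂ) c (conjFreq F)]
    exact conjFreq_smul c F
  cont := continuous_conjFreq

/-- Real data have real solutions: the conjugate of a solution solves the same equation. -/
theorem IsProfile.conjFreq_eq {V : ℝ → ℝ} (hV : IsNormalizedPotential V) {lam T : ℝ}
    {U : ℝ → FreqL2 h} {w : ℝ → ℝ → FreqL2 h} (hw : IsProfile V h lam T U w)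
    (hU : ∀ ε, |ε| = 1 → conjFreq (U ε) = U ε)
    {ε : ℝ} (hε : |ε| = 1) {t : ℝ} (ht : t ∈ Icc 0 T) : conjFreq (w ε t) = w ε t := by
  refine IsProfile.unique hV (w := fun ε t => conjFreq (w ε t)) ⟨fun ε hε =>
    continuous_conjFreq.comp (hw.continuous ε hε), fun ε hε t ht => ?_⟩ hw hε ht
  have hc := continuous_profileNL hV lam ε (hw.continuous ε hε) (hw.continuous (-ε) (by rwa [abs_neg]))
  rw [hw.eq ε hε t ht, conjFreq_add, hU ε hε]
  congr 1
  have := (conjFreqL h).intervalIntegral_comp_comm (hc.intervalIntegrable (μ := volume) 0 t)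
  simp only [conjFreqL, ContinuousLinearMap.coe_mk', LinearMap.coe_mk, AddHom.coe_mk] at this
  rw [← this]
  simp only [conjFreq_profileNL hV]

end

/-! ### From the Duhamel formula to the profile equation and back -/

/-- The nonlinearity on the lattice for the sign `σ` at time `t`, which interpolates between the
decoupled (`lam = 0`) and the coupled (`lam = 1`) equation. -/
def latticeNL (V : ℝ → ℝ) (h : ℝ) [Fact (0 < h)] (lam σ t : ℝ) (u w : ℤ → ℝ) : ℤ → ℝ := fun n =>
  (u n + lam * expPartial h (σ * (2 * t / h ^ 2)) w n) ^ 2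
    + lam * (h ^ 2 * expPartial h (σ * (t / h ^ 2)) (fun k => remainder V h
      ((expPartial h (-(σ * (t / h ^ 2))) u + expPartial h (σ * (t / h ^ 2)) w) k)) n)

/-- A solution of the equation with the nonlinearity `latticeNL`, as a family indexed by the
signs `±1`. -/
structure IsLatticeSolution (V : ℝ → ℝ) (h : ℝ) [Fact (0 < h)] (lam T : ℝ) (u₀ : ℝ → LatticeL2)
    (u : ℝ → ℝ → LatticeL2) : Prop where
  continuousOn : ∀ σ, |σ| = 1 → ContinuousOn (u σ) (Icc (-T) T)
  duhamel : ∀ σ, |σ| = 1 →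
    Duhamel h σ T (u₀ σ) (fun t => latticeNL V h lam σ t (u σ t) (u (-σ) t)) (u σ)

/-- The family indexed by signs with the value `a` at positive and `b` at negative numbers. -/
def signFamily {α : Type*} (a b : α) (σ : ℝ) : α := if 0 < σ then a else b

theorem signFamily_one {α : Type*} (a b : α) : signFamily a b 1 = a := if_pos one_pos
theorem signFamily_neg_one {α : Type*} (a b : α) : signFamily a b (-1) = b := if_neg (by norm_num)

theorem forall_sign {p : ℝ → Prop} : (∀ σ, |σ| = 1 → p σ) ↔ p 1 ∧ p (-1) := by
  constructor
  · exact fun H => ⟨H 1 (by norm_num), H (-1) (by norm_num)⟩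
  · intro H σ hσ
    rcases (abs_eq zero_le_one).1 hσ with rfl | rfl
    exacts [H.1, H.2]

section
variable {h : ℝ} [hh : Fact (0 < h)]

theorem latticeNL_zero (V : ℝ → ℝ) (σ t : ℝ) (u w : ℤ → ℝ) :
    latticeNL V h 0 σ t u w = fun n => u n ^ 2 := by
  ext n; simp [latticeNL]

theorem latticeNL_one (V : ℝ → ℝ) (t : ℝ) (u w : ℤ → ℝ) :
    latticeNL V h 1 1 t u w = coupledNonlinearity V h 1 t u w (displacement h t u w) := by
  ext n; simp [latticeNL, coupledNonlinearity, displacement]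

theorem latticeNL_one_neg (V : ℝ → ℝ) (t : ℝ) (u w : ℤ → ℝ) :
    latticeNL V h 1 (-1) t u w = coupledNonlinearity V h (-1) t u w (displacement h t w u) := by
  ext n; simp [latticeNL, coupledNonlinearity, displacement, add_comm]

theorem isCoupledSolution_iff {V : ℝ → ℝ} {T : ℝ} {u₀p u₀m : LatticeL2} {u : ℝ → ℝ → LatticeL2} :
    IsCoupledSolution V h T u₀p u₀m (u 1) (u (-1)) ↔
      IsLatticeSolution V h 1 T (signFamily u₀p u₀m) u := by
  constructor
  · intro H
    refine ⟨forall_sign.2 ⟨H.1, H.2⟩, forall_sign.2 ⟨?_, ?_⟩⟩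
    · simp only [signFamily_one, latticeNL_one]; exact H.3
    · simp only [signFamily_neg_one, latticeNL_one_neg, neg_neg]; exact H.4
  · intro H
    have h3 := H.duhamel 1 (by norm_num)
    have h4 := H.duhamel (-1) (by norm_num)
    simp only [signFamily_one, latticeNL_one] at h3
    simp only [signFamily_neg_one, latticeNL_one_neg, neg_neg] at h4
    exact ⟨H.1 1 (by norm_num), H.1 (-1) (by norm_num), h3, h4⟩

theorem isDecoupledSolution_iff (V : ℝ → ℝ) {T : ℝ} {u₀p u₀m : LatticeL2} {u : ℝ → ℝ → LatticeL2} :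
    IsDecoupledSolution h T u₀p u₀m (u 1) (u (-1)) ↔
      IsLatticeSolution V h 0 T (signFamily u₀p u₀m) u := by
  constructor
  · intro H
    refine ⟨forall_sign.2 ⟨H.1, H.2⟩, forall_sign.2 ⟨?_, ?_⟩⟩
    · simp only [signFamily_one, latticeNL_zero]; exact H.3
    · simp only [signFamily_neg_one, latticeNL_zero]; exact H.4
  · intro H
    have h3 := H.duhamel 1 (by norm_num)
    have h4 := H.duhamel (-1) (by norm_num)
    simp only [signFamily_one, latticeNL_zero] at h3
    simp only [signFamily_neg_one, latticeNL_zero] at h4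
    exact ⟨H.1 1 (by norm_num), H.1 (-1) (by norm_num), h3, h4⟩

theorem expPartial_eq (a : ℝ) (f : ℤ → ℝ) : expPartial h a f = multiplier h (flow a id) f := by
  rw [expPartial]
  congr 1
  ext x
  simp only [flow, partialSymbol, id]
  congr 1; push_cast; ring

theorem propagator_eq (σ t : ℝ) (f : ℤ → ℝ) :
    propagator h σ t f = multiplier h (flow (σ * t) (dispersion h)) f := by
  have h0 := hh.out
  have : (h : ℂ) ≠ 0 := by exact_mod_cast h0.ne'
  rw [propagator]
  congr 1
  ext x
  simp only [flow, partialSymbol, nablaSymbol, dispersion]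
  congr 1; push_cast; field_simp; ring

theorem Represents.expPartial {F : FreqL2 h} {f : ℤ → ℝ} (hF : Represents F f) (a : ℝ) :
    Represents (FPULattice.symb h (flow a id) F) (expPartial h a f) := by
  rw [expPartial_eq]
  exact hF.symb (by fun_prop) (flow_neg_arg a (q := id) (fun _ => rfl))

theorem Represents.propagator {F : FreqL2 h} {f : ℤ → ℝ} (hF : Represents F f) (σ t : ℝ) :
    Represents (FPULattice.symb h (flow (σ * t) (dispersion h)) F) (propagator h σ t f) := by
  rw [propagator_eq]
  exact hF.symb (by fun_prop) (flow_neg_arg _ (dispersion_neg h))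

theorem Represents.nabla {F : FreqL2 h} {f : ℤ → ℝ} (hF : Represents F f) :
    Represents (FPULattice.symb h (nablaSymbol h) F) (nabla h f) :=
  hF.symb (by fun_prop) (nablaSymbol_neg h)

/-- The nonlinearity on the frequency side, in the original (untransported) unknowns. -/
def physNL (V : ℝ → ℝ) (h : ℝ) [Fact (0 < h)] (lam a : ℝ) (A B : FreqL2 h) : FreqL2 h :=
  prodFreq (A + (lam : ℂ) • symb h (flow (2 * a / h ^ 2) id) B)
      (A + (lam : ℂ) • symb h (flow (2 * a / h ^ 2) id) B)
    + (lam : ℂ) • ((h ^ 2 : ℝ) : ℂ) • symb h (flow (a / h ^ 2) id)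
      (remFreq V (symb h (flow (-(a / h ^ 2)) id) A + symb h (flow (a / h ^ 2) id) B))

theorem represents_physNL {V : ℝ → ℝ} (hV : IsNormalizedPotential V) (lam σ t : ℝ)
    {A B : FreqL2 h} {u w : ℤ → ℝ} (hA : Represents A u) (hB : Represents B w) :
    Represents (physNL V h lam (σ * t) A B) (latticeNL V h lam σ t u w) := by
  have h1 := hA.add ((hB.expPartial (σ * (2 * t / h ^ 2))).smul lam)
  have h2 := (((hA.expPartial (-(σ * (t / h ^ 2)))).add (hB.expPartial (σ * (t / h ^ 2)))).remFreq
    hV).expPartial (σ * (t / h ^ 2))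
  have h3 := (h1.mul h1).add ((h2.smul (h ^ 2)).smul lam)
  rw [physNL, show 2 * (σ * t) / h ^ 2 = σ * (2 * t / h ^ 2) by ring,
    show σ * t / h ^ 2 = σ * (t / h ^ 2) by ring]
  convert! h3 using 1
  ext n
  simp only [latticeNL, Pi.add_apply]
  ring

theorem profileNL_eq_symb_physNL (V : ℝ → ℝ) (lam ε t : ℝ) (F G : FreqL2 h) :
    profileNL V h lam ε t F G = symb h (outSymbol h ε t)
      (physNL V h lam (ε * t) (symb h (flow (ε * t) (dispersion h)) F)
        (symb h (flow (-(ε * t)) (dispersion h)) G)) := by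
  have h0 := hh.out
  have c1 := continuous_dispersion h
  have c2 := continuous_dispersionOpp h
  have e1 : symb h (flow (2 * (ε * t) / h ^ 2) id) (symb h (flow (-(ε * t)) (dispersion h)) G) =
      symb h (flow (ε * t) (dispersionOpp h)) G := by
    apply symb_symb (by fun_prop) (by fun_prop)
    intro x
    simp only [flow, dispersionOpp, ← Complex.exp_add, id]
    congr 1
    push_cast; ring
  have e2 : symb h (flow (-(ε * t / h ^ 2)) id) (symb h (flow (ε * t) (dispersion h)) F)
      + symb h (flow (ε * t / h ^ 2) id) (symb h (flow (-(ε * t)) (dispersion h)) G) =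
      dispFreq h ε t F G := by
    rw [dispFreq, map_add]
    congr 1
    rw [symb_symb (m'' := fun x => flow (ε * t / h ^ 2) id x * flow (-(ε * t)) (dispersion h) x)
      (by fun_prop) (by fun_prop) (fun _ => rfl),
      symb_symb (m'' := fun x => flow (ε * t / h ^ 2) id x * flow (-(ε * t)) (dispersion h) x)
      (by fun_prop) (by fun_prop)]
    intro x
    simp only [flow, dispersionOpp, ← Complex.exp_add, id]
    congr 1
    push_cast; ring
  have e3 : remTerm V h ε t F G = symb h (outSymbol h ε t) (((h ^ 2 : ℝ) : ℂ) •
      symb h (flow (ε * t / h ^ 2) id) (remFreq V (dispFreq h ε t F G))) := by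
    rw [remTerm, ← symb_symb (m := fun _ => ((h ^ 2 : ℝ) : ℂ))
      (m' := fun x => outSymbol h ε t x * flow (ε * t / h ^ 2) id x) (by fun_prop) (by fun_prop)
      (fun _ => rfl), map_smul, symb_symb (m'' := fun x => outSymbol h ε t x *
        flow (ε * t / h ^ 2) id x) (by fun_prop) (by fun_prop) (fun _ => rfl)]
    apply Lp.ext
    set R := symb h (fun x => outSymbol h ε t x * flow (ε * t / h ^ 2) id x)
      (remFreq V (dispFreq h ε t F G))
    filter_upwards [coeFn_symb (continuous_const (y := ((h ^ 2 : ℝ) : ℂ))) R,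
      Lp.coeFn_smul ((h ^ 2 : ℝ) : ℂ) R] with x hx hy
    rw [hx, hy]; rfl
  rw [physNL, e1, e2, profileNL, e3]
  simp only [bil, ← prodFreqL_apply, map_add, map_smul, _root_.add_apply, _root_.smul_apply]
  have comm : prodFreqL h (symb h (flow (ε * t) (dispersionOpp h)) G)
      (symb h (flow (ε * t) (dispersion h)) F) = prodFreqL h (symb h (flow (ε * t) (dispersion h)) F)
      (symb h (flow (ε * t) (dispersionOpp h)) G) := val_ext fun n => by
    rw [prodFreqL_apply, prodFreqL_apply, val_prodFreq, val_prodFreq, mul_comm]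
  rw [comm]
  module

/-- The profile equation at time `t ≥ 0` and the Duhamel formula at the time `τ t`, for `τ = ±1`,
are the same identity: reversing the time exchanges the roles of the two signs. -/
theorem val_profile_eq {V : ℝ → ℝ} (hV : IsNormalizedPotential V) (lam : ℝ) {ε τ : ℝ}
    (hτ : |τ| = 1) {t : ℝ} (ht : 0 ≤ t) {U : FreqL2 h} {u₀ : ℤ → ℝ} (hU : Represents U u₀)
    {F G : ℝ → FreqL2 h} (hF : Continuous F) (hG : Continuous G) {u w : ℝ → ℤ → ℝ}
    (hu : ∀ t' ∈ Icc 0 t, Represents (symb h (flow (ε * t') (dispersion h)) (F t')) (u (τ * t')))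
    (hw : ∀ t' ∈ Icc 0 t, Represents (symb h (flow (-(ε * t')) (dispersion h)) (G t')) (w (τ * t')))
    (n : ℤ) :
    val (symb h (flow (ε * t) (dispersion h))
      (U + ∫ t' in (0 : ℝ)..t, profileNL V h lam ε t' (F t') (G t'))) n =
    ((propagator h (τ * ε) (τ * t) u₀ n - (τ * ε) * (1 / 4) * ∫ t₁ in (0 : ℝ)..(τ * t),
      propagator h (τ * ε) (τ * t - t₁) (nabla h (latticeNL V h lam (τ * ε) t₁ (u t₁) (w t₁))) n : ℝ)
        : ℂ) := by
  have hττ : τ * τ = 1 := by rw [← abs_mul_abs_self, hτ, one_mul]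
  have hτ0 : τ ≠ 0 := by intro h0; simp [h0] at hτ
  have hc := continuous_profileNL hV lam ε hF hG
  have e0 : τ * ε * (τ * t) = ε * t := by linear_combination (ε * t) * hττ
  rw [map_add, val_add]
  have h1 := hU.propagator (τ * ε) (τ * t) n
  rw [e0] at h1
  rw [h1]
  push_cast
  rw [sub_eq_add_neg]
  congr 1
  have h2 := ((valL h n).comp (symb h (flow (ε * t) (dispersion h)))).intervalIntegral_comp_comm
    (hc.intervalIntegrable (μ := volume) 0 t)
  simp only [ContinuousLinearMap.comp_apply, valL_apply] at h2
  rw [← h2]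
  have h3 : ∀ t' ∈ uIcc 0 t, val (symb h (flow (ε * t) (dispersion h))
      (profileNL V h lam ε t' (F t') (G t'))) n = ((-(ε / 4) * propagator h (τ * ε) (τ * t - τ * t')
      (nabla h (latticeNL V h lam (τ * ε) (τ * t') (u (τ * t')) (w (τ * t')))) n : ℝ) : ℂ) := by
    intro t' ht'
    rw [uIcc_of_le ht] at ht'
    have r1 := represents_physNL hV lam (τ * ε) (τ * t') (hu t' ht') (hw t' ht')
    have e1 : τ * ε * (τ * t') = ε * t' := by linear_combination (ε * t') * hττ
    have e2 : τ * ε * (τ * t - τ * t') = ε * (t - t') := by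
      linear_combination (ε * (t - t')) * hττ
    rw [e1] at r1
    have r2 := ((r1.nabla.propagator (τ * ε) (τ * t - τ * t')).smul (-(ε / 4))) n
    rw [e2] at r2
    rw [← r2, profileNL_eq_symb_physNL]
    set N := physNL V h lam (ε * t') (symb h (flow (ε * t') (dispersion h)) (F t'))
        (symb h (flow (-(ε * t')) (dispersion h)) (G t'))
    congr 1
    rw [symb_symb (m'' := fun x => flow (ε * t) (dispersion h) x * outSymbol h ε t' x)
      (by fun_prop) (by fun_prop) (fun _ => rfl), symb_symb (m'' := fun x =>
        flow (ε * (t - t')) (dispersion h) x * nablaSymbol h x) (by fun_prop) (by fun_prop)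
      (fun _ => rfl)]
    apply Lp.ext
    filter_upwards [coeFn_symb (by fun_prop : Continuous fun x => flow (ε * t) (dispersion h) x *
        outSymbol h ε t' x) N, coeFn_symb (by fun_prop : Continuous fun x =>
        flow (ε * (t - t')) (dispersion h) x * nablaSymbol h x) N, Lp.coeFn_smul ((-(ε / 4) : ℝ) : ℂ)
        (symb h (fun x => flow (ε * (t - t')) (dispersion h) x * nablaSymbol h x) N)] with x x1 x2 x3
    rw [x1, x3, Pi.smul_apply, x2, smul_eq_mul, outSymbol]
    have : flow (ε * (t - t')) (dispersion h) (rep x) =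
        flow (ε * t) (dispersion h) (rep x) * flow (-(ε * t')) (dispersion h) (rep x) := by
      simp only [flow, ← Complex.exp_add]
      congr 1; push_cast; ring
    rw [this]; ring
  rw [intervalIntegral.integral_congr h3, intervalIntegral.integral_ofReal,
    intervalIntegral.integral_const_mul]
  have h4 := intervalIntegral.integral_comp_mul_left (a := 0) (b := t) (fun t₁ =>
      propagator h (τ * ε) (τ * t - t₁) (nabla h (latticeNL V h lam (τ * ε) t₁ (u t₁) (w t₁))) n) hτ0
  rw [mul_zero, smul_eq_mul] at h4
  rw [h4]
  have : τ⁻¹ = τ := by field_simp; nlinarith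
  rw [this]
  push_cast
  ring

theorem mul_sign {ε τ : ℝ} (hε : |ε| = 1) (hτ : |τ| = 1) : |τ * ε| = 1 := by
  rw [abs_mul, hε, hτ, one_mul]

/-- Every solution on the lattice yields a solution of the profile equation, for positive (`τ = 1`)
or for negative (`τ = -1`) times. The projection to `[0, T]` only extends the curve continuously to
all times. -/
theorem IsLatticeSolution.isProfile {V : ℝ → ℝ} (hV : IsNormalizedPotential V) {lam T : ℝ}
    (hT : 0 ≤ T) {u₀ : ℝ → LatticeL2} {u : ℝ → ℝ → LatticeL2}
    (hu : IsLatticeSolution V h lam T u₀ u) {τ : ℝ} (hτ : |τ| = 1) :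
    IsProfile V h lam T (fun ε => toFreq h (u₀ (τ * ε))) (fun ε t =>
      symb h (flow (-(ε * t)) (dispersion h)) (toFreq h (u (τ * ε) (τ * projIcc 0 T hT t)))) := by
  have c1 := continuous_dispersion h
  have hmem : ∀ t : Icc 0 T, τ * t ∈ Icc (-T) T := fun t => by
    rw [mem_Icc, ← abs_le, abs_mul, hτ, one_mul, abs_of_nonneg t.2.1]; exact t.2.2
  have hcont : ∀ ε, |ε| = 1 → Continuous (fun t =>
      symb h (flow (-(ε * t)) (dispersion h)) (toFreq h (u (τ * ε) (τ * projIcc 0 T hT t)))) := by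
    intro ε hε
    have a1 : Continuous fun t => symb h (flow (-(ε * t)) (dispersion h)) :=
      (continuous_symb_family (continuous_flow_family c1)).comp (by fun_prop)
    have a2 : Continuous fun t => u (τ * ε) (τ * projIcc 0 T hT t) := by
      apply (hu.continuousOn _ (mul_sign hε hτ)).comp_continuous
      · exact continuous_const.mul (continuous_subtype_val.comp continuous_projIcc)
      · exact fun t => hmem _
    exact a1.clm_apply (continuous_toFreq.comp a2)
  refine ⟨hcont, fun ε hε t ht => ?_⟩
  have hproj : ∀ t' ∈ Icc 0 T, (projIcc 0 T hT t' : ℝ) = t' := fun t' ht' => by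
    rw [projIcc_of_mem hT ht']
  have hε' : |-ε| = 1 := by rwa [abs_neg]
  have hinj : Function.Injective (symb h (flow (ε * t) (dispersion h))) := fun x y hxy => by
    rw [← symb_flow_neg (ε * t) c1 x, hxy, symb_flow_neg _ c1]
  apply hinj
  apply val_ext
  intro n
  have hback : ∀ (a : ℝ) (F : FreqL2 h),
      symb h (flow a (dispersion h)) (symb h (flow (-a) (dispersion h)) F) = F := fun a F => by
    have := symb_flow_neg (-a) c1 F
    rwa [neg_neg] at this
  rw [val_profile_eq hV lam hτ ht.1 (represents_toFreq _) (hcont ε hε) (hcont (-ε) hε')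
    (u := fun t => u (τ * ε) t) (w := fun t => u (-(τ * ε)) t)]
  · rw [hback, hproj t ht, represents_toFreq]
    have := hu.duhamel (τ * ε) (mul_sign hε hτ) (τ * t) (hmem ⟨t, ht⟩) n
    rw [this]
  · intro t' ht'
    rw [hback, hproj t' ⟨ht'.1, ht'.2.trans ht.2⟩]
    exact represents_toFreq _
  · intro t' ht'
    have e : -(ε * t') = (-ε * t') := by ring
    rw [e, hback, hproj t' ⟨ht'.1, ht'.2.trans ht.2⟩, mul_neg]
    exact represents_toFreq _

/-- Solutions of the two profile equations, forward and backward in time, are glued to a solution on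
`[-T, T]`. -/
theorem exists_isLatticeSolution {V : ℝ → ℝ} (hV : IsNormalizedPotential V) {lam T : ℝ}
    {u₀ : ℝ → LatticeL2}
    (H : ∀ τ : ℝ, |τ| = 1 → ∃ w, IsProfile V h lam T (fun ε => toFreq h (u₀ (τ * ε))) w) :
    ∃ u, IsLatticeSolution V h lam T u₀ u := by
  have c1 := continuous_dispersion h
  -- the time interval is empty if `T < 0`
  rcases lt_or_ge T 0 with hT | hT
  · refine ⟨fun _ _ => 0, fun _ _ => continuousOn_const, fun _ _ t ht => ?_⟩
    linarith [ht.1, ht.2]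
  obtain ⟨wp, hwp⟩ := H 1 (by norm_num)
  obtain ⟨wm, hwm⟩ := H (-1) (by norm_num)
  set A : ℝ → ℝ → FreqL2 h := fun σ t => symb h (flow (σ * t) (dispersion h)) (wp σ t) with hA
  set B : ℝ → ℝ → FreqL2 h := fun σ t =>
    symb h (flow (σ * t) (dispersion h)) (wm (-σ) (-t)) with hB
  have h0 : (0 : ℝ) ∈ Icc 0 T := ⟨le_rfl, hT⟩
  have cA : ∀ σ, |σ| = 1 → Continuous (A σ) := fun σ hσ =>
    ((continuous_symb_family (continuous_flow_family c1)).comp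
      (by fun_prop : Continuous fun t => σ * t)).clm_apply (hwp.continuous σ hσ)
  have cB : ∀ σ, |σ| = 1 → Continuous (B σ) := fun σ hσ =>
    ((continuous_symb_family (continuous_flow_family c1)).comp
      (by fun_prop : Continuous fun t => σ * t)).clm_apply
        ((hwm.continuous (-σ) (by rwa [abs_neg])).comp continuous_neg)
  have hAB : ∀ σ, |σ| = 1 → A σ 0 = B σ 0 := by
    intro σ hσ
    simp only [hA, hB, neg_zero]
    rw [hwp.eq σ hσ 0 h0, hwm.eq (-σ) (by rwa [abs_neg]) 0 h0]
    simp
  set W : ℝ → ℝ → FreqL2 h := fun σ t => if 0 ≤ t then A σ t else B σ t with hW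
  have cW : ∀ σ, |σ| = 1 → Continuous (W σ) := fun σ hσ => by
    apply Continuous.if_le (cA σ hσ) (cB σ hσ) continuous_const continuous_id
    rintro t rfl
    exact hAB σ hσ
  have hWτ : ∀ σ, |σ| = 1 → ∀ t, 0 ≤ t → W σ t = A σ t ∧ W σ (-t) = B σ (-t) := by
    intro σ hσ t ht
    refine ⟨if_pos ht, ?_⟩
    rcases ht.eq_or_lt with rfl | ht
    · rw [neg_zero, hW]; simp [hAB σ hσ]
    · exact if_neg (by linarith)
  -- the curves on the frequency side are transforms of real functions
  have rU : ∀ τ ε : ℝ, conjFreq (toFreq h (u₀ (τ * ε))) = toFreq h (u₀ (τ * ε)) := fun τ ε =>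
    (represents_toFreq _).conjFreq_eq
  have rW : ∀ σ, |σ| = 1 → ∀ t ∈ Icc 0 T, conjFreq (W σ t) = W σ t ∧ conjFreq (W σ (-t)) = W σ (-t) := by
    intro σ hσ t ht
    rw [(hWτ σ hσ t ht.1).1, (hWτ σ hσ t ht.1).2]
    simp only [hA, hB]
    rw [conjFreq_symb (by fun_prop) (flow_neg_arg _ (dispersion_neg h)),
      conjFreq_symb (by fun_prop) (flow_neg_arg _ (dispersion_neg h)), neg_neg,
      hwp.conjFreq_eq hV (fun ε _ => rU 1 ε) hσ ht,
      hwm.conjFreq_eq hV (fun ε _ => rU (-1) ε) (by rwa [abs_neg]) ht]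
    exact ⟨rfl, rfl⟩
  have rR : ∀ σ, |σ| = 1 → ∀ t ∈ Icc 0 T,
      Represents (W σ t) (ofFreq (W σ t)) ∧ Represents (W σ (-t)) (ofFreq (W σ (-t))) :=
    fun σ hσ t ht => ⟨represents_of_conjFreq_eq (rW σ hσ t ht).1,
      represents_of_conjFreq_eq (rW σ hσ t ht).2⟩
  refine ⟨fun σ t => ofFreq (W σ t), fun σ hσ => (continuous_ofFreq.comp (cW σ hσ)).continuousOn,
    fun σ hσ t ht n => ?_⟩
  have hσ' : |-σ| = 1 := by rwa [abs_neg]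
  have goal' : val (W σ t) n = ((propagator h σ t (u₀ σ) n - σ * (1 / 4) * ∫ t₁ in (0 : ℝ)..t,
      propagator h σ (t - t₁) (nabla h (latticeNL V h lam σ t₁ (ofFreq (W σ t₁))
        (ofFreq (W (-σ) t₁)))) n : ℝ) : ℂ) := by
    rcases le_total 0 t with h0t | h0t
    · have := val_profile_eq hV lam (ε := σ) (τ := 1) (by norm_num) h0t
        (represents_toFreq (h := h) (u₀ (1 * σ))) (hwp.continuous σ hσ) (hwp.continuous (-σ) hσ')
        (u := fun t => ofFreq (W σ t)) (w := fun t => ofFreq (W (-σ) t)) ?_ ?_ n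
      · rw [← hwp.eq σ hσ t ⟨h0t, ht.2⟩] at this
        simp only [one_mul] at this
        rw [(hWτ σ hσ t h0t).1, hA]
        exact this
      · intro t' ht'
        have ht'' : t' ∈ Icc 0 T := ⟨ht'.1, ht'.2.trans ht.2⟩
        have := (rR σ hσ t' ht'').1
        rw [one_mul]
        convert! this using 1
        rw [(hWτ σ hσ t' ht'.1).1]
      · intro t' ht'
        have ht'' : t' ∈ Icc 0 T := ⟨ht'.1, ht'.2.trans ht.2⟩
        have := (rR (-σ) hσ' t' ht'').1
        rw [one_mul]
        convert! this using 1
        simp only [(hWτ (-σ) hσ' t' ht'.1).1, hA, neg_mul]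
    · have h0t' : 0 ≤ -t := by linarith
      have := val_profile_eq hV lam (ε := -σ) (τ := -1) (by norm_num) h0t'
        (represents_toFreq (h := h) (u₀ (-1 * -σ))) (hwm.continuous (-σ) hσ')
        (hwm.continuous (- -σ) (by rwa [neg_neg]))
        (u := fun t => ofFreq (W σ t)) (w := fun t => ofFreq (W (-σ) t)) ?_ ?_ n
      · rw [← hwm.eq (-σ) hσ' (-t) ⟨h0t', by linarith [ht.1]⟩] at this
        simp only [neg_mul, one_mul, neg_neg, mul_neg] at this
        have e := (hWτ σ hσ (-t) h0t').2
        rw [neg_neg] at e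
        rw [e, hB]
        convert! this using 3
      · intro t' ht'
        have ht'' : t' ∈ Icc 0 T := ⟨ht'.1, by linarith [ht'.2, ht.1]⟩
        have := (rR σ hσ t' ht'').2
        rw [neg_one_mul]
        convert! this using 1
        rw [(hWτ σ hσ t' ht'.1).2, hB]
        simp
      · intro t' ht'
        have ht'' : t' ∈ Icc 0 T := ⟨ht'.1, by linarith [ht'.2, ht.1]⟩
        have := (rR (-σ) hσ' t' ht'').2
        rw [neg_one_mul]
        convert! this using 1
        rw [(hWτ (-σ) hσ' t' ht'.1).2, hB]
        simp
  change (val (W σ t) n).re = _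
  rw [goal', Complex.ofReal_re]

end

/-! ### Bilinear integral operators between `L²` spaces -/

section
variable {Ω X A B : Type*} [MeasurableSpace Ω] [MeasurableSpace X] [MeasurableSpace A]
  [MeasurableSpace B]

theorem lintegral_enorm_sq_congr {μ : Measure Ω} {f g : Ω → ℂ} (hfg : f =ᵐ[μ] g) :
    ∫⁻ x, ‖f x‖ₑ ^ 2 ∂μ = ∫⁻ x, ‖g x‖ₑ ^ 2 ∂μ :=
  lintegral_congr_ae (by filter_upwards [hfg] with x hx; rw [hx])

/-- The data of a bounded bilinear operator `(f, g) ↦ ∫ κ(ω, x) f(a(ω, x)) g(b(ω, x)) dν(x)` from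
`L²(α) × L²(β)` to `L²(μ)`; the bound is assumed for the absolute values of the functions. -/
structure IntKernel (μ : Measure Ω) (ν : Measure X) (α : Measure A) (β : Measure B) where
  /-- The kernel. -/
  κ : Ω × X → ℂ
  /-- The point where the first argument is evaluated. -/
  a : Ω × X → A
  /-- The point where the second argument is evaluated. -/
  b : Ω × X → B
  /-- The bound of the operator. -/
  C : ℝ
  measurable_κ : Measurable κ
  measurable_a : Measurable a
  measurable_b : Measurable b
  nonneg : 0 ≤ C
  bound : ∀ (F : A → ℝ≥0∞) (G : B → ℝ≥0∞), Measurable F → Measurable G →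
    ∫⁻ ω, (∫⁻ x, ‖κ (ω, x)‖ₑ * (F (a (ω, x)) * G (b (ω, x))) ∂ν) ^ 2 ∂μ ≤
      ENNReal.ofReal C ^ 2 * ((∫⁻ y, F y ^ 2 ∂α) * ∫⁻ y, G y ^ 2 ∂β)

namespace IntKernel

variable {μ : Measure Ω} {ν : Measure X} {α : Measure A} {β : Measure B}
  (N : IntKernel μ ν α β)

/-- The operator with absolute values everywhere. -/
def maj (F : A → ℝ≥0∞) (G : B → ℝ≥0∞) (ω : Ω) : ℝ≥0∞ :=
  ∫⁻ x, ‖N.κ (ω, x)‖ₑ * (F (N.a (ω, x)) * G (N.b (ω, x))) ∂ν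

/-- The value of the operator as a function. -/
def raw (f : A → ℂ) (g : B → ℂ) (ω : Ω) : ℂ :=
  ∫ x, N.κ (ω, x) * (f (N.a (ω, x)) * g (N.b (ω, x))) ∂ν

theorem measurable_integrand {F : A → ℝ≥0∞} {G : B → ℝ≥0∞} (hF : Measurable F) (hG : Measurable G) :
    Measurable fun p => ‖N.κ p‖ₑ * (F (N.a p) * G (N.b p)) :=
  N.measurable_κ.enorm.mul ((hF.comp N.measurable_a).mul (hG.comp N.measurable_b))

theorem stronglyMeasurable_integrand {f : A → ℂ} {g : B → ℂ} (hf : StronglyMeasurable f)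
    (hg : StronglyMeasurable g) :
    StronglyMeasurable fun p => N.κ p * (f (N.a p) * g (N.b p)) :=
  N.measurable_κ.stronglyMeasurable.mul
    ((hf.comp_measurable N.measurable_a).mul (hg.comp_measurable N.measurable_b))

theorem enorm_raw_le (f : A → ℂ) (g : B → ℂ) (ω : Ω) :
    ‖N.raw f g ω‖ₑ ≤ N.maj (fun y => ‖f y‖ₑ) (fun y => ‖g y‖ₑ) ω := by
  refine (enorm_integral_le_lintegral_enorm _).trans_eq ?_
  simp only [enorm_mul, maj]

variable [SFinite ν]

theorem measurable_maj {F : A → ℝ≥0∞} {G : B → ℝ≥0∞} (hF : Measurable F) (hG : Measurable G) :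
    Measurable (N.maj F G) := (N.measurable_integrand hF hG).lintegral_prod_right'

theorem stronglyMeasurable_raw {f : A → ℂ} {g : B → ℂ} (hf : StronglyMeasurable f)
    (hg : StronglyMeasurable g) : StronglyMeasurable (N.raw f g) :=
  (N.stronglyMeasurable_integrand hf hg).integral_prod_right'

theorem memLp_raw (f : Lp ℂ 2 α) (g : Lp ℂ 2 β) : MemLp (N.raw f g) 2 μ := by
  refine ⟨(N.stronglyMeasurable_raw (Lp.stronglyMeasurable f)
    (Lp.stronglyMeasurable g)).aestronglyMeasurable, ?_⟩
  rw [eLpNorm_lt_top_iff_lintegral_rpow_enorm_lt_top (by norm_num) (by norm_num)]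
  simp only [ENNReal.toReal_ofNat, ENNReal.rpow_ofNat]
  refine lt_of_le_of_lt (lintegral_mono fun ω => pow_le_pow_left₀ zero_le (N.enorm_raw_le f g ω) 2) ?_
  refine lt_of_le_of_lt (N.bound _ _ (Lp.stronglyMeasurable f).measurable.enorm
    (Lp.stronglyMeasurable g).measurable.enorm) ?_
  rw [lintegral_enorm_sq, lintegral_enorm_sq]
  finiteness

theorem ae_maj_lt_top {F : A → ℝ≥0∞} {G : B → ℝ≥0∞} (hF : Measurable F) (hG : Measurable G)
    (hF2 : ∫⁻ y, F y ^ 2 ∂α ≠ ∞) (hG2 : ∫⁻ y, G y ^ 2 ∂β ≠ ∞) : ∀ᵐ ω ∂μ, N.maj F G ω < ∞ := by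
  have h1 : ∫⁻ ω, N.maj F G ω ^ 2 ∂μ ≠ ∞ :=
    ne_top_of_le_ne_top (by finiteness) (N.bound F G hF hG)
  filter_upwards [ae_lt_top ((N.measurable_maj hF hG).pow_const 2) h1] with ω hω
  by_contra hcon
  rw [not_lt_top_iff] at hcon
  simp [hcon] at hω

theorem ae_integrable (f : Lp ℂ 2 α) (g : Lp ℂ 2 β) :
    ∀ᵐ ω ∂μ, Integrable (fun x => N.κ (ω, x) * (f (N.a (ω, x)) * g (N.b (ω, x)))) ν := by
  have hf := Lp.stronglyMeasurable f
  have hg := Lp.stronglyMeasurable g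
  filter_upwards [N.ae_maj_lt_top hf.measurable.enorm hg.measurable.enorm
    (by rw [lintegral_enorm_sq]; finiteness) (by rw [lintegral_enorm_sq]; finiteness)] with ω hω
  refine ⟨((N.stronglyMeasurable_integrand hf hg).comp_measurable
    measurable_prodMk_left).aestronglyMeasurable, ?_⟩
  rw [hasFiniteIntegral_iff_enorm]
  simpa only [enorm_mul, maj] using hω

theorem ae_maj_eq_zero {F : A → ℝ≥0∞} {G : B → ℝ≥0∞} (hF : Measurable F) (hG : Measurable G)
    (hz : (∫⁻ y, F y ^ 2 ∂α) * (∫⁻ y, G y ^ 2 ∂β) = 0) : ∀ᵐ ω ∂μ, N.maj F G ω = 0 := by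
  have h1 : ∫⁻ ω, N.maj F G ω ^ 2 ∂μ = 0 := by
    have := N.bound F G hF hG
    rw [hz, mul_zero] at this
    exact le_antisymm this zero_le
  filter_upwards [(lintegral_eq_zero_iff ((N.measurable_maj hF hG).pow_const 2)).1 h1] with ω hω
  simpa using hω

/-- Modifying the arguments on null sets does not change the integral. -/
theorem ae_raw_congr {f f' : A → ℂ} {g g' : B → ℂ} (hf : StronglyMeasurable f)
    (hf' : StronglyMeasurable f') (hg : StronglyMeasurable g) (hg' : StronglyMeasurable g')
    (ef : f =ᵐ[α] f') (eg : g =ᵐ[β] g') : N.raw f g =ᵐ[μ] N.raw f' g' := by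
  have z1 : ∫⁻ y, ‖(f - f') y‖ₑ ^ 2 ∂α = 0 := by
    rw [lintegral_eq_zero_iff ((hf.sub hf').measurable.enorm.pow_const 2)]
    filter_upwards [ef] with y hy
    simp [hy]
  have z2 : ∫⁻ y, ‖(g - g') y‖ₑ ^ 2 ∂β = 0 := by
    rw [lintegral_eq_zero_iff ((hg.sub hg').measurable.enorm.pow_const 2)]
    filter_upwards [eg] with y hy
    simp [hy]
  filter_upwards [N.ae_maj_eq_zero (hf.sub hf').measurable.enorm hg.measurable.enorm
      (by rw [z1, zero_mul]), N.ae_maj_eq_zero hf'.measurable.enorm (hg.sub hg').measurable.enorm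
      (by rw [z2, mul_zero])] with ω h1 h2
  replace h1 := (lintegral_eq_zero_iff ((N.measurable_integrand (hf.sub hf').measurable.enorm
    hg.measurable.enorm).comp measurable_prodMk_left)).1 h1
  replace h2 := (lintegral_eq_zero_iff ((N.measurable_integrand hf'.measurable.enorm
    (hg.sub hg').measurable.enorm).comp measurable_prodMk_left)).1 h2
  apply integral_congr_ae
  filter_upwards [h1, h2] with x e1 e2
  simp only [Function.comp_apply, Pi.zero_apply, ← enorm_mul, enorm_eq_zero, Pi.sub_apply] at e1 e2
  linear_combination e1 + e2

/-- The bounded bilinear operator of the kernel. -/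
def bilin : Lp ℂ 2 α →L[ℂ] Lp ℂ 2 β →L[ℂ] Lp ℂ 2 μ :=
  LinearMap.mkContinuous₂ (LinearMap.mk₂ ℂ (fun f g => (N.memLp_raw f g).toLp)
    (fun f f' g => by
      rw [← MemLp.toLp_add]
      apply MemLp.toLp_congr
      have hf := Lp.stronglyMeasurable f
      have hf' := Lp.stronglyMeasurable f'
      have hg := Lp.stronglyMeasurable g
      refine (N.ae_raw_congr (Lp.stronglyMeasurable (f + f')) (hf.add hf') hg hg (Lp.coeFn_add f f')
        (Filter.EventuallyEq.refl _ _)).trans ?_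
      · filter_upwards [N.ae_integrable f g, N.ae_integrable f' g] with ω h1 h2
        rw [Pi.add_apply, raw, raw, raw, ← integral_add h1 h2]
        congr 1; ext x; simp only [Pi.add_apply]; ring)
    (fun c f g => by
      rw [← MemLp.toLp_const_smul]
      apply MemLp.toLp_congr
      have hf := Lp.stronglyMeasurable f
      have hg := Lp.stronglyMeasurable g
      refine (N.ae_raw_congr (Lp.stronglyMeasurable (c • f)) (hf.const_smul c) hg hg
        (Lp.coeFn_smul c f) (Filter.EventuallyEq.refl _ _)).trans ?_
      · filter_upwards with ω
        rw [Pi.smul_apply, raw, raw, smul_eq_mul, ← integral_const_mul]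
        congr 1; ext x; simp only [Pi.smul_apply, smul_eq_mul]; ring)
    (fun f g g' => by
      rw [← MemLp.toLp_add]
      apply MemLp.toLp_congr
      have hf := Lp.stronglyMeasurable f
      have hg' := Lp.stronglyMeasurable g'
      have hg := Lp.stronglyMeasurable g
      refine (N.ae_raw_congr hf hf (Lp.stronglyMeasurable (g + g')) (hg.add hg')
        (Filter.EventuallyEq.refl _ _) (Lp.coeFn_add g g')).trans ?_
      filter_upwards [N.ae_integrable f g, N.ae_integrable f g'] with ω h1 h2
      rw [Pi.add_apply, raw, raw, raw, ← integral_add h1 h2]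
      congr 1; ext x; simp only [Pi.add_apply]; ring)
    (fun c f g => by
      rw [← MemLp.toLp_const_smul]
      apply MemLp.toLp_congr
      have hf := Lp.stronglyMeasurable f
      have hg := Lp.stronglyMeasurable g
      refine (N.ae_raw_congr hf hf (Lp.stronglyMeasurable (c • g)) (hg.const_smul c)
        (Filter.EventuallyEq.refl _ _) (Lp.coeFn_smul c g)).trans ?_
      filter_upwards with ω
      rw [Pi.smul_apply, raw, raw, smul_eq_mul, ← integral_const_mul]
      congr 1; ext x; simp only [Pi.smul_apply, smul_eq_mul]; ring))
    N.C (fun f g => by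
      have h1 : ‖(N.memLp_raw f g).toLp‖ₑ ≤ ENNReal.ofReal N.C * (‖f‖ₑ * ‖g‖ₑ) := by
        rw [← ENNReal.pow_le_pow_left_iff two_ne_zero, ← lintegral_enorm_sq,
          lintegral_enorm_sq_congr (N.memLp_raw f g).coeFn_toLp, mul_pow,
          mul_pow, ← lintegral_enorm_sq f, ← lintegral_enorm_sq g]
        exact (lintegral_mono fun ω => pow_le_pow_left₀ zero_le (N.enorm_raw_le f g ω) 2).trans
          (N.bound _ _ (Lp.stronglyMeasurable f).measurable.enorm
            (Lp.stronglyMeasurable g).measurable.enorm)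
      have h2 := ENNReal.toReal_mono (by finiteness) h1
      rw [ENNReal.toReal_mul, ENNReal.toReal_mul, toReal_enorm, toReal_enorm, toReal_enorm,
        ENNReal.toReal_ofReal N.nonneg, ← mul_assoc] at h2
      exact h2)

theorem coeFn_bilin (f : Lp ℂ 2 α) (g : Lp ℂ 2 β) : N.bilin f g =ᵐ[μ] N.raw f g :=
  (N.memLp_raw f g).coeFn_toLp

theorem norm_bilin_le (f : Lp ℂ 2 α) (g : Lp ℂ 2 β) : ‖N.bilin f g‖ ≤ N.C * ‖f‖ * ‖g‖ :=
  (N.bilin.le_opNorm₂ f g).trans (by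
    gcongr
    exact LinearMap.mkContinuous₂_norm_le _ N.nonneg _)

theorem ae_enorm_bilin_le (f : Lp ℂ 2 α) (g : Lp ℂ 2 β) :
    ∀ᵐ ω ∂μ, ‖N.bilin f g ω‖ₑ ≤ N.maj (fun y => ‖f y‖ₑ) (fun y => ‖g y‖ₑ) ω := by
  filter_upwards [N.coeFn_bilin f g] with ω hω
  rw [hω]
  exact N.enorm_raw_le _ _ ω

end IntKernel
end

/-! ### Integrability of the modulation density -/

theorem lintegral_comp_abs_le {g G : ℝ → ℝ} {l : ℝ} (hg : ∀ x, 0 ≤ x → 0 ≤ g x)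
    (hG : ∀ x, 0 ≤ x → HasDerivAt G (g x) x) (hl : Filter.Tendsto G Filter.atTop (nhds l)) :
    ∫⁻ x : ℝ, ENNReal.ofReal (g |x|) ≤ ENNReal.ofReal (2 * (l - G 0)) := by
  have hc : ContinuousWithinAt G (Ici 0) 0 := (hG 0 le_rfl).continuousAt.continuousWithinAt
  have hi := integrableOn_Ioi_deriv_of_nonneg hc (fun x hx => hG x (le_of_lt hx))
    (fun x hx => hg x (le_of_lt hx)) hl
  have hv := integral_Ioi_of_hasDerivAt_of_nonneg hc (fun x hx => hG x (le_of_lt hx))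
    (fun x hx => hg x (le_of_lt hx)) hl
  have h1 : ∫⁻ x in Ioi (0 : ℝ), ENNReal.ofReal (g |x|) = ENNReal.ofReal (l - G 0) := by
    rw [← hv, ofReal_integral_eq_lintegral_ofReal hi
      (by filter_upwards [ae_restrict_mem measurableSet_Ioi] with x hx using hg x (le_of_lt hx))]
    exact setLIntegral_congr_fun measurableSet_Ioi fun x hx => by rw [abs_of_pos hx]
  have h2 : ∫⁻ x in Iio (0 : ℝ), ENNReal.ofReal (g |x|) = ENNReal.ofReal (l - G 0) := by
    rw [← h1]
    have := (Measure.measurePreserving_neg (volume : Measure ℝ)).setLIntegral_comp_preimage_emb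
      (MeasurableEquiv.neg ℝ).measurableEmbedding (fun x => ENNReal.ofReal (g |x|)) (Ioi 0)
    rw [← this]
    simp
  rw [← lintegral_add_compl _ (measurableSet_Ioi (a := (0 : ℝ))), compl_Ioi,
    ← setLIntegral_congr (Iio_ae_eq_Iic (a := (0 : ℝ))), h1, h2]
  rcases le_total 0 (l - G 0) with h | h
  · rw [← ENNReal.ofReal_add h h]; apply ENNReal.ofReal_le_ofReal; linarith
  · rw [ENNReal.ofReal_of_nonpos h]; simp

theorem continuous_modDensity {h K : ℝ} (h0 : 0 < h) (hK : 0 < K) : Continuous (modDensity h K) := by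
  unfold modDensity
  have h1 : ∀ σ : ℝ, √(K + |σ|) ≠ 0 := fun σ => (Real.sqrt_pos.2 (by positivity)).ne'
  have h2 : ∀ σ : ℝ, 1 + h ^ 2 * √(K + |σ|) ^ 2 ≠ 0 := fun σ => by positivity
  have h3 : ∀ σ : ℝ, √(K + |σ|) * (1 + h ^ 2 * √(K + |σ|) ^ 2) ≠ 0 := fun σ => mul_ne_zero (h1 σ) (h2 σ)
  have h4 : ∀ σ : ℝ, √(K + |σ|) ^ 3 ≠ 0 := fun σ => pow_ne_zero _ (h1 σ)
  fun_prop (disch := assumption)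

/-- On the positive half line, `modDensity` has the primitive `-2√K / √(K + x) + 2 arctan (h √(K +
x))`, so its integral is at most `2 (2 + π) ≤ 12`. -/
theorem isDensity_modDensity {h K : ℝ} (h0 : 0 < h) (hK : 0 < K) :
    IsDensity K (ENNReal.ofReal 12) (fun σ => ENNReal.ofReal (modDensity h K σ)) := by
  refine ⟨(continuous_modDensity h0 hK).measurable.ennreal_ofReal, ?_, fun z => ?_⟩
  · have hsq : ∀ x : ℝ, 0 ≤ x → 0 < √(K + x) := fun x hx => Real.sqrt_pos.2 (by linarith)
    have := lintegral_comp_abs_le (g := fun x => √K / √(K + x) ^ 3 + h / (√(K + x) *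
      (1 + h ^ 2 * √(K + x) ^ 2))) (G := fun x => -(2 * √K) / √(K + x) + 2 * Real.arctan (h * √(K + x)))
      (l := 0 + 2 * (Real.pi / 2)) (fun x hx => by have := hsq x hx; positivity) (fun x hx => ?_) ?_
    · refine this.trans (ENNReal.ofReal_le_ofReal ?_)
      have h1 : 0 < √K := Real.sqrt_pos.2 hK
      have h2 : 0 ≤ Real.arctan (h * √K) := Real.arctan_nonneg.2 (by positivity)
      rw [add_zero]
      have : -(2 * √K) / √K = -2 := by field_simp
      rw [this]
      linarith [Real.pi_lt_four]
    · have hs := hsq x hx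
      have d1 : HasDerivAt (fun x => √(K + x)) (1 / (2 * √(K + x))) x := by
        have := (((hasDerivAt_id x).const_add K)).sqrt (by simp only [id]; linarith)
        simpa using this
      have d2 := (hasDerivAt_const x (-(2 * √K))).div d1 hs.ne'
      have d3 := ((d1.const_mul h).arctan).const_mul 2
      convert! d2.add d3 using 1
      field_simp
      ring
    · have t1 : Filter.Tendsto (fun x => √(K + x)) Filter.atTop Filter.atTop :=
        Real.tendsto_sqrt_atTop.comp (Filter.tendsto_atTop_add_const_left _ _ Filter.tendsto_id)
      apply Filter.Tendsto.add
      · exact t1.const_div_atTop _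
      · apply Filter.Tendsto.const_mul
        exact (Real.tendsto_arctan_atTop.mono_right nhdsWithin_le_nhds).comp (t1.const_mul_atTop h0)
  · rw [← ENNReal.ofReal_mul (by positivity)]
    apply ENNReal.ofReal_le_ofReal
    have hL : 0 < K + |z| := by positivity
    have hl : 0 < √(K + |z|) := Real.sqrt_pos.2 hL
    have hsq : K + |z| = √(K + |z|) ^ 2 := (Real.sq_sqrt hL.le).symm
    have hKl : √K ≤ √(K + |z|) := Real.sqrt_le_sqrt (by linarith [abs_nonneg z])
    unfold modDensity
    rw [mul_add]
    set l := √(K + |z|)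
    rw [hsq]
    have e1 : l ^ 2 * (√K / l ^ 3) ≤ 1 := by
      rw [show l ^ 2 * (√K / l ^ 3) = √K / l by field_simp]
      exact (div_le_one hl).2 hKl
    have e2 : l ^ 2 * (h / (l * (1 + h ^ 2 * l ^ 2))) ≤ 1 := by
      rw [show l ^ 2 * (h / (l * (1 + h ^ 2 * l ^ 2))) = (h * l) / (1 + h ^ 2 * l ^ 2) by field_simp]
      rw [div_le_one (by positivity)]
      nlinarith [sq_nonneg (h * l - 1), mul_pos h0 hl]
    linarith

/-! ### The modulation space and the reconstruction of a profile -/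

section
variable {h : ℝ} [hh : Fact (0 < h)]

/-- The measure on modulations times frequencies. -/
abbrev modMeasure (h : ℝ) [Fact (0 < h)] : Measure (ℝ × Freq h) :=
  (volume : Measure ℝ).prod (haarFreq h)

/-- The space of weighted space-time Fourier transforms `f(σ, ξ)` of profiles, with the modulation
`σ` and the frequency `ξ`; it plays the role of the Fourier restriction space `X^{0,b}`. -/
abbrev ModL2 (h : ℝ) [Fact (0 < h)] : Type := Lp ℂ 2 (modMeasure h)

/-- Integration against a function of the modulation. -/
def recKernel (h : ℝ) [Fact (0 < h)] :
    IntKernel (haarFreq h) (volume : Measure ℝ) (volume : Measure ℝ) (modMeasure h) where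
  κ _ := 1
  a p := p.2
  b p := (p.2, p.1)
  C := 1
  measurable_κ := measurable_const
  measurable_a := measurable_snd
  measurable_b := measurable_snd.prodMk measurable_fst
  nonneg := zero_le_one
  bound F G hF hG := by
    simp only [enorm_one, one_mul, ENNReal.ofReal_one, one_pow]
    calc ∫⁻ ξ, (∫⁻ σ, F σ * G (σ, ξ)) ^ 2 ∂haarFreq h
        ≤ ∫⁻ ξ, ((∫⁻ σ, F σ ^ 2) * ∫⁻ σ, G (σ, ξ) ^ 2) ∂haarFreq h := by
          apply lintegral_mono
          intro ξ
          exact sq_lintegral_mul_le volume hF.aemeasurable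
            (hG.comp (measurable_id.prodMk measurable_const)).aemeasurable
      _ = (∫⁻ σ, F σ ^ 2) * ∫⁻ y, G y ^ 2 ∂modMeasure h := by
          rw [lintegral_prod_symm _ (hG.pow_const 2).aemeasurable, lintegral_const_mul]
          exact (hG.pow_const 2).lintegral_prod_left'

/-- The character `e^{2πiσt}` of the modulation. -/
def modChar (t σ : ℝ) : ℂ := Complex.exp ((2 * Real.pi * σ * t : ℝ) * Complex.I)

theorem norm_modChar (t σ : ℝ) : ‖modChar t σ‖ = 1 := Complex.norm_exp_ofReal_mul_I _

theorem continuous_modChar : Continuous (Function.uncurry modChar) := by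
  unfold modChar Function.uncurry; fun_prop

theorem continuous_modChar_right (t : ℝ) : Continuous (modChar t) := by
  unfold modChar; fun_prop

theorem continuous_modChar_left (σ : ℝ) : Continuous fun t => modChar t σ := by
  unfold modChar; fun_prop

/-- The reconstruction weight `e^{2πiσt} √(modDensity)`. -/
def recFun (h K t σ : ℝ) : ℂ := modChar t σ * (√(modDensity h K σ) : ℝ)

theorem continuous_recFun {K : ℝ} (hK : 0 < K) (t : ℝ) : Continuous (recFun h K t) := by
  have := continuous_modDensity hh.out hK
  have := continuous_modChar_right t
  unfold recFun; fun_prop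

theorem enorm_recFun_sq {K : ℝ} (hK : 0 < K) (t σ : ℝ) :
    ‖recFun h K t σ‖ₑ ^ 2 = ENNReal.ofReal (modDensity h K σ) := by
  rw [← ofReal_norm, ← ENNReal.ofReal_pow (norm_nonneg _), recFun, norm_mul, norm_modChar,
    one_mul, Complex.norm_real, Real.norm_eq_abs, sq_abs, Real.sq_sqrt (modDensity_pos hh.out hK σ).le]

theorem memLp_two_of_lintegral {α : Type*} [MeasurableSpace α] {μ : Measure α} {f : α → ℂ}
    (hf : AEStronglyMeasurable f μ) (h2 : ∫⁻ x, ‖f x‖ₑ ^ 2 ∂μ < ∞) : MemLp f 2 μ := by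
  refine ⟨hf, ?_⟩
  rw [eLpNorm_lt_top_iff_lintegral_rpow_enorm_lt_top (by norm_num) (by norm_num)]
  simpa using h2

theorem memLp_recFun {K : ℝ} (hK : 0 < K) (t : ℝ) : MemLp (recFun h K t) 2 volume := by
  apply memLp_two_of_lintegral (continuous_recFun hK t).aestronglyMeasurable
  simp only [enorm_recFun_sq hK]
  exact (isDensity_modDensity hh.out hK).lintegral_le.trans_lt ENNReal.ofReal_lt_top

open Classical in
/-- The reconstruction weight as an element of `L²`; zero if `K ≤ 0`. -/
def recLp (h : ℝ) [Fact (0 < h)] (K t : ℝ) : Lp ℂ 2 (volume : Measure ℝ) :=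
  if hK : 0 < K then (memLp_recFun (h := h) hK t).toLp else 0

theorem coeFn_recLp {K : ℝ} (hK : 0 < K) (t : ℝ) : recLp h K t =ᵐ[volume] recFun h K t := by
  rw [recLp, dif_pos hK]; exact MemLp.coeFn_toLp _

theorem norm_le_of_lintegral {α : Type*} [MeasurableSpace α] {μ : Measure α} {f : Lp ℂ 2 μ} {c : ℝ}
    (hc : 0 ≤ c) (hf : ∫⁻ x, ‖f x‖ₑ ^ 2 ∂μ ≤ ENNReal.ofReal (c ^ 2)) : ‖f‖ ≤ c := by
  rw [lintegral_enorm_sq, ENNReal.ofReal_pow hc, ENNReal.pow_le_pow_left_iff two_ne_zero] at hf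
  have := ENNReal.toReal_mono (by finiteness) hf
  rwa [toReal_enorm, ENNReal.toReal_ofReal hc] at this

theorem norm_recLp_le {K : ℝ} (hK : 0 < K) (t : ℝ) : ‖recLp h K t‖ ≤ 4 := by
  apply norm_le_of_lintegral (by norm_num)
  rw [lintegral_enorm_sq_congr (coeFn_recLp hK t)]
  simp only [enorm_recFun_sq hK]
  exact (isDensity_modDensity hh.out hK).lintegral_le.trans (ENNReal.ofReal_le_ofReal (by norm_num))

theorem integrable_modDensity {K : ℝ} (hK : 0 < K) : Integrable (modDensity h K) := by
  refine ⟨(continuous_modDensity hh.out hK).aestronglyMeasurable, ?_⟩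
  rw [hasFiniteIntegral_iff_ofReal (.of_forall fun σ => (modDensity_pos hh.out hK σ).le)]
  exact (isDensity_modDensity hh.out hK).lintegral_le.trans_lt ENNReal.ofReal_lt_top

/-- Continuity in time, by dominated convergence. -/
theorem continuous_recLp {K : ℝ} (hK : 0 < K) : Continuous (recLp h K) := by
  rw [continuous_iff_continuousAt]
  intro t
  have hρ := continuous_modDensity hh.out hK
  set I : ℝ → ℝ := fun s => ∫ σ, modDensity h K σ * ‖modChar s σ - modChar t σ‖ ^ 2 with hI
  have cI : Continuous I := by
    apply continuous_of_dominated (bound := fun σ => modDensity h K σ * 4)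
    · intro s
      have := continuous_modChar_right s
      have := continuous_modChar_right t
      apply Continuous.aestronglyMeasurable; fun_prop
    · intro s
      filter_upwards with σ
      have h1 := (modDensity_pos (h := h) hh.out hK σ).le
      rw [Real.norm_eq_abs, abs_of_nonneg (by positivity)]
      gcongr
      have := norm_sub_le (modChar s σ) (modChar t σ)
      rw [norm_modChar, norm_modChar] at this
      nlinarith [norm_nonneg (modChar s σ - modChar t σ)]
    · exact (integrable_modDensity (h := h) hK).mul_const 4
    · filter_upwards with σ
      have := continuous_modChar_left σ
      fun_prop
  have hsq : ∀ s, ‖recLp h K s - recLp h K t‖ ^ 2 = I s := by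
    intro s
    have e1 : ∫⁻ σ, ‖(recLp h K s - recLp h K t) σ‖ₑ ^ 2 =
        ∫⁻ σ, ENNReal.ofReal (modDensity h K σ * ‖modChar s σ - modChar t σ‖ ^ 2) := by
      apply lintegral_congr_ae
      filter_upwards [Lp.coeFn_sub (recLp h K s) (recLp h K t), coeFn_recLp (h := h) hK s, coeFn_recLp (h := h) hK t]
        with σ h1 h2 h3
      rw [h1, Pi.sub_apply, h2, h3, recFun, recFun, ← sub_mul, ← ofReal_norm,
        ← ENNReal.ofReal_pow (norm_nonneg _), norm_mul, Complex.norm_real, Real.norm_eq_abs, mul_pow,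
        sq_abs, Real.sq_sqrt (modDensity_pos hh.out hK σ).le, mul_comm]
    rw [lintegral_enorm_sq] at e1
    have e2 := congrArg ENNReal.toReal e1
    rw [ENNReal.toReal_pow, toReal_enorm] at e2
    rw [e2, hI]
    have := continuous_modChar_right s
    have := continuous_modChar_right t
    rw [← integral_eq_lintegral_of_nonneg_ae
      (.of_forall fun σ => mul_nonneg (modDensity_pos hh.out hK σ).le (by positivity))
      (by apply Continuous.aestronglyMeasurable; fun_prop)]
  have hI0 : I t = 0 := by simp [hI]
  rw [ContinuousAt, tendsto_iff_norm_sub_tendsto_zero]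
  have : (fun s => ‖recLp h K s - recLp h K t‖) = fun s => √(I s) := by
    ext s; rw [← hsq, Real.sqrt_sq (norm_nonneg _)]
  rw [this]
  have h2 := (Real.continuous_sqrt.comp cI).tendsto t
  simpa [hI0, Function.comp_def] using h2

/-- The profile at time `t` with the weighted space-time transform `f`, damped by `e^{-Kt}`. -/
def modRec (h : ℝ) [Fact (0 < h)] (K t : ℝ) : ModL2 h →L[ℂ] FreqL2 h :=
  (recKernel h).bilin (recLp h K t)

theorem norm_modRec_le {K : ℝ} (hK : 0 < K) (t : ℝ) (f : ModL2 h) : ‖modRec h K t f‖ ≤ 4 * ‖f‖ := by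
  refine ((recKernel h).norm_bilin_le _ f).trans ?_
  have := norm_recLp_le (h := h) hK t
  have e : (recKernel h).C = 1 := rfl
  rw [e, one_mul]
  gcongr

theorem continuous_modRec {K : ℝ} (hK : 0 < K) (f : ModL2 h) : Continuous fun t => modRec h K t f :=
  ((recKernel h).bilin.continuous.comp (continuous_recLp hK)).clm_apply continuous_const

theorem coeFn_modRec {K : ℝ} (hK : 0 < K) (t : ℝ) (f : ModL2 h) {g : ℝ × Freq h → ℂ}
    (hg : StronglyMeasurable g) (hfg : f =ᵐ[modMeasure h] g) :
    modRec h K t f =ᵐ[haarFreq h] fun ξ => ∫ σ, recFun h K t σ * g (σ, ξ) := by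
  refine ((recKernel h).coeFn_bilin _ f).trans (((recKernel h).ae_raw_congr
    (Lp.stronglyMeasurable _) (continuous_recFun hK t).stronglyMeasurable (Lp.stronglyMeasurable _) hg
    (coeFn_recLp hK t) hfg).trans ?_)
  filter_upwards with ξ
  simp [IntKernel.raw, recKernel]

/-- Multiplication by a symbol in the frequency. -/
def modSymb (h : ℝ) [Fact (0 < h)] (m : ℝ → ℂ) : ModL2 h →L[ℂ] ModL2 h :=
  mulLp (modMeasure h) fun p => m (rep p.2)

theorem memLp_modSymbol {m : ℝ → ℂ} (hm : Continuous m) :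
    MemLp (fun p : ℝ × Freq h => m (rep p.2)) ∞ (modMeasure h) := by
  obtain ⟨c, hc⟩ := exists_bound_symbol h hm
  exact memLp_top_of_bound (hm.measurable.comp
    (measurable_rep.comp measurable_snd)).aestronglyMeasurable c
    (.of_forall fun p => hc _ ⟨(rep_mem p.2).1.le, (rep_mem p.2).2⟩)

theorem coeFn_modSymb {m : ℝ → ℂ} (hm : Continuous m) (f : ModL2 h) :
    modSymb h m f =ᵐ[modMeasure h] fun p => m (rep p.2) * f p := coeFn_mulLp (memLp_modSymbol hm) f

theorem modRec_modSymb {K : ℝ} (hK : 0 < K) (t : ℝ) {m : ℝ → ℂ} (hm : Continuous m) (f : ModL2 h) :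
    modRec h K t (modSymb h m f) = symb h m (modRec h K t f) := by
  apply Lp.ext
  have hg : StronglyMeasurable fun p : ℝ × Freq h => m (rep p.2) * f p :=
    (hm.measurable.comp (measurable_rep.comp measurable_snd)).stronglyMeasurable.mul
      (Lp.stronglyMeasurable f)
  filter_upwards [coeFn_modRec hK t _ hg (coeFn_modSymb hm f), coeFn_symb hm (modRec h K t f),
    coeFn_modRec hK t f (Lp.stronglyMeasurable f) (Filter.EventuallyEq.refl _ _)] with ξ h1 h2 h3
  rw [h1, h2, h3, ← integral_const_mul]
  congr 1; ext σ; ring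

/-! ### Elementary tensors -/

/-- The tensor product `a(σ) F(ξ)`. -/
def tensKernel (h : ℝ) [Fact (0 < h)] :
    IntKernel (modMeasure h) (Measure.dirac ()) (volume : Measure ℝ) (haarFreq h) where
  κ _ := 1
  a p := p.1.1
  b p := p.1.2
  C := 1
  measurable_κ := measurable_const
  measurable_a := measurable_fst.comp measurable_fst
  measurable_b := measurable_snd.comp measurable_fst
  nonneg := zero_le_one
  bound F G hF hG := by
    simp only [enorm_one, one_mul, ENNReal.ofReal_one, one_pow, lintegral_dirac, mul_pow]
    rw [lintegral_prod_mul (hF.pow_const 2).aemeasurable (hG.pow_const 2).aemeasurable]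

/-- The tensor product of a function of the modulation and a function of the frequency. -/
def tens (h : ℝ) [Fact (0 < h)] :
    Lp ℂ 2 (volume : Measure ℝ) →L[ℂ] FreqL2 h →L[ℂ] ModL2 h := (tensKernel h).bilin

theorem coeFn_tens (a : Lp ℂ 2 (volume : Measure ℝ)) (F : FreqL2 h) :
    tens h a F =ᵐ[modMeasure h] fun p => a p.1 * F p.2 := by
  filter_upwards [(tensKernel h).coeFn_bilin a F] with p hp
  rw [tens, hp]
  simp [IntKernel.raw, tensKernel]

theorem norm_tens_le (a : Lp ℂ 2 (volume : Measure ℝ)) (F : FreqL2 h) :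
    ‖tens h a F‖ ≤ ‖a‖ * ‖F‖ := by
  have := (tensKernel h).norm_bilin_le a F
  rwa [show (tensKernel h).C = 1 from rfl, one_mul] at this

theorem modSymb_tens {m : ℝ → ℂ} (hm : Continuous m) (a : Lp ℂ 2 (volume : Measure ℝ))
    (F : FreqL2 h) : modSymb h m (tens h a F) = tens h a (symb h m F) := by
  apply Lp.ext
  have h1 := Measure.quasiMeasurePreserving_snd (μ := (volume : Measure ℝ)) (ν := haarFreq h)
  filter_upwards [coeFn_modSymb hm (tens h a F), coeFn_tens a F, coeFn_tens a (symb h m F),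
    h1.ae (coeFn_symb hm F)] with p e1 e2 e3 e4
  rw [e1, e2, e3, e4]; ring

theorem modRec_tens {K : ℝ} (hK : 0 < K) (t : ℝ) {a : ℝ → ℂ} (ha : StronglyMeasurable a)
    {A : Lp ℂ 2 (volume : Measure ℝ)} (hA : A =ᵐ[volume] a) (F : FreqL2 h) :
    modRec h K t (tens h A F) = (∫ σ, recFun h K t σ * a σ) • F := by
  apply Lp.ext
  have hg : StronglyMeasurable fun p : ℝ × Freq h => a p.1 * F p.2 :=
    (ha.comp_measurable measurable_fst).mul ((Lp.stronglyMeasurable F).comp_measurable measurable_snd)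
  have h1 := Measure.quasiMeasurePreserving_fst (μ := (volume : Measure ℝ)) (ν := haarFreq h)
  have e : tens h A F =ᵐ[modMeasure h] fun p => a p.1 * F p.2 := by
    filter_upwards [coeFn_tens A F, h1.ae hA] with p e1 e2
    rw [e1, e2]
  filter_upwards [coeFn_modRec hK t _ hg e, Lp.coeFn_smul (∫ σ, recFun h K t σ * a σ) F] with ξ e1 e2
  rw [e1, e2, Pi.smul_apply, smul_eq_mul, ← integral_mul_const]
  congr 1; ext σ; ring

theorem inner_tens (a b : Lp ℂ 2 (volume : Measure ℝ)) (F G : FreqL2 h) :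
    inner ℂ (tens h a F) (tens h b G) = inner ℂ a b * inner ℂ F G := by
  rw [L2.inner_def, L2.inner_def, L2.inner_def, ← integral_prod_mul]
  apply integral_congr_ae
  filter_upwards [coeFn_tens a F, coeFn_tens b G] with p e1 e2
  rw [e1, e2]
  simp only [RCLike.inner_apply, map_mul]
  ring

end

/-! ### The bilinear estimate in the modulation space -/

section
variable {h : ℝ} [hh : Fact (0 < h)]

/-- The resonance function of the interaction, for the output frequency `ξ` and the input
frequencies `ξ₁`, `ξ - ξ₁`, in units of modulation. -/
def resonance (h : ℝ) [Fact (0 < h)] (ε : ℝ) (q₁ q₂ : ℝ → ℝ) (ξ ξ₁ : Freq h) : ℝ :=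
  ε * (-dispersion h (rep ξ) + q₁ (rep ξ₁) + q₂ (rep (ξ - ξ₁))) / (2 * Real.pi)

/-- The output multiplier of the bilinear operator: `K + 2πiσ` inverts the damped time derivative,
and the weight turns the transform into an element of the modulation space. -/
def outCoef (h : ℝ) [Fact (0 < h)] (K ε : ℝ) (p : ℝ × Freq h) : ℂ :=
  (((√h)⁻¹ * -(ε / 4) : ℝ) : ℂ) * nablaSymbol h (rep p.2) /
    ((K + (2 * Real.pi * p.1 : ℝ) * Complex.I) * (√(modDensity h K p.1) : ℝ))

/-- The transform of a time cut-off which equals `e^{Kt}` on `[0, 1/K]`. -/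
def timeKernel (K μ : ℝ) : ℂ :=
  modChar (-(1 / K)) μ * ((Real.exp 1 * (2 * K / (K ^ 2 + (2 * Real.pi * μ) ^ 2)) : ℝ) : ℂ)

@[fun_prop]
theorem measurable_dispersion (h : ℝ) : Measurable (dispersion h) := (continuous_dispersion h).measurable

@[fun_prop]
theorem measurable_modDensity (h K : ℝ) : Measurable (modDensity h K) := by
  unfold modDensity; fun_prop

@[fun_prop]
theorem measurable_nablaSymbol (h : ℝ) : Measurable (nablaSymbol h) :=
  (continuous_nablaSymbol h).measurable

theorem measurable_resonance {ε : ℝ} {q₁ q₂ : ℝ → ℝ} (h1 : Measurable q₁) (h2 : Measurable q₂) :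
    Measurable fun p : Freq h × Freq h => resonance h ε q₁ q₂ p.1 p.2 := by
  unfold resonance; fun_prop

theorem measurable_resonance_right {ε : ℝ} {q₁ q₂ : ℝ → ℝ} (h1 : Measurable q₁)
    (h2 : Measurable q₂) (ξ : Freq h) : Measurable (resonance h ε q₁ q₂ ξ) := by
  unfold resonance; fun_prop

@[fun_prop]
theorem measurable_outCoef (K ε : ℝ) : Measurable (outCoef h K ε) := by
  unfold outCoef; fun_prop

@[fun_prop]
theorem measurable_timeKernel (K : ℝ) : Measurable (timeKernel K) := by
  have := (continuous_modChar_right (-(1 / K))).measurable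
  unfold timeKernel; fun_prop

theorem sq_half_le (K σ : ℝ) :
    (K + |σ|) ^ 2 ≤ 2 * (K ^ 2 + (2 * Real.pi * σ) ^ 2) := by
  have hpi := Real.pi_gt_three
  have h1 : σ ^ 2 ≤ (2 * Real.pi * σ) ^ 2 := by
    rw [mul_pow]
    exact le_mul_of_one_le_left (sq_nonneg σ) (by nlinarith)
  nlinarith [sq_abs σ, sq_nonneg (K - |σ|)]

/-- The Poisson kernel is bounded by the density, so the free evolution and the time cut-off are
bounded uniformly in `h` and `K`. -/
theorem poisson_le_modDensity {K : ℝ} (hK : 0 < K) (μ : ℝ) :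
    2 * K / (K ^ 2 + (2 * Real.pi * μ) ^ 2) ≤ 4 * modDensity h K μ := by
  have h0 := hh.out
  have hL : 0 < K + |μ| := by positivity
  have hl : 0 < √(K + |μ|) := Real.sqrt_pos.2 hL
  have hk : 0 < √K := Real.sqrt_pos.2 hK
  have hsq : (K + |μ|) ^ 2 = √(K + |μ|) ^ 4 := by
    rw [show (4 : ℕ) = 2 * 2 by norm_num, pow_mul, Real.sq_sqrt hL.le]
  have hkq : K = √K ^ 2 := (Real.sq_sqrt hK.le).symm
  have hKl : √K ≤ √(K + |μ|) := Real.sqrt_le_sqrt (by linarith [abs_nonneg μ])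
  have h1 : 2 * K / (K ^ 2 + (2 * Real.pi * μ) ^ 2) ≤ 4 * K / (K + |μ|) ^ 2 := by
    rw [div_le_div_iff₀ (by positivity) (by positivity)]
    nlinarith [sq_half_le K μ]
  have h2 : 4 * K / (K + |μ|) ^ 2 ≤ 4 * (√K / √(K + |μ|) ^ 3) := by
    rw [hsq, mul_div_assoc]
    gcongr 4 * ?_
    rw [div_le_div_iff₀ (by positivity) (by positivity)]
    set l := √(K + |μ|)
    calc K * l ^ 3 = √K * √K * l ^ 3 := by rw [← sq, ← hkq]
      _ ≤ √K * l * l ^ 3 := by gcongr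
      _ = _ := by ring
  refine h1.trans (h2.trans ?_)
  unfold modDensity
  have : 0 ≤ h / (√(K + |μ|) * (1 + h ^ 2 * √(K + |μ|) ^ 2)) := by positivity
  linarith

theorem enorm_timeKernel_le {K : ℝ} (hK : 0 < K) (μ : ℝ) :
    ‖timeKernel K μ‖ₑ ≤ 12 * ENNReal.ofReal (modDensity h K μ) := by
  have h1 : ‖timeKernel K μ‖ ≤ 12 * modDensity h K μ := by
    rw [timeKernel, norm_mul, norm_modChar, one_mul, Complex.norm_real, Real.norm_eq_abs,
      abs_of_nonneg (by positivity)]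
    have := poisson_le_modDensity (h := h) hK μ
    have h3 := Real.exp_one_lt_three
    calc Real.exp 1 * (2 * K / (K ^ 2 + (2 * Real.pi * μ) ^ 2)) ≤ 3 * (4 * modDensity h K μ) := by
          gcongr
      _ = _ := by ring
  rw [← ofReal_norm]
  refine (ENNReal.ofReal_le_ofReal h1).trans_eq ?_
  rw [ENNReal.ofReal_mul (by norm_num)]; norm_num

theorem isDensity_timeKernel {K : ℝ} (h0 : 0 < h) (hK : 0 < K) :
    IsDensity K 144 (fun μ => ‖timeKernel K μ‖ₑ) := by
  have hρ := isDensity_modDensity h0 hK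
  have e : (144 : ℝ≥0∞) = 12 * ENNReal.ofReal 12 := by norm_num
  refine ⟨(measurable_timeKernel K).enorm, ?_, fun z => ?_⟩
  · rw [e]
    refine (lintegral_mono (enorm_timeKernel_le (h := h) hK)).trans ?_
    rw [lintegral_const_mul _ hρ.measurable]
    gcongr
    exact hρ.lintegral_le
  · rw [e]
    calc _ ≤ ENNReal.ofReal (K + |z|) * (12 * ENNReal.ofReal (modDensity h K z)) := by
          gcongr; exact enorm_timeKernel_le hK z
      _ = 12 * (ENNReal.ofReal (K + |z|) * ENNReal.ofReal (modDensity h K z)) := by ring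
      _ ≤ _ := by gcongr; exact hρ.mul_le z

/-- The square of the output multiplier is bounded by the coefficient in `HasResonanceBound`. -/
theorem enorm_outCoef_sq_le {K : ℝ} (hK : 0 < K) {ε : ℝ} (hε : |ε| = 1) (p : ℝ × Freq h) :
    ‖outCoef h K ε p‖ₑ ^ 2 ≤
      ENNReal.ofReal (4 / h ^ 3 * Real.sin (h * rep p.2 / 2) ^ 2 * outWeight h K p.1) := by
  have h0 := hh.out
  rw [← ofReal_norm, ← ENNReal.ofReal_pow (norm_nonneg _)]
  apply ENNReal.ofReal_le_ofReal
  have hρ := modDensity_pos h0 hK p.1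
  have hε2 : ε ^ 2 = 1 := by rw [← sq_abs, hε, one_pow]
  have hn : ‖(K : ℂ) + (2 * Real.pi * p.1 : ℝ) * Complex.I‖ ^ 2 = K ^ 2 + (2 * Real.pi * p.1) ^ 2 := by
    rw [← Complex.normSq_eq_norm_sq, Complex.normSq_add_mul_I]
  have e : ‖outCoef h K ε p‖ ^ 2 = 1 / 4 * (Real.sin (h * rep p.2 / 2) ^ 2 / h ^ 3) /
      ((K ^ 2 + (2 * Real.pi * p.1) ^ 2) * modDensity h K p.1) := by
    rw [outCoef, norm_div, norm_mul, norm_mul, norm_nablaSymbol, Complex.norm_real, Complex.norm_real,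
      div_pow, mul_pow, mul_pow, mul_pow, hn, Real.norm_eq_abs, Real.norm_eq_abs, sq_abs, sq_abs,
      sq_abs, Real.sq_sqrt hρ.le, mul_pow (√h)⁻¹, inv_pow, Real.sq_sqrt h0.le, neg_sq, div_pow, hε2]
    congr 1
    field_simp
    norm_num
  rw [e, outWeight, mul_one_div]
  have hL : 0 < K + |p.1| := by positivity
  rw [div_le_div_iff₀ (by positivity) (by positivity)]
  set S := Real.sin (h * rep p.2 / 2) ^ 2 / h ^ 3 with hS
  have hS0 : 0 ≤ S := by positivity
  rw [show 4 / h ^ 3 * Real.sin (h * rep p.2 / 2) ^ 2 = 4 * S by rw [hS]; ring]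
  have h1 := sq_half_le K p.1
  set X := (2 * Real.pi * p.1) ^ 2
  calc 1 / 4 * S * ((K + |p.1|) ^ 2 * modDensity h K p.1)
      ≤ 1 / 4 * S * (2 * (K ^ 2 + X) * modDensity h K p.1) := by gcongr
    _ = 1 / 2 * (S * ((K ^ 2 + X) * modDensity h K p.1)) := by ring
    _ ≤ 4 * (S * ((K ^ 2 + X) * modDensity h K p.1)) := by
        have : 0 ≤ S * ((K ^ 2 + X) * modDensity h K p.1) := by positivity
        linarith
    _ = _ := by ring

/-- The kernel of the bilinear operator; the integration variables are `(ξ₁, (μ, σ₁))`. -/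
def bilKer (h : ℝ) [Fact (0 < h)] (K ε : ℝ) (q₁ q₂ : ℝ → ℝ)
    (p : (ℝ × Freq h) × (Freq h × (ℝ × ℝ))) : ℂ :=
  outCoef h K ε p.1 * (timeKernel K p.2.2.1 * ((√(modDensity h K p.2.2.2) *
    √(modDensity h K (p.1.1 - p.2.2.1 - p.2.2.2 - resonance h ε q₁ q₂ p.1.2 p.2.1)) : ℝ) : ℂ))

/-- The point where the second argument of the bilinear operator is evaluated. -/
def bilArg (h : ℝ) [Fact (0 < h)] (ε : ℝ) (q₁ q₂ : ℝ → ℝ)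
    (p : (ℝ × Freq h) × (Freq h × (ℝ × ℝ))) : ℝ × Freq h :=
  (p.1.1 - p.2.2.1 - p.2.2.2 - resonance h ε q₁ q₂ p.1.2 p.2.1, p.1.2 - p.2.1)

theorem measurable_bilArg {ε : ℝ} {q₁ q₂ : ℝ → ℝ} (h1 : Measurable q₁) (h2 : Measurable q₂) :
    Measurable (bilArg h ε q₁ q₂) := by
  have := (measurable_resonance (h := h) (ε := ε) h1 h2).comp
    (f := fun p : (ℝ × Freq h) × (Freq h × (ℝ × ℝ)) => (p.1.2, p.2.1)) (by fun_prop)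
  simp only [Function.comp_def] at this
  unfold bilArg; fun_prop

theorem measurable_bilKer {K ε : ℝ} {q₁ q₂ : ℝ → ℝ} (h1 : Measurable q₁) (h2 : Measurable q₂) :
    Measurable (bilKer h K ε q₁ q₂) := by
  have := (measurable_resonance (h := h) (ε := ε) h1 h2).comp
    (f := fun p : (ℝ × Freq h) × (Freq h × (ℝ × ℝ)) => (p.1.2, p.2.1)) (by fun_prop)
  simp only [Function.comp_def] at this
  unfold bilKer; fun_prop

/-- The Sobolev weight `⟨ξ⟩^s` on the modulation space. -/
def sobWeight (s : ℝ) (p : ℝ × Freq h) : ℝ≥0∞ := ENNReal.ofReal (jap (rep p.2) ^ s)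

theorem continuous_jap_rpow (s : ℝ) : Continuous fun x => jap x ^ s :=
  continuous_jap.rpow_const fun x => Or.inl (jap_pos x).ne'

theorem measurable_sobWeight (s : ℝ) : Measurable (sobWeight (h := h) s) :=
  ((continuous_jap_rpow s).measurable.comp (measurable_rep.comp measurable_snd)).ennreal_ofReal

theorem enorm_rpow_half_sq (a : ℝ≥0∞) : a ^ (1 / 2 : ℝ) * a ^ (1 / 2 : ℝ) = a := by
  rw [← ENNReal.rpow_add_of_nonneg _ _ (by norm_num) (by norm_num)]; norm_num

/-- The inverse of the product of the input weights. -/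
def invWeight (s : ℝ) (ξ ξ₁ : Freq h) : ℝ≥0∞ :=
  ENNReal.ofReal ((jap (rep ξ₁) * jap (rep (ξ - ξ₁))) ^ (-s))

theorem measurable_invWeight (s : ℝ) (ξ : Freq h) : Measurable (invWeight s ξ) := by
  have c : Continuous fun z : ℝ × ℝ => (jap z.1 * jap z.2) ^ (-s) :=
    ((continuous_jap.comp continuous_fst).mul (continuous_jap.comp continuous_snd)).rpow_const
      fun z => Or.inl (mul_pos (jap_pos _) (jap_pos _)).ne'
  exact (c.measurable.comp (f := fun ξ₁ => (rep ξ₁, rep (ξ - ξ₁))) (by fun_prop)).ennreal_ofReal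

theorem invWeight_sq (s : ℝ) (ξ ξ₁ : Freq h) :
    invWeight s ξ ξ₁ ^ 2 = ENNReal.ofReal (wt s (rep ξ₁) (rep (ξ - ξ₁))) := by
  have := mul_pos (jap_pos (rep ξ₁)) (jap_pos (rep (ξ - ξ₁)))
  rw [invWeight, ← ENNReal.ofReal_pow (by positivity), ← Real.rpow_natCast, ← Real.rpow_mul this.le, wt]
  congr 2; push_cast; ring

theorem invWeight_mul (s : ℝ) (ξ ξ₁ : Freq h) (a b : ℝ) :
    invWeight s ξ ξ₁ * (sobWeight s (a, ξ₁) * sobWeight s (b, ξ - ξ₁)) = 1 := by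
  have p1 := jap_pos (rep ξ₁)
  have p2 := jap_pos (rep (ξ - ξ₁))
  rw [sobWeight, sobWeight, invWeight, ← ENNReal.ofReal_mul (by positivity), ← ENNReal.ofReal_mul
    (by positivity), ← Real.mul_rpow p1.le p2.le, ← Real.rpow_add (by positivity)]
  simp

/-- The square of the first factor in the Cauchy-Schwarz inequality: three densities are convolved
and tested against the resonance bound. -/
theorem enorm_outCoef_mul_lintegral_le {K : ℝ} (hK : 0 < K) {ε : ℝ} (hε : |ε| = 1) {q₁ q₂ : ℝ → ℝ}
    (h1 : Measurable q₁) (h2 : Measurable q₂) {s B : ℝ} (hB : HasResonanceBound h K ε q₁ q₂ s B)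
    {P : ℝ → ℝ≥0∞} {CP : ℝ≥0∞} (hP : IsDensity K CP P) (σ : ℝ) (ξ : Freq h) :
    ‖outCoef h K ε (σ, ξ)‖ₑ ^ 2 * ∫⁻ x : Freq h × (ℝ × ℝ), invWeight s ξ x.1 ^ 2 * (P x.2.1 *
      (ENNReal.ofReal (modDensity h K x.2.2) *
        ENNReal.ofReal (modDensity h K (σ - x.2.1 - x.2.2 - resonance h ε q₁ q₂ ξ x.1))))
          ∂(haarFreq h).prod (volume.prod volume) ≤
    ENNReal.ofReal B * (4 * (CP * (4 * (ENNReal.ofReal 12 * ENNReal.ofReal 12)))) := by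
  have hρ := isDensity_modDensity hh.out hK
  have mP := hP.measurable
  have mφ : Measurable (resonance h ε q₁ q₂ ξ) := measurable_resonance_right h1 h2 ξ
  have hρ₃d := hP.conv hK.le (hρ.conv hK.le hρ)
  have mw := (measurable_invWeight s ξ).pow_const 2
  have min2 : Measurable fun x : Freq h × (ℝ × ℝ) => P x.2.1 * (ENNReal.ofReal
      (modDensity h K x.2.2) *
        ENNReal.ofReal (modDensity h K (σ - x.2.1 - x.2.2 - resonance h ε q₁ q₂ ξ x.1))) := by
    fun_prop
  have min3 : Measurable fun x : Freq h × (ℝ × ℝ) => invWeight s ξ x.1 ^ 2 * (P x.2.1 *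
      (ENNReal.ofReal (modDensity h K x.2.2) *
        ENNReal.ofReal (modDensity h K (σ - x.2.1 - x.2.2 - resonance h ε q₁ q₂ ξ x.1)))) :=
    (mw.comp measurable_fst).mul min2
  rw [lintegral_prod _ min3.aemeasurable]
  have inner : ∀ ξ₁ : Freq h, ∫⁻ y : ℝ × ℝ, invWeight s ξ ξ₁ ^ 2 *
      (P y.1 * (ENNReal.ofReal (modDensity h K y.2) * ENNReal.ofReal
        (modDensity h K (σ - y.1 - y.2 - resonance h ε q₁ q₂ ξ ξ₁)))) ∂volume.prod volume =
      (∫⁻ μ, P μ * ∫⁻ σ₁, ENNReal.ofReal (modDensity h K σ₁) * ENNReal.ofReal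
        (modDensity h K (σ - resonance h ε q₁ q₂ ξ ξ₁ - μ - σ₁))) *
          ENNReal.ofReal (wt s (rep ξ₁) (rep (ξ - ξ₁))) := by
    intro ξ₁
    have m3 : Measurable fun y : ℝ × ℝ => P y.1 * (ENNReal.ofReal (modDensity h K y.2) *
      ENNReal.ofReal (modDensity h K (σ - y.1 - y.2 - resonance h ε q₁ q₂ ξ ξ₁))) := by fun_prop
    rw [lintegral_const_mul _ m3, lintegral_prod _ m3.aemeasurable, mul_comm, invWeight_sq]
    congr 1
    apply lintegral_congr
    intro μ
    dsimp only
    rw [lintegral_const_mul _ (by fun_prop)]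
    congr 1
    apply lintegral_congr
    intro σ₁
    congr 3
    ring
  simp only [inner]
  exact (mul_le_mul_left (enorm_outCoef_sq_le hK hε (σ, ξ)) _).trans (hB _ _ hρ₃d σ ξ)

theorem lintegral_bilArg (ε : ℝ) {q₁ q₂ : ℝ → ℝ} (h1 : Measurable q₁) (h2 : Measurable q₂)
    {G : ℝ × Freq h → ℝ≥0∞} (mG : Measurable G) (x : Freq h × (ℝ × ℝ)) :
    ∫⁻ ω, G (bilArg h ε q₁ q₂ (ω, x)) ∂modMeasure h = ∫⁻ p, G p ∂modMeasure h := by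
  obtain ⟨ξ₁, μ, σ₁⟩ := x
  have mA : Measurable fun ω : ℝ × Freq h => bilArg h ε q₁ q₂ (ω, (ξ₁, μ, σ₁)) :=
    (measurable_bilArg h1 h2).comp measurable_prodMk_right
  have mGA : Measurable fun ω : ℝ × Freq h => G (bilArg h ε q₁ q₂ (ω, (ξ₁, μ, σ₁))) := mG.comp mA
  rw [lintegral_prod_symm _ mGA.aemeasurable, lintegral_prod_symm _ mG.aemeasurable]
  have e1 : ∀ ξ : Freq h, ∫⁻ σ, G (bilArg h ε q₁ q₂ ((σ, ξ), (ξ₁, μ, σ₁))) =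
      ∫⁻ σ, G (σ, ξ - ξ₁) := by
    intro ξ
    have := lintegral_sub_right_eq_self (μ := (volume : Measure ℝ)) (fun σ => G (σ, ξ - ξ₁))
      (μ + σ₁ + resonance h ε q₁ q₂ ξ ξ₁)
    rw [← this]
    apply lintegral_congr
    intro σ
    simp only [bilArg]
    congr 2
    ring
  simp only [e1]
  exact lintegral_sub_right_eq_self (μ := haarFreq h) (fun ξ => ∫⁻ σ, G (σ, ξ)) ξ₁

/-- The integral of the square of the second factor in the Cauchy-Schwarz inequality. -/
theorem lintegral_lintegral_bilArg_le (ε : ℝ) {q₁ q₂ : ℝ → ℝ} (h1 : Measurable q₁)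
    (h2 : Measurable q₂) {K : ℝ} {P : ℝ → ℝ≥0∞} {CP : ℝ≥0∞} (hP : IsDensity K CP P)
    {F G : ℝ × Freq h → ℝ≥0∞} (mF : Measurable F) (mG : Measurable G) :
    ∫⁻ ω, (∫⁻ x : Freq h × (ℝ × ℝ), P x.2.1 * (F (x.2.2, x.1) * G (bilArg h ε q₁ q₂ (ω, x)))
      ∂(haarFreq h).prod (volume.prod volume)) ∂modMeasure h ≤
    CP * ((∫⁻ p, F p ∂modMeasure h) * ∫⁻ p, G p ∂modMeasure h) := by
  have mP := hP.measurable
  have mArg := measurable_bilArg (h := h) (ε := ε) h1 h2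
  have m1 : Measurable fun z : (ℝ × Freq h) × (Freq h × (ℝ × ℝ)) => P z.2.2.1 *
      (F (z.2.2.2, z.2.1) * G (bilArg h ε q₁ q₂ z)) := by fun_prop
  rw [lintegral_lintegral_swap m1.aemeasurable]
  have inner : ∀ x : Freq h × (ℝ × ℝ), ∫⁻ ω, P x.2.1 * (F (x.2.2, x.1) *
      G (bilArg h ε q₁ q₂ (ω, x))) ∂modMeasure h =
      P x.2.1 * (F (x.2.2, x.1) * ∫⁻ p, G p ∂modMeasure h) := by
    intro x
    have mA : Measurable fun ω : ℝ × Freq h => G (bilArg h ε q₁ q₂ (ω, x)) :=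
      mG.comp (mArg.comp measurable_prodMk_right)
    rw [lintegral_const_mul _ (mA.const_mul _), lintegral_const_mul _ mA, lintegral_bilArg ε h1 h2 mG]
  simp only [inner]
  set g := ∫⁻ p, G p ∂modMeasure h
  have m2 : Measurable fun x : Freq h × (ℝ × ℝ) => P x.2.1 * (F (x.2.2, x.1) * g) := by fun_prop
  rw [lintegral_prod _ m2.aemeasurable]
  have e2 : ∀ ξ₁ : Freq h, ∫⁻ y : ℝ × ℝ, P y.1 * (F (y.2, ξ₁) * g) ∂volume.prod volume =
      (∫⁻ μ, P μ) * ((∫⁻ σ, F (σ, ξ₁)) * g) := fun ξ₁ => by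
    have m3 : Measurable fun σ => F (σ, ξ₁) := mF.comp measurable_prodMk_right
    rw [lintegral_prod_mul (f := P) (g := fun σ => F (σ, ξ₁) * g) mP.aemeasurable
      (m3.mul_const g).aemeasurable, lintegral_mul_const _ m3]
  simp only [e2]
  rw [lintegral_const_mul _ (mF.lintegral_prod_left'.mul_const g),
    lintegral_mul_const _ mF.lintegral_prod_left', ← lintegral_prod_symm _ mF.aemeasurable]
  gcongr
  exact hP.lintegral_le

theorem enorm_bilKer (K ε : ℝ) (q₁ q₂ : ℝ → ℝ) (σ : ℝ) (ξ : Freq h) (x : Freq h × (ℝ × ℝ)) :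
    ‖bilKer h K ε q₁ q₂ ((σ, ξ), x)‖ₑ = ‖outCoef h K ε (σ, ξ)‖ₑ * (‖timeKernel K x.2.1‖ₑ *
      (ENNReal.ofReal (√(modDensity h K x.2.2)) *
        ENNReal.ofReal (√(modDensity h K (σ - x.2.1 - x.2.2 - resonance h ε q₁ q₂ ξ x.1))))) := by
  rw [bilKer, enorm_mul, enorm_mul, ← ofReal_norm (((_ : ℝ) : ℂ)), Complex.norm_real,
    Real.norm_eq_abs, abs_of_nonneg (by positivity), ENNReal.ofReal_mul (by positivity)]

/-- Cauchy-Schwarz turns the resonance bound into a bilinear estimate. -/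
theorem lintegral_bilKer_sq_le {K : ℝ} (hK : 0 < K) {ε : ℝ} (hε : |ε| = 1) {q₁ q₂ : ℝ → ℝ}
    (h1 : Measurable q₁) (h2 : Measurable q₂) {s B : ℝ} (hB : HasResonanceBound h K ε q₁ q₂ s B)
    {CP : ℝ≥0∞} (hCP : CP ≠ ∞) (hP : IsDensity K CP (fun μ => ‖timeKernel K μ‖ₑ))
    {F G : ℝ × Freq h → ℝ≥0∞} (hF : Measurable F) (hG : Measurable G) :
    ∫⁻ ω, (∫⁻ x, ‖bilKer h K ε q₁ q₂ (ω, x)‖ₑ * (F (x.2.2, x.1) * G (bilArg h ε q₁ q₂ (ω, x)))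
      ∂(haarFreq h).prod (volume.prod volume)) ^ 2 ∂modMeasure h ≤
    (ENNReal.ofReal B * (4 * (CP * (4 * (ENNReal.ofReal 12 * ENNReal.ofReal 12))))) * (CP *
      ((∫⁻ p, (sobWeight s p * F p) ^ 2 ∂modMeasure h) *
      ∫⁻ p, (sobWeight s p * G p) ^ 2 ∂modMeasure h)) := by
  have h0 := hh.out
  have mP := hP.measurable
  have mArg := measurable_bilArg (h := h) (ε := ε) h1 h2
  have mJ := measurable_sobWeight (h := h) s
  have key : ∀ ω : ℝ × Freq h, (∫⁻ x, ‖bilKer h K ε q₁ q₂ (ω, x)‖ₑ * (F (x.2.2, x.1) *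
      G (bilArg h ε q₁ q₂ (ω, x))) ∂(haarFreq h).prod (volume.prod volume)) ^ 2 ≤
      (ENNReal.ofReal B * (4 * (CP * (4 * (ENNReal.ofReal 12 * ENNReal.ofReal 12))))) *
      ∫⁻ x : Freq h × (ℝ × ℝ), ‖timeKernel K x.2.1‖ₑ *
        ((sobWeight s (x.2.2, x.1) * F (x.2.2, x.1)) ^ 2 *
        (sobWeight s (bilArg h ε q₁ q₂ (ω, x)) * G (bilArg h ε q₁ q₂ (ω, x))) ^ 2)
        ∂(haarFreq h).prod (volume.prod volume) := by
    rintro ⟨σ, ξ⟩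
    have mA : Measurable fun x : Freq h × (ℝ × ℝ) => bilArg h ε q₁ q₂ ((σ, ξ), x) :=
      mArg.comp measurable_prodMk_left
    have mφ : Measurable (resonance h ε q₁ q₂ ξ) := measurable_resonance_right h1 h2 ξ
    have mw := measurable_invWeight s ξ
    -- `u` collects the output multiplier and the weights, to which the resonance bound applies, and
    -- `v` the two arguments; each receives one half of the time cut-off
    set u : Freq h × (ℝ × ℝ) → ℝ≥0∞ := fun x => ‖outCoef h K ε (σ, ξ)‖ₑ *
      (‖timeKernel K x.2.1‖ₑ ^ (1 / 2 : ℝ) * (ENNReal.ofReal (√(modDensity h K x.2.2)) *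
      ENNReal.ofReal (√(modDensity h K (σ - x.2.1 - x.2.2 - resonance h ε q₁ q₂ ξ x.1))) *
      invWeight s ξ x.1)) with hu
    set v : Freq h × (ℝ × ℝ) → ℝ≥0∞ := fun x => ‖timeKernel K x.2.1‖ₑ ^ (1 / 2 : ℝ) *
      (sobWeight s (x.2.2, x.1) * F (x.2.2, x.1) *
        (sobWeight s (bilArg h ε q₁ q₂ ((σ, ξ), x)) * G (bilArg h ε q₁ q₂ ((σ, ξ), x)))) with hv
    have muu : Measurable u := by rw [hu]; fun_prop
    have mvv : Measurable v := by rw [hv]; fun_prop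
    have huv : ∀ x, ‖bilKer h K ε q₁ q₂ ((σ, ξ), x)‖ₑ * (F (x.2.2, x.1) *
        G (bilArg h ε q₁ q₂ ((σ, ξ), x))) = u x * v x := by
      intro x
      have e2 := invWeight_mul s ξ x.1 x.2.2 (σ - x.2.1 - x.2.2 - resonance h ε q₁ q₂ ξ x.1)
      have e3 : bilArg h ε q₁ q₂ ((σ, ξ), x) =
        (σ - x.2.1 - x.2.2 - resonance h ε q₁ q₂ ξ x.1, ξ - x.1) := rfl
      have e4 := enorm_rpow_half_sq ‖timeKernel K x.2.1‖ₑ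
      rw [← e3] at e2
      simp only [enorm_bilKer, hu, hv]
      generalize ‖timeKernel K x.2.1‖ₑ ^ (1 / 2 : ℝ) = k at e4 ⊢
      generalize bilArg h ε q₁ q₂ ((σ, ξ), x) = y at e2 ⊢
      rw [← e4]
      calc _ = ‖outCoef h K ε (σ, ξ)‖ₑ * (k * k * (ENNReal.ofReal (√(modDensity h K x.2.2)) *
        ENNReal.ofReal (√(modDensity h K (σ - x.2.1 - x.2.2 - resonance h ε q₁ q₂ ξ x.1))))) *
            (F (x.2.2, x.1) * G y) *
            (invWeight s ξ x.1 * (sobWeight s (x.2.2, x.1) * sobWeight s y)) := by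
            rw [e2, mul_one]
        _ = _ := by ring
    simp only [huv]
    refine (sq_lintegral_mul_le _ muu.aemeasurable mvv.aemeasurable).trans ?_
    apply mul_le_mul' _ (le_of_eq _)
    · have hu2 : ∀ x, u x ^ 2 = ‖outCoef h K ε (σ, ξ)‖ₑ ^ 2 * (invWeight s ξ x.1 ^ 2 *
          (‖timeKernel K x.2.1‖ₑ * (ENNReal.ofReal (modDensity h K x.2.2) * ENNReal.ofReal
          (modDensity h K (σ - x.2.1 - x.2.2 - resonance h ε q₁ q₂ ξ x.1))))) := fun x => by
        have hr2 : ∀ σ, ENNReal.ofReal (modDensity h K σ) =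
            ENNReal.ofReal (√(modDensity h K σ)) ^ 2 := fun σ => by
          rw [← ENNReal.ofReal_pow (Real.sqrt_nonneg _), Real.sq_sqrt (modDensity_pos h0 hK σ).le]
        have e4 := enorm_rpow_half_sq ‖timeKernel K x.2.1‖ₑ
        simp only [hr2, hu]
        generalize ‖timeKernel K x.2.1‖ₑ ^ (1 / 2 : ℝ) = k at e4 ⊢
        rw [← e4]
        ring
      simp only [hu2]
      rw [lintegral_const_mul _ (by fun_prop)]
      exact enorm_outCoef_mul_lintegral_le hK hε h1 h2 hB hP σ ξ
    · apply lintegral_congr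
      intro x
      have e4 := enorm_rpow_half_sq ‖timeKernel K x.2.1‖ₑ
      simp only [hv]
      generalize ‖timeKernel K x.2.1‖ₑ ^ (1 / 2 : ℝ) = k at e4 ⊢
      rw [← e4]
      ring
  refine (lintegral_mono key).trans ?_
  rw [lintegral_const_mul' _ _ (by finiteness)]
  gcongr
  exact lintegral_lintegral_bilArg_le ε h1 h2 hP ((mJ.mul hF).pow_const 2) ((mJ.mul hG).pow_const 2)

end

/-! ### The bilinear operators on the modulation space -/

section
variable {h : ℝ} [hh : Fact (0 < h)]

theorem bilKer_bound {K : ℝ} (hK : 0 < K) {ε : ℝ} (hε : |ε| = 1) {q₁ q₂ : ℝ → ℝ}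
    (h1 : Measurable q₁) (h2 : Measurable q₂) {s B : ℝ} (hB : HasResonanceBound h K ε q₁ q₂ s B)
    {F G : ℝ × Freq h → ℝ≥0∞} (hF : Measurable F) (hG : Measurable G) :
    ∫⁻ ω, (∫⁻ x, ‖bilKer h K ε q₁ q₂ (ω, x)‖ₑ * (F (x.2.2, x.1) * G (bilArg h ε q₁ q₂ (ω, x)))
      ∂(haarFreq h).prod (volume.prod volume)) ^ 2 ∂modMeasure h ≤
    ENNReal.ofReal (6912 * √B) ^ 2 * ((∫⁻ p, (sobWeight s p * F p) ^ 2 ∂modMeasure h) *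
      ∫⁻ p, (sobWeight s p * G p) ^ 2 ∂modMeasure h) := by
  refine (lintegral_bilKer_sq_le hK hε h1 h2 hB (by norm_num)
    (isDensity_timeKernel (h := h) hh.out hK) hF hG).trans_eq ?_
  rw [← mul_assoc]
  congr 1
  rw [ENNReal.ofReal_mul (by norm_num), mul_pow, ← ENNReal.ofReal_pow (Real.sqrt_nonneg _)]
  have e : ENNReal.ofReal (√B ^ 2) = ENNReal.ofReal B := by
    rcases le_total 0 B with hB0 | hB0
    · rw [Real.sq_sqrt hB0]
    · rw [Real.sqrt_eq_zero_of_nonpos hB0, ENNReal.ofReal_of_nonpos hB0]; simp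
  rw [e, show (6912 : ℝ) = (6912 : ℕ) by norm_num, ENNReal.ofReal_natCast,
    show (12 : ℝ) = (12 : ℕ) by norm_num, ENNReal.ofReal_natCast]
  push_cast
  ring

theorem sobWeight_zero (p : ℝ × Freq h) : sobWeight 0 p = 1 := by simp [sobWeight]

/-- The kernel of the bilinear operator with its bound in terms of the resonance bound. -/
def bilIntKernel {K : ℝ} (hK : 0 < K) {ε : ℝ} (hε : |ε| = 1) {q₁ q₂ : ℝ → ℝ}
    (h1 : Measurable q₁) (h2 : Measurable q₂) {B : ℝ} (hB : HasResonanceBound h K ε q₁ q₂ 0 B) :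
    IntKernel (modMeasure h)
      ((haarFreq h).prod ((volume : Measure ℝ).prod (volume : Measure ℝ))) (modMeasure h)
      (modMeasure h) where
  κ := bilKer h K ε q₁ q₂
  a p := (p.2.2.2, p.2.1)
  b := bilArg h ε q₁ q₂
  C := 6912 * √B
  measurable_κ := measurable_bilKer h1 h2
  measurable_a := by fun_prop
  measurable_b := measurable_bilArg h1 h2
  nonneg := by positivity
  bound F G hF hG := by
    simpa only [sobWeight_zero, one_mul] using bilKer_bound hK hε h1 h2 hB hF hG

/-- The bilinear operator of the interaction of two profiles in the modulation space. -/
def modBil {K : ℝ} (hK : 0 < K) {ε : ℝ} (hε : |ε| = 1) {q₁ q₂ : ℝ → ℝ}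
    (h1 : Measurable q₁) (h2 : Measurable q₂) {B : ℝ} (hB : HasResonanceBound h K ε q₁ q₂ 0 B) :
    ModL2 h →L[ℂ] ModL2 h →L[ℂ] ModL2 h := (bilIntKernel hK hε h1 h2 hB).bilin

/-- Multiplication by the Sobolev weight `⟨ξ⟩^s`. -/
def modSob (h : ℝ) [Fact (0 < h)] (s : ℝ) : ModL2 h →L[ℂ] ModL2 h :=
  modSymb h fun x => ((jap x ^ s : ℝ) : ℂ)

theorem continuous_japC (s : ℝ) : Continuous fun x => ((jap x ^ s : ℝ) : ℂ) :=
  Complex.continuous_ofReal.comp (continuous_jap_rpow s)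

theorem ae_enorm_modSob (s : ℝ) (f : ModL2 h) :
    ∀ᵐ p ∂modMeasure h, ‖modSob h s f p‖ₑ = sobWeight s p * ‖f p‖ₑ := by
  filter_upwards [coeFn_modSymb (continuous_japC s) f] with p hp
  rw [modSob, hp, enorm_mul, sobWeight, ← ofReal_norm (((_ : ℝ) : ℂ)), Complex.norm_real,
    Real.norm_eq_abs, abs_of_nonneg (Real.rpow_nonneg (jap_pos _).le _)]

theorem lintegral_sobWeight_mul_sq (s : ℝ) (f : ModL2 h) :
    ∫⁻ p, (sobWeight s p * ‖f p‖ₑ) ^ 2 ∂modMeasure h = ‖modSob h s f‖ₑ ^ 2 := by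
  rw [← lintegral_enorm_sq]
  apply lintegral_congr_ae
  filter_upwards [ae_enorm_modSob s f] with p hp
  rw [hp]

section
variable {K : ℝ} (hK : 0 < K) {ε : ℝ} (hε : |ε| = 1) {q₁ q₂ : ℝ → ℝ}
    (h1 : Measurable q₁) (h2 : Measurable q₂) {B : ℝ} (hB : HasResonanceBound h K ε q₁ q₂ 0 B)

theorem norm_modBil_le (f g : ModL2 h) :
    ‖modBil hK hε h1 h2 hB f g‖ ≤ 6912 * √B * ‖f‖ * ‖g‖ :=
  (bilIntKernel hK hε h1 h2 hB).norm_bilin_le f g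

theorem norm_le_of_enorm_sq_le {X Y : Type*} [NormedAddCommGroup X] [NormedAddCommGroup Y]
    {Z : Type*} [NormedAddCommGroup Z] {x : X} {y : Y} {z : Z} {c : ℝ} (hc : 0 ≤ c)
    (hx : ‖x‖ₑ ^ 2 ≤ ENNReal.ofReal c ^ 2 * (‖y‖ₑ ^ 2 * ‖z‖ₑ ^ 2)) : ‖x‖ ≤ c * ‖y‖ * ‖z‖ := by
  rw [← mul_pow, ← mul_pow, ENNReal.pow_le_pow_left_iff two_ne_zero] at hx
  have h2 := ENNReal.toReal_mono (by finiteness) hx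
  rwa [ENNReal.toReal_mul, ENNReal.toReal_mul, toReal_enorm, toReal_enorm, toReal_enorm,
    ENNReal.toReal_ofReal hc, ← mul_assoc] at h2

/-- The bilinear estimate which gains from the regularity of the arguments. -/
theorem norm_modBil_le_modSob {s B' : ℝ} (hB' : HasResonanceBound h K ε q₁ q₂ s B') (f g : ModL2 h) :
    ‖modBil hK hε h1 h2 hB f g‖ ≤ 6912 * √B' * ‖modSob h s f‖ * ‖modSob h s g‖ := by
  apply norm_le_of_enorm_sq_le (by positivity)
  rw [← lintegral_sobWeight_mul_sq, ← lintegral_sobWeight_mul_sq, ← lintegral_enorm_sq]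
  refine le_trans (lintegral_mono_ae ?_) (bilKer_bound hK hε h1 h2 hB'
    (Lp.stronglyMeasurable f).measurable.enorm (Lp.stronglyMeasurable g).measurable.enorm)
  filter_upwards [(bilIntKernel hK hε h1 h2 hB).ae_enorm_bilin_le f g] with ω hω
  gcongr
  exact hω

/-- Subadditivity of the Sobolev weight on the frequency circle. -/
theorem sobWeight_le_add {s : ℝ} (hs0 : 0 ≤ s) (hs1 : s ≤ 1) (σ σ₁ σ₂ : ℝ) (ξ ξ₁ : Freq h) :
    sobWeight s (σ, ξ) ≤ sobWeight s (σ₁, ξ₁) + sobWeight s (σ₂, ξ - ξ₁) := by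
  have hpi := hh.out
  have h1 : |rep ξ| ≤ |rep ξ₁| + |rep (ξ - ξ₁)| := by
    have hz : ((rep ξ₁ + rep (ξ - ξ₁) - rep ξ : ℝ) : Freq h) = 0 := by
      rw [AddCircle.coe_sub, AddCircle.coe_add, coe_rep, coe_rep, coe_rep]; abel
    obtain ⟨k, hk⟩ := (AddCircle.coe_eq_zero_iff _).1 hz
    rw [zsmul_eq_mul] at hk
    have hp : 0 < Real.pi / h := div_pos Real.pi_pos hpi
    have hm := abs_rep_le ξ
    -- if the sum of the representatives wraps around the circle, then it exceeds `π / h ≥ |rep ξ|`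
    rcases eq_or_ne k 0 with rfl | hk0
    · have e : rep ξ = rep ξ₁ + rep (ξ - ξ₁) := by
        rw [Int.cast_zero, zero_mul] at hk; linarith
      rw [e]; exact abs_add_le _ _
    · have hk1 : (1 : ℝ) ≤ |(k : ℝ)| := by exact_mod_cast Int.one_le_abs hk0
      have h3 : |(k : ℝ) * (2 * Real.pi / h)| = |(k : ℝ)| * (2 * (Real.pi / h)) := by
        rw [abs_mul, mul_div_assoc, abs_of_pos (a := 2 * (Real.pi / h)) (by positivity)]
      have h4 := abs_sub (rep ξ₁ + rep (ξ - ξ₁)) (rep ξ)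
      have h5 := abs_add_le (rep ξ₁) (rep (ξ - ξ₁))
      rw [← hk, h3] at h4
      nlinarith
  have h2 : jap (rep ξ) ≤ jap (rep ξ₁) + jap (rep (ξ - ξ₁)) := by
    have := one_le_jap (rep ξ₁)
    have := one_le_jap (rep (ξ - ξ₁))
    have := abs_le_jap (rep ξ₁)
    have := abs_le_jap (rep (ξ - ξ₁))
    have e : ∀ x, jap x ^ 2 = 1 + |x| ^ 2 := fun x => Real.sq_sqrt (by positivity)
    have e0 := e (rep ξ); have e1 := e (rep ξ₁); have e2 := e (rep (ξ - ξ₁))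
    apply le_of_sq_le_sq _ (by linarith)
    nlinarith [abs_nonneg (rep ξ), abs_nonneg (rep ξ₁), abs_nonneg (rep (ξ - ξ₁))]
  unfold sobWeight
  rw [← ENNReal.ofReal_add (Real.rpow_nonneg (jap_pos _).le _) (Real.rpow_nonneg (jap_pos _).le _)]
  apply ENNReal.ofReal_le_ofReal
  exact (Real.rpow_le_rpow (jap_pos _).le h2 hs0).trans
    (Real.rpow_add_le_add_rpow (jap_pos _).le (jap_pos _).le hs0 hs1)

/-- The Leibniz type estimate for the bilinear operator. -/
theorem norm_modSob_modBil_le {s : ℝ} (hs0 : 0 ≤ s) (hs1 : s ≤ 1) (f g : ModL2 h) :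
    ‖modSob h s (modBil hK hε h1 h2 hB f g)‖ ≤
      2 * (6912 * √B) * (‖modSob h s f‖ * ‖g‖ + ‖f‖ * ‖modSob h s g‖) := by
  set N := bilIntKernel hK hε h1 h2 hB with hN
  have mf := (Lp.stronglyMeasurable f).measurable.enorm
  have mg := (Lp.stronglyMeasurable g).measurable.enorm
  have mJ := measurable_sobWeight (h := h) s
  have m1 := N.measurable_maj (mJ.mul mf) mg
  have m2 := N.measurable_maj mf (mJ.mul mg)
  set a := N.maj (fun p => sobWeight s p * ‖f p‖ₑ) (fun p => ‖g p‖ₑ) with ha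
  set b := N.maj (fun p => ‖f p‖ₑ) (fun p => sobWeight s p * ‖g p‖ₑ) with hb
  have pt : ∀ᵐ ω ∂modMeasure h, ‖modSob h s (modBil hK hε h1 h2 hB f g) ω‖ₑ ^ 2 ≤
      2 * (a ω ^ 2 + b ω ^ 2) := by
    filter_upwards [N.ae_enorm_bilin_le f g, ae_enorm_modSob s (modBil hK hε h1 h2 hB f g)]
      with ω hω e
    have h3 : sobWeight s ω * N.maj (fun y => ‖f y‖ₑ) (fun y => ‖g y‖ₑ) ω ≤ a ω + b ω := by
      rw [ha, hb, IntKernel.maj, IntKernel.maj, IntKernel.maj, ← lintegral_add_left,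
        ← lintegral_const_mul]
      · apply lintegral_mono
        intro x
        have := sobWeight_le_add hs0 hs1 ω.1 x.2.2 (N.b (ω, x)).1 ω.2 x.1
        dsimp only
        calc _ = (‖N.κ (ω, x)‖ₑ * (‖f (N.a (ω, x))‖ₑ * ‖g (N.b (ω, x))‖ₑ)) * sobWeight s (ω.1, ω.2) :=
              mul_comm _ _
          _ ≤ (‖N.κ (ω, x)‖ₑ * (‖f (N.a (ω, x))‖ₑ * ‖g (N.b (ω, x))‖ₑ)) *
              (sobWeight s (N.a (ω, x)) + sobWeight s (N.b (ω, x))) := by gcongr; exact this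
          _ = _ := by ring
      · exact (N.measurable_integrand mf mg).comp measurable_prodMk_left
      · exact (N.measurable_integrand (mJ.mul mf) mg).comp measurable_prodMk_left
    have h4 : ‖modSob h s (modBil hK hε h1 h2 hB f g) ω‖ₑ ≤ a ω + b ω := by
      rw [e]
      refine le_trans ?_ h3
      gcongr
      exact hω
    calc _ ≤ (a ω + b ω) ^ 2 := by gcongr
      _ ≤ 2 * (a ω ^ 2 + b ω ^ 2) := by
        have := ENNReal.rpow_add_le_mul_rpow_add_rpow (a ω) (b ω) (p := 2) (by norm_num)
        norm_num at this
        exact_mod_cast this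
  have e1 : ∫⁻ ω, a ω ^ 2 ∂modMeasure h ≤
      ENNReal.ofReal (6912 * √B) ^ 2 * (‖modSob h s f‖ₑ ^ 2 * ‖g‖ₑ ^ 2) := by
    have := N.bound _ _ (mJ.mul mf) mg
    simp only [Pi.mul_apply] at this
    rwa [lintegral_sobWeight_mul_sq, lintegral_enorm_sq g] at this
  have e2 : ∫⁻ ω, b ω ^ 2 ∂modMeasure h ≤
      ENNReal.ofReal (6912 * √B) ^ 2 * (‖f‖ₑ ^ 2 * ‖modSob h s g‖ₑ ^ 2) := by
    have := N.bound _ _ mf (mJ.mul mg)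
    simp only [Pi.mul_apply] at this
    rwa [lintegral_sobWeight_mul_sq, lintegral_enorm_sq f] at this
  have e3 := lintegral_mono_ae pt
  rw [lintegral_enorm_sq, lintegral_const_mul _ (by fun_prop), lintegral_add_left (by fun_prop)] at e3
  set c := ENNReal.ofReal (6912 * √B) with hc
  have e4 : ‖modSob h s (modBil hK hε h1 h2 hB f g)‖ₑ ≤
      2 * c * (‖modSob h s f‖ₑ * ‖g‖ₑ + ‖f‖ₑ * ‖modSob h s g‖ₑ) := by
    rw [← ENNReal.pow_le_pow_left_iff two_ne_zero]
    refine e3.trans ?_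
    calc 2 * (∫⁻ ω, a ω ^ 2 ∂modMeasure h + ∫⁻ ω, b ω ^ 2 ∂modMeasure h)
        ≤ 2 * (c ^ 2 * (‖modSob h s f‖ₑ ^ 2 * ‖g‖ₑ ^ 2) +
          c ^ 2 * (‖f‖ₑ ^ 2 * ‖modSob h s g‖ₑ ^ 2)) := by gcongr
      _ ≤ 2 * (c ^ 2 * (‖modSob h s f‖ₑ ^ 2 * ‖g‖ₑ ^ 2) +
          c ^ 2 * (‖f‖ₑ ^ 2 * ‖modSob h s g‖ₑ ^ 2)) + (2 * (c ^ 2 * (‖modSob h s f‖ₑ ^ 2 * ‖g‖ₑ ^ 2) +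
          c ^ 2 * (‖f‖ₑ ^ 2 * ‖modSob h s g‖ₑ ^ 2)) + 8 * (c ^ 2 * (‖modSob h s f‖ₑ * ‖g‖ₑ *
            (‖f‖ₑ * ‖modSob h s g‖ₑ)))) := le_self_add
      _ = _ := by ring
  have e5 := ENNReal.toReal_mono (by finiteness) e4
  rw [ENNReal.toReal_mul, ENNReal.toReal_mul, ENNReal.toReal_add (by finiteness) (by finiteness),
    ENNReal.toReal_mul, ENNReal.toReal_mul, hc, ENNReal.toReal_ofReal (by positivity)] at e5
  simpa only [toReal_enorm, ENNReal.toReal_ofNat] using e5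
end
end

/-! ### Fourier transforms in time -/

theorem fourier_eq_integral_modChar (f : ℝ → ℂ) (σ : ℝ) : 𝓕 f σ = ∫ t, modChar (-σ) t * f t := by
  rw [Real.fourier_real_eq_integral_exp_smul]
  congr 1; ext t
  rw [modChar, smul_eq_mul]
  congr 3; push_cast; ring

theorem fourierInv_eq_integral_modChar (f : ℝ → ℂ) (t : ℝ) :
    𝓕⁻ f t = ∫ σ, modChar t σ * f σ := by
  rw [Real.fourierInv_eq']
  congr 1; ext σ
  rw [modChar, smul_eq_mul]
  congr 3; simp; ring

/-- The exponential decay on the positive half line. -/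
def decay (K : ℝ) : ℝ → ℂ := indicator (Ioi 0) fun t => Complex.exp (-(K * t : ℝ))

theorem integrable_decay {K : ℝ} (hK : 0 < K) : Integrable (decay K) := by
  rw [decay, integrable_indicator_iff measurableSet_Ioi]
  have := integrableOn_exp_mul_complex_Ioi (a := -(K : ℂ)) (by simpa using hK) 0
  refine this.congr_fun (fun t _ => ?_) measurableSet_Ioi
  push_cast; ring_nf

theorem fourier_decay {K : ℝ} (hK : 0 < K) (σ : ℝ) :
    𝓕 (decay K) σ = 1 / ((K : ℂ) + (2 * Real.pi * σ : ℝ) * Complex.I) := by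
  rw [fourier_eq_integral_modChar]
  have e : (fun t => modChar (-σ) t * decay K t) = indicator (Ioi 0) fun t : ℝ =>
      Complex.exp (-((K : ℂ) + (2 * Real.pi * σ : ℝ) * Complex.I) * t) := by
    ext t
    rw [decay]
    by_cases ht : t ∈ Ioi (0 : ℝ)
    · rw [indicator_of_mem ht, indicator_of_mem ht, modChar, ← Complex.exp_add]
      congr 1; push_cast; ring
    · rw [indicator_of_notMem ht, indicator_of_notMem ht, mul_zero]
  rw [e, integral_indicator measurableSet_Ioi, integral_exp_mul_complex_Ioi (by simpa using hK)]
  rw [Complex.ofReal_zero, mul_zero, Complex.exp_zero, neg_div_neg_eq]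

theorem fourier_exp_neg_abs {K : ℝ} (hK : 0 < K) (σ : ℝ) :
    𝓕 (fun t : ℝ => Complex.exp (-(K * |t| : ℝ))) σ =
      ((2 * K / (K ^ 2 + (2 * Real.pi * σ) ^ 2) : ℝ) : ℂ) := by
  rw [fourier_eq_integral_modChar]
  have d : ∀ σ t, modChar (-σ) t * decay K t = indicator (Ioi 0) (fun t : ℝ =>
      modChar (-σ) t * Complex.exp (-(K * t : ℝ))) t := fun σ t => by
    rw [decay]
    by_cases ht : t ∈ Ioi (0 : ℝ)
    · rw [indicator_of_mem ht, indicator_of_mem ht]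
    · rw [indicator_of_notMem ht, indicator_of_notMem ht, mul_zero]
  have i1 : Integrable fun t => modChar (-σ) t * decay K t := by
    apply (integrable_decay hK).bdd_mul (c := 1)
    · exact (continuous_modChar_right _).aestronglyMeasurable
    · exact .of_forall fun t => (norm_modChar _ _).le
  have i2 : Integrable fun t => modChar (- -σ) t * decay K t := by
    apply (integrable_decay hK).bdd_mul (c := 1)
    · exact (continuous_modChar_right _).aestronglyMeasurable
    · exact .of_forall fun t => (norm_modChar _ _).le
  have e : (fun t => modChar (-σ) t * Complex.exp (-(K * |t| : ℝ))) =ᵐ[volume]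
      fun t => modChar (-σ) t * decay K t + modChar (- -σ) (-t) * decay K (-t) := by
    filter_upwards [Measure.ae_ne volume (0 : ℝ)] with t ht
    have h2 : modChar (- -σ) (-t) = modChar (-σ) t := by
      unfold modChar; congr 3; ring
    rcases lt_or_gt_of_ne ht with h | h
    · rw [h2, decay, indicator_of_notMem (by simpa using h.le), indicator_of_mem (by simpa using h),
        abs_of_neg h, mul_zero, zero_add]
    · rw [decay, indicator_of_mem (by simpa using h), indicator_of_notMem (by simpa using h.le),
        abs_of_pos h, mul_zero, add_zero]
  rw [integral_congr_ae e, integral_add i1 i2.comp_neg,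
    integral_neg_eq_self (fun t => modChar (- -σ) t * decay K t), ← fourier_eq_integral_modChar,
    ← fourier_eq_integral_modChar, fourier_decay hK, fourier_decay hK]
  have n1 : (K : ℂ) + (2 * Real.pi * σ : ℝ) * Complex.I ≠ 0 := by
    intro h0; have := congrArg Complex.re h0; simp at this; exact hK.ne' this
  have n2 : (K : ℂ) + (2 * Real.pi * -σ : ℝ) * Complex.I ≠ 0 := by
    intro h0; have := congrArg Complex.re h0; simp at this; exact hK.ne' this
  have n3 : ((K : ℂ) ^ 2 + (2 * Real.pi * σ) ^ 2) ≠ 0 := by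
    have : K ^ 2 + (2 * Real.pi * σ) ^ 2 ≠ 0 := by positivity
    exact_mod_cast this
  have n4 : ((K : ℂ) + (2 * Real.pi * σ : ℝ) * Complex.I) *
      ((K : ℂ) + (2 * Real.pi * -σ : ℝ) * Complex.I) = (K : ℂ) ^ 2 + (2 * Real.pi * σ) ^ 2 := by
    push_cast
    linear_combination (-(2 * Real.pi * σ : ℂ) ^ 2) * Complex.I_sq
  rw [div_add_div _ _ n1 n2, n4]
  push_cast
  congr 1; ring

theorem integrable_poisson {K : ℝ} (hK : 0 < K) :
    Integrable fun σ : ℝ => ((2 * K / (K ^ 2 + (2 * Real.pi * σ) ^ 2) : ℝ) : ℂ) := by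
  have : Fact ((0 : ℝ) < 1) := ⟨one_pos⟩
  refine (((integrable_modDensity (h := 1) hK).const_mul 4).mono' ?_ (.of_forall fun σ => ?_))
  · apply Measurable.aestronglyMeasurable; fun_prop
  · rw [Complex.norm_real, Real.norm_eq_abs, abs_of_nonneg (by positivity)]
    exact poisson_le_modDensity hK σ

/-- The Poisson kernel is the inverse transform of the two-sided exponential. -/
theorem integral_modChar_poisson {K : ℝ} (hK : 0 < K) (t : ℝ) :
    ∫ σ, modChar t σ * ((2 * K / (K ^ 2 + (2 * Real.pi * σ) ^ 2) : ℝ) : ℂ) =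
      Complex.exp (-(K * |t| : ℝ)) := by
  have c : Continuous fun t : ℝ => Complex.exp (-(K * |t| : ℝ)) := by fun_prop
  have e := funext (fourier_exp_neg_abs hK)
  have i : Integrable fun t : ℝ => Complex.exp (-(K * |t| : ℝ)) := by
    have hd := integrable_decay hK
    refine (hd.add hd.comp_neg).congr ?_
    filter_upwards [Measure.ae_ne volume (0 : ℝ)] with t ht
    rcases lt_or_gt_of_ne ht with h | h
    · rw [Pi.add_apply, decay, indicator_of_notMem (by simpa using h.le),
        indicator_of_mem (by simpa using h), abs_of_neg h, zero_add]
    · rw [Pi.add_apply, decay, indicator_of_mem (by simpa using h),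
        indicator_of_notMem (by simpa using h.le), abs_of_pos h, add_zero]
  have h3 := congrFun (c.fourierInv_fourier_eq i (by rw [e]; exact integrable_poisson hK)) t
  rwa [e, fourierInv_eq_integral_modChar] at h3

theorem modChar_add_left (s t σ : ℝ) : modChar (s + t) σ = modChar s σ * modChar t σ := by
  rw [modChar, modChar, modChar, ← Complex.exp_add]
  congr 1; push_cast; ring

theorem modChar_add_right (t σ τ : ℝ) : modChar t (σ + τ) = modChar t σ * modChar t τ := by
  rw [modChar, modChar, modChar, ← Complex.exp_add]
  congr 1; push_cast; ring

/-- The time cut-off equals `e^{Kt}` up to the time `1 / K`. -/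
theorem integral_modChar_timeKernel {K : ℝ} (hK : 0 < K) {t : ℝ} (ht : t ≤ 1 / K) :
    ∫ μ, modChar t μ * timeKernel K μ = Complex.exp (K * t : ℝ) := by
  have e : ∀ μ, modChar t μ * timeKernel K μ = (Real.exp 1 : ℂ) * (modChar (t + -(1 / K)) μ *
      ((2 * K / (K ^ 2 + (2 * Real.pi * μ) ^ 2) : ℝ) : ℂ)) := by
    intro μ
    rw [modChar_add_left, timeKernel]; push_cast; ring
  simp only [e]
  rw [integral_const_mul, integral_modChar_poisson hK, abs_of_nonpos (by linarith),
    Complex.ofReal_exp, ← Complex.exp_add]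
  congr 1
  have : (K : ℂ) ≠ 0 := by exact_mod_cast hK.ne'
  push_cast
  field_simp
  ring

/-- The `L²` Fourier transform of an integrable function is its Fourier integral. -/
theorem coeFn_fourier_toLp {c : ℝ → ℂ} (h1 : Integrable c) (h2 : MemLp c 2) :
    (𝓕 (h2.toLp : Lp ℂ 2 (volume : Measure ℝ)) : Lp ℂ 2 (volume : Measure ℝ)) =ᵐ[volume] 𝓕 c := by
  have hc : Continuous (𝓕 c) := VectorFourier.fourierIntegral_continuous
    Real.continuous_fourierChar continuous_inner h1
  apply ae_eq_of_integral_contDiff_smul_eq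
    ((Lp.memLp _).locallyIntegrable (by norm_num)) hc.locallyIntegrable
  intro g g1 g2
  set φ : SchwartzMap ℝ ℂ := (g2.comp_left (g := ((↑) : ℝ → ℂ)) (by simp)).toSchwartzMap
    (Complex.ofRealCLM.contDiff.comp g1) with hφ
  have e0 : ∀ x, φ x = (g x : ℂ) := fun x => rfl
  have e1 := congrArg (fun T => T φ)
    (Lp.fourier_toTemperedDistribution_eq (h2.toLp : Lp ℂ 2 (volume : Measure ℝ)))
  simp only [TemperedDistribution.fourier_apply, Lp.toTemperedDistribution_apply] at e1
  have e2 : ∫ x, 𝓕 (φ : ℝ → ℂ) x • c x = ∫ x, φ x • 𝓕 c x :=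
by
    simpa using! VectorFourier.integral_fourierIntegral_smul_eq_flip (L := innerₗ ℝ)
      Real.continuous_fourierChar continuous_inner φ.integrable h1
  have e3 : ∫ x, (𝓕 φ) x • (h2.toLp : Lp ℂ 2 (volume : Measure ℝ)) x =
      ∫ x, 𝓕 (φ : ℝ → ℂ) x • c x := by
    apply integral_congr_ae
    filter_upwards [h2.coeFn_toLp] with x hx
    rw [hx, SchwartzMap.fourier_coe]
  rw [e3, e2] at e1
  simpa [e0] using e1.symm

/-! ### Reconstruction of the bilinear operator -/

section
variable {h : ℝ}

/-- The integrand of the space-time convolution of `a` and `b` with the time cut-off `P`, for a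
fixed output frequency `ξ`; the variables are `(σ, (ξ₁, (μ, σ₁)))`. -/
def stConv (P : ℝ → ℂ) (a b : ℝ × Freq h → ℂ) (φ : Freq h → ℝ) (ξ : Freq h)
    (z : ℝ × (Freq h × (ℝ × ℝ))) : ℂ :=
  P z.2.2.1 * (a (z.2.2.2, z.2.1) * b (z.1 - z.2.2.1 - z.2.2.2 - φ z.2.1, ξ - z.2.1))

variable {P : ℝ → ℂ} {a b : ℝ × Freq h → ℂ} {φ : Freq h → ℝ} {ξ : Freq h}

theorem measurable_stConv (mP : Measurable P) (ma : Measurable a) (mb : Measurable b)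
    (mφ : Measurable φ) : Measurable (stConv P a b φ ξ) := by
  unfold stConv; fun_prop

variable [hh : Fact (0 < h)]

theorem integrable_stConv (mP : Measurable P) (ma : Measurable a) (mb : Measurable b)
    (mφ : Measurable φ) (hP : ∫⁻ μ, ‖P μ‖ₑ ≠ ∞)
    (hab : ∫⁻ ξ₁, (∫⁻ σ, ‖a (σ, ξ₁)‖ₑ) * (∫⁻ σ, ‖b (σ, ξ - ξ₁)‖ₑ) ∂haarFreq h ≠ ∞) :
    Integrable (stConv P a b φ ξ)
      ((volume : Measure ℝ).prod ((haarFreq h).prod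
        ((volume : Measure ℝ).prod (volume : Measure ℝ)))) := by
  have m := measurable_stConv (ξ := ξ) mP ma mb mφ
  refine ⟨m.aestronglyMeasurable, ?_⟩
  rw [hasFiniteIntegral_iff_enorm, lintegral_prod_symm _ m.enorm.aemeasurable]
  have e1 : ∀ x : Freq h × (ℝ × ℝ), ∫⁻ σ, ‖stConv P a b φ ξ (σ, x)‖ₑ =
      ‖P x.2.1‖ₑ * (‖a (x.2.2, x.1)‖ₑ * ∫⁻ σ, ‖b (σ, ξ - x.1)‖ₑ) := by
    intro x
    simp only [stConv, enorm_mul]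
    rw [lintegral_const_mul _ (by fun_prop), lintegral_const_mul _ (by fun_prop)]
    congr 2
    rw [← lintegral_sub_right_eq_self (fun σ => ‖b (σ, ξ - x.1)‖ₑ) (x.2.1 + x.2.2 + φ x.1)]
    apply lintegral_congr
    intro σ
    congr 3
    ring
  simp only [e1]
  have mb' : Measurable fun ξ₁ : Freq h => ∫⁻ σ, ‖b (σ, ξ - ξ₁)‖ₑ := by
    have : Measurable fun p : ℝ × Freq h => ‖b (p.1, ξ - p.2)‖ₑ := by fun_prop
    exact this.lintegral_prod_left'
  have m2 : Measurable fun x : Freq h × (ℝ × ℝ) =>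
      ‖P x.2.1‖ₑ * (‖a (x.2.2, x.1)‖ₑ * ∫⁻ σ, ‖b (σ, ξ - x.1)‖ₑ) := by fun_prop
  rw [lintegral_prod _ m2.aemeasurable]
  have e2 : ∀ ξ₁ : Freq h, ∫⁻ y : ℝ × ℝ, ‖P y.1‖ₑ * (‖a (y.2, ξ₁)‖ₑ * ∫⁻ σ, ‖b (σ, ξ - ξ₁)‖ₑ)
      ∂(volume : Measure ℝ).prod volume =
      (∫⁻ μ, ‖P μ‖ₑ) * ((∫⁻ σ, ‖a (σ, ξ₁)‖ₑ) * ∫⁻ σ, ‖b (σ, ξ - ξ₁)‖ₑ) := by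
    intro ξ₁
    rw [lintegral_prod_mul (f := fun μ => ‖P μ‖ₑ)
      (g := fun σ => ‖a (σ, ξ₁)‖ₑ * ∫⁻ σ, ‖b (σ, ξ - ξ₁)‖ₑ) (by fun_prop) (by fun_prop),
      lintegral_mul_const _ (by fun_prop)]
  simp only [e2]
  rw [lintegral_const_mul' _ _ hP]
  exact ENNReal.mul_lt_top hP.lt_top hab.lt_top

/-- The time transform of a space-time convolution factorizes. -/
theorem integral_modChar_stConv (mP : Measurable P) (ma : Measurable a) (mb : Measurable b)
    (mφ : Measurable φ) (hP : ∫⁻ μ, ‖P μ‖ₑ ≠ ∞)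
    (hab : ∫⁻ ξ₁, (∫⁻ σ, ‖a (σ, ξ₁)‖ₑ) * (∫⁻ σ, ‖b (σ, ξ - ξ₁)‖ₑ) ∂haarFreq h ≠ ∞) (t : ℝ) :
    ∫ σ, modChar t σ * ∫ x, stConv P a b φ ξ (σ, x)
        ∂(haarFreq h).prod ((volume : Measure ℝ).prod (volume : Measure ℝ)) =
      (∫ μ, modChar t μ * P μ) * ∫ ξ₁, modChar t (φ ξ₁) *
        ((∫ σ, modChar t σ * a (σ, ξ₁)) * ∫ σ, modChar t σ * b (σ, ξ - ξ₁)) ∂haarFreq h := by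
  have hint := integrable_stConv (ξ := ξ) mP ma mb mφ hP hab
  have hint2 : Integrable (fun z : ℝ × (Freq h × (ℝ × ℝ)) => modChar t z.1 * stConv P a b φ ξ z)
      ((volume : Measure ℝ).prod ((haarFreq h).prod
        ((volume : Measure ℝ).prod (volume : Measure ℝ)))) :=
    hint.bdd_mul (c := 1) ((continuous_modChar_right t).comp continuous_fst).aestronglyMeasurable
      (.of_forall fun z => (norm_modChar _ _).le)
  conv_lhs => simp only [← integral_const_mul]
  rw [integral_integral_swap hint2]
  have e1 : ∀ x : Freq h × (ℝ × ℝ), ∫ σ, modChar t σ * stConv P a b φ ξ (σ, x) =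
      (modChar t x.2.1 * P x.2.1) * ((modChar t x.2.2 * a (x.2.2, x.1)) *
        (modChar t (φ x.1) * ∫ σ, modChar t σ * b (σ, ξ - x.1))) := by
    intro x
    have e := integral_sub_right_eq_self (μ := (volume : Measure ℝ))
      (fun σ => modChar t σ * b (σ, ξ - x.1)) (x.2.1 + x.2.2 + φ x.1)
    rw [← e, ← integral_const_mul, ← integral_const_mul, ← integral_const_mul]
    congr 1
    ext σ
    have h1 : modChar t σ = modChar t (σ - (x.2.1 + x.2.2 + φ x.1)) *
        (modChar t x.2.1 * modChar t x.2.2 * modChar t (φ x.1)) := by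
      rw [← modChar_add_right, ← modChar_add_right, ← modChar_add_right]; congr 1; ring
    rw [h1, stConv]
    simp only [sub_sub]
    ring
  have hint3 := hint2.integral_prod_right
  simp only [e1] at hint3 ⊢
  rw [integral_prod _ hint3]
  have e2 : ∀ ξ₁ : Freq h, ∫ y : ℝ × ℝ, (modChar t y.1 * P y.1) * ((modChar t y.2 * a (y.2, ξ₁)) *
        (modChar t (φ ξ₁) * ∫ σ, modChar t σ * b (σ, ξ - ξ₁))) ∂(volume : Measure ℝ).prod volume =
      (∫ μ, modChar t μ * P μ) * (modChar t (φ ξ₁) *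
        ((∫ σ, modChar t σ * a (σ, ξ₁)) * ∫ σ, modChar t σ * b (σ, ξ - ξ₁))) := by
    intro ξ₁
    rw [integral_prod_mul (fun μ => modChar t μ * P μ) (fun σ => (modChar t σ * a (σ, ξ₁)) *
        (modChar t (φ ξ₁) * ∫ σ, modChar t σ * b (σ, ξ - ξ₁))), integral_mul_const]
    ring
  simp only [e2]
  rw [integral_const_mul]

/-- The solution operator of the damped equation `y' + K y = e^{2πiσt}`, with zero initial value. -/
theorem exp_modChar_eq_integral {K : ℝ} (hK : 0 < K) (t σ : ℝ) :
    (modChar t σ - Complex.exp (-(K * t : ℝ))) / ((K : ℂ) + (2 * Real.pi * σ : ℝ) * Complex.I) =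
      ∫ τ in (0 : ℝ)..t, Complex.exp (-(K * (t - τ) : ℝ)) * modChar τ σ := by
  set w : ℂ := (K : ℂ) + (2 * Real.pi * σ : ℝ) * Complex.I with hw
  have n1 : w ≠ 0 := by
    intro h0; have := congrArg Complex.re h0; simp [hw] at this; exact hK.ne' this
  have e : ∀ τ : ℝ, Complex.exp (-(K * (t - τ) : ℝ)) * modChar τ σ =
      Complex.exp (-(K * t : ℝ)) * Complex.exp (w * τ) := by
    intro τ
    rw [modChar, ← Complex.exp_add, ← Complex.exp_add]
    congr 1; rw [hw]; push_cast; ring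
  simp only [e]
  rw [intervalIntegral.integral_const_mul, integral_exp_mul_complex n1, Complex.ofReal_zero, mul_zero,
    Complex.exp_zero, mul_div_assoc', mul_sub, ← Complex.exp_add, mul_one]
  congr 3
  rw [modChar]; congr 1; rw [hw]; push_cast; ring

/-- The Duhamel formula on the side of the modulations. -/
theorem integral_modChar_sub_div {K : ℝ} (hK : 0 < K) (t : ℝ) {N : ℝ → ℂ} (hN : Integrable N) :
    ∫ σ, (modChar t σ - Complex.exp (-(K * t : ℝ))) /
        ((K : ℂ) + (2 * Real.pi * σ : ℝ) * Complex.I) * N σ =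
      ∫ τ in (0 : ℝ)..t, Complex.exp (-(K * (t - τ) : ℝ)) * ∫ σ, modChar τ σ * N σ := by
  simp only [exp_modChar_eq_integral hK]
  simp only [← intervalIntegral.integral_mul_const]
  have c1 : Continuous fun p : ℝ × ℝ => Complex.exp (-(K * (t - p.1) : ℝ)) * modChar p.1 p.2 :=
    (by fun_prop : Continuous fun p : ℝ × ℝ => Complex.exp (-(K * (t - p.1) : ℝ))).mul continuous_modChar
  rw [← intervalIntegral_integral_swap]
  · apply intervalIntegral.integral_congr
    intro τ _
    simp only [mul_assoc]
    rw [integral_const_mul]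
  · have : IsFiniteMeasure ((volume : Measure ℝ).restrict (uIoc 0 t)) := by
      unfold uIoc; infer_instance
    have i1 : Integrable (fun p : ℝ × ℝ => N p.2) ((volume.restrict (uIoc 0 t)).prod volume) :=
      hN.comp_snd _
    obtain ⟨c, hc⟩ := (isCompact_uIcc (a := (0 : ℝ)) (b := t)).exists_bound_of_continuousOn
      (f := fun τ : ℝ => Complex.exp (-(K * (t - τ) : ℝ))) (by fun_prop)
    apply i1.bdd_mul (c := c) c1.aestronglyMeasurable
    have : ∀ᵐ p ∂((volume.restrict (uIoc 0 t)).prod (volume : Measure ℝ)), p.1 ∈ uIoc 0 t :=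
      Measure.quasiMeasurePreserving_fst.ae (ae_restrict_mem measurableSet_uIoc)
    filter_upwards [this] with p hp
    rw [norm_mul, norm_modChar, mul_one]
    exact hc _ (uIoc_subset_uIcc hp)

/-- The modulation density times a function on the modulation space. -/
def modWeighted (h : ℝ) [Fact (0 < h)] (K : ℝ) (f : ModL2 h) (p : ℝ × Freq h) : ℂ :=
  ((√(modDensity h K p.1) : ℝ) : ℂ) * f p

@[fun_prop]
theorem measurable_modWeighted (K : ℝ) (f : ModL2 h) : Measurable (modWeighted h K f) := by
  have := (Lp.stronglyMeasurable f).measurable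
  unfold modWeighted; fun_prop

/-- The value of a reconstructed profile at a frequency. -/
def modRecFun (h : ℝ) [Fact (0 < h)] (K : ℝ) (f : ModL2 h) (t : ℝ) (ξ : Freq h) : ℂ :=
  ∫ σ, modChar t σ * modWeighted h K f (σ, ξ)

theorem coeFn_modRec_modRecFun {K : ℝ} (hK : 0 < K) (t : ℝ) (f : ModL2 h) :
    modRec h K t f =ᵐ[haarFreq h] modRecFun h K f t := by
  filter_upwards [coeFn_modRec hK t f (Lp.stronglyMeasurable f) (Filter.EventuallyEq.refl _ _)]
    with ξ hξ
  rw [hξ, modRecFun]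
  congr 1; ext σ; rw [recFun, modWeighted]; ring

/-- The `L¹` norm in the modulation is controlled in `L²` in the frequency. -/
theorem lintegral_modWeighted_sq_le {K : ℝ} (hK : 0 < K) (f : ModL2 h) :
    ∫⁻ ξ, (∫⁻ σ, ‖modWeighted h K f (σ, ξ)‖ₑ) ^ 2 ∂haarFreq h ≤ (4 * ‖f‖ₑ) ^ 2 := by
  have hρ := isDensity_modDensity hh.out hK
  have mf := (Lp.stronglyMeasurable f).measurable.enorm
  calc ∫⁻ ξ, (∫⁻ σ, ‖modWeighted h K f (σ, ξ)‖ₑ) ^ 2 ∂haarFreq h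
      ≤ ∫⁻ ξ, ENNReal.ofReal 12 * (∫⁻ σ, ‖f (σ, ξ)‖ₑ ^ 2) ∂haarFreq h := by
        apply lintegral_mono
        intro ξ
        simp only [modWeighted, enorm_mul]
        refine (sq_lintegral_mul_le volume (by fun_prop)
          (mf.comp (measurable_id.prodMk measurable_const)).aemeasurable).trans ?_
        apply mul_le_mul' _ le_rfl
        refine le_trans (le_of_eq ?_) hρ.lintegral_le
        apply lintegral_congr
        intro σ
        rw [← ofReal_norm, ← ENNReal.ofReal_pow (norm_nonneg _), Complex.norm_real,
          Real.norm_eq_abs, sq_abs, Real.sq_sqrt (modDensity_pos hh.out hK σ).le]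
    _ = ENNReal.ofReal 12 * ‖f‖ₑ ^ 2 := by
        rw [lintegral_const_mul _ (mf.pow_const 2).lintegral_prod_left', ← lintegral_enorm_sq,
          lintegral_prod_symm _ (mf.pow_const 2).aemeasurable]
    _ ≤ 16 * ‖f‖ₑ ^ 2 := by
        gcongr
        rw [show (16 : ℝ≥0∞) = ENNReal.ofReal 16 by norm_num]
        exact ENNReal.ofReal_le_ofReal (by norm_num)
    _ = _ := by ring

theorem lintegral_modWeighted_conv_le {K : ℝ} (hK : 0 < K) (f g : ModL2 h) (ξ : Freq h) :
    ∫⁻ ξ₁, (∫⁻ σ, ‖modWeighted h K f (σ, ξ₁)‖ₑ) * (∫⁻ σ, ‖modWeighted h K g (σ, ξ - ξ₁)‖ₑ)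
      ∂haarFreq h ≤ 4 * ‖f‖ₑ * (4 * ‖g‖ₑ) := by
  have mL : ∀ f : ModL2 h, Measurable fun ξ => ∫⁻ σ, ‖modWeighted h K f (σ, ξ)‖ₑ := fun f =>
    (measurable_modWeighted K f).enorm.lintegral_prod_left'
  have mg : Measurable fun ξ₁ => ∫⁻ σ, ‖modWeighted h K g (σ, ξ - ξ₁)‖ₑ :=
    (mL g).comp (measurable_const.sub measurable_id)
  rw [← ENNReal.pow_le_pow_left_iff two_ne_zero]
  refine (sq_lintegral_mul_le _ (mL f).aemeasurable mg.aemeasurable).trans ?_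
  rw [mul_pow]
  apply mul_le_mul' (lintegral_modWeighted_sq_le hK f)
  rw [lintegral_sub_left_eq_self (fun ξ => (∫⁻ σ, ‖modWeighted h K g (σ, ξ)‖ₑ) ^ 2) ξ]
  exact lintegral_modWeighted_sq_le hK g

/-- The convolution in frequency which describes the interaction of two reconstructed profiles. -/
def recConv (h : ℝ) [Fact (0 < h)] (K ε : ℝ) (q₁ q₂ : ℝ → ℝ) (f g : ModL2 h) (t : ℝ) (ξ : Freq h) :
    ℂ :=
  ∫ ξ₁, modChar t (resonance h ε q₁ q₂ ξ ξ₁) *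
    (modRecFun h K f t ξ₁ * modRecFun h K g t (ξ - ξ₁)) ∂haarFreq h

theorem enorm_modRecFun_le (K : ℝ) (f : ModL2 h) (t : ℝ) (ξ : Freq h) :
    ‖modRecFun h K f t ξ‖ₑ ≤ ∫⁻ σ, ‖modWeighted h K f (σ, ξ)‖ₑ := by
  refine (enorm_integral_le_lintegral_enorm _).trans_eq ?_
  apply lintegral_congr
  intro σ
  rw [enorm_mul, ← ofReal_norm (modChar t σ), norm_modChar, ENNReal.ofReal_one, one_mul]

theorem norm_recConv_le {K : ℝ} (hK : 0 < K) (ε : ℝ) (q₁ q₂ : ℝ → ℝ) (f g : ModL2 h) (t : ℝ)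
    (ξ : Freq h) : ‖recConv h K ε q₁ q₂ f g t ξ‖ ≤ 4 * ‖f‖ * (4 * ‖g‖) := by
  have h1 : ‖recConv h K ε q₁ q₂ f g t ξ‖ₑ ≤ 4 * ‖f‖ₑ * (4 * ‖g‖ₑ) := by
    refine (enorm_integral_le_lintegral_enorm _).trans
      (le_trans (lintegral_mono fun ξ₁ => ?_) (lintegral_modWeighted_conv_le hK f g ξ))
    rw [enorm_mul, enorm_mul, ← ofReal_norm (modChar _ _), norm_modChar, ENNReal.ofReal_one, one_mul]
    gcongr <;> exact enorm_modRecFun_le _ _ _ _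
  have := ENNReal.toReal_mono (by finiteness) h1
  simpa using this

/-- The output multiplier without the modulation. -/
def outMult (h : ℝ) [Fact (0 < h)] (ε : ℝ) (ξ : Freq h) : ℂ :=
  (((√h)⁻¹ * -(ε / 4) : ℝ) : ℂ) * nablaSymbol h (rep ξ)

theorem stronglyMeasurable_modRecFun (K : ℝ) (f : ModL2 h) :
    StronglyMeasurable fun p : ℝ × Freq h => modRecFun h K f p.1 p.2 := by
  apply StronglyMeasurable.integral_prod_right
  have c := continuous_modChar.measurable
  have m : Measurable fun z : (ℝ × Freq h) × ℝ => modChar z.1.1 z.2 :=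
    c.comp (f := fun z : (ℝ × Freq h) × ℝ => (z.1.1, z.2)) (by fun_prop)
  have m2 : Measurable fun z : (ℝ × Freq h) × ℝ => modWeighted h K f (z.2, z.1.2) := by fun_prop
  exact (m.mul m2).stronglyMeasurable

theorem stronglyMeasurable_recConv (K ε : ℝ) {q₁ q₂ : ℝ → ℝ} (h1 : Measurable q₁)
    (h2 : Measurable q₂) (f g : ModL2 h) :
    StronglyMeasurable fun p : ℝ × Freq h => recConv h K ε q₁ q₂ f g p.1 p.2 := by
  apply StronglyMeasurable.integral_prod_right
  have c := continuous_modChar.measurable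
  have mr : Measurable fun z : (ℝ × Freq h) × Freq h => resonance h ε q₁ q₂ z.1.2 z.2 :=
    (measurable_resonance h1 h2).comp (f := fun z : (ℝ × Freq h) × Freq h => (z.1.2, z.2))
      (by fun_prop)
  have m : Measurable fun z : (ℝ × Freq h) × Freq h =>
      modChar z.1.1 (resonance h ε q₁ q₂ z.1.2 z.2) :=
    c.comp (f := fun z : (ℝ × Freq h) × Freq h => (z.1.1, resonance h ε q₁ q₂ z.1.2 z.2))
      (by fun_prop)
  have mf := (stronglyMeasurable_modRecFun K f).measurable.comp
    (f := fun z : (ℝ × Freq h) × Freq h => (z.1.1, z.2)) (by fun_prop)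
  have mg := (stronglyMeasurable_modRecFun K g).measurable.comp
    (f := fun z : (ℝ × Freq h) × Freq h => (z.1.1, z.1.2 - z.2)) (by fun_prop)
  exact (m.mul (mf.mul mg)).stronglyMeasurable

theorem coeFn_bil_modRec {K : ℝ} (hK : 0 < K) (ε : ℝ) {q₁ q₂ : ℝ → ℝ} (h1 : Continuous q₁)
    (h2 : Continuous q₂) (f g : ModL2 h) (t : ℝ) :
    bil h ε q₁ q₂ t (modRec h K t f) (modRec h K t g) =ᵐ[haarFreq h]
      fun ξ => outMult h ε ξ * recConv h K ε q₁ q₂ f g t ξ := by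
  have ef : symb h (flow (ε * t) q₁) (modRec h K t f) =ᵐ[haarFreq h]
      fun ξ => flow (ε * t) q₁ (rep ξ) * modRecFun h K f t ξ := by
    filter_upwards [coeFn_symb (continuous_flow (ε * t) h1) (modRec h K t f),
      coeFn_modRec_modRecFun hK t f] with ξ e1 e2
    rw [e1, e2]
  have eg : symb h (flow (ε * t) q₂) (modRec h K t g) =ᵐ[haarFreq h]
      fun ξ => flow (ε * t) q₂ (rep ξ) * modRecFun h K g t ξ := by
    filter_upwards [coeFn_symb (continuous_flow (ε * t) h2) (modRec h K t g),
      coeFn_modRec_modRecFun hK t g] with ξ e1 e2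
    rw [e1, e2]
  rw [bil]
  filter_upwards [coeFn_symb (continuous_outSymbol h ε t)
    (prodFreq (symb h (flow (ε * t) q₁) (modRec h K t f)) (symb h (flow (ε * t) q₂) (modRec h K t g))),
    coeFn_prodFreq (symb h (flow (ε * t) q₁) (modRec h K t f))
      (symb h (flow (ε * t) q₂) (modRec h K t g))] with ξ e1 e2
  rw [e1, e2, recConv, outSymbol, outMult]
  have e3 : ∫ ξ₁, symb h (flow (ε * t) q₁) (modRec h K t f) ξ₁ *
      symb h (flow (ε * t) q₂) (modRec h K t g) (ξ - ξ₁) ∂haarFreq h =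
      ∫ ξ₁, flow (ε * t) (dispersion h) (rep ξ) * (modChar t (resonance h ε q₁ q₂ ξ ξ₁) *
        (modRecFun h K f t ξ₁ * modRecFun h K g t (ξ - ξ₁))) ∂haarFreq h := by
    apply integral_congr_ae
    have qmp := quasiMeasurePreserving_sub_left (haarFreq h) ξ
    filter_upwards [ef, qmp.ae eg] with ξ₁ e4 e5
    have e6 : flow (ε * t) q₁ (rep ξ₁) * flow (ε * t) q₂ (rep (ξ - ξ₁)) =
        flow (ε * t) (dispersion h) (rep ξ) * modChar t (resonance h ε q₁ q₂ ξ ξ₁) := by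
      rw [flow, flow, flow, modChar, ← Complex.exp_add, ← Complex.exp_add, resonance]
      congr 1
      rw [← add_mul, ← add_mul, ← Complex.ofReal_add, ← Complex.ofReal_add]
      congr 2
      field_simp
      ring
    rw [e4, e5]
    linear_combination (modRecFun h K f t ξ₁ * modRecFun h K g t (ξ - ξ₁)) * e6
  rw [e3, integral_const_mul]
  have e7 : flow (-(ε * t)) (dispersion h) (rep ξ) * flow (ε * t) (dispersion h) (rep ξ) = 1 := by
    rw [flow, flow, ← Complex.exp_add, ← add_mul, ← Complex.ofReal_add]
    simp
  push_cast
  linear_combination ((-(ε / 4) : ℂ) * nablaSymbol h (rep ξ) * (√h : ℂ)⁻¹ *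
    ∫ ξ₁, modChar t (resonance h ε q₁ q₂ ξ ξ₁) *
        (modRecFun h K f t ξ₁ * modRecFun h K g t (ξ - ξ₁)) ∂haarFreq h) * e7

end

section
variable {h : ℝ} [hh : Fact (0 < h)]

variable {K : ℝ} (hK : 0 < K) {ε : ℝ} (hε : |ε| = 1) {q₁ q₂ : ℝ → ℝ}
    (h1 : Continuous q₁) (h2 : Continuous q₂) {B : ℝ} (hB : HasResonanceBound h K ε q₁ q₂ 0 B)

theorem coeFn_modRec_modBil_sub {t : ℝ} (ht : t ∈ Icc 0 (1 / K)) (f g : ModL2 h) :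
    (modRec h K t (modBil hK hε h1.measurable h2.measurable hB f g) -
      Complex.exp (-(K * t : ℝ)) • modRec h K 0 (modBil hK hε h1.measurable h2.measurable hB f g) :
        FreqL2 h) =ᵐ[haarFreq h]
    fun ξ => ∫ τ in (0 : ℝ)..t, (Complex.exp (-(K * (t - τ) : ℝ)) * Complex.exp (K * τ : ℝ)) *
      (outMult h ε ξ * recConv h K ε q₁ q₂ f g τ ξ) := by
  set N := bilIntKernel (h := h) hK hε h1.measurable h2.measurable hB with hN
  have mf := Lp.stronglyMeasurable f
  have mg := Lp.stronglyMeasurable g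
  have sraw := N.stronglyMeasurable_raw mf mg
  have hP : ∫⁻ μ, ‖timeKernel K μ‖ₑ ≠ ∞ :=
    ne_top_of_le_ne_top (by norm_num) (isDensity_timeKernel (h := h) hh.out hK).lintegral_le
  have n0 : ∀ σ : ℝ, (K : ℂ) + (2 * Real.pi * σ : ℝ) * Complex.I ≠ 0 := fun σ h0 => by
    have := congrArg Complex.re h0; simp at this; exact hK.ne' this
  have nK : ∀ σ : ℝ, K ≤ ‖(K : ℂ) + (2 * Real.pi * σ : ℝ) * Complex.I‖ := fun σ => by
    refine le_trans ?_ (Complex.abs_re_le_norm _)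
    simp [abs_of_pos hK]
  have cB : modBil hK hε h1.measurable h2.measurable hB f g =ᵐ[modMeasure h] N.raw f g :=
    N.coeFn_bilin f g
  filter_upwards [Lp.coeFn_sub (modRec h K t (modBil hK hε h1.measurable h2.measurable hB f g))
      (Complex.exp (-(K * t : ℝ)) • modRec h K 0 (modBil hK hε h1.measurable h2.measurable hB f g)),
    Lp.coeFn_smul (Complex.exp (-(K * t : ℝ)))
      (modRec h K 0 (modBil hK hε h1.measurable h2.measurable hB f g)),
    coeFn_modRec hK t _ sraw cB, coeFn_modRec hK 0 _ sraw cB]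
    with ξ e1 e2 e3 e4
  have mφ := measurable_resonance_right (h := h) (ε := ε) h1.measurable h2.measurable ξ
  have hab : ∫⁻ ξ₁, (∫⁻ σ, ‖modWeighted h K f (σ, ξ₁)‖ₑ) *
      (∫⁻ σ, ‖modWeighted h K g (σ, ξ - ξ₁)‖ₑ) ∂haarFreq h ≠ ∞ :=
    ne_top_of_le_ne_top (by finiteness) (lintegral_modWeighted_conv_le hK f g ξ)
  set M : ℝ → ℂ := fun σ => ∫ x, stConv (timeKernel K) (modWeighted h K f) (modWeighted h K g)
    (resonance h ε q₁ q₂ ξ) ξ (σ, x) ∂(haarFreq h).prod ((volume : Measure ℝ).prod volume) with hM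
  have hMi : Integrable M := (integrable_stConv (measurable_timeKernel K) (measurable_modWeighted K f)
    (measurable_modWeighted K g) mφ hP hab).integral_prod_left
  have hraw : ∀ s σ, recFun h K s σ * N.raw f g (σ, ξ) = outMult h ε ξ * (modChar s σ /
      ((K : ℂ) + (2 * Real.pi * σ : ℝ) * Complex.I) * M σ) := by
    intro s σ
    have hρ : ((√(modDensity h K σ) : ℝ) : ℂ) ≠ 0 := by
      exact_mod_cast (Real.sqrt_pos.2 (modDensity_pos hh.out hK σ)).ne'
    have := n0 σ
    rw [hM, IntKernel.raw, ← integral_const_mul, ← integral_const_mul, ← integral_const_mul]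
    congr 1
    ext x
    simp only [hN, bilIntKernel, bilKer, bilArg, stConv, modWeighted, outCoef, outMult, recFun]
    push_cast at this ⊢
    field_simp
  have hi : ∀ s, Integrable fun σ => modChar s σ /
      ((K : ℂ) + (2 * Real.pi * σ : ℝ) * Complex.I) * M σ := by
    intro s
    have := continuous_modChar_right s
    apply hMi.bdd_mul (c := 1 / K)
    · apply Measurable.aestronglyMeasurable
      have := this.measurable
      fun_prop
    · filter_upwards with σ
      rw [norm_div, norm_modChar]
      exact one_div_le_one_div_of_le hK (nK σ)
  rw [e1, Pi.sub_apply, e2, Pi.smul_apply, e3, e4, smul_eq_mul]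
  simp only [hraw]
  rw [integral_const_mul, integral_const_mul, mul_left_comm, ← mul_sub, ← integral_const_mul,
    ← integral_sub (hi t) ((hi 0).const_mul _)]
  have e5 : ∀ σ, modChar t σ / ((K : ℂ) + (2 * Real.pi * σ : ℝ) * Complex.I) * M σ -
      Complex.exp (-(K * t : ℝ)) * (modChar 0 σ / ((K : ℂ) + (2 * Real.pi * σ : ℝ) * Complex.I) * M σ)
      = (modChar t σ - Complex.exp (-(K * t : ℝ))) /
        ((K : ℂ) + (2 * Real.pi * σ : ℝ) * Complex.I) * M σ := by
    intro σ
    have : modChar 0 σ = 1 := by simp [modChar]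
    rw [this]; ring
  simp only [e5]
  rw [integral_modChar_sub_div hK t hMi, ← intervalIntegral.integral_const_mul]
  apply intervalIntegral.integral_congr
  intro τ hτ
  rw [uIcc_of_le ht.1] at hτ
  dsimp only
  rw [hM, integral_modChar_stConv (measurable_timeKernel K) (measurable_modWeighted K f)
    (measurable_modWeighted K g) mφ hP hab, integral_modChar_timeKernel hK (hτ.2.trans ht.2), recConv]
  simp only [modRecFun]
  ring

/-- The bilinear operator of the modulation space realizes the damped Duhamel integral of the
interaction of the reconstructed profiles. -/
theorem modRec_modBil {t : ℝ} (ht : t ∈ Icc 0 (1 / K)) (f g : ModL2 h) :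
    modRec h K t (modBil hK hε h1.measurable h2.measurable hB f g) -
      Complex.exp (-(K * t : ℝ)) • modRec h K 0 (modBil hK hε h1.measurable h2.measurable hB f g) =
    ∫ τ in (0 : ℝ)..t, (Complex.exp (-(K * (t - τ) : ℝ)) * Complex.exp (K * τ : ℝ)) •
      bil h ε q₁ q₂ τ (modRec h K τ f) (modRec h K τ g) := by
  apply val_ext
  intro n
  have cb := continuous_bil (h := h) ε h1 h2 (continuous_modRec hK f) (continuous_modRec hK g)
  have ci : Continuous fun τ : ℝ => (Complex.exp (-(K * (t - τ) : ℝ)) * Complex.exp (K * τ : ℝ)) •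
      bil h ε q₁ q₂ τ (modRec h K τ f) (modRec h K τ g) := by
    have c0 : Continuous fun τ : ℝ =>
      Complex.exp (-(K * (t - τ) : ℝ)) * Complex.exp (K * τ : ℝ) := by fun_prop
    exact c0.smul cb
  rw [val_congr_ae (coeFn_modRec_modBil_sub hK hε h1 h2 hB ht f g),
    ← valL_apply, ← ContinuousLinearMap.intervalIntegral_comp_comm _ (ci.intervalIntegrable (μ := volume) 0 t)]
  simp only [map_smul, valL_apply, val_congr_ae (coeFn_bil_modRec hK ε h1 h2 f g _), smul_eq_mul,
    ← intervalIntegral.integral_const_mul]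
  rw [← intervalIntegral_integral_swap, ← intervalIntegral.integral_const_mul]
  · apply intervalIntegral.integral_congr
    intro τ _
    dsimp only
    rw [mul_left_comm]
    congr 1
    rw [← integral_const_mul]
    congr 1; ext ξ; ring
  · have : IsFiniteMeasure ((volume : Measure ℝ).restrict (uIoc 0 t)) := by
      unfold uIoc; infer_instance
    obtain ⟨c, hc⟩ := (isCompact_uIcc (a := (0 : ℝ)) (b := t)).exists_bound_of_continuousOn
      (f := fun τ : ℝ => Complex.exp (-(K * (t - τ) : ℝ)) * Complex.exp (K * τ : ℝ)) (by fun_prop)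
    obtain ⟨d, hd⟩ := exists_bound_symbol h (continuous_nablaSymbol h)
    apply Integrable.of_bound (C := c * (‖(((√h)⁻¹ * -(ε / 4) : ℝ) : ℂ)‖ * d *
      (4 * ‖f‖ * (4 * ‖g‖))))
    · have m1 := (stronglyMeasurable_recConv (h := h) K ε h1.measurable h2.measurable f g).measurable
      have m2 : Measurable fun p : ℝ × Freq h => (fourier n p.2 : ℂ) :=
        (map_continuous (fourier n)).measurable.comp measurable_snd
      have m3 : Measurable fun p : ℝ × Freq h => outMult h ε p.2 := by unfold outMult; fun_prop
      have m4 : Measurable fun p : ℝ × Freq h =>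
        (Complex.exp (-(K * (t - p.1) : ℝ)) * Complex.exp (K * p.1 : ℝ)) := by fun_prop
      exact (m2.mul (m4.mul (m3.mul m1))).aestronglyMeasurable
    · have : ∀ᵐ p ∂((volume.restrict (uIoc 0 t)).prod (haarFreq h)), p.1 ∈ uIoc 0 t :=
        Measure.quasiMeasurePreserving_fst.ae (ae_restrict_mem measurableSet_uIoc)
      filter_upwards [this] with p hp
      have b1 := hc _ (uIoc_subset_uIcc hp)
      have b2 := hd (rep p.2) ⟨(rep_mem p.2).1.le, (rep_mem p.2).2⟩
      have b3 := norm_recConv_le hK ε q₁ q₂ f g p.1 p.2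
      have d0 := (norm_nonneg _).trans b2
      have c0 := (norm_nonneg _).trans b1
      simp only [Function.uncurry, norm_mul _ _, outMult] at b1 ⊢
      rw [show ‖(fourier n p.2 : ℂ)‖ = 1 from Circle.norm_coe _, one_mul]
      gcongr
end

/-! ### Embedding of a continuous forcing term into the modulation space -/

/-- The restriction of a function of time to `(0, T]`. -/
def cutoff (T : ℝ) (u : ℝ → ℂ) : ℝ → ℂ := indicator (Ioc 0 T) u

theorem memLp_cutoff (T : ℝ) {u : ℝ → ℂ} (hu : Continuous u) (p : ℝ≥0∞) :
    MemLp (cutoff T u) p := by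
  rw [cutoff, memLp_indicator_iff_restrict measurableSet_Ioc]
  obtain ⟨c, hc⟩ := (isCompact_Icc (a := (0 : ℝ)) (b := T)).exists_bound_of_continuousOn
    hu.continuousOn
  apply MemLp.of_bound hu.aestronglyMeasurable c
  filter_upwards [ae_restrict_mem measurableSet_Ioc] with t ht
  exact hc t (Ioc_subset_Icc_self ht)

theorem integrable_cutoff (T : ℝ) {u : ℝ → ℂ} (hu : Continuous u) : Integrable (cutoff T u) :=
  memLp_one_iff_integrable.1 (memLp_cutoff T hu 1)

/-- The solution of the damped equation with forcing `c`. -/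
def damped (K : ℝ) (c : ℝ → ℂ) (t : ℝ) : ℂ :=
  ∫ τ in (0 : ℝ)..t, Complex.exp (-(K * (t - τ) : ℝ)) * c τ

theorem continuous_damped (K : ℝ) {c : ℝ → ℂ} (hc : Integrable c) : Continuous (damped K c) := by
  have e : damped K c = fun t : ℝ => Complex.exp (-(K * t : ℝ)) *
      ∫ τ in (0 : ℝ)..t, Complex.exp (K * τ : ℝ) * c τ := by
    ext t
    rw [damped, ← intervalIntegral.integral_const_mul]
    apply intervalIntegral.integral_congr
    intro τ _
    dsimp only
    rw [← mul_assoc, ← Complex.exp_add]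
    congr 2; push_cast; ring
  rw [e]
  refine Continuous.mul (by fun_prop) (intervalIntegral.continuous_primitive (fun a b => ?_) 0)
  exact (hc.intervalIntegrable).continuousOn_mul (by fun_prop)

/-- The solution of the damped equation is the convolution of the forcing with the exponential
decay. -/
theorem convolution_decay (K T : ℝ) (u : ℝ → ℂ) :
    MeasureTheory.convolution (cutoff T u) (decay K) (ContinuousLinearMap.mul ℂ ℂ) volume =
      damped K (cutoff T u) := by
  ext t
  rw [convolution, damped]
  simp only [ContinuousLinearMap.mul_apply']
  rcases le_or_gt t 0 with ht | ht
  · have e1 : ∀ τ, cutoff T u τ * decay K (t - τ) = 0 := by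
      intro τ
      by_cases hτ : τ ∈ Ioc 0 T
      · rw [decay, indicator_of_notMem (by simp; linarith [hτ.1]), mul_zero]
      · rw [cutoff, indicator_of_notMem hτ, zero_mul]
    simp only [e1, integral_zero]
    rw [intervalIntegral.integral_of_ge ht, setIntegral_eq_zero_of_forall_eq_zero, neg_zero]
    intro τ hτ
    rw [cutoff, indicator_of_notMem (fun h => absurd h.1 (not_lt.2 hτ.2)), mul_zero]
  · rw [intervalIntegral.integral_of_le ht.le, ← integral_indicator measurableSet_Ioc]
    apply integral_congr_ae
    filter_upwards [Measure.ae_ne volume t] with τ hτ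
    by_cases h1 : τ ∈ Ioc 0 t
    · rw [indicator_of_mem h1, decay, indicator_of_mem (by simpa using lt_of_le_of_ne h1.2 hτ), mul_comm]
    · rw [indicator_of_notMem h1]
      by_cases h2 : τ ∈ Ioc 0 T
      · have : t ≤ τ := by
          by_contra hcon
          exact h1 ⟨h2.1, (not_le.1 hcon).le⟩
        rw [decay, indicator_of_notMem (by simpa using this), mul_zero]
      · rw [cutoff, indicator_of_notMem h2, zero_mul]

theorem norm_dampSymbol (K σ : ℝ) :
    ‖(K : ℂ) + (2 * Real.pi * σ : ℝ) * Complex.I‖ ^ 2 = K ^ 2 + (2 * Real.pi * σ) ^ 2 := by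
  rw [← Complex.normSq_eq_norm_sq, Complex.normSq_add_mul_I]

theorem memLp_inv_dampSymbol {K : ℝ} (hK : 0 < K) :
    MemLp (fun σ : ℝ => ((K : ℂ) + (2 * Real.pi * σ : ℝ) * Complex.I)⁻¹) 2 := by
  have m : Measurable fun σ : ℝ => ((K : ℂ) + (2 * Real.pi * σ : ℝ) * Complex.I)⁻¹ := by fun_prop
  apply memLp_two_of_lintegral m.aestronglyMeasurable
  have : Integrable fun σ : ℝ => ‖((K : ℂ) + (2 * Real.pi * σ : ℝ) * Complex.I)⁻¹‖ ^ 2 := by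
    refine ((integrable_poisson hK).norm.const_mul (1 / (2 * K))).congr (.of_forall fun σ => ?_)
    dsimp only
    rw [norm_inv, inv_pow, norm_dampSymbol, Complex.norm_real, Real.norm_eq_abs,
      abs_of_nonneg (by positivity)]
    have : 0 < K ^ 2 + (2 * Real.pi * σ) ^ 2 := by positivity
    field_simp
  have h2 := this.2
  rw [hasFiniteIntegral_iff_enorm] at h2
  refine lt_of_le_of_lt (lintegral_mono fun σ => le_of_eq ?_) h2
  rw [← ofReal_norm, ← ofReal_norm, ← ENNReal.ofReal_pow (norm_nonneg _), norm_pow, norm_norm]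

theorem memLp_fourier {c : ℝ → ℂ} (h1 : Integrable c) (h2 : MemLp c 2) : MemLp (𝓕 c) 2 :=
  (memLp_congr_ae (coeFn_fourier_toLp h1 h2)).1 (Lp.memLp _)

/-- Fourier inversion for the solution of the damped equation. -/
theorem integral_modChar_fourier_div {K : ℝ} (hK : 0 < K) (T : ℝ) {u : ℝ → ℂ} (hu : Continuous u)
    (t : ℝ) :
    ∫ σ, modChar t σ * (𝓕 (cutoff T u) σ * ((K : ℂ) + (2 * Real.pi * σ : ℝ) * Complex.I)⁻¹) =
      damped K (cutoff T u) t := by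
  have ic := integrable_cutoff T hu
  have e1 : 𝓕 (damped K (cutoff T u)) =
      fun σ => 𝓕 (cutoff T u) σ * ((K : ℂ) + (2 * Real.pi * σ : ℝ) * Complex.I)⁻¹ := by
    ext σ
    rw [← convolution_decay, Real.fourier_mul_convolution_eq ic (integrable_decay hK),
      fourier_decay hK, one_div]
  have i1 : Integrable (damped K (cutoff T u)) := by
    rw [← convolution_decay]
    exact ic.integrable_convolution _ (integrable_decay hK)
  have i2 : Integrable (𝓕 (damped K (cutoff T u))) := by
    rw [e1]
    exact (memLp_fourier ic (memLp_cutoff T hu 2)).integrable_mul (memLp_inv_dampSymbol hK)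
  have := congrFun ((continuous_damped K ic).fourierInv_fourier_eq i1 i2) t
  rw [fourierInv_eq_integral_modChar, e1] at this
  exact this

section
variable {h : ℝ} [hh : Fact (0 < h)]

/-- The multiplier which solves the damped equation in the modulation space. -/
def solveMult (h K σ : ℝ) : ℂ :=
  ((K : ℂ) + (2 * Real.pi * σ : ℝ) * Complex.I)⁻¹ * ((√(modDensity h K σ))⁻¹ : ℝ)

theorem measurable_solveMult (h K : ℝ) : Measurable (solveMult h K) := by
  unfold solveMult; fun_prop

theorem norm_solveMult_le {K : ℝ} (hK : 0 < K) (σ : ℝ) : ‖solveMult h K σ‖ ≤ √(2 / K) := by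
  have h0 := hh.out
  have hρ := modDensity_pos h0 hK σ
  apply Real.le_sqrt_of_sq_le
  rw [solveMult, norm_mul, mul_pow, norm_inv, inv_pow, norm_dampSymbol, Complex.norm_real,
    Real.norm_eq_abs, sq_abs, inv_pow, Real.sq_sqrt hρ.le]
  have hL : 0 < K + |σ| := by positivity
  have h1 := sq_half_le K σ
  have h2 : outWeight h K σ ≤ 1 / K := by
    refine (outWeight_le h0 hK σ).trans ?_
    apply one_div_le_one_div_of_le hK
    calc K = √K * √K := (Real.mul_self_sqrt hK.le).symm
      _ ≤ √K * √(K + |σ|) := by gcongr; linarith [abs_nonneg σ]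
  calc (K ^ 2 + (2 * Real.pi * σ) ^ 2)⁻¹ * (modDensity h K σ)⁻¹
      ≤ ((K + |σ|) ^ 2 / 2)⁻¹ * (modDensity h K σ)⁻¹ := by
        gcongr
        linarith
    _ = 2 * outWeight h K σ := by rw [outWeight]; field_simp
    _ ≤ 2 * (1 / K) := by gcongr
    _ = 2 / K := by ring

theorem memLp_solveMult {K : ℝ} (hK : 0 < K) : MemLp (solveMult h K) ∞ :=
  memLp_top_of_bound (measurable_solveMult h K).aestronglyMeasurable _
    (.of_forall (norm_solveMult_le hK))

/-- The space-time transform, relative to the modulation weight, of the solution of the damped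
equation with forcing `u` on `(0, T]`. -/
def timeSolve (h K T : ℝ) {u : ℝ → ℂ} (hu : Continuous u) : Lp ℂ 2 (volume : Measure ℝ) :=
  mulLp volume (solveMult h K) (Lp.fourierTransformₗᵢ ℝ ℂ (memLp_cutoff T hu 2).toLp)

theorem norm_timeSolve_le {K : ℝ} (hK : 0 < K) (T : ℝ) {u : ℝ → ℂ} (hu : Continuous u) :
    ‖timeSolve h K T hu‖ ≤ √(2 / K) * ‖(memLp_cutoff T hu 2).toLp‖ := by
  have := norm_mulLp_le (memLp_solveMult (h := h) hK) (norm_solveMult_le hK)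
    (Lp.fourierTransformₗᵢ ℝ ℂ (memLp_cutoff T hu 2).toLp)
  rwa [LinearIsometryEquiv.norm_map] at this

theorem timeSolve_sub (h K T : ℝ) {u v : ℝ → ℂ} (hu : Continuous u) (hv : Continuous v) :
    timeSolve h K T (u := fun t => u t - v t) (hu.sub hv) =
      timeSolve h K T hu - timeSolve h K T hv := by
  rw [timeSolve, timeSolve, timeSolve, ← map_sub, ← map_sub, ← MemLp.toLp_sub]
  congr 2
  apply MemLp.toLp_congr
  filter_upwards with t
  simp only [cutoff, Pi.sub_apply]
  by_cases ht : t ∈ Ioc 0 T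
  · simp only [indicator_of_mem ht]
  · simp only [indicator_of_notMem ht, sub_zero]

theorem modRec_tens_timeSolve {K : ℝ} (hK : 0 < K) (T t : ℝ) {u : ℝ → ℂ} (hu : Continuous u)
    (F : FreqL2 h) : modRec h K t (tens h (timeSolve h K T hu) F) = damped K (cutoff T u) t • F := by
  have ic := integrable_cutoff T hu
  have hc : Continuous (𝓕 (cutoff T u)) := VectorFourier.fourierIntegral_continuous
    Real.continuous_fourierChar continuous_inner ic
  have hm : Measurable fun σ => solveMult h K σ * 𝓕 (cutoff T u) σ :=
    (measurable_solveMult h K).mul hc.measurable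
  have e : timeSolve h K T hu =ᵐ[volume] fun σ => solveMult h K σ * 𝓕 (cutoff T u) σ := by
    filter_upwards [coeFn_mulLp (memLp_solveMult (h := h) hK)
      (Lp.fourierTransformₗᵢ ℝ ℂ (memLp_cutoff T hu 2).toLp),
      coeFn_fourier_toLp ic (memLp_cutoff T hu 2)] with σ e1 e2
    rw [timeSolve, e1]
    exact congrArg _ e2
  rw [modRec_tens hK t hm.stronglyMeasurable e, ← integral_modChar_fourier_div hK T hu t]
  congr 2
  ext σ
  have : ((√(modDensity h K σ) : ℝ) : ℂ) ≠ 0 := by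
    exact_mod_cast (Real.sqrt_pos.2 (modDensity_pos hh.out hK σ)).ne'
  rw [recFun, solveMult]
  push_cast
  field_simp

/-- The coefficient functions of a curve in the frequency space. -/
def coefCurve (F : ℝ → FreqL2 h) (n : ℤ) (t : ℝ) : ℂ :=
  inner ℂ (fourierBasis (T := 2 * Real.pi / h) n) (F t)

theorem continuous_coefCurve {F : ℝ → FreqL2 h} (hF : Continuous F) (n : ℤ) :
    Continuous (coefCurve F n) := continuous_const.inner hF

theorem sum_norm_timeSolve_sq_le {K : ℝ} (hK : 0 < K) {T M : ℝ} (hT : 0 ≤ T) {F : ℝ → FreqL2 h}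
    (hF : Continuous F) (hM : ∀ t ∈ Icc 0 T, ‖F t‖ ≤ M) (s : Finset ℤ) :
    ∑ n ∈ s, ‖timeSolve h K T (continuous_coefCurve hF n)‖ ^ 2 ≤ 2 / K * (T * M ^ 2) := by
  have h1 : ∀ n, ‖timeSolve h K T (continuous_coefCurve hF n)‖ ^ 2 ≤
      2 / K * ‖(memLp_cutoff T (continuous_coefCurve hF n) 2).toLp‖ ^ 2 := fun n => by
    have := pow_le_pow_left₀ (norm_nonneg _)
      (norm_timeSolve_le (h := h) hK T (continuous_coefCurve hF n)) 2
    rwa [mul_pow, Real.sq_sqrt (by positivity)] at this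
  refine (Finset.sum_le_sum fun n _ => h1 n).trans ?_
  rw [← Finset.mul_sum]
  gcongr
  have h2 : ∀ n, ‖(memLp_cutoff T (continuous_coefCurve hF n) 2).toLp‖ₑ ^ 2 =
      ∫⁻ t in Ioc 0 T, ‖coefCurve F n t‖ₑ ^ 2 := fun n => by
    rw [← lintegral_enorm_sq, lintegral_enorm_sq_congr (MemLp.coeFn_toLp _),
      ← lintegral_indicator measurableSet_Ioc]
    apply lintegral_congr
    intro t
    rw [cutoff]
    by_cases ht : t ∈ Ioc 0 T
    · rw [indicator_of_mem ht, indicator_of_mem ht]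
    · rw [indicator_of_notMem ht, indicator_of_notMem ht]; simp
  have h3 : ∑ n ∈ s, ‖(memLp_cutoff T (continuous_coefCurve hF n) 2).toLp‖ₑ ^ 2 ≤
      ENNReal.ofReal (T * M ^ 2) := by
    simp only [h2]
    rw [← lintegral_finsetSum]
    · calc ∫⁻ t in Ioc 0 T, ∑ n ∈ s, ‖coefCurve F n t‖ₑ ^ 2
          ≤ ∫⁻ t in Ioc 0 T, ENNReal.ofReal (M ^ 2) := by
            apply setLIntegral_mono measurable_const
            intro t ht
            simp only [← ofReal_norm, ← ENNReal.ofReal_pow (norm_nonneg _)]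
            rw [← ENNReal.ofReal_sum_of_nonneg (fun _ _ => by positivity)]
            apply ENNReal.ofReal_le_ofReal
            refine (fourierBasis.orthonormal.sum_inner_products_le (x := F t) (s := s)).trans ?_
            have := hM t (Ioc_subset_Icc_self ht)
            gcongr
        _ = _ := by
            rw [setLIntegral_const, Real.volume_Ioc, sub_zero, mul_comm, ← ENNReal.ofReal_mul hT]
    · intro n _
      exact ((continuous_coefCurve hF n).measurable.enorm.pow_const 2)
  have h4 := ENNReal.toReal_mono ENNReal.ofReal_ne_top h3
  rw [ENNReal.toReal_ofReal (by positivity), ENNReal.toReal_sum (fun _ _ => by finiteness)] at h4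
  simpa only [ENNReal.toReal_pow, toReal_enorm] using h4

/-- The tensor product with a basis function is an isometry. -/
def tensBasis (h : ℝ) [Fact (0 < h)] (n : ℤ) : Lp ℂ 2 (volume : Measure ℝ) →ₗᵢ[ℂ] ModL2 h where
  toLinearMap := ((tens h).flip (fourierBasis n) : Lp ℂ 2 (volume : Measure ℝ) →L[ℂ] ModL2 h)
  norm_map' a := by
    have h1 := inner_tens (h := h) a a (fourierBasis n) (fourierBasis n)
    rw [inner_self_eq_norm_sq_to_K, inner_self_eq_norm_sq_to_K, inner_self_eq_norm_sq_to_K,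
      fourierBasis.orthonormal.1 n] at h1
    have h2 : ‖tens h a (fourierBasis n)‖ ^ 2 = ‖a‖ ^ 2 := by
      have h3 : ((‖tens h a (fourierBasis n)‖ ^ 2 : ℝ) : ℂ) = ((‖a‖ ^ 2 : ℝ) : ℂ) := by
        simpa using h1
      exact_mod_cast h3
    exact (sq_eq_sq₀ (norm_nonneg _) (norm_nonneg _)).1 h2

theorem tensBasis_apply (n : ℤ) (a : Lp ℂ 2 (volume : Measure ℝ)) :
    tensBasis h n a = tens h a (fourierBasis n) := rfl

theorem orthogonalFamily_tensBasis :
    OrthogonalFamily ℂ (fun _ : ℤ => Lp ℂ 2 (volume : Measure ℝ)) (tensBasis h) := by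
  intro n m hnm a b
  rw [tensBasis_apply, tensBasis_apply, inner_tens, fourierBasis.orthonormal.2 hnm, mul_zero]

/-- The coefficients of the forced solution are square summable, so they may be synthesized to an
element of the modulation space. -/
theorem memlp_timeSolve {K : ℝ} (hK : 0 < K) {T : ℝ} (hT : 0 ≤ T) {F : ℝ → FreqL2 h}
    (hF : Continuous F) :
    Memℓp (fun n => timeSolve h K T (continuous_coefCurve hF n)) 2 := by
  obtain ⟨M, hM⟩ := (isCompact_Icc (a := (0 : ℝ)) (b := T)).exists_bound_of_continuousOn
    hF.continuousOn
  apply memℓp_gen' (C := 2 / K * (T * M ^ 2))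
  intro s
  simpa using sum_norm_timeSolve_sq_le hK hT hF hM s

/-- The space-time transform of the solution of the damped equation with forcing `F`. -/
def forcing {K : ℝ} (hK : 0 < K) {T : ℝ} (hT : 0 ≤ T) {F : ℝ → FreqL2 h} (hF : Continuous F) :
    ModL2 h :=
  (orthogonalFamily_tensBasis (h := h)).linearIsometry ⟨_, memlp_timeSolve hK hT hF⟩

theorem hasSum_forcing {K : ℝ} (hK : 0 < K) {T : ℝ} (hT : 0 ≤ T) {F : ℝ → FreqL2 h}
    (hF : Continuous F) : HasSum (fun n => tens h (timeSolve h K T (continuous_coefCurve hF n))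
      (fourierBasis n)) (forcing hK hT hF) :=
  (orthogonalFamily_tensBasis (h := h)).hasSum_linearIsometry ⟨_, memlp_timeSolve hK hT hF⟩

theorem norm_forcing_le {K : ℝ} (hK : 0 < K) {T M : ℝ} (hT : 0 ≤ T) (hM0 : 0 ≤ M)
    {F : ℝ → FreqL2 h} (hF : Continuous F) (hM : ∀ t ∈ Icc 0 T, ‖F t‖ ≤ M) :
    ‖forcing hK hT hF‖ ≤ √(2 / K * T) * M := by
  rw [forcing, LinearIsometry.norm_map]
  apply lp.norm_le_of_forall_sum_le (by norm_num) (by positivity)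
  intro s
  have := sum_norm_timeSolve_sq_le hK hT hF hM s
  simp only [ENNReal.toReal_ofNat, Real.rpow_ofNat]
  rw [mul_pow, Real.sq_sqrt (by positivity), mul_assoc]
  exact this

theorem forcing_sub {K : ℝ} (hK : 0 < K) {T : ℝ} (hT : 0 ≤ T) {F G : ℝ → FreqL2 h}
    (hF : Continuous F) (hG : Continuous G) :
    forcing hK hT (F := fun t => F t - G t) (hF.sub hG) = forcing hK hT hF - forcing hK hT hG := by
  rw [forcing, forcing, forcing, ← map_sub]
  congr 1
  ext1
  funext n
  rw [lp.coeFn_sub, Pi.sub_apply, ← timeSolve_sub]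
  have e : coefCurve (fun t => F t - G t) n = fun t => coefCurve F n t - coefCurve G n t :=
    funext fun t => inner_sub_right _ _ _
  simp only [e]

theorem norm_forcing_sub_le {K : ℝ} (hK : 0 < K) {T M : ℝ} (hT : 0 ≤ T) (hM0 : 0 ≤ M)
    {F G : ℝ → FreqL2 h} (hF : Continuous F) (hG : Continuous G)
    (hM : ∀ t ∈ Icc 0 T, ‖F t - G t‖ ≤ M) :
    ‖forcing hK hT hF - forcing hK hT hG‖ ≤ √(2 / K * T) * M := by
  rw [← forcing_sub]
  exact norm_forcing_le hK hT hM0 _ hM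

/-- On `[0, T]`, the profile of `forcing` is the Duhamel integral of `F`. -/
theorem modRec_forcing {K : ℝ} (hK : 0 < K) {T : ℝ} (hT : 0 ≤ T) {F : ℝ → FreqL2 h}
    (hF : Continuous F) {t : ℝ} (ht : t ∈ Icc 0 T) :
    modRec h K t (forcing hK hT hF) =
      ∫ τ in (0 : ℝ)..t, Complex.exp (-(K * (t - τ) : ℝ)) • F τ := by
  have h1 := (hasSum_forcing hK hT hF).mapL (modRec h K t)
  simp only [modRec_tens_timeSolve hK] at h1
  have h2 := fourierBasis.hasSum_repr (∫ τ in (0 : ℝ)..t, Complex.exp (-(K * (t - τ) : ℝ)) • F τ)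
  refine h1.unique ?_
  convert! h2 using 3 with n
  have ci : Continuous fun τ : ℝ => Complex.exp (-(K * (t - τ) : ℝ)) • F τ := by
    have c0 : Continuous fun τ : ℝ => Complex.exp (-(K * (t - τ) : ℝ)) := by fun_prop
    exact c0.smul hF
  rw [HilbertBasis.repr_apply_apply, ← innerSL_apply_apply ℂ,
    ← ContinuousLinearMap.intervalIntegral_comp_comm _ (ci.intervalIntegrable (μ := volume) 0 t), damped,
    intervalIntegral.integral_of_le ht.1, intervalIntegral.integral_of_le ht.1]
  apply setIntegral_congr_fun measurableSet_Ioc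
  intro τ hτ
  dsimp only
  rw [map_smul, smul_eq_mul, cutoff,
    indicator_of_mem (show τ ∈ Ioc 0 T from ⟨hτ.1, hτ.2.trans ht.2⟩), coefCurve, innerSL_apply_apply]

end

/-! ### The profile equation in the modulation space -/

section
variable {h : ℝ} [hh : Fact (0 < h)]

/-- The resonance bounds, without regularity, of the three interactions. -/
structure ResonanceBounds (h : ℝ) [Fact (0 < h)] (K B : ℝ) : Prop where
  same : ∀ ε, |ε| = 1 → HasResonanceBound h K ε (dispersion h) (dispersion h) 0 B
  cross : ∀ ε, |ε| = 1 → HasResonanceBound h K ε (dispersion h) (dispersionOpp h) 0 B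
  opp : ∀ ε, |ε| = 1 → HasResonanceBound h K ε (dispersionOpp h) (dispersionOpp h) 0 B

/-- The profile with the space-time transform `f`, without the damping. -/
def modProfile (h : ℝ) [Fact (0 < h)] (K : ℝ) (f : ModL2 h) (t : ℝ) : FreqL2 h :=
  Complex.exp (K * t : ℝ) • modRec h K t f

theorem continuous_modProfile {K : ℝ} (hK : 0 < K) (f : ModL2 h) :
    Continuous (modProfile h K f) := by
  have c0 : Continuous fun t : ℝ => Complex.exp (K * t : ℝ) := by fun_prop
  exact c0.smul (continuous_modRec hK f)

theorem modProfile_sub (K : ℝ) (f g : ModL2 h) (t : ℝ) :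
    modProfile h K (f - g) t = modProfile h K f t - modProfile h K g t := by
  rw [modProfile, modProfile, modProfile, map_sub, smul_sub]

theorem exp_mul_le {K : ℝ} (hK : 0 < K) {t : ℝ} (ht : t ∈ Icc 0 (1 / K)) : Real.exp (K * t) ≤ 3 := by
  have h1 : K * t ≤ 1 := by
    calc K * t ≤ K * (1 / K) := by gcongr; exact ht.2
      _ = 1 := by field_simp
  exact (Real.exp_le_exp.2 h1).trans Real.exp_one_lt_three.le

theorem norm_modProfile_le {K : ℝ} (hK : 0 < K) (f : ModL2 h) {t : ℝ} (ht : t ∈ Icc 0 (1 / K)) :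
    ‖modProfile h K f t‖ ≤ 12 * ‖f‖ := by
  rw [modProfile, norm_smul, Complex.norm_exp_ofReal]
  calc Real.exp (K * t) * ‖modRec h K t f‖ ≤ 3 * (4 * ‖f‖) := by
        gcongr
        · exact exp_mul_le hK ht
        · exact norm_modRec_le hK t f
    _ = _ := by ring

theorem modProfile_modSymb {K : ℝ} (hK : 0 < K) (t : ℝ) {m : ℝ → ℂ} (hm : Continuous m)
    (f : ModL2 h) : modProfile h K (modSymb h m f) t = symb h m (modProfile h K f t) := by
  rw [modProfile, modProfile, modRec_modSymb hK t hm, map_smul]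

/-! ### The free evolution in the modulation space -/

/-- The space-time transform of the damped constant profile, relative to the modulation weight. -/
def homFun (h K σ : ℝ) : ℂ :=
  ((2 * K / (K ^ 2 + (2 * Real.pi * σ) ^ 2) / √(modDensity h K σ) : ℝ) : ℂ)

theorem measurable_homFun (h K : ℝ) : Measurable (homFun h K) := by unfold homFun; fun_prop

theorem lintegral_homFun_sq_le {K : ℝ} (hK : 0 < K) :
    ∫⁻ σ, ‖homFun h K σ‖ₑ ^ 2 ≤ ENNReal.ofReal (14 ^ 2) := by
  have h0 := hh.out
  have hρ := isDensity_modDensity h0 hK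
  calc ∫⁻ σ, ‖homFun h K σ‖ₑ ^ 2 ≤ ∫⁻ σ, ENNReal.ofReal 16 * ENNReal.ofReal (modDensity h K σ) := by
        apply lintegral_mono
        intro σ
        have hp := modDensity_pos h0 hK σ
        dsimp only
        rw [← ofReal_norm, ← ENNReal.ofReal_pow (norm_nonneg _), ← ENNReal.ofReal_mul (by norm_num)]
        apply ENNReal.ofReal_le_ofReal
        rw [homFun, Complex.norm_real, Real.norm_eq_abs, sq_abs, div_pow, Real.sq_sqrt hp.le,
          div_le_iff₀ hp]
        have h1 := poisson_le_modDensity (h := h) hK σ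
        calc (2 * K / (K ^ 2 + (2 * Real.pi * σ) ^ 2)) ^ 2 ≤ (4 * modDensity h K σ) ^ 2 := by gcongr
          _ = _ := by ring
    _ = ENNReal.ofReal 16 * ∫⁻ σ, ENNReal.ofReal (modDensity h K σ) := by
        rw [lintegral_const_mul _ hρ.measurable]
    _ ≤ ENNReal.ofReal 16 * ENNReal.ofReal 12 := by gcongr; exact hρ.lintegral_le
    _ ≤ _ := by
        rw [← ENNReal.ofReal_mul (by norm_num)]
        exact ENNReal.ofReal_le_ofReal (by norm_num)

theorem memLp_homFun {K : ℝ} (hK : 0 < K) : MemLp (homFun h K) 2 volume :=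
  memLp_two_of_lintegral (measurable_homFun h K).aestronglyMeasurable
    ((lintegral_homFun_sq_le hK).trans_lt ENNReal.ofReal_lt_top)

/-- The space-time transform of the damped constant profile `F`. -/
def modHom {K : ℝ} (hK : 0 < K) : FreqL2 h →L[ℂ] ModL2 h := tens h (memLp_homFun (h := h) hK).toLp

theorem norm_modHom_le {K : ℝ} (hK : 0 < K) (F : FreqL2 h) : ‖modHom hK F‖ ≤ 14 * ‖F‖ := by
  refine (norm_tens_le _ F).trans ?_
  gcongr
  apply norm_le_of_lintegral (by norm_num)
  rw [lintegral_enorm_sq_congr (MemLp.coeFn_toLp _)]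
  exact lintegral_homFun_sq_le hK

theorem modRec_modHom {K : ℝ} (hK : 0 < K) {t : ℝ} (ht : 0 ≤ t) (F : FreqL2 h) :
    modRec h K t (modHom hK F) = Complex.exp (-(K * t : ℝ)) • F := by
  rw [modHom, modRec_tens hK t (measurable_homFun h K).stronglyMeasurable (MemLp.coeFn_toLp _)]
  congr 1
  have e := integral_modChar_poisson hK t
  rw [abs_of_nonneg ht] at e
  rw [← e]
  congr 1; ext σ
  have : ((√(modDensity h K σ) : ℝ) : ℂ) ≠ 0 := by
    exact_mod_cast (Real.sqrt_pos.2 (modDensity_pos hh.out hK σ)).ne'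
  rw [recFun, homFun, mul_assoc, ← Complex.ofReal_mul]
  congr 2
  have := (Real.sqrt_pos.2 (modDensity_pos hh.out hK σ)).ne'
  field_simp

theorem modSymb_modHom {K : ℝ} (hK : 0 < K) {m : ℝ → ℂ} (hm : Continuous m) (F : FreqL2 h) :
    modSymb h m (modHom hK F) = modHom hK (symb h m F) := modSymb_tens hm _ F

/-! ### The nonlinear terms in the modulation space -/

/-- The damped remainder along a pair of profiles. -/
def remCurve (V : ℝ → ℝ) (h : ℝ) [Fact (0 < h)] (K ε : ℝ) (f g : ModL2 h) (t : ℝ) : FreqL2 h :=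
  Complex.exp (-(K * t : ℝ)) • remTerm V h ε t (modProfile h K f t) (modProfile h K g t)

theorem continuous_remCurve {V : ℝ → ℝ} (hV : IsNormalizedPotential V) {K : ℝ} (hK : 0 < K) (ε : ℝ)
    (f g : ModL2 h) : Continuous (remCurve V h K ε f g) := by
  have c0 : Continuous fun t : ℝ => Complex.exp (-(K * t : ℝ)) := by fun_prop
  exact c0.smul (continuous_remTerm hV ε (continuous_modProfile hK f) (continuous_modProfile hK g))

section
variable {V : ℝ → ℝ} (hV : IsNormalizedPotential V) {K B : ℝ} (hK : 0 < K)
  (hR : ResonanceBounds h K B) {ε : ℝ} (hε : |ε| = 1)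

/-- The interaction of two waves of the sign `ε`. -/
def bilSame : ModL2 h →L[ℂ] ModL2 h →L[ℂ] ModL2 h :=
  modBil hK hε (continuous_dispersion h).measurable (continuous_dispersion h).measurable (hR.same ε hε)

/-- The interaction of two waves of different signs, with output of the sign `ε`. -/
def bilCross : ModL2 h →L[ℂ] ModL2 h →L[ℂ] ModL2 h :=
  modBil hK hε (continuous_dispersion h).measurable (continuous_dispersionOpp h).measurable
    (hR.cross ε hε)

/-- The interaction of two waves of the sign `-ε`, with output of the sign `ε`. -/
def bilOpp : ModL2 h →L[ℂ] ModL2 h →L[ℂ] ModL2 h :=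
  modBil hK hε (continuous_dispersionOpp h).measurable (continuous_dispersionOpp h).measurable
    (hR.opp ε hε)

/-- The remainder in the modulation space. -/
def modRem (ε : ℝ) (f g : ModL2 h) : ModL2 h :=
  forcing hK (one_div_pos.2 hK).le (continuous_remCurve hV hK ε f g)

/-- The nonlinearity of the profile equation in the modulation space; `f` is the profile of the sign
`ε` and `g` the one of the sign `-ε`. -/
def modNL (lam : ℝ) (f g : ModL2 h) : ModL2 h :=
  bilSame hK hR hε f f + ((2 * lam : ℝ) : ℂ) • bilCross hK hR hε f g
    + ((lam ^ 2 : ℝ) : ℂ) • bilOpp hK hR hε g g + (lam : ℂ) • modRem hV hK ε f g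

/-- The fixed point map of the profile equation with initial value `U`. -/
def modMap (lam : ℝ) (U : FreqL2 h) (f g : ModL2 h) : ModL2 h :=
  modHom hK (U - modRec h K 0 (modNL hV hK hR hε lam f g)) + modNL hV hK hR hε lam f g

theorem exp_neg_smul_bil (q₁ q₂ : ℝ → ℝ) (t : ℝ) (f g : ModL2 h) :
    Complex.exp (-(K * t : ℝ)) • bil h ε q₁ q₂ t (modProfile h K f t) (modProfile h K g t) =
      Complex.exp (K * t : ℝ) • bil h ε q₁ q₂ t (modRec h K t f) (modRec h K t g) := by
  rw [modProfile, modProfile, bil_smul_smul, smul_smul]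
  congr 1
  rw [sq, ← Complex.exp_add, ← Complex.exp_add]
  congr 1; ring

/-- The nonlinearity of the modulation space realizes the Duhamel integral. -/
theorem modRec_modNL (lam : ℝ) (f g : ModL2 h) {t : ℝ} (ht : t ∈ Icc 0 (1 / K)) :
    modRec h K t (modNL hV hK hR hε lam f g) -
      Complex.exp (-(K * t : ℝ)) • modRec h K 0 (modNL hV hK hR hε lam f g) =
    Complex.exp (-(K * t : ℝ)) • ∫ τ in (0 : ℝ)..t,
      profileNL V h lam ε τ (modProfile h K f τ) (modProfile h K g τ) := by
  have c1 := continuous_dispersion h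
  have c2 := continuous_dispersionOpp h
  have cf := continuous_modProfile (h := h) hK f
  have cg := continuous_modProfile (h := h) hK g
  have hT : (0 : ℝ) ≤ 1 / K := (one_div_pos.2 hK).le
  have conv : ∀ {q₁ q₂ : ℝ → ℝ} (k₁ : Continuous q₁) (k₂ : Continuous q₂)
      (hb : HasResonanceBound h K ε q₁ q₂ 0 B) (a b : ModL2 h),
      modRec h K t (modBil hK hε k₁.measurable k₂.measurable hb a b) - Complex.exp (-(K * t : ℝ)) •
        modRec h K 0 (modBil hK hε k₁.measurable k₂.measurable hb a b) =
      Complex.exp (-(K * t : ℝ)) • ∫ τ in (0 : ℝ)..t,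
        bil h ε q₁ q₂ τ (modProfile h K a τ) (modProfile h K b τ) := by
    intro q₁ q₂ k₁ k₂ hb a b
    rw [modRec_modBil hK hε k₁ k₂ hb ht, ← intervalIntegral.integral_smul]
    apply intervalIntegral.integral_congr
    intro τ _
    dsimp only
    rw [← smul_smul, ← exp_neg_smul_bil, smul_smul, ← Complex.exp_add]
    congr 2; push_cast; ring
  have hrem : modRec h K t (modRem hV hK ε f g) - Complex.exp (-(K * t : ℝ)) •
        modRec h K 0 (modRem hV hK ε f g) = Complex.exp (-(K * t : ℝ)) • ∫ τ in (0 : ℝ)..t,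
        remTerm V h ε τ (modProfile h K f τ) (modProfile h K g τ) := by
    rw [modRem, modRec_forcing hK hT _ ht, modRec_forcing hK hT _ ⟨le_rfl, hT⟩,
      intervalIntegral.integral_same, smul_zero, sub_zero, ← intervalIntegral.integral_smul]
    apply intervalIntegral.integral_congr
    intro τ _
    dsimp only [remCurve]
    rw [smul_smul, ← Complex.exp_add]
    congr 2; push_cast; ring
  have e1 := conv c1 c1 (hR.same ε hε) f f
  have e2 := conv c1 c2 (hR.cross ε hε) f g
  have e3 := conv c2 c2 (hR.opp ε hε) g g
  have i1 := (continuous_bil ε c1 c1 cf cf).intervalIntegrable (μ := volume) 0 t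
  have k2 : Continuous fun τ => ((2 * lam : ℝ) : ℂ) • bil h ε (dispersion h) (dispersionOpp h) τ
      (modProfile h K f τ) (modProfile h K g τ) := (continuous_bil ε c1 c2 cf cg).fun_const_smul _
  have k3 : Continuous fun τ => ((lam ^ 2 : ℝ) : ℂ) • bil h ε (dispersionOpp h) (dispersionOpp h) τ
      (modProfile h K g τ) (modProfile h K g τ) := (continuous_bil ε c2 c2 cg cg).fun_const_smul _
  have k4 : Continuous fun τ => (lam : ℂ) • remTerm V h ε τ
      (modProfile h K f τ) (modProfile h K g τ) := (continuous_remTerm hV ε cf cg).fun_const_smul _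
  have i2 := k2.intervalIntegrable (μ := volume) 0 t
  have i3 := k3.intervalIntegrable (μ := volume) 0 t
  have i4 := k4.intervalIntegrable (μ := volume) 0 t
  simp only [profileNL]
  rw [intervalIntegral.integral_add ((i1.add i2).add i3) i4,
    intervalIntegral.integral_add (i1.add i2) i3, intervalIntegral.integral_add i1 i2,
    intervalIntegral.integral_smul, intervalIntegral.integral_smul, intervalIntegral.integral_smul,
    smul_add, smul_add, smul_add, smul_comm _ ((2 * lam : ℝ) : ℂ), smul_comm _ ((lam ^ 2 : ℝ) : ℂ),
    smul_comm _ (lam : ℂ), ← e1, ← e2, ← e3, ← hrem]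
  simp only [modNL, bilSame, bilCross, bilOpp, map_add, map_smul, smul_add, smul_sub]
  simp only [smul_comm (Complex.exp _)]
  abel

/-- A fixed point yields a solution of the profile equation. -/
theorem modProfile_eq (lam : ℝ) {U : FreqL2 h} {f g : ModL2 h}
    (hf : f = modMap hV hK hR hε lam U f g) {t : ℝ} (ht : t ∈ Icc 0 (1 / K)) :
    modProfile h K f t = U + ∫ τ in (0 : ℝ)..t,
      profileNL V h lam ε τ (modProfile h K f τ) (modProfile h K g τ) := by
  have e1 : modRec h K t f = Complex.exp (-(K * t : ℝ)) • U + (modRec h K t (modNL hV hK hR hε lam f g)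
      - Complex.exp (-(K * t : ℝ)) • modRec h K 0 (modNL hV hK hR hε lam f g)) := by
    conv_lhs => rw [hf, modMap, map_add, modRec_modHom hK ht.1, smul_sub]
    abel
  have e2 : Complex.exp (K * t : ℝ) * Complex.exp (-(K * t : ℝ)) = 1 := by
    rw [← Complex.exp_add, add_neg_cancel, Complex.exp_zero]
  rw [modRec_modNL hV hK hR hε lam f g ht, ← smul_add] at e1
  conv_lhs => rw [modProfile, e1, smul_smul, e2, one_smul]

end
end

/-! ### Sobolev norms on the frequency side -/

section
variable {h : ℝ} [hh : Fact (0 < h)]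

/-- The multiplier `⟨ξ⟩ˢ` on the frequency side. -/
def freqSob (h : ℝ) [Fact (0 < h)] (s : ℝ) : FreqL2 h →L[ℂ] FreqL2 h :=
  symb h fun x => ((jap x ^ s : ℝ) : ℂ)

theorem sobolevNorm_eq (s : ℝ) (f : LatticeL2) : sobolevNorm h s f = ‖freqSob h s (toFreq h f)‖ := by
  apply ((represents_toFreq f).symb (continuous_japC s) _).l2Norm_eq
  intro x
  rw [Complex.conj_ofReal, jap, jap, abs_neg]

theorem norm_le_norm_freqSob {s : ℝ} (hs0 : 0 ≤ s) (F : FreqL2 h) : ‖F‖ ≤ ‖freqSob h s F‖ := by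
  have := norm_symb_le_norm (h := h) (m := fun _ => 1) continuous_const (continuous_japC s)
    (fun x => by
      rw [norm_one, Complex.norm_real, Real.norm_eq_abs]
      exact (Real.one_le_rpow (one_le_jap x) hs0).trans (le_abs_self _)) F
  rwa [symb_one fun _ => rfl] at this

theorem sq_jap_rpow_neg_le {s : ℝ} (hs0 : 0 ≤ s) (hs1 : s ≤ 1) {a : ℝ} (ha : 0 < a) (x : ℝ) :
    (jap x ^ (-s)) ^ 2 ≤ a ^ s + a ^ (s - 1) * (1 + x ^ 2)⁻¹ := by
  have hj : jap x ^ 2 = 1 + x ^ 2 := by rw [jap, Real.sq_sqrt (by positivity), sq_abs]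
  have hb : 0 < (1 + x ^ 2)⁻¹ := by positivity
  have e : (jap x ^ (-s)) ^ 2 = ((1 + x ^ 2)⁻¹) ^ s := by
    rw [Real.inv_rpow (by positivity), ← hj, ← Real.rpow_neg (by positivity), ← Real.rpow_natCast,
      ← Real.rpow_natCast, ← Real.rpow_mul (jap_pos x).le, ← Real.rpow_mul (jap_pos x).le]
    congr 1; push_cast; ring
  rw [e]
  set b := (1 + x ^ 2)⁻¹
  have hp : 0 < a ^ s := Real.rpow_pos_of_pos ha _
  have hp' : 0 < a ^ (s - 1) := Real.rpow_pos_of_pos ha _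
  rcases le_total b a with hba | hba
  · have := Real.rpow_le_rpow hb.le hba hs0
    nlinarith
  · have h1 : b ^ s = b ^ (s - 1) * b := by
      rw [← Real.rpow_add_one hb.ne', sub_add_cancel]
    have h2 : b ^ (s - 1) ≤ a ^ (s - 1) := Real.rpow_le_rpow_of_nonpos ha hba (by linarith)
    rw [h1]
    nlinarith

theorem lintegral_inv_one_add_sq_le :
    ∫⁻ ξ, ENNReal.ofReal (1 + rep ξ ^ 2)⁻¹ ∂haarFreq h ≤ ENNReal.ofReal h := by
  have h0 := hh.out
  have hpi := Real.pi_pos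
  rw [lintegral_haarFreq, setLIntegral_congr_fun (g := fun x => ENNReal.ofReal (1 + x ^ 2)⁻¹)
    measurableSet_Ioc (fun x hx => by dsimp only; rw [rep_coe hx])]
  calc _ ≤ ENNReal.ofReal (h / (2 * Real.pi)) * ∫⁻ x : ℝ, ENNReal.ofReal (1 + x ^ 2)⁻¹ := by
        gcongr; exact Measure.restrict_le_self
    _ = ENNReal.ofReal (h / (2 * Real.pi)) * ENNReal.ofReal Real.pi := by
        rw [← ofReal_integral_eq_lintegral_ofReal integrable_inv_one_add_sq
          (.of_forall fun x => by positivity), integral_univ_inv_one_add_sq]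
    _ ≤ _ := by
        rw [← ENNReal.ofReal_mul (by positivity)]
        apply ENNReal.ofReal_le_ofReal
        have : h / (2 * Real.pi) * Real.pi = h / 2 := by field_simp
        linarith

theorem lintegral_jap_rpow_neg_le {s : ℝ} (hs0 : 0 ≤ s) (hs1 : s ≤ 1) :
    ∫⁻ ξ, ENNReal.ofReal (jap (rep ξ) ^ (-s)) ^ 2 ∂haarFreq h ≤ ENNReal.ofReal (2 * h ^ s) := by
  have h0 := hh.out
  have hp : 0 < h ^ s := Real.rpow_pos_of_pos h0 _
  have hp' : 0 < h ^ (s - 1) := Real.rpow_pos_of_pos h0 _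
  calc _ ≤ ∫⁻ ξ, (ENNReal.ofReal (h ^ s) + ENNReal.ofReal (h ^ (s - 1)) *
          ENNReal.ofReal (1 + rep ξ ^ 2)⁻¹) ∂haarFreq h := by
        apply lintegral_mono
        intro ξ
        dsimp only
        rw [← ENNReal.ofReal_pow (Real.rpow_nonneg (jap_pos _).le _), ← ENNReal.ofReal_mul hp'.le,
          ← ENNReal.ofReal_add hp.le (by positivity)]
        exact ENNReal.ofReal_le_ofReal (sq_jap_rpow_neg_le hs0 hs1 h0 _)
    _ = ENNReal.ofReal (h ^ s) + ENNReal.ofReal (h ^ (s - 1)) *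
          ∫⁻ ξ, ENNReal.ofReal (1 + rep ξ ^ 2)⁻¹ ∂haarFreq h := by
        rw [lintegral_add_left measurable_const, lintegral_const, measure_univ, mul_one,
          lintegral_const_mul' _ _ ENNReal.ofReal_ne_top]
    _ ≤ ENNReal.ofReal (h ^ s) + ENNReal.ofReal (h ^ (s - 1)) * ENNReal.ofReal h := by
        gcongr; exact lintegral_inv_one_add_sq_le
    _ = _ := by
        rw [← ENNReal.ofReal_mul hp'.le, ← ENNReal.ofReal_add hp.le (by positivity),
          ← Real.rpow_add_one h0.ne', sub_add_cancel, two_mul]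

/-- The Sobolev embedding on the lattice, which loses the power `(s - 1) / 2` of `h`. -/
theorem norm_val_le_freqSob {s : ℝ} (hs0 : 0 ≤ s) (hs1 : s ≤ 1) (F : FreqL2 h) (n : ℤ) :
    ‖val F n‖ ≤ 2 * h ^ ((s - 1) / 2) * ‖freqSob h s F‖ := by
  have h0 := hh.out
  set G := freqSob h s F with hG
  have hF : F = symb h (fun x => ((jap x ^ (-s) : ℝ) : ℂ)) G := by
    rw [hG, freqSob, symb_symb (m'' := fun _ => 1) (continuous_japC _) (continuous_japC _),
      symb_one fun _ => rfl]
    intro x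
    rw [← Complex.ofReal_mul, ← Real.rpow_add (jap_pos x), neg_add_cancel, Real.rpow_zero,
      Complex.ofReal_one]
  have hv : val F n = ((√h)⁻¹ : ℝ) * ∫ ξ, fourier n ξ * (((jap (rep ξ) ^ (-s) : ℝ) : ℂ) * G ξ)
      ∂haarFreq h := by
    conv_lhs => rw [hF]
    exact val_congr_ae (coeFn_symb (continuous_japC _) G) n
  -- the Cauchy-Schwarz inequality for `F = ⟨ξ⟩⁻ˢ G`
  have h1 : ‖∫ ξ, fourier n ξ * (((jap (rep ξ) ^ (-s) : ℝ) : ℂ) * G ξ) ∂haarFreq h‖ₑ ^ 2 ≤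
      ENNReal.ofReal (2 * h ^ s) * ‖G‖ₑ ^ 2 := by
    calc _ ≤ (∫⁻ ξ, ENNReal.ofReal (jap (rep ξ) ^ (-s)) * ‖G ξ‖ₑ ∂haarFreq h) ^ 2 := by
          gcongr
          refine (enorm_integral_le_lintegral_enorm _).trans (le_of_eq ?_)
          congr 1; ext ξ
          have e1 : ‖(fourier n ξ : ℂ)‖ = 1 := by rw [fourier_apply]; exact Circle.norm_coe _
          rw [enorm_mul, enorm_mul, ← ofReal_norm (fourier n ξ : ℂ), e1, ENNReal.ofReal_one, one_mul,
            ← ofReal_norm ((_ : ℝ) : ℂ), Complex.norm_real,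
            Real.norm_of_nonneg (Real.rpow_nonneg (jap_pos _).le _)]
      _ ≤ _ := by
          refine (sq_lintegral_mul_le _ ?_ (Lp.stronglyMeasurable G).measurable.enorm.aemeasurable).trans ?_
          · have c1 : Continuous fun x => jap x ^ (-s) :=
              continuous_jap.rpow_const fun x => .inl (jap_pos x).ne'
            exact (c1.measurable.comp measurable_rep).ennreal_ofReal.aemeasurable
          · rw [lintegral_enorm_sq]
            gcongr
            exact lintegral_jap_rpow_neg_le hs0 hs1
  have h2 : ‖∫ ξ, fourier n ξ * (((jap (rep ξ) ^ (-s) : ℝ) : ℂ) * G ξ) ∂haarFreq h‖ ^ 2 ≤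
      2 * h ^ s * ‖G‖ ^ 2 := by
    have h3 := ENNReal.toReal_mono (by finiteness) h1
    rwa [ENNReal.toReal_pow, ENNReal.toReal_mul, ENNReal.toReal_pow, toReal_enorm, toReal_enorm,
      ENNReal.toReal_ofReal (by positivity)] at h3
  rw [hv, norm_mul, Complex.norm_real, Real.norm_of_nonneg (by positivity)]
  have hp : 0 < h ^ ((s - 1) / 2) := Real.rpow_pos_of_pos h0 _
  apply le_of_sq_le_sq _ (by positivity)
  have e1 : (h ^ ((s - 1) / 2)) ^ 2 = h ^ s * h⁻¹ := by
    rw [← Real.rpow_natCast, ← Real.rpow_mul h0.le, ← Real.rpow_neg_one, ← Real.rpow_add h0]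
    congr 1; push_cast; ring
  have hs : 0 < h ^ s := Real.rpow_pos_of_pos h0 _
  rw [mul_pow, mul_pow, mul_pow, inv_pow, Real.sq_sqrt h0.le, e1]
  calc _ ≤ h⁻¹ * (2 * h ^ s * ‖G‖ ^ 2) := by gcongr
    _ ≤ 2 ^ 2 * (h ^ s * h⁻¹) * ‖G‖ ^ 2 := by
        have : 0 ≤ h ^ s * h⁻¹ * ‖G‖ ^ 2 := by positivity
        linarith

theorem freqSob_symb (s : ℝ) {m : ℝ → ℂ} (hm : Continuous m) (F : FreqL2 h) :
    freqSob h s (symb h m F) = symb h m (freqSob h s F) := by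
  rw [freqSob, symb_symb (continuous_japC s) hm (fun _ => rfl),
    symb_symb hm (continuous_japC s) (fun _ => mul_comm _ _)]

theorem freqSob_dispFreq (s ε t : ℝ) (F G : FreqL2 h) :
    freqSob h s (dispFreq h ε t F G) = dispFreq h ε t (freqSob h s F) (freqSob h s G) := by
  rw [dispFreq, dispFreq, freqSob_symb s (continuous_flow _ continuous_id), map_add,
    freqSob_symb s (continuous_flow _ (continuous_dispersion h)),
    freqSob_symb s (continuous_flow _ (continuous_dispersionOpp h))]

theorem modProfile_modSob {K : ℝ} (hK : 0 < K) (s t : ℝ) (f : ModL2 h) :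
    modProfile h K (modSob h s f) t = freqSob h s (modProfile h K f t) :=
  modProfile_modSymb hK t (continuous_japC s) f

theorem modSob_zero_apply (f : ModL2 h) : modSob h 0 f = f := by
  rw [modSob]
  simp only [Real.rpow_zero, Complex.ofReal_one]
  exact mulLp_one f

/-! ### Estimates for the nonlinearity -/

/-- The Lipschitz bound for the higher-order remainder, for functions with `h² ‖·‖_∞ ≤ N`. -/
def RemainderBound (V : ℝ → ℝ) (h : ℝ) [Fact (0 < h)] (N C : ℝ) : Prop :=
  ∀ (F G : FreqL2 h) (m : ℝ), (∀ n, ‖val F n‖ ≤ m) → (∀ n, ‖val G n‖ ≤ m) → h ^ 2 * m ≤ N →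
    ‖remFreq V F - remFreq V G‖ ≤ C * m ^ 2 * ‖F - G‖

theorem remFreq_zero {V : ℝ → ℝ} (hV : IsNormalizedPotential V) : remFreq V (0 : FreqL2 h) = 0 := by
  apply val_ext
  intro n
  rw [represents_remFreq hV]
  simp [remainder_zero hV, val]

theorem remTerm_zero {V : ℝ → ℝ} (hV : IsNormalizedPotential V) (ε t : ℝ) :
    remTerm V h ε t (0 : FreqL2 h) 0 = 0 := by
  rw [remTerm, dispFreq]
  simp [remFreq_zero hV]

theorem norm_val_dispFreq_le {K : ℝ} (hK : 0 < K) {s : ℝ} (hs0 : 0 ≤ s) (hs1 : s ≤ 1) (ε : ℝ)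
    {f g : ModL2 h} {M : ℝ} (hf : ‖modSob h s f‖ ≤ M) (hg : ‖modSob h s g‖ ≤ M) {t : ℝ}
    (ht : t ∈ Icc 0 (1 / K)) (n : ℤ) :
    ‖val (dispFreq h ε t (modProfile h K f t) (modProfile h K g t)) n‖ ≤
      h ^ ((s - 1) / 2) * (48 * M) := by
  have hp : 0 < h ^ ((s - 1) / 2) := Real.rpow_pos_of_pos hh.out _
  refine (norm_val_le_freqSob hs0 hs1 _ n).trans ?_
  rw [freqSob_dispFreq, ← modProfile_modSob hK, ← modProfile_modSob hK]
  calc _ ≤ 2 * h ^ ((s - 1) / 2) * (12 * M + 12 * M) := by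
        gcongr
        refine (norm_dispFreq_le _ _ _ _).trans (add_le_add ?_ ?_)
        · exact (norm_modProfile_le hK _ ht).trans (by gcongr)
        · exact (norm_modProfile_le hK _ ht).trans (by gcongr)
    _ = _ := by ring

section
variable {V : ℝ → ℝ} (hV : IsNormalizedPotential V) {K : ℝ} (hK : 0 < K)

theorem modRem_zero (ε : ℝ) : modRem hV hK ε (0 : ModL2 h) 0 = 0 := by
  rw [← norm_le_zero_iff]
  have := norm_forcing_le hK (one_div_pos.2 hK).le le_rfl
    (continuous_remCurve hV hK ε (0 : ModL2 h) 0) (fun t _ => by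
      rw [remCurve, modProfile, map_zero, smul_zero, remTerm_zero hV, smul_zero, norm_zero])
  rwa [mul_zero] at this

/-- The remainder is cubic with a factor `h`, and two of the three arguments are bounded in the
supremum norm by the Sobolev embedding; this is where it gains `hˢ`. -/
theorem norm_modRem_sub_le {ε : ℝ} (hε : |ε| = 1) (hh1 : h ≤ 1) {N C : ℝ} (hC : RemainderBound V h N C) (hC0 : 0 ≤ C)
    {s : ℝ} (hs0 : 0 ≤ s) (hs1 : s ≤ 1) {M : ℝ} (hM : 48 * M ≤ N) {f g f' g' : ModL2 h}
    (hf : ‖modSob h s f‖ ≤ M) (hg : ‖modSob h s g‖ ≤ M)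
    (hf' : ‖modSob h s f'‖ ≤ M) (hg' : ‖modSob h s g'‖ ≤ M) :
    ‖modRem hV hK ε f g - modRem hV hK ε f' g'‖ ≤
      55296 * C * M ^ 2 / K * h ^ s * (‖f - f'‖ + ‖g - g'‖) := by
  have h0 := hh.out
  have hM0 : 0 ≤ M := (norm_nonneg _).trans hf
  set m := h ^ ((s - 1) / 2) * (48 * M) with hm
  have hp : 0 < h ^ ((s - 1) / 2) := Real.rpow_pos_of_pos h0 _
  have hm2 : h * m ^ 2 = 2304 * M ^ 2 * h ^ s := by
    have e1 : h * (h ^ ((s - 1) / 2)) ^ 2 = h ^ s := by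
      rw [← Real.rpow_natCast, ← Real.rpow_mul h0.le, mul_comm, ← Real.rpow_add_one h0.ne']
      congr 1; push_cast; ring
    rw [hm, mul_pow, ← mul_assoc, e1]; ring
  have hmN : h ^ 2 * m ≤ N := by
    have e1 : h ^ 2 * h ^ ((s - 1) / 2) ≤ 1 := by
      rw [← Real.rpow_natCast, ← Real.rpow_add h0]
      exact Real.rpow_le_one h0.le hh1 (by push_cast; linarith)
    calc h ^ 2 * m = h ^ 2 * h ^ ((s - 1) / 2) * (48 * M) := by rw [hm]; ring
      _ ≤ 1 * (48 * M) := by gcongr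
      _ ≤ N := by linarith
  -- `forcing` costs `√(2 / K * T)` with `T = 1 / K`
  have key := norm_forcing_sub_le hK (one_div_pos.2 hK).le
    (M := h * (C * m ^ 2 * (12 * (‖f - f'‖ + ‖g - g'‖)))) (by positivity)
    (continuous_remCurve hV hK ε f g) (continuous_remCurve hV hK ε f' g') (fun t ht => by
      rw [remCurve, remCurve, ← smul_sub, norm_smul, ← Complex.ofReal_neg, Complex.norm_exp_ofReal]
      have hex : Real.exp (-(K * t)) ≤ 1 := Real.exp_le_one_iff.2 (by
        have := mul_nonneg hK.le ht.1; linarith)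
      refine (mul_le_of_le_one_left (norm_nonneg _) hex).trans ?_
      refine (norm_remTerm_sub_le V hε t _ _ _ _).trans ?_
      gcongr
      refine (hC _ _ m (norm_val_dispFreq_le hK hs0 hs1 ε hf hg ht)
        (norm_val_dispFreq_le hK hs0 hs1 ε hf' hg' ht) hmN).trans ?_
      gcongr
      rw [dispFreq_sub, ← modProfile_sub, ← modProfile_sub, mul_add]
      exact (norm_dispFreq_le _ _ _ _).trans (add_le_add (norm_modProfile_le hK _ ht)
        (norm_modProfile_le hK _ ht)))
  refine key.trans ?_
  have hsq : √(2 / K * (1 / K)) ≤ 2 / K := by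
    rw [Real.sqrt_le_left (by positivity)]
    have : 0 ≤ 1 / K * (1 / K) := by positivity
    have e : (2 / K) ^ 2 = 4 * (1 / K * (1 / K)) := by ring
    have e' : 2 / K * (1 / K) = 2 * (1 / K * (1 / K)) := by ring
    rw [e, e']; linarith
  calc _ ≤ 2 / K * (h * (C * m ^ 2 * (12 * (‖f - f'‖ + ‖g - g'‖)))) := by gcongr
    _ = 2 / K * (C * (h * m ^ 2) * (12 * (‖f - f'‖ + ‖g - g'‖))) := by ring
    _ = _ := by rw [hm2]; ring

end
end

/-! ### The contraction -/

/-- A bounded bilinear map is Lipschitz on the ball of radius `M`. -/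
theorem norm_bilin_sub_le {X : Type*} [NormedAddCommGroup X] [NormedSpace ℂ X]
    (N : X →L[ℂ] X →L[ℂ] X) {b M δ : ℝ} (hb : 0 ≤ b) (hN : ∀ f g, ‖N f g‖ ≤ b * ‖f‖ * ‖g‖)
    {f g f' g' : X} (hf : ‖f‖ ≤ M) (hg : ‖g'‖ ≤ M) (hδ : ‖f - f'‖ ≤ δ) (hδ' : ‖g - g'‖ ≤ δ) :
    ‖N f g - N f' g'‖ ≤ 2 * b * M * δ := by
  have hM : 0 ≤ M := (norm_nonneg _).trans hf
  have hδ0 : 0 ≤ δ := (norm_nonneg _).trans hδ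
  have e : N f g - N f' g' = N f (g - g') + N (f - f') g' := by
    rw [map_sub, map_sub, _root_.sub_apply]; abel
  rw [e]
  calc _ ≤ b * M * δ + b * δ * M :=
        (norm_add_le _ _).trans (add_le_add ((hN _ _).trans (by gcongr)) ((hN _ _).trans (by gcongr)))
    _ = _ := by ring

section
variable {h : ℝ} [hh : Fact (0 < h)]
variable {V : ℝ → ℝ} (hV : IsNormalizedPotential V) {K B : ℝ} (hK : 0 < K)
  (hR : ResonanceBounds h K B) {ε : ℝ} (hε : |ε| = 1)

/-- Differences of the fixed point map only see the nonlinearity; `57 = 1 + 14 * 4`. -/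
theorem norm_modMap_sub_le (lam lam' : ℝ) (U : FreqL2 h) (f g f' g' : ModL2 h) :
    ‖modMap hV hK hR hε lam U f g - modMap hV hK hR hε lam' U f' g'‖ ≤
      57 * ‖modNL hV hK hR hε lam f g - modNL hV hK hR hε lam' f' g'‖ := by
  set D := modNL hV hK hR hε lam f g - modNL hV hK hR hε lam' f' g' with hD
  have e : modMap hV hK hR hε lam U f g - modMap hV hK hR hε lam' U f' g' =
      D - modHom hK (modRec h K 0 D) := by
    rw [modMap, modMap, hD]; simp only [map_sub]; abel
  rw [e]
  have h1 := norm_modHom_le hK (modRec h K 0 D)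
  have h2 := norm_modRec_le hK 0 D
  have h3 := norm_sub_le D (modHom hK (modRec h K 0 D))
  linarith

theorem modNL_zero (lam : ℝ) : modNL hV hK hR hε lam (0 : ModL2 h) 0 = 0 := by
  rw [modNL, modRem_zero]; simp

/-- The size condition under which the fixed point map contracts the ball of radius `M`. -/
def IsSmall (K B C M : ℝ) : Prop := 57 * (8 * (6912 * √B) * M + 110592 * C * M ^ 2 / K) ≤ 1 / 2

theorem norm_modNL_sub_le (hh1 : h ≤ 1) {N C : ℝ} (hC : RemainderBound V h N C) (hC0 : 0 ≤ C)
    {M δ : ℝ} (hM : 48 * M ≤ N) {lam : ℝ} (hl : |lam| ≤ 1) {f g f' g' : ModL2 h} (hf : ‖f‖ ≤ M)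
    (hg : ‖g‖ ≤ M) (hf' : ‖f'‖ ≤ M) (hg' : ‖g'‖ ≤ M) (hδ : ‖f - f'‖ ≤ δ) (hδ' : ‖g - g'‖ ≤ δ) :
    ‖modNL hV hK hR hε lam f g - modNL hV hK hR hε lam f' g'‖ ≤
      (8 * (6912 * √B) * M + 110592 * C * M ^ 2 / K) * δ := by
  have hb : 0 ≤ 6912 * √B := by positivity
  have hM0 : 0 ≤ M := (norm_nonneg _).trans hf
  have hδ0 : 0 ≤ δ := (norm_nonneg _).trans hδ
  have b1 := norm_bilin_sub_le (bilSame hK hR hε) hb (norm_modBil_le _ _ _ _ _) hf hf' hδ hδ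
  have b2 := norm_bilin_sub_le (bilCross hK hR hε) hb (norm_modBil_le _ _ _ _ _) hf hg' hδ hδ'
  have b3 := norm_bilin_sub_le (bilOpp hK hR hε) hb (norm_modBil_le _ _ _ _ _) hg hg' hδ' hδ'
  have b4 := norm_modRem_sub_le hV hK hε hh1 hC hC0 le_rfl zero_le_one hM
    (f := f) (g := g) (f' := f') (g' := g') (by rwa [modSob_zero_apply]) (by rwa [modSob_zero_apply])
    (by rwa [modSob_zero_apply]) (by rwa [modSob_zero_apply])
  rw [Real.rpow_zero, mul_one] at b4
  have b5 : ‖modRem hV hK ε f g - modRem hV hK ε f' g'‖ ≤ 110592 * C * M ^ 2 / K * δ := by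
    calc _ ≤ 55296 * C * M ^ 2 / K * (δ + δ) := b4.trans (by gcongr)
      _ = _ := by ring
  have l1 : ‖((2 * lam : ℝ) : ℂ)‖ ≤ 2 := by
    rw [Complex.norm_real, Real.norm_eq_abs, abs_mul, abs_two]; linarith
  have l2 : ‖((lam ^ 2 : ℝ) : ℂ)‖ ≤ 1 := by
    rw [Complex.norm_real, Real.norm_eq_abs, abs_pow]; exact pow_le_one₀ (abs_nonneg _) hl
  have l3 : ‖(lam : ℂ)‖ ≤ 1 := by rwa [Complex.norm_real, Real.norm_eq_abs]
  have e : modNL hV hK hR hε lam f g - modNL hV hK hR hε lam f' g' =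
      (bilSame hK hR hε f f - bilSame hK hR hε f' f')
      + ((2 * lam : ℝ) : ℂ) • (bilCross hK hR hε f g - bilCross hK hR hε f' g')
      + ((lam ^ 2 : ℝ) : ℂ) • (bilOpp hK hR hε g g - bilOpp hK hR hε g' g')
      + (lam : ℂ) • (modRem hV hK ε f g - modRem hV hK ε f' g') := by
    simp only [modNL, smul_sub]; abel
  rw [e]
  refine norm_add₄_le.trans ?_
  rw [norm_smul, norm_smul, norm_smul]
  calc _ ≤ 2 * (6912 * √B) * M * δ + 2 * (2 * (6912 * √B) * M * δ) + 1 * (2 * (6912 * √B) * M * δ)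
        + 1 * (110592 * C * M ^ 2 / K * δ) := by gcongr
    _ = _ := by ring

theorem norm_modMap_sub_le_half (hh1 : h ≤ 1) {N C : ℝ} (hC : RemainderBound V h N C) (hC0 : 0 ≤ C)
    {M δ : ℝ} (hM : 48 * M ≤ N) (hs : IsSmall K B C M) {lam : ℝ} (hl : |lam| ≤ 1) (U : FreqL2 h)
    {f g f' g' : ModL2 h} (hf : ‖f‖ ≤ M)
    (hg : ‖g‖ ≤ M) (hf' : ‖f'‖ ≤ M) (hg' : ‖g'‖ ≤ M) (hδ : ‖f - f'‖ ≤ δ) (hδ' : ‖g - g'‖ ≤ δ) :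
    ‖modMap hV hK hR hε lam U f g - modMap hV hK hR hε lam U f' g'‖ ≤ 1 / 2 * δ := by
  have hδ0 : 0 ≤ δ := (norm_nonneg _).trans hδ
  have h1 := norm_modNL_sub_le hV hK hR hε hh1 hC hC0 hM hl hf hg hf' hg' hδ hδ'
  have h2 := norm_modMap_sub_le hV hK hR hε lam lam U f g f' g'
  have h3 := mul_le_mul_of_nonneg_right hs hδ0
  linarith

theorem norm_modMap_le (hh1 : h ≤ 1) {N C : ℝ} (hC : RemainderBound V h N C) (hC0 : 0 ≤ C)
    {M : ℝ} (hM : 48 * M ≤ N) (hs : IsSmall K B C M) {lam : ℝ} (hl : |lam| ≤ 1) {U : FreqL2 h}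
    (hU : 28 * ‖U‖ ≤ M) {f g : ModL2 h} (hf : ‖f‖ ≤ M) (hg : ‖g‖ ≤ M) :
    ‖modMap hV hK hR hε lam U f g‖ ≤ M := by
  have hM0 : 0 ≤ M := (norm_nonneg _).trans hf
  have h0 : ‖(0 : ModL2 h)‖ ≤ M := by rwa [norm_zero]
  have h1 := norm_modMap_sub_le_half hV hK hR hε hh1 hC hC0 hM hs hl U (δ := M) hf hg h0 h0
    (by rwa [sub_zero]) (by rwa [sub_zero])
  have h2 : ‖modMap hV hK hR hε lam U 0 0‖ ≤ 14 * ‖U‖ := by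
    rw [modMap, modNL_zero, map_zero, sub_zero, add_zero]; exact norm_modHom_le hK U
  have h3 := norm_le_norm_sub_add (modMap hV hK hR hε lam U f g) (modMap hV hK hR hε lam U 0 0)
  linarith

theorem abs_neg_one_eq : |(-1 : ℝ)| = 1 := by norm_num

/-- The coupled pair of profile equations is solved by the contraction principle in a ball of
`ModL2 h × ModL2 h`; the condition on `U` keeps the free evolution in the ball of half the radius. -/
theorem exists_modMap_eq (hh1 : h ≤ 1) {N C : ℝ} (hC : RemainderBound V h N C) (hC0 : 0 ≤ C)
    {M : ℝ} (hM0 : 0 ≤ M) (hM : 48 * M ≤ N) (hs : IsSmall K B C M) {lam : ℝ} (hl : |lam| ≤ 1)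
    {U : ℝ → FreqL2 h} (hU : ∀ ε, |ε| = 1 → 28 * ‖U ε‖ ≤ M) :
    ∃ f g : ModL2 h, ‖f‖ ≤ M ∧ ‖g‖ ≤ M ∧ f = modMap hV hK hR abs_one lam (U 1) f g ∧
      g = modMap hV hK hR abs_neg_one_eq lam (U (-1)) g f := by
  have hU1 := hU 1 abs_one
  have hU2 := hU (-1) abs_neg_one_eq
  set Ψ : ModL2 h × ModL2 h → ModL2 h × ModL2 h := fun p =>
    (modMap hV hK hR abs_one lam (U 1) p.1 p.2,
      modMap hV hK hR abs_neg_one_eq lam (U (-1)) p.2 p.1) with hΨ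
  set S : Set (ModL2 h × ModL2 h) := Metric.closedBall 0 M with hS
  have hmem : ∀ p, p ∈ S ↔ ‖p.1‖ ≤ M ∧ ‖p.2‖ ≤ M := fun p => by
    rw [hS, mem_closedBall_zero_iff, Prod.norm_def, max_le_iff]
  have hmaps : MapsTo Ψ S S := by
    intro p hp
    rw [hmem] at hp ⊢
    exact ⟨norm_modMap_le hV hK hR abs_one hh1 hC hC0 hM hs hl hU1 hp.1 hp.2,
      norm_modMap_le hV hK hR abs_neg_one_eq hh1 hC hC0 hM hs hl hU2 hp.2 hp.1⟩
  have hcon : ContractingWith (1 / 2) (hmaps.restrict Ψ S S) := by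
    refine ⟨by norm_num, LipschitzWith.of_dist_le_mul fun p q => ?_⟩
    have hp := (hmem _).1 p.2
    have hq := (hmem _).1 q.2
    rw [Subtype.dist_eq, MapsTo.val_restrict_apply, MapsTo.val_restrict_apply, Subtype.dist_eq,
      dist_eq_norm, dist_eq_norm]
    have n1 : ‖p.1.1 - q.1.1‖ ≤ ‖p.1 - q.1‖ := norm_fst_le (p.1 - q.1)
    have n2 : ‖p.1.2 - q.1.2‖ ≤ ‖p.1 - q.1‖ := norm_snd_le (p.1 - q.1)
    have := max_le
      (norm_modMap_sub_le_half hV hK hR abs_one hh1 hC hC0 hM hs hl (U 1) hp.1 hp.2 hq.1 hq.2 n1 n2)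
      (norm_modMap_sub_le_half hV hK hR abs_neg_one_eq hh1 hC hC0 hM hs hl (U (-1)) hp.2 hp.1 hq.2
        hq.1 n2 n1)
    simpa [Prod.norm_def, hΨ] using this
  obtain ⟨p, hp, hfix, -⟩ := hcon.exists_fixedPoint' (Metric.isClosed_closedBall.isComplete) hmaps
    (x := 0) (Metric.mem_closedBall_self hM0) (edist_ne_top _ _)
  rw [hmem] at hp
  exact ⟨p.1, p.2, hp.1, hp.2, (congrArg Prod.fst hfix).symm, (congrArg Prod.snd hfix).symm⟩

theorem isProfile_signFamily {lam : ℝ} {U : ℝ → FreqL2 h} {f g : ModL2 h}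
    (hf : f = modMap hV hK hR abs_one lam (U 1) f g)
    (hg : g = modMap hV hK hR abs_neg_one_eq lam (U (-1)) g f) :
    IsProfile V h lam (1 / K) U fun ε => modProfile h K (signFamily f g ε) where
  continuous _ _ := continuous_modProfile hK _
  eq := by
    rw [forall_sign]
    simp only [neg_neg, signFamily_one, signFamily_neg_one]
    exact ⟨fun t ht => modProfile_eq hV hK hR abs_one lam hf ht,
      fun t ht => modProfile_eq hV hK hR abs_neg_one_eq lam hg ht⟩

/-! ### Comparison of the two equations -/

/-- Persistence of regularity for the decoupled equation. -/
theorem norm_modSob_le_of_eq {C M : ℝ} (hC0 : 0 ≤ C) (hs : IsSmall K B C M) {s : ℝ} (hs0 : 0 ≤ s)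
    (hs1 : s ≤ 1) {U : FreqL2 h} {f g : ModL2 h} (hM : ‖f‖ ≤ M)
    (hf : f = modMap hV hK hR hε 0 U f g) : ‖modSob h s f‖ ≤ 28 * ‖freqSob h s U‖ := by
  have hM0 : 0 ≤ M := (norm_nonneg _).trans hM
  set D := bilSame hK hR hε f f with hD
  have hNL : modNL hV hK hR hε 0 f g = D := by simp [modNL, hD]
  have cj := continuous_japC s
  have e : modSob h s f = modHom hK (freqSob h s U - modRec h K 0 (modSob h s D)) + modSob h s D := by
    conv_lhs => rw [hf, modMap, hNL]
    rw [map_add, modSob, modSymb_modHom hK cj, freqSob, modRec_modSymb hK 0 cj, map_sub]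
  have h1 : ‖modSob h s D‖ ≤ 4 * (6912 * √B) * M * ‖modSob h s f‖ := by
    refine (norm_modSob_modBil_le _ _ _ _ _ hs0 hs1 f f).trans ?_
    calc _ = 4 * (6912 * √B) * ‖f‖ * ‖modSob h s f‖ := by ring
      _ ≤ _ := by gcongr
  have h2 := norm_modHom_le hK (freqSob h s U - modRec h K 0 (modSob h s D))
  have h3 := norm_modRec_le hK 0 (modSob h s D)
  have h4 := norm_sub_le (freqSob h s U) (modRec h K 0 (modSob h s D))
  have h5 := norm_add_le (modHom hK (freqSob h s U - modRec h K 0 (modSob h s D))) (modSob h s D)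
  rw [← e] at h5
  have h6 : 57 * (4 * (6912 * √B) * M) ≤ 1 / 2 := by
    refine le_trans ?_ hs
    have : 0 ≤ 110592 * C * M ^ 2 / K := by positivity
    have : 0 ≤ 6912 * √B * M := by positivity
    linarith
  have h7 := mul_le_mul_of_nonneg_right h6 (norm_nonneg (modSob h s f))
  linarith

/-- The terms which the decoupled equation neglects. -/
theorem norm_modNL_one_sub_zero_le (hh1 : h ≤ 1) (hK1 : 1 ≤ K) {N C : ℝ}
    (hC : RemainderBound V h N C) (hC0 : 0 ≤ C) {s c : ℝ} (hs0 : 0 ≤ s) (hs1 : s ≤ 1)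
    (hcross : HasResonanceBound h K ε (dispersion h) (dispersionOpp h) s (c * h ^ (2 * s)))
    (hopp : HasResonanceBound h K ε (dispersionOpp h) (dispersionOpp h) s (c * h ^ (2 * s)))
    {M m : ℝ} (hm : 48 * m ≤ N) {f g : ModL2 h}
    (hf : ‖f‖ ≤ M) (hg : ‖g‖ ≤ M) (hf' : ‖modSob h s f‖ ≤ m) (hg' : ‖modSob h s g‖ ≤ m) :
    ‖modNL hV hK hR hε 1 f g - modNL hV hK hR hε 0 f g‖ ≤
      (20736 * √c + 110592 * C * M) * m ^ 2 * h ^ s := by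
  have h0 := hh.out
  have hM0 : 0 ≤ M := (norm_nonneg _).trans hf
  have hm0 : 0 ≤ m := (norm_nonneg _).trans hf'
  have hp : 0 < h ^ s := Real.rpow_pos_of_pos h0 _
  have hsq : √(c * h ^ (2 * s)) = √c * h ^ s := by
    have : h ^ (2 * s) = (h ^ s) ^ 2 := by
      rw [← Real.rpow_natCast, ← Real.rpow_mul h0.le]; congr 1; push_cast; ring
    rw [this, Real.sqrt_mul' _ (by positivity), Real.sqrt_sq hp.le]
  have b2 : ‖bilCross hK hR hε f g‖ ≤ 6912 * (√c * h ^ s) * m * m := by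
    refine (norm_modBil_le_modSob _ _ _ _ _ hcross f g).trans ?_
    rw [hsq]; gcongr
  have b3 : ‖bilOpp hK hR hε g g‖ ≤ 6912 * (√c * h ^ s) * m * m := by
    refine (norm_modBil_le_modSob _ _ _ _ _ hopp g g).trans ?_
    rw [hsq]; gcongr
  have b4 : ‖modRem hV hK ε f g‖ ≤ 110592 * C * M * m ^ 2 * h ^ s := by
    have hz : ‖modSob h s (0 : ModL2 h)‖ ≤ m := by rwa [map_zero, norm_zero]
    have := norm_modRem_sub_le hV hK hε hh1 hC hC0 hs0 hs1 hm hf' hg' hz hz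
    rw [modRem_zero, sub_zero, sub_zero, sub_zero] at this
    calc _ ≤ 55296 * C * m ^ 2 / 1 * h ^ s * (M + M) := this.trans (by gcongr)
      _ = _ := by ring
  have e : modNL hV hK hR hε 1 f g - modNL hV hK hR hε 0 f g =
      (2 : ℂ) • bilCross hK hR hε f g + bilOpp hK hR hε g g + modRem hV hK ε f g := by
    simp [modNL]; abel
  rw [e]
  refine norm_add₃_le.trans ?_
  rw [norm_smul, Complex.norm_ofNat]
  linarith

end

/-! ### Uniform choice of the parameters -/

theorem HasResonanceBound.mono {h : ℝ} [Fact (0 < h)] {K ε : ℝ} {q₁ q₂ : ℝ → ℝ} {s B B' : ℝ}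
    (hB : HasResonanceBound h K ε q₁ q₂ s B) (hBB : B ≤ B') :
    HasResonanceBound h K ε q₁ q₂ s B' := fun C ρ hρ σ ξ => (hB C ρ hρ σ ξ).trans (by gcongr)

/-- The smallness condition holds for large `K`, as the resonance bound is `c / √K`. -/
theorem exists_isSmall (c C M : ℝ) : ∃ K, 1 ≤ K ∧ IsSmall K (c / √K) C M := by
  have h1 : Filter.Tendsto (fun K => √(c / √K)) Filter.atTop (nhds 0) := by
    have := (Real.continuous_sqrt.tendsto 0).comp
      ((tendsto_const_nhds (x := c)).div_atTop Real.tendsto_sqrt_atTop)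
    rwa [Real.sqrt_zero] at this
  have h2 : Filter.Tendsto (fun K : ℝ => 110592 * C * M ^ 2 / K) Filter.atTop (nhds 0) :=
    tendsto_const_nhds.div_atTop Filter.tendsto_id
  have h3 := ((((h1.const_mul 6912).const_mul 8).mul_const M).add h2).const_mul 57
  simp only [mul_zero, zero_mul, add_zero] at h3
  obtain ⟨K, hK, hK1⟩ := ((h3.eventually_le_const one_half_pos).and
    (Filter.eventually_ge_atTop 1)).exists
  exact ⟨K, hK1, hK⟩

theorem exists_resonanceBounds : ∃ c : ℝ, ∀ (h : ℝ) [Fact (0 < h)], h ≤ 1 → ∀ K : ℝ, 1 ≤ K →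
    ResonanceBounds h K (c / √K) := by
  obtain ⟨c, hc, H⟩ := hasResonanceBound_opp le_rfl zero_le_one
  have hpi := Real.pi_pos
  refine ⟨128 * Real.pi + c, fun h hh hh1 K hK => ⟨fun ε hε => ?_, fun ε hε => ?_, fun ε hε => ?_⟩⟩
  · exact (hasResonanceBound_same hK hε).mono (by gcongr; linarith)
  · refine (hasResonanceBound_cross hh1 hK hε le_rfl zero_le_one).mono ?_
    rw [mul_zero, Real.rpow_zero]; gcongr; linarith
  · refine (H h hh1 K hK ε hε).mono ?_
    rw [mul_zero, Real.rpow_zero]; gcongr; linarith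

theorem exists_weighted_resonanceBounds {s : ℝ} (hs0 : 0 ≤ s) (hs1 : s ≤ 1) :
    ∃ c : ℝ, ∀ (h : ℝ) [Fact (0 < h)], h ≤ 1 → ∀ K : ℝ, 1 ≤ K → ∀ ε : ℝ, |ε| = 1 →
      HasResonanceBound h K ε (dispersion h) (dispersionOpp h) s (c * h ^ (2 * s)) ∧
      HasResonanceBound h K ε (dispersionOpp h) (dispersionOpp h) s (c * h ^ (2 * s)) := by
  obtain ⟨c, hc, H⟩ := hasResonanceBound_opp hs0 hs1
  have hpi := Real.pi_pos
  refine ⟨24 * Real.pi + c, fun h hh hh1 K hK ε hε => ?_⟩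
  have hp : 0 < h ^ (2 * s) := Real.rpow_pos_of_pos hh.out _
  have hK' : 1 ≤ √K := Real.one_le_sqrt.2 hK
  constructor
  · refine (hasResonanceBound_cross hh1 hK hε hs0 hs1).mono ?_
    refine (div_le_self (by positivity) hK').trans ?_
    gcongr; linarith
  · refine (H h hh1 K hK ε hε).mono ?_
    refine (div_le_self (by positivity) hK').trans ?_
    gcongr; linarith

/-- The comparison of the coupled and the decoupled profile equation. -/
theorem exists_isProfile_sub_le {V : ℝ → ℝ} (hV : IsNormalizedPotential V) {R : ℝ} (hR : 0 < R) :
    ∃ T : ℝ, 0 < T ∧ ∀ s : ℝ, 0 ≤ s → s ≤ 1 → ∃ A : ℝ, 0 < A ∧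
      ∀ (h : ℝ) [Fact (0 < h)], h ≤ 1 → ∀ (U : ℝ → FreqL2 h) (N : ℝ), N ≤ R →
        (∀ ε, |ε| = 1 → ‖freqSob h s (U ε)‖ ≤ N) →
        ∃ w w', IsProfile V h 1 T U w ∧ IsProfile V h 0 T U w' ∧
          ∀ ε, |ε| = 1 → ∀ t ∈ Icc 0 T, ‖w ε t - w' ε t‖ ≤ A * h ^ s * N := by
  obtain ⟨c, hc⟩ := exists_resonanceBounds
  obtain ⟨C, hC0, hC⟩ := exists_remFreq_sub_le hV (48 * (28 * R))
  obtain ⟨K, hK1, hsmall⟩ := exists_isSmall c C (28 * R)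
  have hK : 0 < K := by linarith
  refine ⟨1 / K, one_div_pos.2 hK, fun s hs0 hs1 => ?_⟩
  obtain ⟨c', hc'⟩ := exists_weighted_resonanceBounds hs0 hs1
  set A₀ := 20736 * √c' + 110592 * C * (28 * R) with hA₀
  have hA0 : 0 ≤ A₀ := by positivity
  -- `28 = 2 * 14` is twice the norm of the free evolution, and `114 = 2 * 57` comes from absorbing
  -- half of the difference of the solutions
  refine ⟨12 * (114 * (A₀ * (28 ^ 2 * R))) + 1, by positivity, fun h hh hh1 U N hN hU => ?_⟩
  have hB := hc h hh1 K hK1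
  have hrem : RemainderBound V h (48 * (28 * R)) C := hC h
  have hU' : ∀ ε, |ε| = 1 → 28 * ‖U ε‖ ≤ 28 * R := fun ε hε => by
    gcongr; exact ((norm_le_norm_freqSob hs0 _).trans (hU ε hε)).trans hN
  have hM0 : 0 ≤ 28 * R := by positivity
  have hN0 : 0 ≤ N := (norm_nonneg _).trans (hU 1 abs_one)
  have hp : 0 < h ^ s := Real.rpow_pos_of_pos hh.out _
  obtain ⟨f, g, hf, hg, ef, eg⟩ := exists_modMap_eq hV hK hB hh1 hrem hC0 hM0 le_rfl hsmall
    (lam := 1) (by norm_num) hU'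
  obtain ⟨v, z, hv, hz, ev, ez⟩ := exists_modMap_eq hV hK hB hh1 hrem hC0 hM0 le_rfl hsmall
    (lam := 0) (by norm_num) hU'
  refine ⟨_, _, isProfile_signFamily hV hK hB ef eg, isProfile_signFamily hV hK hB ev ez, ?_⟩
  have hv' : ‖modSob h s v‖ ≤ 28 * N :=
    (norm_modSob_le_of_eq hV hK hB abs_one hC0 hsmall hs0 hs1 hv ev).trans
      (by gcongr; exact hU 1 abs_one)
  have hz' : ‖modSob h s z‖ ≤ 28 * N :=
    (norm_modSob_le_of_eq hV hK hB abs_neg_one_eq hC0 hsmall hs0 hs1 hz ez).trans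
      (by gcongr; exact hU (-1) abs_neg_one_eq)
  have hm : 48 * (28 * N) ≤ 48 * (28 * R) := by gcongr
  set δ := max ‖f - v‖ ‖g - z‖ with hδ
  set D := A₀ * (28 * N) ^ 2 * h ^ s with hD
  -- compare `f = Φ₁(f, g)` with `v = Φ₀(v, z)` through `Φ₁(v, z)`
  have d1 : ‖f - v‖ ≤ 1 / 2 * δ + 57 * D := by
    have h1 := norm_modMap_sub_le_half hV hK hB abs_one hh1 hrem hC0 le_rfl hsmall (lam := 1)
      (by norm_num) (U 1) hf hg hv hz (le_max_left _ _) (le_max_right _ _)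
    have h2 := norm_modMap_sub_le hV hK hB abs_one 1 0 (U 1) v z v z
    have h3 := norm_modNL_one_sub_zero_le hV hK hB abs_one hh1 hK1 hrem hC0 hs0 hs1
      (hc' h hh1 K hK1 1 abs_one).1 (hc' h hh1 K hK1 1 abs_one).2 hm hv hz hv' hz'
    rw [← ef] at h1
    rw [← ev] at h2
    have h4 := norm_sub_le_norm_sub_add_norm_sub f (modMap hV hK hB abs_one 1 (U 1) v z) v
    linarith
  have d2 : ‖g - z‖ ≤ 1 / 2 * δ + 57 * D := by
    have h1 := norm_modMap_sub_le_half hV hK hB abs_neg_one_eq hh1 hrem hC0 le_rfl hsmall (lam := 1)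
      (by norm_num) (U (-1)) hg hf hz hv (le_max_right _ _) (le_max_left _ _)
    have h2 := norm_modMap_sub_le hV hK hB abs_neg_one_eq 1 0 (U (-1)) z v z v
    have h3 := norm_modNL_one_sub_zero_le hV hK hB abs_neg_one_eq hh1 hK1 hrem hC0 hs0 hs1
      (hc' h hh1 K hK1 (-1) abs_neg_one_eq).1 (hc' h hh1 K hK1 (-1) abs_neg_one_eq).2 hm hz hv hz' hv'
    rw [← eg] at h1
    rw [← ez] at h2
    have h4 := norm_sub_le_norm_sub_add_norm_sub g (modMap hV hK hB abs_neg_one_eq 1 (U (-1)) z v) z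
    linarith
  have hδD : δ ≤ 114 * D := by
    have := max_le d1 d2
    rw [← hδ] at this
    linarith
  have hfin : 12 * (114 * D) ≤ (12 * (114 * (A₀ * (28 ^ 2 * R))) + 1) * h ^ s * N := by
    have e1 : D ≤ A₀ * (28 ^ 2 * R) * h ^ s * N := by
      calc D = A₀ * 28 ^ 2 * h ^ s * N * N := by rw [hD]; ring
        _ ≤ A₀ * 28 ^ 2 * h ^ s * N * R := by gcongr
        _ = _ := by ring
    have e2 : 0 ≤ h ^ s * N := by positivity
    linarith
  rw [forall_sign]
  simp only [signFamily_one, signFamily_neg_one]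
  constructor
  · intro t ht
    rw [← modProfile_sub]
    have := norm_modProfile_le hK (f - v) ht
    have := le_max_left ‖f - v‖ ‖g - z‖
    linarith
  · intro t ht
    rw [← modProfile_sub]
    have := norm_modProfile_le hK (g - z) ht
    have := le_max_right ‖f - v‖ ‖g - z‖
    linarith

/-! ### Return to the lattice -/

section
variable {h : ℝ} [hh : Fact (0 < h)]

/-- Negative times are treated by the reflection `t ↦ -t`, which exchanges the two signs. -/
theorem l2Norm_sub_le_of_isProfile {V : ℝ → ℝ} (hV : IsNormalizedPotential V) {T D : ℝ} (hT : 0 ≤ T)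
    {u₀ : ℝ → LatticeL2} {u v : ℝ → ℝ → LatticeL2} (hu : IsLatticeSolution V h 1 T u₀ u)
    (hv : IsLatticeSolution V h 0 T u₀ v)
    (H : ∀ τ : ℝ, |τ| = 1 → ∃ w w', IsProfile V h 1 T (fun ε => toFreq h (u₀ (τ * ε))) w ∧
      IsProfile V h 0 T (fun ε => toFreq h (u₀ (τ * ε))) w' ∧
      ∀ ε, |ε| = 1 → ∀ t ∈ Icc 0 T, ‖w ε t - w' ε t‖ ≤ D) {σ : ℝ} (hσ : |σ| = 1) {t : ℝ}
    (ht : t ∈ Icc (-T) T) : l2Norm h (fun n => u σ t n - v σ t n) ≤ D := by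
  obtain ⟨τ, hτ, htτ⟩ : ∃ τ : ℝ, |τ| = 1 ∧ τ * |t| = t := by
    rcases le_total 0 t with h0 | h0
    · exact ⟨1, abs_one, by rw [abs_of_nonneg h0, one_mul]⟩
    · exact ⟨-1, abs_neg_one_eq, by rw [abs_of_nonpos h0]; ring⟩
  have hττ : τ * (τ * σ) = σ := by
    have : τ * τ = 1 := by rw [← abs_mul_abs_self, hτ, one_mul]
    rw [← mul_assoc, this, one_mul]
  have ht' : |t| ∈ Icc 0 T := ⟨abs_nonneg t, abs_le.2 ht⟩
  have hε : |τ * σ| = 1 := mul_sign hσ hτ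
  obtain ⟨w, w', hw, hw', hD⟩ := H τ hτ
  have e1 := (hu.isProfile hV hT hτ).unique hV hw hε ht'
  have e2 := (hv.isProfile hV hT hτ).unique hV hw' hε ht'
  have hb := hD (τ * σ) hε |t| ht'
  rw [← e1, ← e2, projIcc_of_mem hT ht', hττ] at hb
  dsimp only at hb
  rw [htτ, ← map_sub, norm_symb_flow _ (continuous_dispersion h)] at hb
  rwa [((represents_toFreq (h := h) (u σ t)).sub (represents_toFreq (v σ t))).l2Norm_eq]

theorem norm_freqSob_le_sobolevPairNorm (s : ℝ) (u₀p u₀m : LatticeL2) {σ : ℝ} (hσ : |σ| = 1) :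
    ‖freqSob h s (toFreq h (signFamily u₀p u₀m σ))‖ ≤ sobolevPairNorm h s u₀p u₀m := by
  rw [← sobolevNorm_eq]
  revert σ
  rw [forall_sign, signFamily_one, signFamily_neg_one]
  exact ⟨Real.le_sqrt_of_sq_le (le_add_of_nonneg_right (sq_nonneg _)),
    Real.le_sqrt_of_sq_le (le_add_of_nonneg_left (sq_nonneg _))⟩

end

end

end FPULattice

theorem proposition2p2 (V : ℝ → ℝ) (hV : FPULattice.IsNormalizedPotential V) (R : ℝ) (hR : 0 < R) :
    ∃ T : ℝ, 0 < T ∧ ∀ s : ℝ, 0 < s → s ≤ 1 → ∃ C : ℝ, 0 < C ∧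
      ∀ (h : ℝ) [Fact (0 < h)], h ≤ 1 →
      ∀ u₀p u₀m : FPULattice.LatticeL2, FPULattice.sobolevPairNorm h s u₀p u₀m ≤ R →
        (∃ up um : ℝ → FPULattice.LatticeL2,
          FPULattice.IsCoupledSolution V h T u₀p u₀m up um) ∧
        (∃ vp vm : ℝ → FPULattice.LatticeL2,
          FPULattice.IsDecoupledSolution h T u₀p u₀m vp vm) ∧
        ∀ up um vp vm : ℝ → FPULattice.LatticeL2,
          FPULattice.IsCoupledSolution V h T u₀p u₀m up um →
          FPULattice.IsDecoupledSolution h T u₀p u₀m vp vm →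
          ∀ t ∈ Set.Icc (-T) T,
            FPULattice.l2Norm h (fun n => up t n - vp t n)
              ≤ C * h ^ s * FPULattice.sobolevPairNorm h s u₀p u₀m ∧
            FPULattice.l2Norm h (fun n => um t n - vm t n)
              ≤ C * h ^ s * FPULattice.sobolevPairNorm h s u₀p u₀m := by
  obtain ⟨T, hT, H⟩ := FPULattice.exists_isProfile_sub_le hV hR
  refine ⟨T, hT, fun s hs0 hs1 => ?_⟩
  obtain ⟨C, hC, H⟩ := H s hs0.le hs1
  refine ⟨C, hC, fun h hh hh1 u₀p u₀m hN => ?_⟩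
  have hprof := fun (τ : ℝ) (hτ : |τ| = 1) =>
    H h hh1 (fun ε => FPULattice.toFreq h (FPULattice.signFamily u₀p u₀m (τ * ε)))
      (FPULattice.sobolevPairNorm h s u₀p u₀m) hN (fun ε hε =>
        FPULattice.norm_freqSob_le_sobolevPairNorm s u₀p u₀m (FPULattice.mul_sign hε hτ))
  refine ⟨?_, ?_, fun up um vp vm hu hv t ht => ?_⟩
  · obtain ⟨u, hu⟩ := FPULattice.exists_isLatticeSolution hV fun τ hτ => by
      obtain ⟨w, -, hw, -⟩ := hprof τ hτ
      exact ⟨w, hw⟩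
    exact ⟨u 1, u (-1), FPULattice.isCoupledSolution_iff.2 hu⟩
  · obtain ⟨v, hv⟩ := FPULattice.exists_isLatticeSolution hV fun τ hτ => by
      obtain ⟨-, w, -, hw, -⟩ := hprof τ hτ
      exact ⟨w, hw⟩
    exact ⟨v 1, v (-1), (FPULattice.isDecoupledSolution_iff V).2 hv⟩
  · have hu' := (FPULattice.isCoupledSolution_iff (u := FPULattice.signFamily up um)).1
      (by rwa [FPULattice.signFamily_one, FPULattice.signFamily_neg_one])
    have hv' := (FPULattice.isDecoupledSolution_iff V (u := FPULattice.signFamily vp vm)).1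
      (by rwa [FPULattice.signFamily_one, FPULattice.signFamily_neg_one])
    have hp := FPULattice.l2Norm_sub_le_of_isProfile hV hT.le hu' hv' hprof abs_one ht
    have hm := FPULattice.l2Norm_sub_le_of_isProfile hV hT.le hu' hv' hprof
      FPULattice.abs_neg_one_eq ht
    simp only [FPULattice.signFamily_one, FPULattice.signFamily_neg_one] at hp hm
    exact ⟨hp, hm⟩
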